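/- Let $\epsilon\in\{1,-1\}$ and let $(M,g)$ be a connected, geodesically complete semi-Riemannian manifold of dimension $n$ (that is, $M$ is a smooth manifold, $g$ is a smooth symmetric non-degenerate bilinear form on $TM$ of constant index, and every tangent vector of $M$ is the initial velocity of a geodesic defined on all of $\mathbb{R}$). Let $\widehat M=\mathbb{R}_{>0}\times M$ with the metric $\widehat g=\epsilon\,dr^2+r^2g$ be the cone over $(M,g)$, and let $V$ be a smooth vector field on $\widehat M$ that is parallel for the Levi-Civita connection of $\widehat g$. (1) If $\widehat g(V,V)=\epsilon$, then $(\widehat M,\widehat g)$ is flat and $(M,g)$ has constant curvature $\epsilon$, i.e. $R(X,Y)Z=\epsilon\,(g(Y,Z)X-g(X,Z)Y)$ for all tangent vectors $X,Y,Z$ at the same point, where $R(X,Y)Z=\nabla_X\nabla_YZ-\nabla_Y\nabla_XZ-\nabla_{[X,Y]}Z$. (2) If $\widehat g(V,V)=-\epsilon$, then $(M,g)$ is globally isometric to $$(\mathbb{R}\times N,\ -\epsilon\,ds^2+\cosh^2(s)\,g_N)$$ for a geodesically complete semi-Riemannian manifold $(N,g_N)$ of dimension $n-1$. (3) If $\widehat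 g(V,V)=0$ and $V$ is not identically zero, then $M$ is a disjoint union $M=M_-\cup M_0\cup M_+$ with $M_-$ and $M_+$ open such that the following hold. Either $M_0$ is empty and one of $M_-$, $M_+$ is empty as well, or $M_0$ is a non-empty smooth totally geodesic hypersurface of $M$, i.e. geodesics of $(M,g)$ that start tangentially to $M_0$ stay in $M_0$ for small times. Each of $(M_\pm,g|_{M_\pm})$ is globally isometric to $$(\mathbb{R}\times N_\pm,\ -\epsilon\,ds^2+e^{2s}g_{N_\pm})$$ for a geodesically complete semi-Riemannian manifold $(N_\pm,g_{N_\pm})$ of dimension $n-1$ (not necessarily connected, and empty if $M_\pm$ is empty). Moreover, $M_0=\emptyset$ if and only if $g$ is positive definite or negative definite. -/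

import Mathlib

open scoped Manifold ContDiff Topology

noncomputable section

namespace SemiRiem

/-! ### Local formulas on a normed space -/

section Local

variable {E : Type*} [NormedAddCommGroup E] [NormedSpace ℝ E]

/-- The Christoffel symbol `Γ_y(v, w)` of a field of bilinear forms `G` on `E`, i.e. the vector with
`2 G_y(Γ_y(v, w), z) = (∂_v G)(w, z) + (∂_w G)(v, z) - (∂_z G)(v, w)` for all `z`. -/
def christoffel (G : E → E →L[ℝ] E →L[ℝ] ℝ) (y v w : E) : E :=
  (G y).inverse ((1 / 2 : ℝ) •
    (fderiv ℝ G y v w + fderiv ℝ G y w v - ((fderiv ℝ G y).flip v).flip w))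

/-- The curvature tensor `R(X, Y)Z = ∇_X ∇_Y Z - ∇_Y ∇_X Z - ∇_[X,Y] Z` in coordinates. -/
def localCurvature (G : E → E →L[ℝ] E →L[ℝ] ℝ) (y X Y Z : E) : E :=
  fderiv ℝ (fun y' => christoffel G y' Y Z) y X - fderiv ℝ (fun y' => christoffel G y' X Z) y Y
    + christoffel G y X (christoffel G y Y Z) - christoffel G y Y (christoffel G y X Z)

end Local

/-! ### Tensor fields and metrics on manifolds -/

section Manifold

variable {E : Type*} [NormedAddCommGroup E] [NormedSpace ℝ E]
  {H : Type*} [TopologicalSpace H] (I : ModelWithCorners ℝ E H)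
  {E' : Type*} [NormedAddCommGroup E'] [NormedSpace ℝ E']
  {H' : Type*} [TopologicalSpace H'] (I' : ModelWithCorners ℝ E' H')
  (M : Type*) [TopologicalSpace M] [ChartedSpace H M]
  {M' : Type*} [TopologicalSpace M'] [ChartedSpace H' M']

/-- Fields of bilinear forms on the tangent spaces of `M`. -/
abbrev BilinField : Type _ :=
  Π x : M, TangentSpace I x →L[ℝ] TangentSpace I x →L[ℝ] ℝ

variable {M}

/-- The index of a bilinear form: the largest dimension of a negative definite subspace. -/
def index {F : Type*} [AddCommGroup F] [Module ℝ F] [TopologicalSpace F]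
    [IsTopologicalAddGroup F] [ContinuousSMul ℝ F] (B : F →L[ℝ] F →L[ℝ] ℝ) : ℕ :=
  sigNeg (LinearMap.BilinMap.toQuadraticMap
    ((ContinuousLinearMap.coeLM ℝ).comp B.toLinearMap : F →ₗ[ℝ] F →ₗ[ℝ] ℝ))

/-- Semi-Riemannian metrics: smooth symmetric non-degenerate bilinear forms of constant index. -/
structure IsSemiRiemannian [IsManifold I ∞ M] (g : BilinField I M) : Prop where
  contMDiff : ContMDiff I (I.prod 𝓘(ℝ, E →L[ℝ] E →L[ℝ] ℝ)) ∞
    (fun x => Bundle.TotalSpace.mk' (E →L[ℝ] E →L[ℝ] ℝ)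
      (E := fun x : M => TangentSpace I x →L[ℝ] TangentSpace I x →L[ℝ] ℝ) x (g x))
  symm : ∀ (x : M) (v w : TangentSpace I x), g x v w = g x w v
  nondegenerate : ∀ (x : M) (v : TangentSpace I x), (∀ w, g x v w = 0) → v = 0
  constant_index : ∃ k : ℕ, ∀ x : M, index (g x) = k

/-- The metric is positive definite or negative definite. -/
def IsDefinite (g : BilinField I M) : Prop :=
  (∀ (x : M) (v : TangentSpace I x), v ≠ 0 → 0 < g x v v) ∨
  (∀ (x : M) (v : TangentSpace I x), v ≠ 0 → g x v v < 0)

/-- The pull-back `(f^* g)_x(v, w) = g_{f(x)}(df_x v, df_x w)`. -/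
def pullback (f : M → M') (g : BilinField I' M') : BilinField I M := fun x =>
  ((mfderiv I I' f x).precomp ℝ).comp ((g (f x)).comp (mfderiv I I' f x))

/-- The bilinear form `c dρ² + h(ρ) π^* g` on `M`, for `ρ : M → ℝ` and `π : M → M'`. -/
def warpedForm (c : ℝ) (h : ℝ → ℝ) (ρ : M → ℝ) (π : M → M') (g : BilinField I' M') :
    BilinField I M := fun x =>
  let dρ : TangentSpace I x →L[ℝ] ℝ := mfderiv I 𝓘(ℝ, ℝ) ρ x
  c • dρ.smulRight dρ + h (ρ x) • pullback I I' π g x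

/-! ### The Levi-Civita connection, geodesics and curvature

All notions are evaluated at a point `x` in the preferred chart at `x`. -/

/-- The metric in the chart at `x₀`. -/
def chartMetric (g : BilinField I M) (x₀ : M) : E → E →L[ℝ] E →L[ℝ] ℝ := fun y =>
  pullback 𝓘(ℝ, E) I (extChartAt I x₀).symm g y

/-- The covariant derivative `∇_X V` at `x` of a vector field `V` for the Levi-Civita connection:
in the chart at `x` it is `∂_X V + Γ(X, V)`. -/
def covDeriv (g : BilinField I M) (V : Π x : M, TangentSpace I x) (x : M)
    (X : TangentSpace I x) : TangentSpace I x :=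
  let V' : E → E := VectorField.mpullback 𝓘(ℝ, E) I (extChartAt I x).symm V
  let y : E := extChartAt I x x
  let ξ : E := mfderiv I 𝓘(ℝ, E) (extChartAt I x) x X
  (mfderiv I 𝓘(ℝ, E) (extChartAt I x) x).inverse
    (fderiv ℝ V' y ξ + christoffel (chartMetric I g x) y ξ (V' y))

/-- The vector field `V` is parallel for the Levi-Civita connection of `g`. -/
def IsParallel (g : BilinField I M) (V : Π x : M, TangentSpace I x) : Prop :=
  ∀ (x : M) (X : TangentSpace I x), covDeriv I g V x X = 0

/-- The Riemann curvature tensor `R(X, Y)Z = ∇_X ∇_Y Z - ∇_Y ∇_X Z - ∇_[X,Y] Z`. -/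
def curvature (g : BilinField I M) (x : M) (X Y Z : TangentSpace I x) : TangentSpace I x :=
  let dφ : TangentSpace I x →L[ℝ] E := mfderiv I 𝓘(ℝ, E) (extChartAt I x) x
  dφ.inverse (localCurvature (chartMetric I g x) (extChartAt I x x) (dφ X) (dφ Y) (dφ Z))

/-- The metric is flat. -/
def IsFlat (g : BilinField I M) : Prop :=
  ∀ (x : M) (X Y Z : TangentSpace I x), curvature I g x X Y Z = 0

/-- The metric has constant curvature `κ`. -/
def HasConstantCurvature (g : BilinField I M) (κ : ℝ) : Prop :=
  ∀ (x : M) (X Y Z : TangentSpace I x),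
    curvature I g x X Y Z = κ • (g x Y Z • X - g x X Z • Y)

/-- The curve `γ` is a geodesic on the open set `s` of times: it is smooth there and in the chart at
each `γ t` it satisfies `c'' + Γ(c', c') = 0` at time `t`. -/
def IsGeodesicOn (g : BilinField I M) (γ : ℝ → M) (s : Set ℝ) : Prop :=
  ContMDiffOn 𝓘(ℝ, ℝ) I ∞ γ s ∧
  ∀ t ∈ s,
    let c : ℝ → E := fun τ => extChartAt I (γ t) (γ τ)
    deriv (deriv c) t + christoffel (chartMetric I g (γ t)) (c t) (deriv c t) (deriv c t) = 0

/-- The velocity of a curve at time `0`, as a point of the tangent bundle. -/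
def initialVelocity (γ : ℝ → M) : TangentBundle I M :=
  tangentMap 𝓘(ℝ, ℝ) I γ ⟨0, (1 : ℝ)⟩

/-- Geodesic completeness: every tangent vector is the initial velocity of a geodesic that is
defined on all of `ℝ`. -/
def IsGeodesicallyComplete (g : BilinField I M) : Prop :=
  ∀ ξ : TangentBundle I M, ∃ γ : ℝ → M,
    IsGeodesicOn I g γ Set.univ ∧ initialVelocity I γ = ξ

/-! ### Hypersurfaces -/

/-- A smooth (embedded) hypersurface: near each of its points it is the zero set of a smooth
function without critical points. -/
def IsSmoothHypersurface (S : Set M) : Prop :=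
  ∀ p ∈ S, ∃ U : Set M, IsOpen U ∧ p ∈ U ∧ ∃ f : M → ℝ,
    ContMDiffOn I 𝓘(ℝ, ℝ) ∞ f U ∧ (∀ x ∈ U, mfderiv I 𝓘(ℝ, ℝ) f x ≠ 0) ∧
    S ∩ U = {x ∈ U | f x = 0}

/-- A tangent vector of `M` is tangent to `S` if it is the velocity of a smooth curve in `S`. -/
def IsTangentTo (S : Set M) (ξ : TangentBundle I M) : Prop :=
  ∃ c : ℝ → M, ContMDiffAt 𝓘(ℝ, ℝ) I ∞ c 0 ∧ (∀ᶠ t in 𝓝 (0 : ℝ), c t ∈ S) ∧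
    initialVelocity I c = ξ

/-- Totally geodesic: each geodesic of the ambient manifold that starts tangentially to `S` stays
in `S` for small times. (This makes sense also where the metric degenerates on `S`.) -/
def IsTotallyGeodesic (g : BilinField I M) (S : Set M) : Prop :=
  ∀ (γ : ℝ → M) (δ : ℝ), 0 < δ → IsGeodesicOn I g γ (Set.Ioo (-δ) δ) →
    IsTangentTo I S (initialVelocity I γ) → ∀ᶠ t in 𝓝 (0 : ℝ), γ t ∈ S

/-! ### Cones -/

/-- The open half-line of positive reals. -/
abbrev PosReals : TopologicalSpace.Opens ℝ := ⟨Set.Ioi 0, isOpen_Ioi⟩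

variable (M) in
/-- The manifold `ℝ_{>0} × M` underlying the cone. -/
abbrev Cone : Type _ := PosReals × M

/-- The model of the cone. -/
abbrev coneModel : ModelWithCorners ℝ (ℝ × E) (ModelProd ℝ H) := 𝓘(ℝ, ℝ).prod I

/-- The cone metric `ε dr² + r² g`. -/
def coneMetric (ε : ℝ) (g : BilinField I M) : BilinField (coneModel I) (Cone M) :=
  warpedForm (coneModel I) I ε (fun r => r ^ 2) (fun p : Cone M => (p.1 : ℝ)) Prod.snd g

/-- The restriction of a metric to an open subset. -/
def restrict (g : BilinField I M) (U : TopologicalSpace.Opens M) : BilinField I U :=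
  pullback I I (Subtype.val : U → M) g

end Manifold

/-! ### Global warped products -/

/-- The `n`-manifold `P` with metric `g` is globally isometric to `ℝ × N` with the metric
`c ds² + h(s) g_N`, for a geodesically complete semi-Riemannian manifold `(N, g_N)` of dimension
`n - 1`. (`N` is not required to be connected; it is empty precisely if `P` is.) -/
def IsometricToWarpedProduct.{u} {n : ℕ} {P : Type u} [TopologicalSpace P]
    [ChartedSpace (EuclideanSpace ℝ (Fin n)) P]
    (g : BilinField (𝓡 n) P) (c : ℝ) (h : ℝ → ℝ) : Prop :=
  ∃ (N : Type u) (_ : TopologicalSpace N)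
    (_ : ChartedSpace (EuclideanSpace ℝ (Fin (n - 1))) N)
    (_ : IsManifold (𝓡 (n - 1)) ∞ N)
    (_ : T2Space N) (_ : SecondCountableTopology N)
    (gN : BilinField (𝓡 (n - 1)) N)
    (Φ : Diffeomorph (𝓘(ℝ, ℝ).prod (𝓡 (n - 1)))
      (𝓡 n) (ℝ × N) P ∞),
    IsSemiRiemannian (𝓡 (n - 1)) gN ∧
    IsGeodesicallyComplete (𝓡 (n - 1)) gN ∧
    pullback (𝓘(ℝ, ℝ).prod (𝓡 (n - 1)))
        (𝓡 n) Φ g =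
      warpedForm (𝓘(ℝ, ℝ).prod (𝓡 (n - 1)))
        (𝓡 (n - 1)) c h Prod.fst Prod.snd gN

end SemiRiem

end

noncomputable section

set_option maxSynthPendingDepth 3
set_option linter.unusedSectionVars false

namespace SemiRiem

/-! ### Calculus of local metrics -/

section LocalCalculus

variable {E : Type*} [NormedAddCommGroup E] [NormedSpace ℝ E]
  {E' : Type*} [NormedAddCommGroup E'] [NormedSpace ℝ E']

/-! Let f be the radial component of V along r = 1 and let ξ be the gradient of f on M. Splitting
the parallel equation into radial and fibre components gives V(r, x) = (f(x), r⁻¹ ε ξ(x)), the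
equation ∇_X ξ = -ε f X, that is Hess f = -ε f g, and ĝ(V, V) = ε f² + g(ξ, ξ)
(`ConeParallel.eq_at_one`, `ConeParallel.hessianData`, `ConeParallel.form_self`). From there on the
argument takes place on M, for a solution of Hess f = -κ f g with κ = ε.

Two facts link f with completeness. Along a geodesic γ the function f ∘ γ solves y'' = -κ g(γ', γ')
y, an equation with constant coefficient (`IsGeodesicOn.hasDerivAt_deriv_comp`). If ξ = b γ' holds
at one time and b' = -κ f along γ, then ξ = b γ' for all times, so gradient lines are reparametrized
geodesics (`HessianData.grad_eq_smul_vel`).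

Case g(ξ, ξ) = κ(1 - f²). Let W be the difference of the curvature tensor and the tensor of constant
curvature κ. The Ricci identity for ξ gives W(X, Y)ξ = 0, pair symmetry gives W(X, ξ)Y = 0, and the
second Bianchi identity then gives ∇_ξ W = 2κ f W. Hence (1 - f²)W is parallel along gradient lines.
By completeness, the geodesic leaving a point with f² ≠ 1 in the direction of ξ reaches a zero of ξ,
where f² = 1; so W = 0 at the starting point. The set f² = 1 has no interior in positive dimension
because there the Hessian would vanish while κ f g does not. The curvature of the cone is W in the
fibre directions and zero otherwise, so the cone is flat as well (`HessianData.defect_eq_zero`,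
`localCurvature_coneForm`).

Cases g(ξ, ξ) = -κ(1 + f²) and g(ξ, ξ) = -κ f². Write f = F(s) with F = sinh, or with F = exp where
f > 0; then g(ξ, ξ) = -κ F'(s)². The vector field T = -(κ / F'(s)) ξ satisfies ds(T) = 1 and g(T, T)
= -κ, and its integral curves are geodesics, so its flow is complete. For w tangent to a level set
∇_w T = (F / F') w, so the flow scales the metric of the level s = 0 by F'(t)². Flowing that level
out is the isometry with -κ dt² + F'(t)² g_N (`WarpData.exists_flow`, `WarpData.form_flow`,
`WarpData.exists_diffeomorph`). The level is complete since geodesics of M project to reparametrized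
geodesics of it; for F = exp only a uniform existence time is obtained, and
`isGeodesicallyComplete_of_uniform` iterates it.

In the null case f and df have no common zero unless V = 0, so f = 0 is a regular, totally geodesic
level. If f has no zero, then κ g(v, v) > 0 is impossible, because f would oscillate along the
geodesic of v; so g is definite. Conversely, at a zero of f the vector ξ is null and nonzero. -/

def christoffelOne (G : E → E →L[ℝ] E →L[ℝ] ℝ) (y v w z : E) : ℝ :=
  (1 / 2 : ℝ) * (fderiv ℝ G y v w z + fderiv ℝ G y w v z - fderiv ℝ G y z v w)

/-- A smooth field of symmetric invertible bilinear forms on an open set. -/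
structure IsMetricOn (G : E → E →L[ℝ] E →L[ℝ] ℝ) (O : Set E) : Prop where
  isOpen : IsOpen O
  contDiffOn : ContDiffOn ℝ ∞ G O
  symm : ∀ y ∈ O, ∀ v w, G y v w = G y w v
  invertible : ∀ y ∈ O, (G y).IsInvertible

/-- Lowering the index cancels the inverse in `christoffel`. Identities for Γ are checked after
pairing with an arbitrary vector, where only derivatives of the metric occur, and `eq_of_apply_eq`
raises the index again. -/
lemma apply_christoffel {G : E → E →L[ℝ] E →L[ℝ] ℝ} {y : E} (h : (G y).IsInvertible)
    (v w z : E) : G y (christoffel G y v w) z = christoffelOne G y v w z := by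
  obtain ⟨e, he⟩ := h
  rw [christoffel, christoffelOne, ← he]
  simp

lemma eq_of_apply_eq {B : E →L[ℝ] E →L[ℝ] ℝ} (h : B.IsInvertible) {u v : E}
    (huv : ∀ z, B u z = B v z) : u = v := by
  obtain ⟨e, he⟩ := h
  apply e.injective
  ext z
  simpa [← he] using huv z

lemma isInvertible_of_nondegenerate [FiniteDimensional ℝ E] (B : E →L[ℝ] E →L[ℝ] ℝ)
    (h : ∀ v, (∀ w, B v w = 0) → v = 0) : B.IsInvertible := by
  have hinj : Function.Injective (B : E →ₗ[ℝ] E →L[ℝ] ℝ) := by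
    rw [← LinearMap.ker_eq_bot, LinearMap.ker_eq_bot']
    intro v hv
    exact h v fun w => by simpa using congrArg (fun l : E →L[ℝ] ℝ => l w) hv
  have hfd : FiniteDimensional ℝ (E →L[ℝ] ℝ) := inferInstance
  have hdim : Module.finrank ℝ E = Module.finrank ℝ (E →L[ℝ] ℝ) := by
    rw [← (LinearMap.toContinuousLinearMap : (E →ₗ[ℝ] ℝ) ≃ₗ[ℝ] _).finrank_eq]
    exact (Subspace.dual_finrank_eq).symm
  exact ⟨(LinearEquiv.ofInjectiveOfFinrankEq _ hinj hdim).toContinuousLinearEquiv, by ext; rfl⟩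

variable {G : E → E →L[ℝ] E →L[ℝ] ℝ} {O : Set E} {y : E}

namespace IsMetricOn

lemma mem_nhds (h : IsMetricOn G O) (hy : y ∈ O) : O ∈ 𝓝 y := h.isOpen.mem_nhds hy

lemma contDiffAt (h : IsMetricOn G O) (hy : y ∈ O) : ContDiffAt ℝ ∞ G y :=
  (h.contDiffOn y hy).contDiffAt (h.mem_nhds hy)

lemma differentiableAt (h : IsMetricOn G O) (hy : y ∈ O) : DifferentiableAt ℝ G y :=
  (h.contDiffAt hy).differentiableAt (by simp)

lemma fderiv_symm (h : IsMetricOn G O) (hy : y ∈ O) (u v w : E) :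
    fderiv ℝ G y u v w = fderiv ℝ G y u w v := by
  have hd := (h.differentiableAt hy).hasFDerivAt
  have key : ∀ v w, fderiv ℝ (fun y => G y v w) y u = fderiv ℝ G y u v w := by
    intro v w
    have := (hd.clm_apply (hasFDerivAt_const v y)).clm_apply (hasFDerivAt_const w y)
    simp [this.fderiv]
  rw [← key, ← key]
  congr 1
  apply Filter.EventuallyEq.fderiv_eq
  filter_upwards [h.mem_nhds hy] with y' hy'
  exact h.symm y' hy' v w

lemma apply_christoffel (h : IsMetricOn G O) (hy : y ∈ O) (v w z : E) :
    G y (christoffel G y v w) z = christoffelOne G y v w z :=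
  SemiRiem.apply_christoffel (h.invertible y hy) v w z

lemma christoffelOne_symm (h : IsMetricOn G O) (hy : y ∈ O) (v w z : E) :
    christoffelOne G y v w z = christoffelOne G y w v z := by
  simp only [christoffelOne, h.fderiv_symm hy z v w]
  ring

lemma christoffel_symm (h : IsMetricOn G O) (hy : y ∈ O) (v w : E) :
    christoffel G y v w = christoffel G y w v :=
  eq_of_apply_eq (h.invertible y hy) fun z => by
    rw [h.apply_christoffel hy, h.apply_christoffel hy, h.christoffelOne_symm hy]

/-- Metric compatibility of the Levi-Civita connection, read off from the Koszul formula. It turns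
every derivative of the metric below into Christoffel symbols. -/
lemma fderiv_eq (h : IsMetricOn G O) (hy : y ∈ O) (u v w : E) :
    fderiv ℝ G y u v w = G y (christoffel G y u v) w + G y v (christoffel G y u w) := by
  rw [h.symm y hy v, h.apply_christoffel hy, h.apply_christoffel hy]
  simp only [christoffelOne, h.fderiv_symm hy u w v]
  rw [h.fderiv_symm hy w u v, h.fderiv_symm hy v u w]
  ring

end IsMetricOn

/-- The Christoffel symbol as a continuous bilinear map. -/
def christoffelCLM (G : E → E →L[ℝ] E →L[ℝ] ℝ) (y : E) : E →L[ℝ] E →L[ℝ] E :=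
  (ContinuousLinearMap.compL ℝ E (E →L[ℝ] ℝ) E (G y).inverse).comp
    ((1 / 2 : ℝ) • (fderiv ℝ G y + (fderiv ℝ G y).flip -
      ((ContinuousLinearMap.flipₗᵢ ℝ E E ℝ).toContinuousLinearEquiv :
        (E →L[ℝ] E →L[ℝ] ℝ) →L[ℝ] (E →L[ℝ] E →L[ℝ] ℝ)).comp (fderiv ℝ G y).flip))

lemma christoffelCLM_apply (G : E → E →L[ℝ] E →L[ℝ] ℝ) (y v w : E) :
    christoffelCLM G y v w = christoffel G y v w := by
  simp [christoffelCLM, christoffel]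

lemma IsMetricOn.contDiffOn_christoffelCLM [CompleteSpace E] (h : IsMetricOn G O) :
    ContDiffOn ℝ ∞ (christoffelCLM G) O := by
  have hD : ContDiffOn ℝ ∞ (fderiv ℝ G) O := h.contDiffOn.fderiv_of_isOpen h.isOpen (by simp)
  have hI : ContDiffOn ℝ ∞ (fun y => (G y).inverse) O := fun y hy =>
    ((h.invertible y hy).contDiffAt_map_inverse.comp y (h.contDiffAt hy)).contDiffWithinAt
  have hF : ContDiffOn ℝ ∞ (fun y => (fderiv ℝ G y).flip) O :=
    ((ContinuousLinearMap.flipₗᵢ ℝ E E (E →L[ℝ] ℝ)).toContinuousLinearEquiv.contDiff).comp_contDiffOn hD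
  unfold christoffelCLM
  refine ((ContinuousLinearMap.contDiff _).comp_contDiffOn hI).clm_comp ?_
  exact ((hD.add hF).sub (contDiffOn_const.clm_comp hF)).const_smul _

/-- The pull-back of a field of bilinear forms under a map of normed spaces. -/
def pull (F : E' → E) (G : E → E →L[ℝ] E →L[ℝ] ℝ) (y : E') : E' →L[ℝ] E' →L[ℝ] ℝ :=
  ((fderiv ℝ F y).precomp ℝ).comp ((G (F y)).comp (fderiv ℝ F y))

@[simp] lemma pull_apply (F : E' → E) (G : E → E →L[ℝ] E →L[ℝ] ℝ) (y v w : E') :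
    pull F G y v w = G (F y) (fderiv ℝ F y v) (fderiv ℝ F y w) := rfl

lemma pull_eq_compL (F : E' → E) (G : E → E →L[ℝ] E →L[ℝ] ℝ) :
    pull F G = fun y => (((ContinuousLinearMap.compL ℝ E' E ℝ).flip (fderiv ℝ F y)).comp
      ((G (F y)).comp (fderiv ℝ F y))) := by
  funext y
  ext v w
  simp

lemma contDiffAt_pull {F : E' → E} {y : E'} {n : ℕ∞} (hF : ContDiffAt ℝ (n + 1) F y)
    (hG : ContDiffAt ℝ n G (F y)) : ContDiffAt ℝ n (pull F G) y := by
  have hD : ContDiffAt ℝ n (fderiv ℝ F) y := hF.fderiv_right le_rfl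
  have hGF : ContDiffAt ℝ n (fun y => G (F y)) y := hG.comp y (hF.of_le le_self_add)
  rw [pull_eq_compL]
  exact ((ContinuousLinearMap.contDiff _).comp_contDiffAt y hD).clm_comp (hGF.clm_comp hD)

lemma fderiv_pull {F : E' → E} {y : E'} (hF : ContDiffAt ℝ 2 F y)
    (hG : ContDiffAt ℝ 1 G (F y)) (u v w : E') :
    fderiv ℝ (pull F G) y u v w =
      fderiv ℝ G (F y) (fderiv ℝ F y u) (fderiv ℝ F y v) (fderiv ℝ F y w)
      + G (F y) (fderiv ℝ (fderiv ℝ F) y u v) (fderiv ℝ F y w)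
      + G (F y) (fderiv ℝ F y v) (fderiv ℝ (fderiv ℝ F) y u w) := by
  have hP : DifferentiableAt ℝ (pull F G) y :=
    (contDiffAt_pull (n := 1) (by norm_num; exact hF) hG).differentiableAt (by simp)
  have h1 := (hP.hasFDerivAt.clm_apply (hasFDerivAt_const v y)).clm_apply (hasFDerivAt_const w y)
  have hD : HasFDerivAt (fderiv ℝ F) (fderiv ℝ (fderiv ℝ F) y) y :=
    ((hF.fderiv_right (m := 1) (by norm_num)).differentiableAt (by simp)).hasFDerivAt
  have hF1 : HasFDerivAt F (fderiv ℝ F y) y := (hF.differentiableAt (by simp)).hasFDerivAt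
  have hG1 : HasFDerivAt G (fderiv ℝ G (F y)) (F y) := (hG.differentiableAt (by simp)).hasFDerivAt
  have h2 := ((hG1.comp y hF1).clm_apply (hD.clm_apply (hasFDerivAt_const v y))).clm_apply
    (hD.clm_apply (hasFDerivAt_const w y))
  have h3 := congrArg (fun l : E' →L[ℝ] ℝ => l u) (h1.unique h2)
  simp at h3
  rw [h3]
  ring

/-- Transformation of the Christoffel symbols of the first kind under pull-back. -/
lemma christoffelOne_pull {F : E' → E} {y : E'} (hF : ContDiffAt ℝ 2 F y)
    (hG : ContDiffAt ℝ 1 G (F y)) (hs : ∀ v w, G (F y) v w = G (F y) w v) (v w z : E') :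
    christoffelOne (pull F G) y v w z =
      christoffelOne G (F y) (fderiv ℝ F y v) (fderiv ℝ F y w) (fderiv ℝ F y z)
      + G (F y) (fderiv ℝ (fderiv ℝ F) y v w) (fderiv ℝ F y z) := by
  have hsym : ∀ a b, fderiv ℝ (fderiv ℝ F) y a b = fderiv ℝ (fderiv ℝ F) y b a :=
    fun a b => hF.isSymmSndFDerivAt (by simp) a b
  simp only [christoffelOne, fderiv_pull hF hG]
  rw [hsym w v, hsym z v, hsym z w, hs (fderiv ℝ (fderiv ℝ F) y v z)]
  ring

/-- Transformation of the Christoffel symbols under a local diffeomorphism. -/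
lemma fderiv_christoffel_pull {F : E' → E} {y : E'} (hF : ContDiffAt ℝ 2 F y)
    (hG : ContDiffAt ℝ 1 G (F y)) (hs : ∀ v w, G (F y) v w = G (F y) w v)
    (hi : (G (F y)).IsInvertible) (hFi : (fderiv ℝ F y).IsInvertible)
    (hP : (pull F G y).IsInvertible) (v w : E') :
    fderiv ℝ F y (christoffel (pull F G) y v w) =
      christoffel G (F y) (fderiv ℝ F y v) (fderiv ℝ F y w) + fderiv ℝ (fderiv ℝ F) y v w := by
  refine eq_of_apply_eq hi fun z => ?_
  obtain ⟨e, he⟩ := hFi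
  obtain ⟨z, rfl⟩ := e.surjective z
  have hez : e z = fderiv ℝ F y z := by rw [← he]; rfl
  rw [hez, map_add, add_apply, apply_christoffel hi, ← pull_apply,
    apply_christoffel hP, christoffelOne_pull hF hG hs]

end LocalCalculus

/-! ### Ordinary differential equations -/

section LinearODE

variable {X : Type*} [NormedAddCommGroup X] [NormedSpace ℝ X]

/-- Grönwall with a variable coefficient: on a compact interval a continuous K is bounded by a
constant. -/
lemma eq_zero_of_norm_deriv_le_right {w w' : ℝ → X} {K : ℝ → ℝ} {a b : ℝ} (hab : a ≤ b)
    (hw : ∀ t ∈ Set.Icc a b, HasDerivAt w (w' t) t) (hK : ContinuousOn K (Set.Icc a b))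
    (hle : ∀ t ∈ Set.Icc a b, ‖w' t‖ ≤ K t * ‖w t‖) (ha : w a = 0) : w b = 0 := by
  obtain ⟨C, hC⟩ := isCompact_Icc.exists_bound_of_continuousOn hK
  refine eq_zero_of_abs_deriv_le_mul_abs_self_of_eq_zero_right (f' := w') (K := C)
    (fun t ht => (hw t ht).continuousAt.continuousWithinAt)
    (fun t ht => (hw t (Set.Ico_subset_Icc_self ht)).hasDerivWithinAt) ha (fun t ht => ?_) b
    ⟨hab, le_rfl⟩
  have ht' := Set.Ico_subset_Icc_self ht
  exact (hle t ht').trans (mul_le_mul_of_nonneg_right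
    ((le_abs_self _).trans (hC t ht')) (norm_nonneg _))

lemma hasDerivAt_comp_neg {w : ℝ → X} {w' : X} {t : ℝ} (h : HasDerivAt w w' (-t)) :
    HasDerivAt (fun τ => w (-τ)) (-w') t := by
  have := h.scomp t (hasDerivAt_neg t)
  rw [neg_one_smul] at this
  exact this

/-- A function whose derivative is bounded by a multiple of itself vanishes on an interval if it
vanishes at one point. -/
lemma eq_zero_of_norm_deriv_le {w w' : ℝ → X} {K : ℝ → ℝ} {s : Set ℝ} (hs : s.OrdConnected)
    (hw : ∀ t ∈ s, HasDerivAt w (w' t) t) (hK : ContinuousOn K s)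
    (hle : ∀ t ∈ s, ‖w' t‖ ≤ K t * ‖w t‖) {t₀ : ℝ} (ht₀ : t₀ ∈ s) (h0 : w t₀ = 0) :
    ∀ t ∈ s, w t = 0 := by
  intro t ht
  rcases le_total t₀ t with h | h
  · have hsub := hs.out ht₀ ht
    exact eq_zero_of_norm_deriv_le_right h (fun τ hτ => hw τ (hsub hτ)) (hK.mono hsub)
      (fun τ hτ => hle τ (hsub hτ)) h0
  · have hsub := hs.out ht ht₀
    have hm : Set.MapsTo (fun τ : ℝ => -τ) (Set.Icc (-t₀) (-t)) (Set.Icc t t₀) := by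
      intro τ hτ
      constructor <;> linarith [hτ.1, hτ.2]
    have := eq_zero_of_norm_deriv_le_right (w := fun τ => w (-τ)) (w' := fun τ => -w' (-τ))
      (K := fun τ => K (-τ)) (neg_le_neg h)
      (fun τ hτ => hasDerivAt_comp_neg (hw (-τ) (hsub (hm hτ))))
      ((hK.mono hsub).comp continuous_neg.continuousOn hm)
      (fun τ hτ => by simpa using hle (-τ) (hsub (hm hτ))) (by simpa using h0)
    simpa using this

end LinearODE

/-! ### Smooth dependence of local flows on initial values. -/

section Flow

universe u

variable {E : Type u} [NormedAddCommGroup E] [NormedSpace ℝ E]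

/-- A quadratic Taylor remainder needs only a Lipschitz derivative: apply the mean value inequality
on the segment from p to q. This is the error with which a linearized trajectory fails to solve the
equation. -/
lemma norm_sub_sub_fderiv_le {v : E → E} {B : Set E} (hB : Convex ℝ B) {K : NNReal}
    (hd : ∀ p ∈ B, DifferentiableAt ℝ v p) (hL : LipschitzOnWith K (fderiv ℝ v) B) {p q : E}
    (hp : p ∈ B) (hq : q ∈ B) :
    ‖v q - v p - fderiv ℝ v p (q - p)‖ ≤ K * ‖q - p‖ * ‖q - p‖ := by
  have hseg : segment ℝ p q ⊆ B := hB.segment_subset hp hq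
  refine Convex.norm_image_sub_le_of_norm_hasFDerivWithin_le' (s := segment ℝ p q)
    (fun z hz => (hd z (hseg hz)).hasFDerivAt.hasFDerivWithinAt) (fun z hz => ?_)
    (convex_segment p q) (left_mem_segment ℝ p q) (right_mem_segment ℝ p q)
  rw [← dist_eq_norm]
  refine (hL.dist_le_mul z (hseg hz) p hp).trans ?_
  gcongr
  rw [dist_eq_norm]
  exact norm_sub_le_of_mem_segment hz

/-- Differentiability of a flow with respect to the initial point. -/
lemma hasFDerivAt_flow {v : E → E} {x₀ x : E} {ρ T : ℝ} {K : NNReal} (hK : 0 < K) (hρ : 0 < ρ)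
    (hT : 0 ≤ T) (hd : ∀ p ∈ Metric.ball x₀ ρ, DifferentiableAt ℝ v p)
    (hL : LipschitzOnWith K (fderiv ℝ v) (Metric.ball x₀ ρ))
    (hv : LipschitzOnWith K v (Metric.ball x₀ ρ))
    {θ : ℝ → E → E} {A : ℝ → E →L[ℝ] E}
    (hθ : ∀ᶠ x' in 𝓝 x, θ 0 x' = x' ∧ ∀ t ∈ Set.Icc 0 T,
      HasDerivAt (fun τ => θ τ x') (v (θ t x')) t ∧ θ t x' ∈ Metric.ball x₀ (ρ / 2))
    (hA : ∀ t ∈ Set.Icc 0 T, HasDerivAt A ((fderiv ℝ v (θ t x)).comp (A t)) t)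
    (hA0 : A 0 = ContinuousLinearMap.id ℝ E) (hAb : ∀ t ∈ Set.Icc 0 T, ‖A t‖ ≤ 2) :
    HasFDerivAt (θ T) (A T) x := by
  have hx := hθ.self_of_nhds
  set C : ℝ := 4 * K / K * (Real.exp (K * T) - 1) with hC
  have hKpos : (0 : ℝ) < K := by exact_mod_cast hK
  have key : ∀ᶠ x' in 𝓝 x, ‖θ T x' - θ T x - A T (x' - x)‖ ≤ C * ‖x' - x‖ ^ 2 := by
    -- Since ‖A‖ ≤ 2 and the trajectory of x stays in the ball of radius ρ / 2, displacements below
    -- ρ / 4 keep the linearized curve in the ball of radius ρ.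
    filter_upwards [hθ, Metric.ball_mem_nhds x (show 0 < ρ / 4 by positivity)] with x' hx' hball
    have hsmall : ‖x' - x‖ < ρ / 4 := by rwa [Metric.mem_ball, dist_eq_norm] at hball
    have hAle : ∀ t ∈ Set.Icc 0 T, ‖A t (x' - x)‖ ≤ 2 * ‖x' - x‖ := fun t ht =>
      (A t).le_of_opNorm_le (hAb t ht) _
    have hmem : ∀ t ∈ Set.Icc 0 T, θ t x + A t (x' - x) ∈ Metric.ball x₀ ρ := by
      intro t ht
      have h1 := (hx.2 t ht).2
      rw [Metric.mem_ball, dist_eq_norm] at h1 ⊢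
      have h2 := hAle t ht
      calc ‖θ t x + A t (x' - x) - x₀‖ = ‖(θ t x - x₀) + A t (x' - x)‖ := by congr 1; abel
        _ ≤ ‖θ t x - x₀‖ + ‖A t (x' - x)‖ := norm_add_le _ _
        _ < ρ := by linarith
    have hsub : Metric.ball x₀ (ρ / 2) ⊆ Metric.ball x₀ ρ :=
      Metric.ball_subset_ball (by linarith)
    have hder : ∀ t ∈ Set.Icc 0 T, HasDerivAt (fun τ => θ τ x + A τ (x' - x))
        (v (θ t x) + fderiv ℝ v (θ t x) (A t (x' - x))) t := by
      intro t ht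
      have h1 := (hA t ht).clm_apply (hasDerivAt_const t (x' - x))
      rw [map_zero, add_zero] at h1
      exact (hx.2 t ht).1.add h1
    -- The curve θ_t x + A_t(x' - x) solves the equation up to K (2‖x' - x‖)², and it starts at x'.
    -- Grönwall bounds its distance to the true trajectory by a constant times ‖x' - x‖², which is
    -- differentiability with derivative A.
    have hgr := dist_le_of_approx_trajectories_ODE_of_mem (v := fun _ => v)
      (s := fun _ => Metric.ball x₀ ρ) (K := K) (f := fun τ => θ τ x')
      (g := fun τ => θ τ x + A τ (x' - x)) (f' := fun t => v (θ t x'))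
      (g' := fun t => v (θ t x) + fderiv ℝ v (θ t x) (A t (x' - x))) (a := 0) (b := T)
      (εf := 0) (εg := 4 * K * ‖x' - x‖ ^ 2) (δ := 0)
      (fun t _ => hv)
      (fun t ht => (hx'.2 t ht).1.continuousAt.continuousWithinAt)
      (fun t ht => (hx'.2 t (Set.Ico_subset_Icc_self ht)).1.hasDerivWithinAt)
      (fun t ht => by simp)
      (fun t ht => hsub (hx'.2 t (Set.Ico_subset_Icc_self ht)).2)
      (fun t ht => (hder t ht).continuousAt.continuousWithinAt)
      (fun t ht => (hder t (Set.Ico_subset_Icc_self ht)).hasDerivWithinAt)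
      (fun t ht => by
        have ht' := Set.Ico_subset_Icc_self ht
        have h1 := norm_sub_sub_fderiv_le (convex_ball x₀ ρ) hd hL (hsub (hx.2 t ht').2)
          (hmem t ht')
        rw [dist_eq_norm, ← norm_neg]
        have h2 := hAle t ht'
        have h3 : -(v (θ t x) + fderiv ℝ v (θ t x) (A t (x' - x)) - v (θ t x + A t (x' - x)))
            = v (θ t x + A t (x' - x)) - v (θ t x)
              - fderiv ℝ v (θ t x) (θ t x + A t (x' - x) - θ t x) := by
          rw [add_sub_cancel_left]; abel
        rw [h3]
        refine h1.trans ?_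
        rw [add_sub_cancel_left]
        calc (K : ℝ) * ‖A t (x' - x)‖ * ‖A t (x' - x)‖
            ≤ K * (2 * ‖x' - x‖) * (2 * ‖x' - x‖) := by gcongr
          _ = _ := by ring)
      (fun t ht => hmem t (Set.Ico_subset_Icc_self ht))
      (by simp [hx.1, hx'.1, hA0]) T ⟨hT, le_rfl⟩
    rw [dist_eq_norm, gronwallBound_of_K_ne_0 hKpos.ne'] at hgr
    calc ‖θ T x' - θ T x - A T (x' - x)‖ = ‖θ T x' - (θ T x + A T (x' - x))‖ := by
          congr 1; abel
      _ ≤ _ := hgr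
      _ = C * ‖x' - x‖ ^ 2 := by simp only [hC]; ring_nf
  rw [hasFDerivAt_iff_isLittleO]
  have hO : (fun x' => θ T x' - θ T x - A T (x' - x)) =O[𝓝 x] fun x' => ‖x' - x‖ ^ 2 :=
    Asymptotics.IsBigO.of_bound C (by
      filter_upwards [key] with x' h
      simpa using h)
  refine hO.trans_isLittleO ?_
  have h2 : (fun x' => ‖x' - x‖ ^ 2) =o[𝓝 x] fun x' => ‖x' - x‖ := by
    have hpow := Asymptotics.isLittleO_pow_id (𝕜 := ℝ) (n := 2) (by norm_num)
    have ht : Filter.Tendsto (fun x' => ‖x' - x‖) (𝓝 x) (𝓝 0) := by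
      have : Continuous fun x' : E => ‖x' - x‖ := by fun_prop
      simpa using this.tendsto x
    exact hpow.comp_tendsto ht
  exact h2.of_norm_right

/-- Picard–Lindelöf with parameters; continuity at (0, x₀) allows shrinking times and initial points
until all trajectories remain in O. -/
lemma exists_continuousOn_flow [CompleteSpace E] {v : E → E} {O : Set E} (hO : IsOpen O) {x₀ : E}
    (hx₀ : x₀ ∈ O) (hv : ContDiffOn ℝ ∞ v O) :
    ∃ δ > 0, ∃ U : Set E, IsOpen U ∧ x₀ ∈ U ∧ ∃ θ : ℝ × E → E,
      ContinuousOn θ (Set.Ioo (-δ) δ ×ˢ U) ∧ (∀ x ∈ U, θ (0, x) = x) ∧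
      ∀ t ∈ Set.Ioo (-δ) δ, ∀ x ∈ U, θ (t, x) ∈ O ∧
        HasDerivAt (fun τ => θ (τ, x)) (v (θ (t, x))) t := by
  have hv1 : ContDiffAt ℝ 1 v x₀ := ((hv x₀ hx₀).contDiffAt (hO.mem_nhds hx₀)).of_le (by simp)
  obtain ⟨ε, hε, a, r, L, K, hr, hpl⟩ := IsPicardLindelof.of_contDiffAt_one hv1
  obtain ⟨α, hα, hαc⟩ := (hpl 0).exists_forall_mem_closedBall_eq_hasDerivWithinAt_continuousOn
  set θ : ℝ × E → E := fun p => α (p.2, p.1) with hθ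
  have hc : ContinuousOn θ (Set.Ioo (-ε) ε ×ˢ Metric.ball x₀ r) := by
    refine hαc.comp continuous_swap.continuousOn ?_
    rintro ⟨t, x⟩ ⟨ht, hx⟩
    exact ⟨Metric.ball_subset_closedBall hx, by simpa using Set.Ioo_subset_Icc_self ht⟩
  have hopen : IsOpen (Set.Ioo (-ε) ε ×ˢ Metric.ball x₀ (r : ℝ)) :=
    isOpen_Ioo.prod Metric.isOpen_ball
  have h0 : ((0 : ℝ), x₀) ∈ Set.Ioo (-ε) ε ×ˢ Metric.ball x₀ (r : ℝ) :=
    ⟨⟨by linarith, hε⟩, Metric.mem_ball_self (by exact_mod_cast hr)⟩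
  have hθ0 : θ (0, x₀) = x₀ := (hα x₀ (Metric.mem_closedBall_self (by positivity))).1
  have hpre : θ ⁻¹' O ∩ (Set.Ioo (-ε) ε ×ˢ Metric.ball x₀ (r : ℝ)) ∈ 𝓝 ((0 : ℝ), x₀) :=
    Filter.inter_mem ((hc.continuousAt (hopen.mem_nhds h0)).preimage_mem_nhds
      (hO.mem_nhds (by rwa [hθ0]))) (hopen.mem_nhds h0)
  rw [nhds_prod_eq] at hpre
  obtain ⟨S, hS, U, hU, hSU⟩ := Filter.mem_prod_iff.1 hpre
  obtain ⟨δ, hδ, hδS⟩ := Metric.mem_nhds_iff.1 hS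
  obtain ⟨U', hU'U, hU'o, hxU'⟩ := mem_nhds_iff.1 hU
  have hsub : Set.Ioo (-δ) δ ×ˢ U' ⊆
      θ ⁻¹' O ∩ (Set.Ioo (-ε) ε ×ˢ Metric.ball x₀ (r : ℝ)) := by
    rintro ⟨t, x⟩ ⟨ht, hx⟩
    refine hSU ⟨hδS ?_, hU'U hx⟩
    rw [Real.ball_eq_Ioo]
    simpa using ht
  refine ⟨δ, hδ, U', hU'o, hxU', θ, hc.mono fun p hp => (hsub hp).2, fun x hx => ?_,
    fun t ht x hx => ⟨(hsub (show (t, x) ∈ _ from ⟨ht, hx⟩)).1, ?_⟩⟩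
  · have := (hsub (show ((0 : ℝ), x) ∈ Set.Ioo (-δ) δ ×ˢ U' from ⟨⟨by linarith, hδ⟩, hx⟩)).2.2
    exact (hα x (Metric.ball_subset_closedBall this)).1
  · have h1 := (hsub (show (t, x) ∈ Set.Ioo (-δ) δ ×ˢ U' from ⟨ht, hx⟩)).2
    have h2 := (hα x (Metric.ball_subset_closedBall h1.2)).2 t
      (by simpa using Set.Ioo_subset_Icc_self h1.1)
    exact h2.hasDerivAt (Icc_mem_nhds (by simpa using h1.1.1) (by simpa using h1.1.2))

/-- Smooth dependence on initial conditions: a smooth vector field has local flows of class `C^k`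
for each `k`. -/
theorem exists_contDiffOn_flow (k : ℕ) : ∀ {E : Type u} [NormedAddCommGroup E] [NormedSpace ℝ E]
    [CompleteSpace E] {v : E → E} {O : Set E} (_ : IsOpen O) {x₀ : E} (_ : x₀ ∈ O)
    (_ : ContDiffOn ℝ ∞ v O),
    ∃ δ > 0, ∃ U : Set E, IsOpen U ∧ x₀ ∈ U ∧ ∃ θ : ℝ × E → E,
      ContDiffOn ℝ k θ (Set.Ioo (-δ) δ ×ˢ U) ∧ (∀ x ∈ U, θ (0, x) = x) ∧
      ∀ t ∈ Set.Ioo (-δ) δ, ∀ x ∈ U, θ (t, x) ∈ O ∧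
        HasDerivAt (fun τ => θ (τ, x)) (v (θ (t, x))) t := by
  induction k with
  | zero =>
    intro E _ _ _ v O hO x₀ hx₀ hv
    simpa using exists_continuousOn_flow hO hx₀ hv
  | succ k ih =>
    intro E _ _ _ v O hO x₀ hx₀ hv
    have hDv : ContDiffOn ℝ ∞ (fderiv ℝ v) O := hv.fderiv_of_isOpen hO (by simp)
    have hvat : ∀ p ∈ O, ContDiffAt ℝ ∞ v p := fun p hp => (hv p hp).contDiffAt (hO.mem_nhds hp)
    obtain ⟨K₁, s₁, hs₁, hL₁⟩ :=
      ((hvat x₀ hx₀).of_le (show (1 : WithTop ℕ∞) ≤ ∞ by simp)).exists_lipschitzOnWith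
    obtain ⟨K₂, s₂, hs₂, hL₂⟩ := (((hDv x₀ hx₀).contDiffAt (hO.mem_nhds hx₀)).of_le
      (show (1 : WithTop ℕ∞) ≤ ∞ by simp)).exists_lipschitzOnWith
    obtain ⟨ρ, hρ, hρs⟩ := Metric.mem_nhds_iff.1
      (Filter.inter_mem (Filter.inter_mem hs₁ hs₂) (hO.mem_nhds hx₀))
    set K : NNReal := K₁ + K₂ + 1 with hK
    have hKpos : 0 < K := by positivity
    have hLv : LipschitzOnWith K v (Metric.ball x₀ ρ) :=
      (hL₁.mono fun p hp => (hρs hp).1.1).weaken (by rw [hK, add_assoc]; exact le_self_add)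
    have hLD : LipschitzOnWith K (fderiv ℝ v) (Metric.ball x₀ ρ) :=
      (hL₂.mono fun p hp => (hρs hp).1.2).weaken
        (by rw [hK, add_comm K₁, add_assoc]; exact le_self_add)
    have hdv : ∀ p ∈ Metric.ball x₀ ρ, DifferentiableAt ℝ v p := fun p hp =>
      (hvat p (hρs hp).2).differentiableAt (by simp)
    -- The variational system: v together with its linearization. A C^k flow of w contains the flow
    -- of v and its spatial derivative, so the flow of v is C^(k+1). As w lives on a larger space,
    -- the induction runs over all spaces of the universe.
    let w : E × (E →L[ℝ] E) → E × (E →L[ℝ] E) := fun p => (v p.1, (fderiv ℝ v p.1).comp p.2)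
    -- The second factor contains the identity and supplies the bound ‖A‖ ≤ 2 that
    -- `hasFDerivAt_flow` requires.
    let O' : Set (E × (E →L[ℝ] E)) := Metric.ball x₀ (ρ / 2) ×ˢ Metric.ball 0 2
    have hO' : IsOpen O' := Metric.isOpen_ball.prod Metric.isOpen_ball
    have hhalf : Metric.ball x₀ (ρ / 2) ⊆ O := fun p hp =>
      (hρs (Metric.ball_subset_ball (by linarith) hp)).2
    have hw : ContDiffOn ℝ ∞ w O' := by
      have hf : Set.MapsTo (Prod.fst : E × (E →L[ℝ] E) → E) O' O := fun p hp => hhalf hp.1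
      exact (hv.comp contDiff_fst.contDiffOn hf).prodMk
        ((hDv.comp contDiff_fst.contDiffOn hf).clm_comp contDiff_snd.contDiffOn)
    have hmem' : (x₀, ContinuousLinearMap.id ℝ E) ∈ O' := by
      refine ⟨Metric.mem_ball_self (by positivity), ?_⟩
      rw [mem_ball_zero_iff]
      exact ContinuousLinearMap.norm_id_le.trans_lt (by norm_num)
    obtain ⟨δ, hδ, U', hU', hxU', Θ, hΘ, hΘ0, hΘd⟩ := ih hO' hmem' hw
    let j : E → E × (E →L[ℝ] E) := fun x => (x, ContinuousLinearMap.id ℝ E)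
    have hj : ContDiff ℝ ∞ j := contDiff_id.prodMk contDiff_const
    let U : Set E := j ⁻¹' U'
    have hU : IsOpen U := hU'.preimage hj.continuous
    let J : ℝ × E → ℝ × (E × (E →L[ℝ] E)) := fun p => (p.1, j p.2)
    have hJ : ContDiff ℝ ∞ J := contDiff_fst.prodMk (hj.comp contDiff_snd)
    have hJm : Set.MapsTo J (Set.Ioo (-δ) δ ×ˢ U) (Set.Ioo (-δ) δ ×ˢ U') := fun p hp => hp
    have hΘJ : ContDiffOn ℝ k (fun p => Θ (J p)) (Set.Ioo (-δ) δ ×ˢ U) :=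
      hΘ.comp (hJ.of_le (by exact_mod_cast le_top)).contDiffOn hJm
    let θ : ℝ × E → E := fun p => (Θ (J p)).1
    let A : ℝ × E → E →L[ℝ] E := fun p => (Θ (J p)).2
    have hθk : ContDiffOn ℝ k θ (Set.Ioo (-δ) δ ×ˢ U) := contDiff_fst.comp_contDiffOn hΘJ
    have hAk : ContDiffOn ℝ k A (Set.Ioo (-δ) δ ×ˢ U) := contDiff_snd.comp_contDiffOn hΘJ
    have hθ0 : ∀ x ∈ U, θ (0, x) = x := fun x hx => congrArg Prod.fst (hΘ0 (j x) hx)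
    have hA0 : ∀ x ∈ U, A (0, x) = ContinuousLinearMap.id ℝ E := fun x hx =>
      congrArg Prod.snd (hΘ0 (j x) hx)
    have hball : ∀ t ∈ Set.Ioo (-δ) δ, ∀ x ∈ U, θ (t, x) ∈ Metric.ball x₀ (ρ / 2) :=
      fun t ht x hx => (hΘd t ht (j x) hx).1.1
    have hAb : ∀ t ∈ Set.Ioo (-δ) δ, ∀ x ∈ U, ‖A (t, x)‖ ≤ 2 := fun t ht x hx =>
      (mem_ball_zero_iff.1 (hΘd t ht (j x) hx).1.2).le
    have hθd : ∀ t ∈ Set.Ioo (-δ) δ, ∀ x ∈ U,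
        HasDerivAt (fun τ => θ (τ, x)) (v (θ (t, x))) t := fun t ht x hx =>
      (ContinuousLinearMap.fst ℝ E (E →L[ℝ] E)).hasFDerivAt.comp_hasDerivAt t
        (hΘd t ht (j x) hx).2
    have hAd : ∀ t ∈ Set.Ioo (-δ) δ, ∀ x ∈ U,
        HasDerivAt (fun τ => A (τ, x)) ((fderiv ℝ v (θ (t, x))).comp (A (t, x))) t :=
      fun t ht x hx =>
      (ContinuousLinearMap.snd ℝ E (E →L[ℝ] E)).hasFDerivAt.comp_hasDerivAt t
        (hΘd t ht (j x) hx).2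
    have hspace : ∀ t ∈ Set.Ioo (-δ) δ, ∀ x ∈ U,
        HasFDerivAt (fun x' => θ (t, x')) (A (t, x)) x := by
      intro t ht x hx
      rcases le_total 0 t with h0 | h0
      · have hI : ∀ τ ∈ Set.Icc 0 t, τ ∈ Set.Ioo (-δ) δ := fun τ hτ =>
          ⟨by linarith [hτ.1], by linarith [hτ.2, ht.2]⟩
        refine hasFDerivAt_flow (v := v) (θ := fun τ x' => θ (τ, x')) (A := fun τ => A (τ, x))
          hKpos hρ h0 hdv hLD hLv ?_ (fun τ hτ => hAd τ (hI τ hτ) x hx) (hA0 x hx)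
          (fun τ hτ => hAb τ (hI τ hτ) x hx)
        filter_upwards [hU.mem_nhds hx] with x' hx'
        exact ⟨hθ0 x' hx', fun τ hτ => ⟨hθd τ (hI τ hτ) x' hx', hball τ (hI τ hτ) x' hx'⟩⟩
      -- Negative times: run the flow of -v forwards.
      · have hI : ∀ τ ∈ Set.Icc 0 (-t), -τ ∈ Set.Ioo (-δ) δ := fun τ hτ =>
          ⟨by linarith [hτ.2, ht.1], by linarith [hτ.1]⟩
        have hneg : ∀ p ∈ Metric.ball x₀ ρ, fderiv ℝ (fun q => -v q) p = -fderiv ℝ v p :=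
          fun p _ => fderiv_neg
        have := hasFDerivAt_flow (v := fun q => -v q) (θ := fun τ x' => θ (-τ, x'))
          (A := fun τ => A (-τ, x)) (T := -t) (x := x)
          hKpos hρ (by linarith) (fun p hp => (hdv p hp).neg)
          (by
            intro p hp q hq
            simpa [hneg p hp, hneg q hq] using hLD hp hq)
          (by
            intro p hp q hq
            simpa using hLv hp hq) ?_ ?_ (by simpa using hA0 x hx)
          (fun τ hτ => hAb (-τ) (hI τ hτ) x hx)
        · simpa using this
        · filter_upwards [hU.mem_nhds hx] with x' hx'
          refine ⟨by simpa using hθ0 x' hx', fun τ hτ => ⟨?_, hball (-τ) (hI τ hτ) x' hx'⟩⟩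
          exact hasDerivAt_comp_neg (hθd (-τ) (hI τ hτ) x' hx')
        · intro τ hτ
          have := hasDerivAt_comp_neg (hAd (-τ) (hI τ hτ) x hx)
          rw [show fderiv ℝ (fun q => -v q) (θ (-τ, x)) = -fderiv ℝ v (θ (-τ, x)) from
            fderiv_neg, ContinuousLinearMap.neg_comp]
          exact this
    have hopen : IsOpen (Set.Ioo (-δ) δ ×ˢ U) := isOpen_Ioo.prod hU
    have hθc : ContinuousOn θ (Set.Ioo (-δ) δ ×ˢ U) := hθk.continuousOn
    have hvθ : ContDiffOn ℝ k (fun p => v (θ p)) (Set.Ioo (-δ) δ ×ˢ U) :=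
      (hv.of_le (by exact_mod_cast le_top)).comp hθk fun p hp => hhalf (hball p.1 hp.1 p.2 hp.2)
    let f₁ : ℝ → E → ℝ →L[ℝ] E := fun t x => ContinuousLinearMap.toSpanSingleton ℝ (v (θ (t, x)))
    have hf₁ : ContDiffOn ℝ k (fun p : ℝ × E => f₁ p.1 p.2) (Set.Ioo (-δ) δ ×ˢ U) :=
      (ContinuousLinearMap.toSpanSingletonCLE (𝕜 := ℝ) (E := E)).contDiff.comp_contDiffOn hvθ
    -- Continuous partial derivatives v ∘ θ in time and A in space give a total derivative. Both are
    -- C^k, which is the regularity gained.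
    have hfd : ∀ p ∈ Set.Ioo (-δ) δ ×ˢ U,
        HasFDerivAt θ ((f₁ p.1 p.2).coprod (A p)) p := by
      intro p hp
      have := hasStrictFDerivAt_uncurry_coprod (u := p) (f := fun t x => θ (t, x)) (f₁ := f₁)
        (f₂ := fun t x => A (t, x))
        (by
          filter_upwards [hopen.mem_nhds hp] with q hq
          exact (hθd q.1 hq.1 q.2 hq.2).hasFDerivAt)
        (by
          filter_upwards [hopen.mem_nhds hp] with q hq
          exact hspace q.1 hq.1 q.2 hq.2)
        (hf₁.continuousOn.continuousAt (hopen.mem_nhds hp))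
        (hAk.continuousOn.continuousAt (hopen.mem_nhds hp))
      exact this.hasFDerivAt
    refine ⟨δ, hδ, U, hU, hxU', θ, ?_, hθ0, fun t ht x hx =>
      ⟨hhalf (hball t ht x hx), hθd t ht x hx⟩⟩
    rw [Nat.cast_add, Nat.cast_one, contDiffOn_succ_iff_fderiv_of_isOpen hopen]
    refine ⟨fun p hp => (hfd p hp).differentiableAt.differentiableWithinAt, by simp, ?_⟩
    refine ContDiffOn.congr ?_ fun p hp => (hfd p hp).fderiv
    have := (hf₁.clm_comp (contDiffOn_const (c := ContinuousLinearMap.fst ℝ ℝ E))).add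
      (hAk.clm_comp (contDiffOn_const (c := ContinuousLinearMap.snd ℝ ℝ E)))
    refine this.congr fun p hp => ?_
    ext <;> simp

end Flow

/-! ### Derivatives and forms in the model space -/

section Bridge

variable {E : Type*} [NormedAddCommGroup E] [NormedSpace ℝ E]
  {H : Type*} [TopologicalSpace H] (I : ModelWithCorners ℝ E H)
  {E' : Type*} [NormedAddCommGroup E'] [NormedSpace ℝ E']
  {H' : Type*} [TopologicalSpace H'] (I' : ModelWithCorners ℝ E' H')
  {E'' : Type*} [NormedAddCommGroup E''] [NormedSpace ℝ E'']
  {H'' : Type*} [TopologicalSpace H''] (I'' : ModelWithCorners ℝ E'' H'')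
  {M : Type*} [TopologicalSpace M] [ChartedSpace H M]
  {M' : Type*} [TopologicalSpace M'] [ChartedSpace H' M']
  {M'' : Type*} [TopologicalSpace M''] [ChartedSpace H'' M'']

/-- All tangent spaces are definitionally the model space. `md` and `form` forget the base point in
the types, so that equations between base points can be rewritten. -/
def md (f : M → M') (x : M) : E →L[ℝ] E' := mfderiv I I' f x

def form (g : BilinField I M) (x : M) : E →L[ℝ] E →L[ℝ] ℝ := g x

variable {I I' I''}

lemma form_pullback (f : M → M') (g : BilinField I' M') (x : M) (v w : E) :
    form I (pullback I I' f g) x v w = form I' g (f x) (md I I' f x v) (md I I' f x w) := rfl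

lemma md_comp {f : M' → M''} {h : M → M'} {x : M} (hf : MDifferentiableAt I' I'' f (h x))
    (hh : MDifferentiableAt I I' h x) :
    md I I'' (f ∘ h) x = (md I' I'' f (h x)).comp (md I I' h x) := mfderiv_comp x hf hh

lemma md_comp_apply {f : M' → M''} {h : M → M'} {x : M} (hf : MDifferentiableAt I' I'' f (h x))
    (hh : MDifferentiableAt I I' h x) (v : E) :
    md I I'' (fun z => f (h z)) x v = md I' I'' f (h x) (md I I' h x v) :=
  congrArg (fun l : E →L[ℝ] E'' => l v) (md_comp hf hh)

lemma md_congr {f f' : M → M'} {x : M} (h : f =ᶠ[𝓝 x] f') : md I I' f x = md I I' f' x :=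
  h.mfderiv_eq

lemma md_eq_fderiv (f : E → E') (x : E) : md 𝓘(ℝ, E) 𝓘(ℝ, E') f x = fderiv ℝ f x :=
  mfderiv_eq_fderiv

lemma md_id (x : M) : md I I (id : M → M) x = ContinuousLinearMap.id ℝ E := mfderiv_id

lemma pullback_congr {f f' : M → M'} {x : M} (h : f =ᶠ[𝓝 x] f') (g : BilinField I' M') :
    form I (pullback I I' f g) x = form I (pullback I I' f' g) x := by
  ext v w
  rw [form_pullback, form_pullback, md_congr h, h.self_of_nhds]

lemma pullback_comp {f : M' → M''} {h : M → M'} {x : M} (hf : MDifferentiableAt I' I'' f (h x))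
    (hh : MDifferentiableAt I I' h x) (g : BilinField I'' M'') :
    form I (pullback I I'' (f ∘ h) g) x = form I (pullback I I' h (pullback I' I'' f g)) x := by
  ext v w
  rw [form_pullback, form_pullback, form_pullback, md_comp hf hh]
  rfl

lemma form_pullback_eq_pull (F : E' → E) (G : BilinField 𝓘(ℝ, E) E) (y : E') :
    form 𝓘(ℝ, E') (pullback 𝓘(ℝ, E') 𝓘(ℝ, E) F G) y = pull F (form 𝓘(ℝ, E) G) y := by
  ext v w
  rw [form_pullback, md_eq_fderiv, pull_apply]

section Chart

variable [I.Boundaryless] [IsManifold I ∞ M]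

lemma isOpen_target (x₀ : M) : IsOpen (extChartAt I x₀).target := isOpen_extChartAt_target x₀

lemma contMDiffAt_chart {x₀ x : M} (hx : x ∈ (extChartAt I x₀).source) :
    ContMDiffAt I 𝓘(ℝ, E) ∞ (extChartAt I x₀) x :=
  contMDiffAt_extChartAt' (by rwa [← extChartAt_source I])

lemma contMDiffAt_chart_symm {x₀ : M} {y : E} (hy : y ∈ (extChartAt I x₀).target) :
    ContMDiffAt 𝓘(ℝ, E) I ∞ (extChartAt I x₀).symm y :=
  (contMDiffOn_extChartAt_symm x₀ y hy).contMDiffAt ((isOpen_target x₀).mem_nhds hy)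

lemma mdifferentiableAt_chart {x₀ x : M} (hx : x ∈ (extChartAt I x₀).source) :
    MDifferentiableAt I 𝓘(ℝ, E) (extChartAt I x₀) x :=
  (contMDiffAt_chart hx).mdifferentiableAt (by simp)

lemma mdifferentiableAt_chart_symm {x₀ : M} {y : E} (hy : y ∈ (extChartAt I x₀).target) :
    MDifferentiableAt 𝓘(ℝ, E) I (extChartAt I x₀).symm y :=
  (contMDiffAt_chart_symm hy).mdifferentiableAt (by simp)

lemma md_chart_self (x : M) :
    md I 𝓘(ℝ, E) (extChartAt I x) x = ContinuousLinearMap.id ℝ E := by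
  have : IsManifold I 1 M := IsManifold.of_le (n := ∞) (by simp)
  exact mfderiv_extChartAt_self

lemma md_chart_comp_symm {x₀ : M} {y : E} (hy : y ∈ (extChartAt I x₀).target) (v : E) :
    md I 𝓘(ℝ, E) (extChartAt I x₀) ((extChartAt I x₀).symm y)
      (md 𝓘(ℝ, E) I (extChartAt I x₀).symm y v) = v := by
  have h := md_comp (mdifferentiableAt_chart (I := I) ((extChartAt I x₀).map_target hy))
    (mdifferentiableAt_chart_symm hy)
  rw [md_congr (f' := id) (by
    filter_upwards [(isOpen_target x₀).mem_nhds hy] with z hz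
    exact (extChartAt I x₀).right_inv hz), md_id] at h
  exact (congrArg (fun l : E →L[ℝ] E => l v) h).symm

lemma md_chart_symm_comp {x₀ x : M} (hx : x ∈ (extChartAt I x₀).source) (v : E) :
    md 𝓘(ℝ, E) I (extChartAt I x₀).symm (extChartAt I x₀ x)
      (md I 𝓘(ℝ, E) (extChartAt I x₀) x v) = v := by
  have h := md_comp (mdifferentiableAt_chart_symm (I := I) ((extChartAt I x₀).map_source hx))
    (mdifferentiableAt_chart hx)
  rw [md_congr (f' := id) (by
    filter_upwards [(isOpen_extChartAt_source x₀).mem_nhds hx] with z hz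
    exact (extChartAt I x₀).left_inv hz), md_id] at h
  exact (congrArg (fun l : E →L[ℝ] E => l v) h).symm

lemma md_chart_symm_self (x : M) :
    md 𝓘(ℝ, E) I (extChartAt I x).symm (extChartAt I x x) = ContinuousLinearMap.id ℝ E := by
  ext v
  have := md_chart_symm_comp (I := I) (mem_extChartAt_source x) v
  rwa [md_chart_self] at this

lemma md_chart_symm_bijective {x₀ : M} {y : E} (hy : y ∈ (extChartAt I x₀).target) :
    Function.Bijective (md 𝓘(ℝ, E) I (extChartAt I x₀).symm y) := by
  refine ⟨Function.LeftInverse.injective (md_chart_comp_symm hy), fun v => ?_⟩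
  have := md_chart_symm_comp (I := I) ((extChartAt I x₀).map_target hy) v
  rw [(extChartAt I x₀).right_inv hy] at this
  exact ⟨_, this⟩

lemma chartMetric_apply (g : BilinField I M) (x₀ : M) (y v w : E) :
    chartMetric I g x₀ y v w = form I g ((extChartAt I x₀).symm y)
      (md 𝓘(ℝ, E) I (extChartAt I x₀).symm y v) (md 𝓘(ℝ, E) I (extChartAt I x₀).symm y w) := rfl

lemma chartMetric_self (g : BilinField I M) (x : M) :
    chartMetric I g x (extChartAt I x x) = form I g x := by
  ext v w
  rw [chartMetric_apply, md_chart_symm_self, extChartAt_to_inv]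
  rfl

lemma form_eq_chartMetric (g : BilinField I M) {x₀ x : M} (hx : x ∈ (extChartAt I x₀).source)
    (v w : E) : form I g x v w = chartMetric I g x₀ (extChartAt I x₀ x)
      (md I 𝓘(ℝ, E) (extChartAt I x₀) x v) (md I 𝓘(ℝ, E) (extChartAt I x₀) x w) := by
  rw [chartMetric_apply, md_chart_symm_comp hx, md_chart_symm_comp hx,
    (extChartAt I x₀).left_inv hx]

/-- A metric in a parametrization is the pull-back of the metric in a chart. -/
lemma pullback_eq_pull_chartMetric (g : BilinField I M) {ψ : E' → M} {y : E'} {x₀ : M}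
    (hψ : MDifferentiableAt 𝓘(ℝ, E') I ψ y) (hy : ψ y ∈ (extChartAt I x₀).source) :
    form 𝓘(ℝ, E') (pullback 𝓘(ℝ, E') I ψ g) y =
      pull (fun z => extChartAt I x₀ (ψ z)) (chartMetric I g x₀) y := by
  have hev : ψ =ᶠ[𝓝 y] (extChartAt I x₀).symm ∘ fun z => extChartAt I x₀ (ψ z) := by
    filter_upwards [hψ.continuousAt.preimage_mem_nhds
      ((isOpen_extChartAt_source x₀).mem_nhds hy)] with z hz
    exact ((extChartAt I x₀).left_inv hz).symm
  have h2 : MDifferentiableAt 𝓘(ℝ, E') 𝓘(ℝ, E) (fun z => extChartAt I x₀ (ψ z)) y :=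
    (mdifferentiableAt_chart hy).comp y hψ
  rw [pullback_congr hev, pullback_comp (h := fun z => extChartAt I x₀ (ψ z))
    (mdifferentiableAt_chart_symm ((extChartAt I x₀).map_source hy)) h2, form_pullback_eq_pull]
  rfl

lemma chartMetric_eq_pull (g : BilinField I M) {x₀ x₁ : M} {y : E}
    (hy : y ∈ (extChartAt I x₀).target) (hy' : (extChartAt I x₀).symm y ∈ (extChartAt I x₁).source) :
    chartMetric I g x₀ y =
      pull (fun z => extChartAt I x₁ ((extChartAt I x₀).symm z)) (chartMetric I g x₁) y :=
  pullback_eq_pull_chartMetric g (mdifferentiableAt_chart_symm hy) hy'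

lemma contDiffAt_chart_comp {ψ : E' → M} {y : E'} {x₀ : M} {n : WithTop ℕ∞}
    (hψ : ContMDiffAt 𝓘(ℝ, E') I n ψ y) (hn : n ≤ ∞) (hy : ψ y ∈ (extChartAt I x₀).source) :
    ContDiffAt ℝ n (fun z => extChartAt I x₀ (ψ z)) y :=
  (((contMDiffAt_chart hy).of_le hn).comp y hψ).contDiffAt

lemma contDiffAt_transition {x₀ x₁ : M} {y : E} (hy : y ∈ (extChartAt I x₀).target)
    (hy' : (extChartAt I x₀).symm y ∈ (extChartAt I x₁).source) :
    ContDiffAt ℝ ∞ (fun z => extChartAt I x₁ ((extChartAt I x₀).symm z)) y :=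
  contDiffAt_chart_comp (contMDiffAt_chart_symm hy) le_rfl hy'

lemma fderiv_chart_comp {ψ : E' → M} {y : E'} {x₀ : M} (hψ : MDifferentiableAt 𝓘(ℝ, E') I ψ y)
    (hy : ψ y ∈ (extChartAt I x₀).source) (v : E') :
    fderiv ℝ (fun z => extChartAt I x₀ (ψ z)) y v =
      md I 𝓘(ℝ, E) (extChartAt I x₀) (ψ y) (md 𝓘(ℝ, E') I ψ y v) := by
  rw [← md_eq_fderiv, md_comp_apply (mdifferentiableAt_chart hy) hψ]

lemma isInvertible_of_bijective [FiniteDimensional ℝ E] {l : E →L[ℝ] E'}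
    (h : Function.Bijective l) : l.IsInvertible := by
  have : FiniteDimensional ℝ E' := Module.Finite.of_surjective l.toLinearMap h.2
  exact ⟨(LinearEquiv.ofBijective l.toLinearMap h).toContinuousLinearEquiv, by ext; rfl⟩

lemma isInvertible_fderiv_transition [FiniteDimensional ℝ E] {x₀ x₁ : M} {y : E}
    (hy : y ∈ (extChartAt I x₀).target)
    (hy' : (extChartAt I x₀).symm y ∈ (extChartAt I x₁).source) :
    (fderiv ℝ (fun z => extChartAt I x₁ ((extChartAt I x₀).symm z)) y).IsInvertible := by
  refine isInvertible_of_bijective ?_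
  have h : ⇑(fderiv ℝ (fun z => extChartAt I x₁ ((extChartAt I x₀).symm z)) y) =
      (md I 𝓘(ℝ, E) (extChartAt I x₁) ((extChartAt I x₀).symm y)) ∘
        (md 𝓘(ℝ, E) I (extChartAt I x₀).symm y) :=
    funext fun v => fderiv_chart_comp (mdifferentiableAt_chart_symm hy) hy' v
  rw [h]
  refine Function.Bijective.comp ⟨Function.LeftInverse.injective (md_chart_symm_comp hy'),
    fun v => ?_⟩ (md_chart_symm_bijective hy)
  have := md_chart_comp_symm (I := I) ((extChartAt I x₁).map_source hy') v
  rw [(extChartAt I x₁).left_inv hy'] at this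
  exact ⟨_, this⟩

/-- Smoothness of a field of bilinear forms in terms of the metric in charts. -/
lemma contMDiffAt_section_iff (g : BilinField I M) (x : M) :
    ContMDiffAt I (I.prod 𝓘(ℝ, E →L[ℝ] E →L[ℝ] ℝ)) ∞
      (fun x => Bundle.TotalSpace.mk' (E →L[ℝ] E →L[ℝ] ℝ)
        (E := fun x : M => TangentSpace I x →L[ℝ] TangentSpace I x →L[ℝ] ℝ) x (g x)) x ↔
    ContDiffAt ℝ ∞ (chartMetric I g x) (extChartAt I x x) := by
  have hcm : IsManifold I 1 M := IsManifold.of_le (n := ∞) (by simp)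
  have key : ∀ᶠ z in 𝓝 x, ContinuousLinearMap.inCoordinates E (TangentSpace I (M := M))
      (E →L[ℝ] ℝ) (fun x : M => TangentSpace I x →L[ℝ] ℝ) x z x z (g z) =
      chartMetric I g x (extChartAt I x z) := by
    filter_upwards [(isOpen_extChartAt_source (I := I) x).mem_nhds (mem_extChartAt_source x)]
      with z hz
    have hz' : z ∈ (chartAt H x).source := by rwa [← extChartAt_source I]
    ext v w
    rw [chartMetric_apply, (extChartAt I x).left_inv hz]
    -- The fibre coordinates of the tangent bundle are given by the derivative of the inverse chart;
    -- this identifies the bundle section in coordinates with the metric in the chart.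
    have h1 : ∀ v : E, (trivializationAt E (TangentSpace I) x).symm z v =
        md 𝓘(ℝ, E) I (extChartAt I x).symm (extChartAt I x z) v := by
      intro v
      have := TangentBundle.symmL_trivializationAt (I := I) hz'
      have h2 : mfderivWithin 𝓘(ℝ, E) I (extChartAt I x).symm (Set.range I) (extChartAt I x z) =
          mfderiv 𝓘(ℝ, E) I (extChartAt I x).symm (extChartAt I x z) := by
        rw [I.range_eq_univ, mfderivWithin_univ]
      rw [h2] at this
      have h3 := congrArg (fun l : E →L[ℝ] E => l v) this
      exact (Bundle.Trivialization.symmL_apply (R := ℝ) _ (by simpa using hz') v).symm.trans h3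
    rw [inCoordinates_apply_eq₂ (by simpa using hz') (by simpa using hz') (by simp)]
    rw [h1, h1]
    simp
    rfl
  rw [contMDiffAt_hom_bundle]
  constructor
  · rintro ⟨-, h⟩
    have h1 := h.congr_of_eventuallyEq (key.mono fun z hz => hz.symm)
    have hc : ContMDiffAt 𝓘(ℝ, E) I ∞ (extChartAt I x).symm (extChartAt I x x) :=
      contMDiffAt_chart_symm (mem_extChartAt_target x)
    have h2 := ContMDiffAt.comp (extChartAt I x x)
      (g := fun z => chartMetric I g x (extChartAt I x z)) (by rwa [extChartAt_to_inv]) hc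
    refine h2.contDiffAt.congr_of_eventuallyEq ?_
    filter_upwards [(isOpen_target (I := I) x).mem_nhds (mem_extChartAt_target x)] with y hy
    exact congrArg _ ((extChartAt I x).right_inv hy).symm
  · intro h
    refine ⟨contMDiffAt_id, ?_⟩
    refine ContMDiffAt.congr_of_eventuallyEq ?_ key
    exact h.contMDiffAt.comp x (contMDiffAt_chart (mem_extChartAt_source x))

variable [FiniteDimensional ℝ E]

/-- The smoothness criterion only sees the centre of a preferred chart, so at any other point y of
the target the metric is compared, through the transition map, with the one in the chart centred at
the point of y. -/
lemma IsSemiRiemannian.isMetricOn {g : BilinField I M} (hg : IsSemiRiemannian I g) (x₀ : M) :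
    IsMetricOn (chartMetric I g x₀) (extChartAt I x₀).target where
  isOpen := isOpen_target x₀
  contDiffOn := by
    intro y hy
    refine ContDiffAt.contDiffWithinAt ?_
    set x := (extChartAt I x₀).symm y with hx
    have hxs : (extChartAt I x₀).symm y ∈ (extChartAt I x).source := mem_extChartAt_source x
    have h1 := (contMDiffAt_section_iff g x).1 (hg.contMDiff x)
    have h2 : ContDiffAt ℝ ∞ (pull (fun z => extChartAt I x ((extChartAt I x₀).symm z))
        (chartMetric I g x)) y :=
      contDiffAt_pull (n := ⊤) (by simpa using contDiffAt_transition hy hxs) h1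
    refine h2.congr_of_eventuallyEq ?_
    filter_upwards [(isOpen_target x₀).mem_nhds hy,
      (contMDiffAt_chart_symm hy).continuousAt.preimage_mem_nhds
        ((isOpen_extChartAt_source x).mem_nhds hxs)] with z hz hz'
    exact chartMetric_eq_pull g hz hz'
  symm y _ v w := by
    rw [chartMetric_apply, chartMetric_apply]
    exact hg.symm _ _ _
  invertible y hy := by
    refine isInvertible_of_nondegenerate _ fun v hv => ?_
    obtain ⟨hi, hs⟩ := md_chart_symm_bijective (I := I) hy
    apply hi
    rw [map_zero]
    refine hg.nondegenerate ((extChartAt I x₀).symm y) _ fun w => ?_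
    obtain ⟨w', hw'⟩ := hs w
    have := hv w'
    rw [chartMetric_apply, hw'] at this
    exact this

end Chart
end Bridge

/-! ### Curves, geodesics and Hessians -/

section LocalCurves

variable {E : Type*} [NormedAddCommGroup E] [NormedSpace ℝ E]
  {E' : Type*} [NormedAddCommGroup E'] [NormedSpace ℝ E']
  {X : Type*} [NormedAddCommGroup X] [NormedSpace ℝ X]

/-- The acceleration of a curve, paired with a vector. -/
def accel (G : E → E →L[ℝ] E →L[ℝ] ℝ) (c : ℝ → E) (t : ℝ) (z : E) : ℝ :=
  G (c t) (deriv (deriv c) t) z + christoffelOne G (c t) (deriv c t) (deriv c t) z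

lemma two_le_infty : (2 : WithTop ℕ∞) ≤ ∞ :=
  WithTop.coe_le_coe.2 (le_top : (2 : ℕ∞) ≤ ⊤)

lemma eventually_differentiableAt {F : E → X} {y : E} (hF : ContDiffAt ℝ 2 F y) :
    ∀ᶠ z in 𝓝 y, DifferentiableAt ℝ F z :=
  (hF.eventually (by simp)).mono fun _ hz => hz.differentiableAt (by simp)

lemma fderiv_fderiv_comp {φ : E → X} {F : E' → E} {y : E'} (hφ : ContDiffAt ℝ 2 φ (F y))
    (hF : ContDiffAt ℝ 2 F y) (v w : E') :
    fderiv ℝ (fderiv ℝ fun z => φ (F z)) y v w =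
      fderiv ℝ (fderiv ℝ φ) (F y) (fderiv ℝ F y v) (fderiv ℝ F y w)
        + fderiv ℝ φ (F y) (fderiv ℝ (fderiv ℝ F) y v w) := by
  have h1 : (fderiv ℝ fun z => φ (F z)) =ᶠ[𝓝 y] fun z => (fderiv ℝ φ (F z)).comp (fderiv ℝ F z) := by
    filter_upwards [eventually_differentiableAt hF,
      hF.continuousAt.eventually (eventually_differentiableAt hφ)] with z hz hz'
    exact fderiv_comp z hz' hz
  have hDφ : HasFDerivAt (fderiv ℝ φ) (fderiv ℝ (fderiv ℝ φ) (F y)) (F y) :=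
    ((hφ.fderiv_right (m := 1) (by norm_num)).differentiableAt (by simp)).hasFDerivAt
  have hDF : HasFDerivAt (fderiv ℝ F) (fderiv ℝ (fderiv ℝ F) y) y :=
    ((hF.fderiv_right (m := 1) (by norm_num)).differentiableAt (by simp)).hasFDerivAt
  have hF1 : HasFDerivAt F (fderiv ℝ F y) y := (hF.differentiableAt (by simp)).hasFDerivAt
  have h2 := (hDφ.comp y hF1).clm_comp hDF
  rw [h1.fderiv_eq]
  have h3 := congrArg (fun l : E' →L[ℝ] E' →L[ℝ] X => l v w) h2.fderiv
  simp at h3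
  exact h3.trans (add_comm _ _)

lemma deriv_comp_curve {F : E → X} {y : ℝ → E} {t : ℝ} (hF : DifferentiableAt ℝ F (y t))
    (hy : DifferentiableAt ℝ y t) :
    deriv (fun τ => F (y τ)) t = fderiv ℝ F (y t) (deriv y t) :=
  (hF.hasFDerivAt.comp_hasDerivAt t hy.hasDerivAt).deriv

lemma hasDerivAt_deriv {y : ℝ → E} {t : ℝ} (hy : ContDiffAt ℝ 2 y t) :
    HasDerivAt (deriv y) (deriv (deriv y) t) t :=
  ((hy.derivWithin (m := 1) (by norm_num)).differentiableAt (by simp)).hasDerivAt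

lemma deriv_deriv_comp_curve {F : E → X} {y : ℝ → E} {t : ℝ} (hF : ContDiffAt ℝ 2 F (y t))
    (hy : ContDiffAt ℝ 2 y t) :
    deriv (deriv fun τ => F (y τ)) t =
      fderiv ℝ (fderiv ℝ F) (y t) (deriv y t) (deriv y t) + fderiv ℝ F (y t) (deriv (deriv y) t) := by
  have h1 : (deriv fun τ => F (y τ)) =ᶠ[𝓝 t] fun τ => fderiv ℝ F (y τ) (deriv y τ) := by
    filter_upwards [eventually_differentiableAt hy,
      hy.continuousAt.eventually (eventually_differentiableAt hF)] with τ h h'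
    exact deriv_comp_curve h' h
  have hDF : HasFDerivAt (fderiv ℝ F) (fderiv ℝ (fderiv ℝ F) (y t)) (y t) :=
    ((hF.fderiv_right (m := 1) (by norm_num)).differentiableAt (by simp)).hasFDerivAt
  rw [h1.deriv_eq]
  exact ((hDF.comp_hasDerivAt t (hy.differentiableAt (by simp)).hasDerivAt).clm_apply
    (hasDerivAt_deriv hy)).deriv

lemma accel_congr {G G' : E → E →L[ℝ] E →L[ℝ] ℝ} {c c' : ℝ → E} {t : ℝ} (hG : G =ᶠ[𝓝 (c t)] G')
    (hc : c =ᶠ[𝓝 t] c') (z : E) : accel G c t z = accel G' c' t z := by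
  simp only [accel, christoffelOne]
  rw [hc.deriv.deriv_eq, hc.deriv_eq, ← hc.self_of_nhds, hG.fderiv_eq, hG.self_of_nhds]

/-- The acceleration of a curve is natural under pull-back. -/
lemma accel_pull {G : E → E →L[ℝ] E →L[ℝ] ℝ} {F : E' → E} {y : ℝ → E'} {t : ℝ}
    (hF : ContDiffAt ℝ 2 F (y t)) (hG : ContDiffAt ℝ 1 G (F (y t)))
    (hs : ∀ v w, G (F (y t)) v w = G (F (y t)) w v) (hy : ContDiffAt ℝ 2 y t) (z : E') :
    accel (pull F G) y t z = accel G (fun τ => F (y τ)) t (fderiv ℝ F (y t) z) := by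
  simp only [accel, christoffelOne_pull hF hG hs, deriv_deriv_comp_curve hF hy,
    deriv_comp_curve (hF.differentiableAt (by simp)) (hy.differentiableAt (by simp)), pull_apply,
    map_add, add_apply]
  ring

/-- `accel` is the acceleration with lowered index. In this form it pulls back under every C² map,
even when the pulled back form is degenerate; invertibility is needed only here, to recover the
geodesic equation. -/
lemma accel_eq {G : E → E →L[ℝ] E →L[ℝ] ℝ} {c : ℝ → E} {t : ℝ} (h : (G (c t)).IsInvertible)
    (z : E) : accel G c t z =
      G (c t) (deriv (deriv c) t + christoffel G (c t) (deriv c t) (deriv c t)) z := by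
  rw [accel, map_add, add_apply, apply_christoffel h]

lemma accel_eq_zero_iff {G : E → E →L[ℝ] E →L[ℝ] ℝ} {c : ℝ → E} {t : ℝ}
    (h : (G (c t)).IsInvertible) : (∀ z, accel G c t z = 0) ↔
      deriv (deriv c) t + christoffel G (c t) (deriv c t) (deriv c t) = 0 := by
  simp only [accel_eq h]
  exact ⟨fun hz => eq_of_apply_eq h fun z => by simpa using hz z, fun hz z => by simp [hz]⟩

end LocalCurves

section Geodesics

variable {E : Type*} [NormedAddCommGroup E] [NormedSpace ℝ E]
  {H : Type*} [TopologicalSpace H] {I : ModelWithCorners ℝ E H}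
  {E' : Type*} [NormedAddCommGroup E'] [NormedSpace ℝ E']
  {M : Type*} [TopologicalSpace M] [ChartedSpace H M]

variable (I) in
/-- The velocity of a curve. -/
def vel (γ : ℝ → M) (t : ℝ) : E := md 𝓘(ℝ, ℝ) I γ t 1

lemma vel_congr {γ γ' : ℝ → M} {t : ℝ} (h : γ =ᶠ[𝓝 t] γ') : vel I γ t = vel I γ' t := by
  rw [vel, vel, md_congr h]

variable (I) in
/-- A function in the chart at `x₀`. -/
def inChart {X : Type*} (f : M → X) (x₀ : M) : E → X := fun y => f ((extChartAt I x₀).symm y)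

variable [I.Boundaryless] [IsManifold I ∞ M]

lemma hasDerivAt_chart_comp {γ : ℝ → M} {t : ℝ} {x₀ : M} (hγ : MDifferentiableAt 𝓘(ℝ, ℝ) I γ t)
    (hx : γ t ∈ (extChartAt I x₀).source) :
    HasDerivAt (fun τ => extChartAt I x₀ (γ τ))
      (md I 𝓘(ℝ, E) (extChartAt I x₀) (γ t) (vel I γ t)) t := by
  have h : DifferentiableAt ℝ (fun τ => extChartAt I x₀ (γ τ)) t :=
    ((mdifferentiableAt_chart hx).comp t hγ).differentiableAt
  have := h.hasDerivAt
  rwa [← fderiv_apply_one_eq_deriv, fderiv_chart_comp hγ hx] at this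

lemma hasDerivAt_comp_vel {f : M → ℝ} {γ : ℝ → M} {t : ℝ}
    (hf : MDifferentiableAt I 𝓘(ℝ, ℝ) f (γ t)) (hγ : MDifferentiableAt 𝓘(ℝ, ℝ) I γ t) :
    HasDerivAt (fun τ => f (γ τ)) (md I 𝓘(ℝ, ℝ) f (γ t) (vel I γ t)) t := by
  have h : DifferentiableAt ℝ (fun τ => f (γ τ)) t := (hf.comp t hγ).differentiableAt
  have h2 := h.hasDerivAt
  rwa [← fderiv_apply_one_eq_deriv, ← md_eq_fderiv, md_comp_apply hf hγ] at h2

lemma vel_comp {E'' H'' M'' : Type*} [NormedAddCommGroup E''] [NormedSpace ℝ E'']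
    [TopologicalSpace H''] {I'' : ModelWithCorners ℝ E'' H''} [TopologicalSpace M'']
    [ChartedSpace H'' M''] {ψ : M → M''} {γ : ℝ → M} {t : ℝ}
    (hψ : MDifferentiableAt I I'' ψ (γ t)) (hγ : MDifferentiableAt 𝓘(ℝ, ℝ) I γ t) :
    vel I'' (fun τ => ψ (γ τ)) t = md I I'' ψ (γ t) (vel I γ t) := md_comp_apply hψ hγ 1

lemma md_inChart {f : M → ℝ} {x₀ : M} {y : E} (hy : y ∈ (extChartAt I x₀).target)
    (hf : MDifferentiableAt I 𝓘(ℝ, ℝ) f ((extChartAt I x₀).symm y)) (v : E) :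
    fderiv ℝ (inChart I f x₀) y v = md I 𝓘(ℝ, ℝ) f ((extChartAt I x₀).symm y)
      (md 𝓘(ℝ, E) I (extChartAt I x₀).symm y v) := by
  rw [← md_eq_fderiv]
  exact md_comp_apply hf (mdifferentiableAt_chart_symm hy) v

lemma contDiffAt_inChart {X : Type*} [NormedAddCommGroup X] [NormedSpace ℝ X] {f : M → X} {x₀ : M}
    {y : E} (hy : y ∈ (extChartAt I x₀).target)
    (hf : ContMDiffAt I 𝓘(ℝ, X) ∞ f ((extChartAt I x₀).symm y)) :
    ContDiffAt ℝ ∞ (inChart I f x₀) y :=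
  (hf.comp y (contMDiffAt_chart_symm hy)).contDiffAt

variable [FiniteDimensional ℝ E] {g : BilinField I M}

/-- The acceleration of a curve in a parametrization and in a chart. -/
lemma accel_param (hg : IsSemiRiemannian I g) {ψ : E' → M} {y : ℝ → E'} {γ : ℝ → M} {t : ℝ}
    {x₀ : M} (hψ : ContMDiffAt 𝓘(ℝ, E') I ∞ ψ (y t)) (hy : ContDiffAt ℝ ∞ y t)
    (hγ : γ =ᶠ[𝓝 t] fun τ => ψ (y τ)) (hx : γ t ∈ (extChartAt I x₀).source) (z : E') :
    accel (form 𝓘(ℝ, E') (pullback 𝓘(ℝ, E') I ψ g)) y t z =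
      accel (chartMetric I g x₀) (fun τ => extChartAt I x₀ (γ τ)) t
        (md I 𝓘(ℝ, E) (extChartAt I x₀) (γ t) (md 𝓘(ℝ, E') I ψ (y t) z)) := by
  have hγt : γ t = ψ (y t) := hγ.self_of_nhds
  have hx' : ψ (y t) ∈ (extChartAt I x₀).source := hγt ▸ hx
  have hm := hg.isMetricOn x₀
  have hF := contDiffAt_chart_comp hψ le_rfl hx'
  have ht := (extChartAt I x₀).map_source hx'
  have h1 : form 𝓘(ℝ, E') (pullback 𝓘(ℝ, E') I ψ g) =ᶠ[𝓝 (y t)]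
      pull (fun z => extChartAt I x₀ (ψ z)) (chartMetric I g x₀) := by
    have h2 : ∀ᶠ z in 𝓝 (y t), ContMDiffAt 𝓘(ℝ, E') I 1 ψ z :=
      have : IsManifold I 1 M := IsManifold.of_le (n := ∞) (by simp)
      (contMDiffAt_iff_contMDiffAt_nhds (by simp)).1 (hψ.of_le (by simp))
    filter_upwards [h2, hψ.continuousAt.preimage_mem_nhds
      ((isOpen_extChartAt_source x₀).mem_nhds hx')] with z hz hz'
    exact pullback_eq_pull_chartMetric g (hz.mdifferentiableAt (by simp)) hz'
  have h3 : (fun τ => extChartAt I x₀ (γ τ)) =ᶠ[𝓝 t] fun τ => extChartAt I x₀ (ψ (y τ)) :=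
    hγ.mono fun τ hτ => congrArg _ hτ
  have h2 := two_le_infty
  rw [accel_congr h1 Filter.EventuallyEq.rfl, accel_pull (hF.of_le h2)
    ((hm.contDiffAt ht).of_le (by simp)) (hm.symm _ ht) (hy.of_le h2),
    accel_congr Filter.EventuallyEq.rfl h3, fderiv_chart_comp (hψ.mdifferentiableAt (by simp)) hx', hγt]

lemma IsGeodesicOn.contMDiffAt {γ : ℝ → M} {s : Set ℝ} (h : IsGeodesicOn I g γ s) (hs : IsOpen s)
    {t : ℝ} (ht : t ∈ s) : ContMDiffAt 𝓘(ℝ, ℝ) I ∞ γ t :=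
  (h.1 t ht).contMDiffAt (hs.mem_nhds ht)

lemma IsGeodesicOn.mdifferentiableAt {γ : ℝ → M} {s : Set ℝ} (h : IsGeodesicOn I g γ s)
    (hs : IsOpen s) {t : ℝ} (ht : t ∈ s) : MDifferentiableAt 𝓘(ℝ, ℝ) I γ t :=
  (h.contMDiffAt hs ht).mdifferentiableAt (by simp)

lemma IsGeodesicOn.accel_eq_zero (hg : IsSemiRiemannian I g) {γ : ℝ → M} {s : Set ℝ}
    (h : IsGeodesicOn I g γ s) {t : ℝ} (ht : t ∈ s) (z : E) :
    accel (chartMetric I g (γ t)) (fun τ => extChartAt I (γ t) (γ τ)) t z = 0 := by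
  have := (accel_eq_zero_iff (G := chartMetric I g (γ t))
    (c := fun τ => extChartAt I (γ t) (γ τ)) (t := t)
    ((hg.isMetricOn (γ t)).invertible _ (mem_extChartAt_target (γ t)))).2 (h.2 t ht)
  exact this z

/-- The geodesic equation in a parametrization. -/
lemma IsGeodesicOn.accel_param_eq_zero (hg : IsSemiRiemannian I g) {γ : ℝ → M} {s : Set ℝ}
    (h : IsGeodesicOn I g γ s) {t : ℝ} (ht : t ∈ s) {ψ : E' → M} {y : ℝ → E'}
    (hψ : ContMDiffAt 𝓘(ℝ, E') I ∞ ψ (y t)) (hy : ContDiffAt ℝ ∞ y t)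
    (hγ : γ =ᶠ[𝓝 t] fun τ => ψ (y τ)) (z : E') :
    accel (form 𝓘(ℝ, E') (pullback 𝓘(ℝ, E') I ψ g)) y t z = 0 := by
  rw [accel_param hg hψ hy hγ (mem_extChartAt_source (γ t)), h.accel_eq_zero hg ht]

lemma eventuallyEq_chart_symm {γ : ℝ → M} {t : ℝ} {x₀ : M} (hγ : ContinuousAt γ t)
    (hx : γ t ∈ (extChartAt I x₀).source) :
    γ =ᶠ[𝓝 t] fun τ => (extChartAt I x₀).symm (extChartAt I x₀ (γ τ)) := by
  filter_upwards [hγ.preimage_mem_nhds ((isOpen_extChartAt_source x₀).mem_nhds hx)] with τ hτ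
  exact ((extChartAt I x₀).left_inv hτ).symm

/-- The geodesic equation in an arbitrary chart. -/
lemma IsGeodesicOn.eq_in_chart (hg : IsSemiRiemannian I g) {γ : ℝ → M} {s : Set ℝ}
    (h : IsGeodesicOn I g γ s) (hs : IsOpen s) {t : ℝ} (ht : t ∈ s) {x₀ : M}
    (hx : γ t ∈ (extChartAt I x₀).source) {c : ℝ → E}
    (hc : c = fun τ => extChartAt I x₀ (γ τ)) :
    deriv (deriv c) t = - christoffel (chartMetric I g x₀) (c t) (deriv c t) (deriv c t) := by
  subst hc
  have ht' := (extChartAt I x₀).map_source hx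
  have h1 := (accel_eq_zero_iff ((hg.isMetricOn x₀).invertible _ ht')
    (c := fun τ => extChartAt I x₀ (γ τ)) (t := t)).1 fun z =>
      h.accel_param_eq_zero hg ht (contMDiffAt_chart_symm ht')
        (contDiffAt_chart_comp (h.contMDiffAt hs ht) le_rfl hx)
        (eventuallyEq_chart_symm (h.contMDiffAt hs ht).continuousAt hx) z
  exact eq_neg_of_add_eq_zero_left h1

/-- A curve which satisfies the geodesic equation in charts is a geodesic. -/
lemma isGeodesicOn_of_accel (hg : IsSemiRiemannian I g) {γ : ℝ → M} {s : Set ℝ}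
    (hγ : ContMDiffOn 𝓘(ℝ, ℝ) I ∞ γ s)
    (h : ∀ t ∈ s, ∀ z, accel (chartMetric I g (γ t)) (fun τ => extChartAt I (γ t) (γ τ)) t z = 0) :
    IsGeodesicOn I g γ s :=
  ⟨hγ, fun t ht => (accel_eq_zero_iff
    ((hg.isMetricOn (γ t)).invertible _ (mem_extChartAt_target (γ t)))).1 (h t ht)⟩

variable (I) in
/-- The square of the velocity of a curve. -/
def energy (g : BilinField I M) (γ : ℝ → M) (t : ℝ) : ℝ := form I g (γ t) (vel I γ t) (vel I γ t)

lemma energy_eq_chart {γ : ℝ → M} {t : ℝ} {x₀ : M} (hγ : MDifferentiableAt 𝓘(ℝ, ℝ) I γ t)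
    (hx : γ t ∈ (extChartAt I x₀).source) {c : ℝ → E}
    (hc : c = fun τ => extChartAt I x₀ (γ τ)) :
    energy I g γ t = chartMetric I g x₀ (c t) (deriv c t) (deriv c t) := by
  subst hc
  rw [energy, form_eq_chartMetric g hx, (hasDerivAt_chart_comp hγ hx).deriv]

/-- Metric compatibility: the derivative is twice the product of the acceleration with the velocity.
-/
lemma IsGeodesicOn.hasDerivAt_energy (hg : IsSemiRiemannian I g) {γ : ℝ → M} {s : Set ℝ}
    (h : IsGeodesicOn I g γ s) (hs : IsOpen s) {t : ℝ} (ht : t ∈ s) :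
    HasDerivAt (energy I g γ) 0 t := by
  set x₀ := γ t
  have hx : γ t ∈ (extChartAt I x₀).source := mem_extChartAt_source _
  set c : ℝ → E := fun τ => extChartAt I x₀ (γ τ) with hc
  have hm := hg.isMetricOn x₀
  have htar : c t ∈ (extChartAt I x₀).target := (extChartAt I x₀).map_source hx
  have hcs : ContDiffAt ℝ ∞ c t := contDiffAt_chart_comp (h.contMDiffAt hs ht) le_rfl hx
  have hev : energy I g γ =ᶠ[𝓝 t] fun τ => chartMetric I g x₀ (c τ) (deriv c τ) (deriv c τ) := by
    filter_upwards [hs.mem_nhds ht, (h.contMDiffAt hs ht).continuousAt.preimage_mem_nhds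
      ((isOpen_extChartAt_source x₀).mem_nhds hx)] with τ hτ hτ'
    exact energy_eq_chart (h.mdifferentiableAt hs hτ) hτ' hc
  refine HasDerivAt.congr_of_eventuallyEq ?_ hev
  have h2 := hasDerivAt_deriv (hcs.of_le two_le_infty)
  have h1 := ((hm.differentiableAt htar).hasFDerivAt.comp_hasDerivAt t
    (hcs.differentiableAt (by simp)).hasDerivAt)
  have h3 := (h1.clm_apply h2).clm_apply h2
  refine h3.congr_deriv ?_
  rw [h.eq_in_chart hg hs ht hx hc]
  simp only [add_apply, Function.comp_def, map_neg, neg_apply, hm.fderiv_eq htar]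
  ring

lemma IsGeodesicOn.energy_eq (hg : IsSemiRiemannian I g) {γ : ℝ → M} {s : Set ℝ}
    (h : IsGeodesicOn I g γ s) (hs : IsOpen s) (hs' : s.OrdConnected) {t t' : ℝ} (ht : t ∈ s)
    (ht' : t' ∈ s) : energy I g γ t = energy I g γ t' := by
  have := eq_zero_of_norm_deriv_le (w := fun τ => energy I g γ τ - energy I g γ t')
    (w' := fun _ => 0) (K := fun _ => 0) hs'
    (fun τ hτ => by simpa using (h.hasDerivAt_energy hg hs hτ).sub_const (energy I g γ t'))
    continuousOn_const (by simp) ht' (by simp) t ht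
  linarith

/-! ### Functions whose Hessian is a multiple of the metric -/

variable (I) in
/-- The equation `Hess f = -κ f g`, at each point in the preferred chart. -/
def HessianEq (g : BilinField I M) (f : M → ℝ) (κ : ℝ) : Prop :=
  ∀ (x : M) (v w : E), fderiv ℝ (fderiv ℝ (inChart I f x)) (extChartAt I x x) v w =
    fderiv ℝ (inChart I f x) (extChartAt I x x)
      (christoffel (chartMetric I g x) (extChartAt I x x) v w) - κ * f x * form I g x v w

/-- The Hessian equation in an arbitrary chart. -/
lemma HessianEq.eq_in_chart (hg : IsSemiRiemannian I g) {f : M → ℝ} {κ : ℝ}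
    (hf : ContMDiff I 𝓘(ℝ, ℝ) ∞ f) (h : HessianEq I g f κ) {x₀ : M} {y : E}
    (hy : y ∈ (extChartAt I x₀).target) (v w : E) :
    fderiv ℝ (fderiv ℝ (inChart I f x₀)) y v w = fderiv ℝ (inChart I f x₀) y
      (christoffel (chartMetric I g x₀) y v w)
        - κ * inChart I f x₀ y * chartMetric I g x₀ y v w := by
  have h2 := two_le_infty
  set x := (extChartAt I x₀).symm y with hxdef
  have hx : (extChartAt I x₀).symm y ∈ (extChartAt I x).source := mem_extChartAt_source x
  set F : E → E := fun z => extChartAt I x ((extChartAt I x₀).symm z) with hF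
  have hFs : ContDiffAt ℝ ∞ F y := contDiffAt_transition hy hx
  have hcont := (contMDiffAt_chart_symm hy).continuousAt.preimage_mem_nhds
    ((isOpen_extChartAt_source x).mem_nhds hx)
  have hev : inChart I f x₀ =ᶠ[𝓝 y] fun z => inChart I f x (F z) := by
    filter_upwards [hcont] with z hz
    simp only [inChart, hF]
    rw [(extChartAt I x).left_inv hz]
  have hG : chartMetric I g x₀ =ᶠ[𝓝 y] pull F (chartMetric I g x) := by
    filter_upwards [hcont, (isOpen_target x₀).mem_nhds hy] with z hz hz'
    exact chartMetric_eq_pull g hz' hz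
  have htar : F y ∈ (extChartAt I x).target := (extChartAt I x).map_source hx
  have hm := hg.isMetricOn x
  have hfx : ContDiffAt ℝ ∞ (inChart I f x) (F y) := contDiffAt_inChart htar (hf _)
  have hchr : christoffel (chartMetric I g x₀) y v w = christoffel (pull F (chartMetric I g x)) y v w := by
    simp only [christoffel, hG.fderiv_eq, hG.self_of_nhds]
  have hD : ∀ u, fderiv ℝ (inChart I f x₀) y u = fderiv ℝ (inChart I f x) (F y) (fderiv ℝ F y u) := by
    intro u
    rw [hev.fderiv_eq]
    exact congrArg (fun l : E →L[ℝ] ℝ => l u)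
      (fderiv_comp y (hfx.differentiableAt (by simp)) (hFs.differentiableAt (by simp)))
  have hpi : (pull F (chartMetric I g x) y).IsInvertible :=
    hG.self_of_nhds ▸ (hg.isMetricOn x₀).invertible y hy
  rw [hD, hchr, fderiv_christoffel_pull (hFs.of_le h2) ((hm.contDiffAt htar).of_le (by simp))
    (hm.symm _ htar) (hm.invertible _ htar) (isInvertible_fderiv_transition hy hx) hpi,
    hev.fderiv.fderiv_eq, fderiv_fderiv_comp (hfx.of_le h2) (hFs.of_le h2), map_add,
    hG.self_of_nhds, pull_apply]
  have hh := h x (fderiv ℝ F y v) (fderiv ℝ F y w)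
  rw [← chartMetric_self] at hh
  have hFy : extChartAt I x x = F y := rfl
  rw [hFy] at hh
  rw [hh]
  simp only [inChart, ← hxdef]
  ring

lemma IsGeodesicOn.hasDerivAt_comp {f : M → ℝ} (hf : ContMDiff I 𝓘(ℝ, ℝ) ∞ f) {γ : ℝ → M}
    {s : Set ℝ} (h : IsGeodesicOn I g γ s) (hs : IsOpen s) {t : ℝ} (ht : t ∈ s) :
    HasDerivAt (fun τ => f (γ τ)) (md I 𝓘(ℝ, ℝ) f (γ t) (vel I γ t)) t :=
  hasDerivAt_comp_vel ((hf _).mdifferentiableAt (by simp)) (h.mdifferentiableAt hs ht)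

/-- The second derivative of a solution of the Hessian equation along a geodesic. -/
lemma IsGeodesicOn.hasDerivAt_deriv_comp (hg : IsSemiRiemannian I g) {f : M → ℝ} {κ : ℝ}
    (hf : ContMDiff I 𝓘(ℝ, ℝ) ∞ f) (hess : HessianEq I g f κ) {γ : ℝ → M}
    {s : Set ℝ} (h : IsGeodesicOn I g γ s) (hs : IsOpen s) {t : ℝ} (ht : t ∈ s) :
    HasDerivAt (fun τ => md I 𝓘(ℝ, ℝ) f (γ τ) (vel I γ τ)) (-(κ * energy I g γ t) * f (γ t)) t := by
  have h2 := two_le_infty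
  set x₀ := γ t with hx₀
  have hx : γ t ∈ (extChartAt I x₀).source := mem_extChartAt_source _
  set c : ℝ → E := fun τ => extChartAt I x₀ (γ τ) with hc
  have hcs : ContDiffAt ℝ ∞ c t := contDiffAt_chart_comp (h.contMDiffAt hs ht) le_rfl hx
  have htar : c t ∈ (extChartAt I x₀).target := (extChartAt I x₀).map_source hx
  have hfx : ContDiffAt ℝ ∞ (inChart I f x₀) (c t) := contDiffAt_inChart htar (hf _)
  have hev : (fun τ => md I 𝓘(ℝ, ℝ) f (γ τ) (vel I γ τ)) =ᶠ[𝓝 t]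
      deriv fun τ => inChart I f x₀ (c τ) := by
    have he : (fun τ => f (γ τ)) =ᶠ[𝓝 t] fun τ => inChart I f x₀ (c τ) :=
      (eventuallyEq_chart_symm (h.contMDiffAt hs ht).continuousAt hx).mono fun τ hτ => congrArg f hτ
    filter_upwards [he.eventuallyEq_nhds, hs.mem_nhds ht] with τ hτ hτs
    rw [← hτ.deriv_eq, (h.hasDerivAt_comp hf hs hτs).deriv]
  refine HasDerivAt.congr_of_eventuallyEq ?_ hev
  have hcd : ContDiffAt ℝ 2 (fun τ => inChart I f x₀ (c τ)) t :=
    (hfx.of_le h2).comp t (hcs.of_le h2)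
  convert hasDerivAt_deriv hcd using 1
  -- In (f ∘ c)'' = D²f(c', c') + Df(c'') the geodesic equation for c'' cancels the Christoffel term
  -- of the Hessian, leaving -κ f times the energy.
  rw [deriv_deriv_comp_curve (hfx.of_le h2) (hcs.of_le h2), hess.eq_in_chart hg hf htar,
    h.eq_in_chart hg hs ht hx hc, map_neg,
    energy_eq_chart (h.mdifferentiableAt hs ht) hx hc]
  have : inChart I f x₀ (c t) = f x₀ := by
    simp only [inChart, hc]
    rw [(extChartAt I x₀).left_inv hx]
  rw [this]
  ring

end Geodesics

/-! ### Gradients of solutions of the Hessian equation -/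

section LocalGradient

variable {E : Type*} [NormedAddCommGroup E] [NormedSpace ℝ E]

/-- The equation `Hess φ = -κ φ G` on an open set of a normed space. -/
structure IsHessianOn (G : E → E →L[ℝ] E →L[ℝ] ℝ) (φ : E → ℝ) (κ : ℝ) (O : Set E) : Prop where
  metric : IsMetricOn G O
  contDiffOn : ContDiffOn ℝ ∞ φ O
  eq : ∀ y ∈ O, ∀ v w, fderiv ℝ (fderiv ℝ φ) y v w =
    fderiv ℝ φ y (christoffel G y v w) - κ * φ y * G y v w

/-- The gradient of a function. -/
def localGrad (G : E → E →L[ℝ] E →L[ℝ] ℝ) (φ : E → ℝ) (y : E) : E :=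
  (G y).inverse (fderiv ℝ φ y)

variable {G : E → E →L[ℝ] E →L[ℝ] ℝ} {φ : E → ℝ} {κ : ℝ} {O : Set E} {y : E}

namespace IsHessianOn

lemma contDiffAt (h : IsHessianOn G φ κ O) (hy : y ∈ O) : ContDiffAt ℝ ∞ φ y :=
  (h.contDiffOn y hy).contDiffAt (h.metric.mem_nhds hy)

lemma contDiffOn_fderiv (h : IsHessianOn G φ κ O) : ContDiffOn ℝ ∞ (fderiv ℝ φ) O :=
  h.contDiffOn.fderiv_of_isOpen h.metric.isOpen (by simp)

lemma apply_localGrad (h : IsHessianOn G φ κ O) (hy : y ∈ O) (z : E) :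
    G y (localGrad G φ y) z = fderiv ℝ φ y z := by
  obtain ⟨e, he⟩ := h.metric.invertible y hy
  rw [localGrad, ← he]
  simp

variable [CompleteSpace E]

lemma contDiffOn_localGrad (h : IsHessianOn G φ κ O) : ContDiffOn ℝ ∞ (localGrad G φ) O := by
  have hI : ContDiffOn ℝ ∞ (fun y => (G y).inverse) O := fun y hy =>
    ((h.metric.invertible y hy).contDiffAt_map_inverse.comp y
      (h.metric.contDiffAt hy)).contDiffWithinAt
  exact hI.clm_apply h.contDiffOn_fderiv

lemma differentiableAt_localGrad (h : IsHessianOn G φ κ O) (hy : y ∈ O) :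
    DifferentiableAt ℝ (localGrad G φ) y :=
  ((h.contDiffOn_localGrad y hy).contDiffAt (h.metric.mem_nhds hy)).differentiableAt (by simp)

/-- The covariant derivative of the gradient is a multiple of the identity. -/
lemma fderiv_localGrad (h : IsHessianOn G φ κ O) (hy : y ∈ O) (v : E) :
    fderiv ℝ (localGrad G φ) y v =
      -christoffel G y v (localGrad G φ y) - (κ * φ y) • v := by
  refine eq_of_apply_eq (h.metric.invertible y hy) fun z => ?_
  have h1 := ((h.metric.differentiableAt hy).hasFDerivAt.clm_apply
    (h.differentiableAt_localGrad hy).hasFDerivAt).clm_apply (hasFDerivAt_const z y)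
  have h2 := ((((h.contDiffOn_fderiv y hy).contDiffAt (h.metric.mem_nhds hy)).differentiableAt
    (by simp)).hasFDerivAt.clm_apply (hasFDerivAt_const z y))
  -- The defining relation of the gradient is differentiated; metric compatibility and the Hessian
  -- equation then leave only the two terms of the claim.
  have hev : (fun y => G y (localGrad G φ y) z) =ᶠ[𝓝 y] fun y => fderiv ℝ φ y z := by
    filter_upwards [h.metric.mem_nhds hy] with y' hy'
    exact h.apply_localGrad hy' z
  have h3 := congrArg (fun l : E →L[ℝ] ℝ => l v) (h1.unique (h2.congr_of_eventuallyEq hev))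
  simp at h3
  rw [h.eq y hy, h.metric.fderiv_eq hy, ← h.apply_localGrad hy] at h3
  simp only [map_sub, map_neg, map_smul, sub_apply, neg_apply, smul_apply, smul_eq_mul]
  linarith

end IsHessianOn
end LocalGradient

/-- The continuity method used throughout: near each point the property holds everywhere or nowhere,
so on a preconnected set it spreads from one point to all, with no separate openness and closedness
arguments. -/
lemma IsPreconnected.of_locally_imp {X : Type*} [TopologicalSpace X] {s : Set X}
    (hs : IsPreconnected s) (P : X → Prop)
    (h : ∀ x ∈ s, ∃ U ∈ 𝓝 x, ∀ a ∈ U ∩ s, ∀ b ∈ U ∩ s, P a → P b) {a b : X} (ha : a ∈ s)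
    (hb : b ∈ s) (hPa : P a) : P b := by
  refine hs.induction₂' (fun a b => P a → P b) (fun x hx => ?_)
    (fun x y z _ _ _ h1 h2 hx => h2 (h1 hx)) ha hb hPa
  obtain ⟨U, hU, hP⟩ := h x hx
  filter_upwards [mem_nhdsWithin_of_mem_nhds hU, self_mem_nhdsWithin] with y hyU hys
  exact ⟨hP x ⟨mem_of_mem_nhds hU, hx⟩ y ⟨hyU, hys⟩, hP y ⟨hyU, hys⟩ x ⟨mem_of_mem_nhds hU, hx⟩⟩

section Gradient

variable {E : Type*} [NormedAddCommGroup E] [NormedSpace ℝ E] [FiniteDimensional ℝ E]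
  {H : Type*} [TopologicalSpace H] {I : ModelWithCorners ℝ E H} [I.Boundaryless]
  {M : Type*} [TopologicalSpace M] [ChartedSpace H M] [IsManifold I ∞ M]

variable (I) in
/-- A metric with a solution `f` of the Hessian equation `Hess f = -κ f g`, with gradient `ξ`. -/
structure HessianData (g : BilinField I M) (f : M → ℝ) (ξ : M → E) (κ : ℝ) : Prop where
  metric : IsSemiRiemannian I g
  contMDiff : ContMDiff I 𝓘(ℝ, ℝ) ∞ f
  hess : HessianEq I g f κ
  grad : ∀ x v, form I g x (ξ x) v = md I 𝓘(ℝ, ℝ) f x v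

variable {g : BilinField I M} {f : M → ℝ} {ξ : M → E} {κ : ℝ}

namespace HessianData

lemma symm (h : HessianData I g f ξ κ) (x : M) (v w : E) : form I g x v w = form I g x w v :=
  h.metric.symm x v w

lemma eq_of_form (h : HessianData I g f ξ κ) {x : M} {u v : E}
    (huv : ∀ w, form I g x u w = form I g x v w) : u = v := by
  have key : ∀ w : E, form I g x (u - v) w = 0 := fun w => by
    rw [map_sub, sub_apply, huv w, sub_self]
  have : u - v = 0 := h.metric.nondegenerate x (u - v) key
  exact sub_eq_zero.1 this

lemma mdifferentiableAt (h : HessianData I g f ξ κ) (x : M) :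
    MDifferentiableAt I 𝓘(ℝ, ℝ) f x := (h.contMDiff x).mdifferentiableAt (by simp)

lemma isHessianOn (h : HessianData I g f ξ κ) (x₀ : M) :
    IsHessianOn (chartMetric I g x₀) (inChart I f x₀) κ (extChartAt I x₀).target where
  metric := h.metric.isMetricOn x₀
  contDiffOn _ hy := (contDiffAt_inChart hy (h.contMDiff _)).contDiffWithinAt
  eq _ hy v w := h.hess.eq_in_chart h.metric h.contMDiff hy v w

/-- The gradient in a chart. -/
lemma grad_in_chart (h : HessianData I g f ξ κ) {x₀ x : M} (hx : x ∈ (extChartAt I x₀).source) :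
    md I 𝓘(ℝ, E) (extChartAt I x₀) x (ξ x) =
      localGrad (chartMetric I g x₀) (inChart I f x₀) (extChartAt I x₀ x) := by
  have ht := (extChartAt I x₀).map_source hx
  refine eq_of_apply_eq ((h.metric.isMetricOn x₀).invertible _ ht) fun z => ?_
  rw [(h.isHessianOn x₀).apply_localGrad ht, md_inChart ht (h.mdifferentiableAt _),
    (extChartAt I x₀).left_inv hx, ← h.grad, chartMetric_apply, md_chart_symm_comp hx,
    (extChartAt I x₀).left_inv hx]

/-- Corresponds to replacing V by -V; it reduces the region f < 0 to the region f > 0. -/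
lemma neg (h : HessianData I g f ξ κ) : HessianData I g (-f) (-ξ) κ where
  metric := h.metric
  contMDiff := h.contMDiff.neg
  hess x v w := by
    have h1 : inChart I (-f) x = -inChart I f x := rfl
    have h2 : fderiv ℝ (-inChart I f x) = -fderiv ℝ (inChart I f x) := by
      funext y
      exact fderiv_neg
    rw [h1, h2, fderiv_neg]
    simp only [neg_apply, Pi.neg_apply, h.hess x v w]
    ring
  grad x v := by
    have h1 : md I 𝓘(ℝ, ℝ) (-f) x = -md I 𝓘(ℝ, ℝ) f x :=
      (h.mdifferentiableAt x).hasMFDerivAt.neg.mfderiv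
    rw [h1, Pi.neg_apply, map_neg, neg_apply, neg_apply, h.grad]

/-- If the gradient is tangent to a geodesic at one point, then it is so along the geodesic. -/
lemma grad_eq_smul_vel (h : HessianData I g f ξ κ) {γ : ℝ → M} {s : Set ℝ}
    (hγ : IsGeodesicOn I g γ s) (hs : IsOpen s) (hs' : s.OrdConnected) {b : ℝ → ℝ}
    (hb : ∀ t ∈ s, HasDerivAt b (-(κ * f (γ t))) t) {t₀ : ℝ} (ht₀ : t₀ ∈ s)
    (h0 : ξ (γ t₀) = b t₀ • vel I γ t₀) {t : ℝ} (ht : t ∈ s) : ξ (γ t) = b t • vel I γ t := by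
  refine IsPreconnected.of_locally_imp hs'.isPreconnected
    (fun t => ξ (γ t) = b t • vel I γ t) (fun τ hτ => ?_) ht₀ ht h0
  set x₀ := γ τ with hx₀
  have hx : γ τ ∈ (extChartAt I x₀).source := mem_extChartAt_source _
  set c : ℝ → E := fun τ => extChartAt I x₀ (γ τ) with hc
  have hloc := h.isHessianOn x₀
  set G := chartMetric I g x₀ with hG
  set φ := inChart I f x₀
  obtain ⟨δ, hδ, hball⟩ := Metric.mem_nhds_iff.1 (Filter.inter_mem (hs.mem_nhds hτ)
    ((hγ.contMDiffAt hs hτ).continuousAt.preimage_mem_nhds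
      ((isOpen_extChartAt_source x₀).mem_nhds hx)))
  refine ⟨Metric.ball τ δ, Metric.ball_mem_nhds τ hδ, fun a ha a' ha' hPa => ?_⟩
  -- Z represents ξ - b γ', which is parallel along γ: ∇ξ contributes -κ f γ' and b' = -κ f cancels
  -- it. Being a solution of a linear equation, it vanishes identically if it vanishes once.
  set Z : ℝ → E := fun t => localGrad G φ (c t) - b t • deriv c t with hZ
  have hZeq : ∀ t ∈ Metric.ball τ δ, Z t =
      md I 𝓘(ℝ, E) (extChartAt I x₀) (γ t) (ξ (γ t) - b t • vel I γ t) := by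
    intro t ht
    have h1 := hball ht
    rw [map_sub, map_smul, h.grad_in_chart h1.2,
      ← (hasDerivAt_chart_comp (hγ.mdifferentiableAt hs h1.1) h1.2).deriv]
  have hcd : ∀ t ∈ Metric.ball τ δ, ContDiffAt ℝ ∞ c t := fun t ht =>
    contDiffAt_chart_comp (hγ.contMDiffAt hs (hball ht).1) le_rfl (hball ht).2
  have htar : ∀ t ∈ Metric.ball τ δ, c t ∈ (extChartAt I x₀).target := fun t ht =>
    (extChartAt I x₀).map_source (hball ht).2
  have hder : ∀ t ∈ Metric.ball τ δ, HasDerivAt Z (-christoffel G (c t) (deriv c t) (Z t)) t := by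
    intro t ht
    have h1 := (hloc.differentiableAt_localGrad (htar t ht)).hasFDerivAt.comp_hasDerivAt t
      ((hcd t ht).differentiableAt (by simp)).hasDerivAt
    have h2 := (hb t (hball ht).1).smul (hasDerivAt_deriv ((hcd t ht).of_le two_le_infty))
    refine (h1.sub h2).congr_deriv ?_
    have hφ : φ (c t) = f (γ t) := by
      simp only [φ, inChart, hc]
      rw [(extChartAt I x₀).left_inv (hball ht).2]
    rw [hloc.fderiv_localGrad (htar t ht), hγ.eq_in_chart h.metric hs (hball ht).1 (hball ht).2 hc,
      hφ, hZ, ← hG]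
    simp only [← christoffelCLM_apply, map_sub, map_smul]
    module
  have hK : ContinuousOn (fun t => ‖christoffelCLM G (c t)‖ * ‖deriv c t‖) (Metric.ball τ δ) := by
    intro t ht
    have h1 : ContinuousAt (christoffelCLM G) (c t) :=
      hloc.metric.contDiffOn_christoffelCLM.continuousOn.continuousAt
        (hloc.metric.mem_nhds (htar t ht))
    have h2 : ContinuousAt (deriv c) t :=
      ((hcd t ht).derivWithin (m := ∞) (by simp)).continuousAt
    have h3 : ContinuousAt (fun t => christoffelCLM G (c t)) t :=
      h1.comp (hcd t ht).continuousAt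
    exact (h3.norm.mul h2.norm).continuousWithinAt
  have hle : ∀ t ∈ Metric.ball τ δ, ‖-christoffel G (c t) (deriv c t) (Z t)‖ ≤
      (‖christoffelCLM G (c t)‖ * ‖deriv c t‖) * ‖Z t‖ := by
    intro t _
    rw [norm_neg, ← christoffelCLM_apply]
    exact ContinuousLinearMap.le_opNorm₂ _ _ _
  have hconn : (Metric.ball τ δ).OrdConnected := by
    rw [Real.ball_eq_Ioo]
    exact Set.ordConnected_Ioo
  have hfin := eq_zero_of_norm_deriv_le hconn hder hK hle ha.1
    (by rw [hZeq a ha.1, hPa, sub_self, map_zero]) a' ha'.1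
  rw [hZeq a' ha'.1] at hfin
  have := md_chart_symm_comp (I := I) (hball ha'.1).2 (ξ (γ a') - b a' • vel I γ a')
  rw [hfin, map_zero] at this
  exact sub_eq_zero.1 this.symm

/-- A solution of the Hessian equation which vanishes to first order at a point vanishes. -/
lemma eq_zero_of_eq_zero [PreconnectedSpace M] (h : HessianData I g f ξ κ) {x : M} (hx : f x = 0)
    (hdx : md I 𝓘(ℝ, ℝ) f x = 0) (x' : M) : f x' = 0 ∧ md I 𝓘(ℝ, ℝ) f x' = 0 := by
  refine IsPreconnected.of_locally_imp (s := Set.univ) isPreconnected_univ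
    (fun x => f x = 0 ∧ md I 𝓘(ℝ, ℝ) f x = 0) (fun x₀ _ => ?_) (Set.mem_univ x) (Set.mem_univ x')
    ⟨hx, hdx⟩
  have hloc := h.isHessianOn x₀
  set G := chartMetric I g x₀
  set φ := inChart I f x₀
  obtain ⟨δ, hδ, hball⟩ := Metric.mem_nhds_iff.1
    ((isOpen_target (I := I) x₀).mem_nhds (mem_extChartAt_target x₀))
  have hiff : ∀ x ∈ (extChartAt I x₀).source, (f x = 0 ∧ md I 𝓘(ℝ, ℝ) f x = 0) ↔
      (φ (extChartAt I x₀ x), fderiv ℝ φ (extChartAt I x₀ x)) = 0 := by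
    intro x hx
    have ht := (extChartAt I x₀).map_source hx
    have h1 : φ (extChartAt I x₀ x) = f x := by
      simp only [φ, inChart, (extChartAt I x₀).left_inv hx]
    have h2 : ∀ v, fderiv ℝ φ (extChartAt I x₀ x) v = md I 𝓘(ℝ, ℝ) f x
        (md 𝓘(ℝ, E) I (extChartAt I x₀).symm (extChartAt I x₀ x) v) := fun v => by
      rw [md_inChart ht (h.mdifferentiableAt _), (extChartAt I x₀).left_inv hx]
    rw [Prod.mk_eq_zero, h1]
    refine and_congr_right fun _ => ⟨fun h3 => ?_, fun h3 => ?_⟩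
    · ext v
      rw [h2, h3]
      simp
    · ext v
      obtain ⟨w, rfl⟩ := (md_chart_symm_bijective (I := I) ht).2 v
      rw [← h2, h3]
      simp
  have hU : (extChartAt I x₀).source ∩ extChartAt I x₀ ⁻¹' Metric.ball (extChartAt I x₀ x₀) δ ∈
      𝓝 x₀ :=
    Filter.inter_mem ((isOpen_extChartAt_source x₀).mem_nhds (mem_extChartAt_source x₀))
      ((contMDiffAt_chart (mem_extChartAt_source x₀)).continuousAt.preimage_mem_nhds
        (Metric.ball_mem_nhds _ hδ))
  refine ⟨_, hU, fun a ha b hb hPa => ?_⟩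
  rw [hiff b hb.1.1]
  rw [hiff a ha.1.1] at hPa
  set p := extChartAt I x₀ a
  set q := extChartAt I x₀ b
  set ℓ : ℝ → E := fun t => p + t • (q - p) with hℓ
  have hℓm : ∀ t ∈ Set.Icc (0 : ℝ) 1, ℓ t ∈ (extChartAt I x₀).target := by
    intro t ht
    refine hball ((convex_ball _ _).segment_subset ha.1.2 hb.1.2 ?_)
    exact ⟨1 - t, t, by linarith [ht.2], ht.1, by ring, by simp only [hℓ, p, q]; module⟩
  have hℓd : ∀ t, HasDerivAt ℓ (q - p) t := fun t => by
    exact (((hasDerivAt_id t).smul_const (q - p)).const_add p).congr_deriv (one_smul _ _)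
  -- Along a segment in a chart the pair (φ, Dφ) solves a linear first order equation, since the
  -- Hessian equation expresses D²φ through φ and Dφ.
  set w : ℝ → ℝ × (E →L[ℝ] ℝ) := fun t => (φ (ℓ t), fderiv ℝ φ (ℓ t)) with hw
  have hwd : ∀ t ∈ Set.Icc (0 : ℝ) 1, HasDerivAt w
      (fderiv ℝ φ (ℓ t) (q - p), fderiv ℝ (fderiv ℝ φ) (ℓ t) (q - p)) t := by
    intro t ht
    have h1 := ((hloc.contDiffAt (hℓm t ht)).differentiableAt (by simp)).hasFDerivAt.comp_hasDerivAt
      t (hℓd t)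
    have h2 := (((hloc.contDiffOn_fderiv _ (hℓm t ht)).contDiffAt
      (hloc.metric.mem_nhds (hℓm t ht))).differentiableAt (by simp)).hasFDerivAt.comp_hasDerivAt
      t (hℓd t)
    exact h1.prodMk h2
  set K : ℝ → ℝ := fun t => ‖q - p‖ + (‖christoffelCLM G (ℓ t)‖ * ‖q - p‖
    + |κ| * (‖G (ℓ t)‖ * ‖q - p‖)) with hK
  have hKc : ContinuousOn K (Set.Icc 0 1) := by
    intro t ht
    have h1 : ContinuousAt (fun t => christoffelCLM G (ℓ t)) t :=
      ContinuousAt.comp (f := ℓ) (g := christoffelCLM G)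
        (hloc.metric.contDiffOn_christoffelCLM.continuousOn.continuousAt
          (hloc.metric.mem_nhds (hℓm t ht))) (hℓd t).continuousAt
    have h2 : ContinuousAt (fun t => G (ℓ t)) t :=
      ContinuousAt.comp (f := ℓ) (g := G) (hloc.metric.differentiableAt (hℓm t ht)).continuousAt
        (hℓd t).continuousAt
    exact (continuousAt_const.add ((h1.norm.mul continuousAt_const).add
      (continuousAt_const.mul (h2.norm.mul continuousAt_const)))).continuousWithinAt
  have hle : ∀ t ∈ Set.Icc (0 : ℝ) 1, ‖(fderiv ℝ φ (ℓ t) (q - p),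
      fderiv ℝ (fderiv ℝ φ) (ℓ t) (q - p))‖ ≤ K t * ‖w t‖ := by
    intro t ht
    have hw1 : ‖φ (ℓ t)‖ ≤ ‖w t‖ := norm_fst_le (w t)
    have hw2 : ‖fderiv ℝ φ (ℓ t)‖ ≤ ‖w t‖ := norm_snd_le (w t)
    have hn := norm_nonneg (w t)
    refine norm_prod_le_iff.2 ⟨?_, ?_⟩
    · calc ‖fderiv ℝ φ (ℓ t) (q - p)‖ ≤ ‖fderiv ℝ φ (ℓ t)‖ * ‖q - p‖ :=
            ContinuousLinearMap.le_opNorm _ _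
        _ ≤ ‖w t‖ * ‖q - p‖ := by gcongr
        _ ≤ K t * ‖w t‖ := by
            rw [mul_comm]
            gcongr
            simp only [hK, le_add_iff_nonneg_right]
            positivity
    · refine ContinuousLinearMap.opNorm_le_bound _ (by positivity) fun z => ?_
      rw [hloc.eq _ (hℓm t ht), ← christoffelCLM_apply]
      calc ‖fderiv ℝ φ (ℓ t) (christoffelCLM G (ℓ t) (q - p) z) - κ * φ (ℓ t) * G (ℓ t) (q - p) z‖
          ≤ ‖fderiv ℝ φ (ℓ t) (christoffelCLM G (ℓ t) (q - p) z)‖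
            + ‖κ * φ (ℓ t) * G (ℓ t) (q - p) z‖ := norm_sub_le _ _
        _ ≤ ‖fderiv ℝ φ (ℓ t)‖ * (‖christoffelCLM G (ℓ t)‖ * ‖q - p‖ * ‖z‖)
            + |κ| * ‖φ (ℓ t)‖ * (‖G (ℓ t)‖ * ‖q - p‖ * ‖z‖) := by
            rw [norm_mul, norm_mul, Real.norm_eq_abs κ]
            gcongr
            · exact (ContinuousLinearMap.le_opNorm _ _).trans (by
                gcongr
                exact ContinuousLinearMap.le_opNorm₂ _ _ _)
            · exact ContinuousLinearMap.le_opNorm₂ _ _ _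
        _ ≤ ‖w t‖ * (‖christoffelCLM G (ℓ t)‖ * ‖q - p‖ * ‖z‖)
            + |κ| * ‖w t‖ * (‖G (ℓ t)‖ * ‖q - p‖ * ‖z‖) := by gcongr
        _ = (‖christoffelCLM G (ℓ t)‖ * ‖q - p‖ + |κ| * (‖G (ℓ t)‖ * ‖q - p‖)) * ‖w t‖ * ‖z‖ := by
            ring
        _ ≤ K t * ‖w t‖ * ‖z‖ := by
            gcongr
            simp only [hK, le_add_iff_nonneg_left]
            positivity
  have := eq_zero_of_norm_deriv_le Set.ordConnected_Icc hwd hKc hle (t₀ := 0) (by simp)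
    (by simpa [hw, hℓ] using hPa) 1 (by simp)
  simpa [hw, hℓ] using this

end HessianData
end Gradient

/-! ### Vector fields in charts -/

section Fields

variable {E : Type*} [NormedAddCommGroup E] [NormedSpace ℝ E]
  {H : Type*} [TopologicalSpace H] {I : ModelWithCorners ℝ E H} [I.Boundaryless]
  {M : Type*} [TopologicalSpace M] [ChartedSpace H M] [IsManifold I ∞ M]

variable (I) in
/-- A vector field in the chart at `x₀`. -/
def chartField (V : M → E) (x₀ : M) (y : E) : E :=
  md I 𝓘(ℝ, E) (extChartAt I x₀) ((extChartAt I x₀).symm y) (V ((extChartAt I x₀).symm y))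

lemma md_symm_chartField (V : M → E) {x₀ : M} {y : E} (hy : y ∈ (extChartAt I x₀).target) :
    md 𝓘(ℝ, E) I (extChartAt I x₀).symm y (chartField I V x₀ y) = V ((extChartAt I x₀).symm y) := by
  have := md_chart_symm_comp (I := I) ((extChartAt I x₀).map_target hy)
    (V ((extChartAt I x₀).symm y))
  rwa [(extChartAt I x₀).right_inv hy] at this

lemma chartField_self (V : M → E) (x : M) : chartField I V x (extChartAt I x x) = V x := by
  rw [chartField, extChartAt_to_inv, md_chart_self]
  rfl

lemma isInvertible_md_symm {x₀ : M} {y : E} (hy : y ∈ (extChartAt I x₀).target) :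
    (mfderiv 𝓘(ℝ, E) I (extChartAt I x₀).symm y).IsInvertible := by
  refine ContinuousLinearMap.IsInvertible.of_inverse
    (g := mfderiv I 𝓘(ℝ, E) (extChartAt I x₀) ((extChartAt I x₀).symm y)) ?_ ?_
  · ext v
    have := md_chart_symm_comp (I := I) ((extChartAt I x₀).map_target hy) v
    rw [(extChartAt I x₀).right_inv hy] at this
    exact this
  · ext v
    exact md_chart_comp_symm hy v

lemma inverse_apply_of_apply_eq {F : Type*} [NormedAddCommGroup F] [NormedSpace ℝ F]
    {D : E →L[ℝ] F} (hD : D.IsInvertible) {u : E} {v : F} (h : D u = v) : D.inverse v = u := by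
  obtain ⟨e, rfl⟩ := hD
  rw [ContinuousLinearMap.inverse_equiv, ← h]
  exact e.symm_apply_apply u

lemma mpullback_eq_chartField (V : Π x : M, TangentSpace I x) {x₀ : M} {y : E}
    (hy : y ∈ (extChartAt I x₀).target) :
    VectorField.mpullback 𝓘(ℝ, E) I (extChartAt I x₀).symm V y = chartField I V x₀ y :=
  inverse_apply_of_apply_eq (D := md 𝓘(ℝ, E) I (extChartAt I x₀).symm y)
    (isInvertible_md_symm hy) (md_symm_chartField V hy)

lemma contDiffAt_chartField [CompleteSpace E] {V : Π x : M, TangentSpace I x} {x₀ : M} {y : E}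
    (hy : y ∈ (extChartAt I x₀).target)
    (hV : ContMDiffAt I I.tangent ∞ (fun x => (⟨x, V x⟩ : TangentBundle I M))
      ((extChartAt I x₀).symm y)) : ContDiffAt ℝ ∞ (chartField I V x₀) y := by
  have h1 := hV.mpullback_vectorField_preimage (contMDiffAt_chart_symm hy)
    (isInvertible_md_symm hy) (by simp)
  have h2 := contMDiffAt_vectorSpace_iff_contDiffAt.1 h1
  refine h2.congr_of_eventuallyEq ?_
  filter_upwards [(isOpen_target x₀).mem_nhds hy] with z hz
  exact (mpullback_eq_chartField V hz).symm

/-- The covariant derivative in the preferred chart. -/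
lemma covDeriv_eq [CompleteSpace E] (g : BilinField I M) {V : Π x : M, TangentSpace I x} (x : M)
    (X : E) : (covDeriv I g V x X : E) = fderiv ℝ (chartField I V x) (extChartAt I x x) X +
      christoffel (chartMetric I g x) (extChartAt I x x) X (V x) := by
  have hev : (VectorField.mpullback 𝓘(ℝ, E) I (extChartAt I x).symm V : E → E) =ᶠ[𝓝 (extChartAt I x x)]
      chartField I V x := by
    filter_upwards [(isOpen_target x).mem_nhds (mem_extChartAt_target x)] with z hz
    exact mpullback_eq_chartField V hz
  have hid : mfderiv I 𝓘(ℝ, E) (extChartAt I x) x = ContinuousLinearMap.id ℝ E := md_chart_self x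
  have h1 : (covDeriv I g V x X : E) = (ContinuousLinearMap.id ℝ E).inverse
      (fderiv ℝ (VectorField.mpullback 𝓘(ℝ, E) I (extChartAt I x).symm V : E → E)
        (extChartAt I x x) ((ContinuousLinearMap.id ℝ E) X) +
      christoffel (chartMetric I g x) (extChartAt I x x) ((ContinuousLinearMap.id ℝ E) X)
        ((VectorField.mpullback 𝓘(ℝ, E) I (extChartAt I x).symm V : E → E) (extChartAt I x x))) := by
    -- The derivative of the chart is generalized to D first, because its dependent type prevents
    -- rewriting it to the identity in place.
    have : ∀ D : E →L[ℝ] E, mfderiv I 𝓘(ℝ, E) (extChartAt I x) x = D →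
      (covDeriv I g V x X : E) = D.inverse
      (fderiv ℝ (VectorField.mpullback 𝓘(ℝ, E) I (extChartAt I x).symm V : E → E)
        (extChartAt I x x) (D X) +
      christoffel (chartMetric I g x) (extChartAt I x x) (D X)
        ((VectorField.mpullback 𝓘(ℝ, E) I (extChartAt I x).symm V : E → E) (extChartAt I x x))) := by
      rintro D rfl
      rfl
    exact this _ hid
  have hs : chartField I V x (extChartAt I x x) = (V x : E) := chartField_self V x
  refine h1.trans ?_
  rw [hev.fderiv_eq, hev.self_of_nhds, ContinuousLinearMap.inverse_id]
  exact congrArg (fun w : E => fderiv ℝ (chartField I V x) (extChartAt I x x) X +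
      christoffel (chartMetric I g x) (extChartAt I x x) X w) hs

lemma curvature_eq (g : BilinField I M) (x : M) (X Y Z : E) :
    (curvature I g x X Y Z : E) =
      localCurvature (chartMetric I g x) (extChartAt I x x) X Y Z := by
  have hid : mfderiv I 𝓘(ℝ, E) (extChartAt I x) x = ContinuousLinearMap.id ℝ E := md_chart_self x
  have : ∀ D : E →L[ℝ] E, mfderiv I 𝓘(ℝ, E) (extChartAt I x) x = D →
      (curvature I g x X Y Z : E) = D.inverse (localCurvature (chartMetric I g x)
        (extChartAt I x x) (D X) (D Y) (D Z)) := by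
    rintro D rfl
    rfl
  rw [this _ hid, ContinuousLinearMap.inverse_id]
  rfl

/-- The derivative of the inclusion of an open subset. -/
lemma md_subtype_val {U : TopologicalSpace.Opens M} (x : U) :
    md I I (Subtype.val : U → M) x = ContinuousLinearMap.id ℝ E := by
  have h1 : md I 𝓘(ℝ, E) (extChartAt I x) x = ContinuousLinearMap.id ℝ E := md_chart_self x
  have h2 : (extChartAt I x : U → E) = extChartAt I (x : M) ∘ Subtype.val := rfl
  rw [h2, md_comp (mdifferentiableAt_chart (mem_extChartAt_source (x : M)))
    (contMDiff_subtype_val.mdifferentiableAt (n := ∞) (by simp)), md_chart_self] at h1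
  exact h1

end Fields

/-! ### The cone metric in coordinates -/

section LocalCone

variable {E : Type*} [NormedAddCommGroup E] [NormedSpace ℝ E]

/-- The form `ε dr² + r² G` on `ℝ × E`. -/
def coneForm (ε : ℝ) (G : E → E →L[ℝ] E →L[ℝ] ℝ) (p : ℝ × E) :
    (ℝ × E) →L[ℝ] (ℝ × E) →L[ℝ] ℝ :=
  ε • (ContinuousLinearMap.fst ℝ ℝ E).smulRight (ContinuousLinearMap.fst ℝ ℝ E) +
    p.1 ^ 2 • pull (Prod.snd : ℝ × E → E) G p

lemma coneForm_apply (ε : ℝ) (G : E → E →L[ℝ] E →L[ℝ] ℝ) (p X Y : ℝ × E) :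
    coneForm ε G p X Y = ε * (X.1 * Y.1) + p.1 ^ 2 * G p.2 X.2 Y.2 := by
  simp [coneForm, fderiv_snd]

variable {G : E → E →L[ℝ] E →L[ℝ] ℝ} {O : Set E} {ε : ℝ}

lemma contDiffAt_coneForm (h : IsMetricOn G O) {p : ℝ × E} (hp : p.2 ∈ O) :
    ContDiffAt ℝ ∞ (coneForm ε G) p :=
  contDiffAt_const.add ((contDiffAt_fst.pow 2).smul
    (contDiffAt_pull (n := ⊤) (by exact contDiffAt_snd) (h.contDiffAt hp)))

lemma isMetricOn_coneForm [FiniteDimensional ℝ E] (h : IsMetricOn G O) (hε : ε ≠ 0) :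
    IsMetricOn (coneForm ε G) (Set.Ioi 0 ×ˢ O) where
  isOpen := isOpen_Ioi.prod h.isOpen
  contDiffOn p hp := (contDiffAt_coneForm h hp.2).contDiffWithinAt
  symm p hp X Y := by
    rw [coneForm_apply, coneForm_apply, h.symm p.2 hp.2, mul_comm X.1]
  invertible p hp := by
    refine isInvertible_of_nondegenerate _ fun X hX => ?_
    have hr : p.1 ≠ 0 := (Set.mem_Ioi.1 hp.1).ne'
    ext1
    · have := hX (1, 0)
      rw [coneForm_apply] at this
      simpa [hε] using this
    · refine eq_of_apply_eq (h.invertible p.2 hp.2) fun z => ?_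
      have := hX (0, z)
      rw [coneForm_apply] at this
      simpa [hr] using this

lemma fderiv_coneForm (h : IsMetricOn G O) {p : ℝ × E} (hp : p.2 ∈ O) (W X Y : ℝ × E) :
    fderiv ℝ (coneForm ε G) p W X Y =
      2 * p.1 * W.1 * G p.2 X.2 Y.2 + p.1 ^ 2 * fderiv ℝ G p.2 W.2 X.2 Y.2 := by
  have h1 := (((contDiffAt_coneForm (ε := ε) h hp).differentiableAt (by simp)).hasFDerivAt.clm_apply
    (hasFDerivAt_const X p)).clm_apply (hasFDerivAt_const Y p)
  have hG : HasFDerivAt (fun p : ℝ × E => G p.2) ((fderiv ℝ G p.2).comp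
    (ContinuousLinearMap.snd ℝ ℝ E)) p :=
    (h.differentiableAt hp).hasFDerivAt.comp p hasFDerivAt_snd
  have h2 := (hG.clm_apply (hasFDerivAt_const X.2 p)).clm_apply (hasFDerivAt_const Y.2 p)
  have h3 := (((hasFDerivAt_fst (𝕜 := ℝ) (p := p)).pow 2).mul h2).const_add (ε * (X.1 * Y.1))
  have hfun : (fun p => coneForm ε G p X Y) =
      fun p => ε * (X.1 * Y.1) + p.1 ^ 2 * G p.2 X.2 Y.2 :=
    funext fun p => coneForm_apply ε G p X Y
  rw [hfun] at h1
  have h4 := congrArg (fun l : (ℝ × E) →L[ℝ] ℝ => l W) (h1.unique h3)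
  simp at h4
  rw [h4]
  ring

/-- The Christoffel symbols of a cone. -/
lemma christoffel_coneForm [FiniteDimensional ℝ E] (h : IsMetricOn G O) (hε : ε * ε = 1)
    {p : ℝ × E} (hp : p ∈ Set.Ioi (0 : ℝ) ×ˢ O) (X Y : ℝ × E) :
    christoffel (coneForm ε G) p X Y = (-(ε * p.1 * G p.2 X.2 Y.2),
      christoffel G p.2 X.2 Y.2 + p.1⁻¹ • (X.1 • Y.2 + Y.1 • X.2)) := by
  have hε0 : ε ≠ 0 := left_ne_zero_of_mul_eq_one hε
  have hr : p.1 ≠ 0 := (Set.mem_Ioi.1 hp.1).ne'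
  have hm := isMetricOn_coneForm h hε0
  refine eq_of_apply_eq (hm.invertible p hp) fun Z => ?_
  rw [hm.apply_christoffel hp, christoffelOne, fderiv_coneForm h hp.2, fderiv_coneForm h hp.2,
    fderiv_coneForm h hp.2, coneForm_apply]
  simp only [map_add, map_smul, add_apply, smul_apply, smul_eq_mul, h.apply_christoffel hp.2,
    christoffelOne]
  -- The radial component of Γ carries a factor ε = ε⁻¹, which the ε of the cone metric removes.
  have e1 : ε * (-(ε * p.1 * G p.2 X.2 Y.2) * Z.1) = -(p.1 * G p.2 X.2 Y.2 * Z.1) := by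
    linear_combination (-(p.1 * G p.2 X.2 Y.2 * Z.1)) * hε
  rw [e1]
  field_simp
  ring

end LocalCone

/-! ### Parallel fields on cones -/

section Cone

variable {E : Type*} [NormedAddCommGroup E] [NormedSpace ℝ E] [FiniteDimensional ℝ E]
  {H : Type*} [TopologicalSpace H] {I : ModelWithCorners ℝ E H} [I.Boundaryless]
  {M : Type*} [TopologicalSpace M] [ChartedSpace H M] [IsManifold I ∞ M]

lemma md_cone_fst (p : Cone M) :
    md (coneModel I) 𝓘(ℝ, ℝ) (fun q : Cone M => (q.1 : ℝ)) p = ContinuousLinearMap.fst ℝ ℝ E := by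
  have h := md_comp (I := coneModel I) (I' := 𝓘(ℝ, ℝ)) (I'' := 𝓘(ℝ, ℝ))
    (f := (Subtype.val : PosReals → ℝ)) (h := (Prod.fst : Cone M → PosReals)) (x := p)
    (contMDiff_subtype_val.mdifferentiableAt (n := ∞) (by simp)) mdifferentiableAt_fst
  rw [md_subtype_val] at h
  refine h.trans ?_
  have h2 : md (coneModel I) 𝓘(ℝ, ℝ) (Prod.fst : Cone M → PosReals) p =
    ContinuousLinearMap.fst ℝ ℝ E := mfderiv_fst
  rw [h2]
  rfl

lemma md_prod_snd {E' : Type*} [NormedAddCommGroup E'] [NormedSpace ℝ E']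
    {H' : Type*} [TopologicalSpace H'] {I' : ModelWithCorners ℝ E' H'}
    {M' : Type*} [TopologicalSpace M'] [ChartedSpace H' M'] (p : M' × M) :
    md (I'.prod I) I (Prod.snd : M' × M → M) p = ContinuousLinearMap.snd ℝ E' E := mfderiv_snd

lemma form_coneMetric (ε : ℝ) (g : BilinField I M) (p : Cone M) (X Y : ℝ × E) :
    form (coneModel I) (coneMetric I ε g) p X Y =
      ε * (X.1 * Y.1) + (p.1 : ℝ) ^ 2 * form I g p.2 X.2 Y.2 := by
  have h1 : form (coneModel I) (coneMetric I ε g) p X Y =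
    ε * (md (coneModel I) 𝓘(ℝ, ℝ) (fun q : Cone M => (q.1 : ℝ)) p X *
      md (coneModel I) 𝓘(ℝ, ℝ) (fun q : Cone M => (q.1 : ℝ)) p Y) +
    (p.1 : ℝ) ^ 2 * form I g p.2 (md (coneModel I) I (Prod.snd : Cone M → M) p X)
      (md (coneModel I) I (Prod.snd : Cone M → M) p Y) := rfl
  rw [h1, md_cone_fst, md_prod_snd]
  rfl

/-- The chart of the half-line is its inclusion into ℝ, so cone coordinates are literally (r, y)
with r > 0. -/
lemma target_cone (p : Cone M) : (extChartAt (coneModel I) p).target =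
    Set.Ioi (0 : ℝ) ×ˢ (extChartAt I p.2).target := by
  rw [extChartAt_prod]
  have h : chartAt ℝ (p.1 : ℝ) = OpenPartialHomeomorph.refl ℝ := chartAt_self_eq
  simp [extChartAt, TopologicalSpace.Opens.chartAt_eq, OpenPartialHomeomorph.subtypeRestr_def, h]

lemma cone_symm_fst {p : Cone M} {q : ℝ × E} (hq : q ∈ (extChartAt (coneModel I) p).target) :
    (((extChartAt (coneModel I) p).symm q).1 : ℝ) = q.1 :=
  congrArg Prod.fst ((extChartAt (coneModel I) p).right_inv hq)

lemma cone_symm_snd (p : Cone M) (q : ℝ × E) :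
    ((extChartAt (coneModel I) p).symm q).2 = (extChartAt I p.2).symm q.2 := by
  rw [extChartAt_prod]; rfl

lemma extChartAt_cone (p q : Cone M) :
    extChartAt (coneModel I) p q = ((q.1 : ℝ), extChartAt I p.2 q.2) := by
  rw [extChartAt_prod]; rfl

lemma chartMetric_coneMetric (ε : ℝ) (g : BilinField I M) {p : Cone M} {q : ℝ × E}
    (hq : q ∈ (extChartAt (coneModel I) p).target) :
    chartMetric (coneModel I) (coneMetric I ε g) p q = coneForm ε (chartMetric I g p.2) q := by
  have hs := mdifferentiableAt_chart_symm (I := coneModel I) hq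
  have h1 : ∀ X, (md 𝓘(ℝ, ℝ × E) (coneModel I) (extChartAt (coneModel I) p).symm q X).1 = X.1 := by
    intro X
    have := md_chart_comp_symm (I := coneModel I) hq X
    have h2 := md_comp_apply (I := 𝓘(ℝ, ℝ × E)) (I' := coneModel I) (I'' := 𝓘(ℝ, ℝ))
      (f := fun q : Cone M => (q.1 : ℝ)) (h := (extChartAt (coneModel I) p).symm) (x := q)
      ((contMDiff_subtype_val.mdifferentiableAt (n := ∞) (by simp)).comp _ mdifferentiableAt_fst)
      hs X
    rw [md_cone_fst, md_congr (f' := Prod.fst) (by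
      filter_upwards [(isOpen_target p).mem_nhds hq] with z hz
      exact cone_symm_fst hz), md_eq_fderiv, fderiv_fst] at h2
    exact h2.symm
  have h3 : ∀ X, (md 𝓘(ℝ, ℝ × E) (coneModel I) (extChartAt (coneModel I) p).symm q X).2 =
      md 𝓘(ℝ, E) I (extChartAt I p.2).symm q.2 X.2 := by
    intro X
    have h2 := md_comp_apply (I := 𝓘(ℝ, ℝ × E)) (I' := coneModel I) (I'' := I)
      (f := (Prod.snd : Cone M → M)) (h := (extChartAt (coneModel I) p).symm) (x := q)
      mdifferentiableAt_snd hs X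
    rw [target_cone] at hq
    rw [md_prod_snd, md_congr (f' := fun z => (extChartAt I p.2).symm z.2)
      (Filter.Eventually.of_forall fun z => cone_symm_snd p z),
      md_comp_apply (I' := 𝓘(ℝ, E)) (mdifferentiableAt_chart_symm hq.2)
        differentiableAt_snd.mdifferentiableAt, md_eq_fderiv, fderiv_snd] at h2
    exact h2.symm
  refine ContinuousLinearMap.ext fun X => ContinuousLinearMap.ext fun Y => ?_
  rw [chartMetric_apply, form_coneMetric, h1, h1, h3, h3, cone_symm_fst hq, cone_symm_snd,
    coneForm_apply, chartMetric_apply]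

lemma chartField_cone (V : Cone M → ℝ × E) {p : Cone M} {q : ℝ × E}
    (hq : q ∈ (extChartAt (coneModel I) p).target) :
    chartField (coneModel I) V p q = ((V ((extChartAt (coneModel I) p).symm q)).1,
      md I 𝓘(ℝ, E) (extChartAt I p.2) ((extChartAt I p.2).symm q.2)
        (V ((extChartAt (coneModel I) p).symm q)).2) := by
  have hx := (extChartAt (coneModel I) p).map_target hq
  set x := (extChartAt (coneModel I) p).symm q with hxd
  have hq' := hq
  rw [target_cone] at hq'
  have hx2 : x.2 = (extChartAt I p.2).symm q.2 := cone_symm_snd p q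
  have hd := mdifferentiableAt_chart (I := coneModel I) hx
  have hf := md_comp_apply (I := coneModel I) (I' := 𝓘(ℝ, ℝ × E)) (I'' := 𝓘(ℝ, ℝ))
    (f := Prod.fst) (x := x) differentiableAt_fst.mdifferentiableAt hd (V x)
  have hsn := md_comp_apply (I := coneModel I) (I' := 𝓘(ℝ, ℝ × E)) (I'' := 𝓘(ℝ, E))
    (f := Prod.snd) (x := x) differentiableAt_snd.mdifferentiableAt hd (V x)
  rw [md_eq_fderiv, fderiv_fst, md_congr (f' := fun q : Cone M => (q.1 : ℝ))
    (Filter.Eventually.of_forall fun z => congrArg Prod.fst (extChartAt_cone p z)),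
    md_cone_fst] at hf
  have hxs : x.2 ∈ (extChartAt I p.2).source := hx2 ▸ (extChartAt I p.2).map_target hq'.2
  rw [md_eq_fderiv, fderiv_snd, md_congr (f' := fun q : Cone M => extChartAt I p.2 q.2)
    (Filter.Eventually.of_forall fun z => congrArg Prod.snd (extChartAt_cone p z)),
    md_comp_apply (I' := I) (mdifferentiableAt_chart hxs) mdifferentiableAt_snd, md_prod_snd,
    hx2] at hsn
  exact Prod.ext hf.symm hsn.symm

lemma christoffel_congr {F : Type*} [NormedAddCommGroup F] [NormedSpace ℝ F]
    {G G' : F → F →L[ℝ] F →L[ℝ] ℝ} {y : F} (h : G =ᶠ[𝓝 y] G') (v w : F) :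
    christoffel G y v w = christoffel G' y v w := by
  rw [christoffel, christoffel, h.fderiv_eq, h.self_of_nhds]

lemma christoffel_coneMetric {ε : ℝ} (hε : ε * ε = 1) {g : BilinField I M}
    (hg : IsSemiRiemannian I g) (p : Cone M) {q : ℝ × E}
    (hq : q ∈ Set.Ioi (0 : ℝ) ×ˢ (extChartAt I p.2).target) (X Y : ℝ × E) :
    christoffel (chartMetric (coneModel I) (coneMetric I ε g) p) q X Y =
      (-(ε * q.1 * chartMetric I g p.2 q.2 X.2 Y.2), christoffel (chartMetric I g p.2) q.2 X.2 Y.2 +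
        q.1⁻¹ • (X.1 • Y.2 + Y.1 • X.2)) := by
  rw [christoffel_congr (G' := coneForm ε (chartMetric I g p.2)),
    christoffel_coneForm (hg.isMetricOn p.2) hε hq]
  have hq' : q ∈ (extChartAt (coneModel I) p).target := by rwa [target_cone]
  filter_upwards [(isOpen_target p).mem_nhds hq'] with z hz using chartMetric_coneMetric ε g hz

/-- A smooth vector field `W` on the cone that is parallel, in terms of its components. -/
structure ConeParallel (ε : ℝ) (g : BilinField I M) (W : Cone M → ℝ × E) : Prop where
  metric : IsSemiRiemannian I g
  sq : ε * ε = 1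
  contDiffAt : ∀ p, ContDiffAt ℝ ∞ (chartField (coneModel I) W p) ((p.1 : ℝ), extChartAt I p.2 p.2)
  fderiv_eq : ∀ p X, fderiv ℝ (chartField (coneModel I) W p) ((p.1 : ℝ), extChartAt I p.2 p.2) X =
      (ε * p.1 * form I g p.2 X.2 (W p).2,
        -(christoffel (chartMetric I g p.2) (extChartAt I p.2 p.2) X.2 (W p).2 +
          (p.1 : ℝ)⁻¹ • (X.1 • (W p).2 + (W p).1 • X.2)))

lemma coneParallel {ε : ℝ} {g : BilinField I M} {V : Π p : Cone M, TangentSpace (coneModel I) p}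
    (hε : ε * ε = 1) (hg : IsSemiRiemannian I g)
    (hV : ContMDiff (coneModel I) (coneModel I).tangent ∞
      (fun p => (⟨p, V p⟩ : TangentBundle (coneModel I) (Cone M))))
    (hp : IsParallel (coneModel I) (coneMetric I ε g) V) : ConeParallel ε g V where
  metric := hg
  sq := hε
  contDiffAt p := by
    rw [← extChartAt_cone]
    exact contDiffAt_chartField (mem_extChartAt_target p) (hV _)
  fderiv_eq p X := by
    have h1 := (covDeriv_eq (I := coneModel I) (coneMetric I ε g) (V := V) p X).symm.trans (hp p X)
    rw [extChartAt_cone] at h1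
    have key : ∀ D W : ℝ × E, D + christoffel (chartMetric (coneModel I) (coneMetric I ε g) p)
        ((p.1 : ℝ), extChartAt I p.2 p.2) X W = 0 → D = (ε * p.1 * form I g p.2 X.2 W.2,
        -(christoffel (chartMetric I g p.2) (extChartAt I p.2 p.2) X.2 W.2 +
          (p.1 : ℝ)⁻¹ • (X.1 • W.2 + W.1 • X.2))) := by
      intro D W h
      rw [eq_neg_of_add_eq_zero_left h, christoffel_coneMetric hε hg p
        ⟨p.1.2, mem_extChartAt_target p.2⟩]
      simp only [chartMetric_self, Prod.neg_mk, neg_neg]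
    exact key _ (V p) h1

/-- The point `1` of the half-line. -/
def onePos : PosReals := ⟨1, Set.mem_Ioi.2 one_pos⟩

namespace ConeParallel

variable {ε : ℝ} {g : BilinField I M} {W : Cone M → ℝ × E}

/-- In the direction ∂_r the cone connection acts on the fibre part alone, by the factor 1 / r. The
curve v is a function on ℝ that agrees with the field for positive r, so that ordinary derivatives
make sense. -/
lemma hasDerivAt_radial (h : ConeParallel ε g W) (r : PosReals) (x : M) (v : ℝ → ℝ × E)
    (hv : ∀ r : PosReals, v r = W (r, x)) :
    HasDerivAt v (0, -((r : ℝ)⁻¹ • (v r).2)) r := by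
  have h1 := ((h.contDiffAt (r, x)).differentiableAt (by simp)).hasFDerivAt
  have h2 : HasDerivAt (fun t : ℝ => ((t, extChartAt I x x) : ℝ × E)) (1, 0) r :=
    (hasDerivAt_id _).prodMk (hasDerivAt_const _ _)
  have h3 := h1.comp_hasDerivAt (r : ℝ) h2
  rw [h.fderiv_eq] at h3
  simp only [map_zero, zero_apply, mul_zero, one_smul, smul_zero, add_zero] at h3
  have hc0 : ∀ u, christoffel (chartMetric I g x) (extChartAt I x x) 0 u = 0 := by
    intro u
    have hm := h.metric.isMetricOn (I := I) x
    refine eq_of_apply_eq (hm.invertible _ (mem_extChartAt_target x)) fun z => ?_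
    rw [hm.apply_christoffel (mem_extChartAt_target x), christoffelOne]
    simp
  simp only [hc0, zero_add, ← hv] at h3
  refine h3.congr_of_eventuallyEq ?_
  filter_upwards [Ioi_mem_nhds r.2] with t ht
  have hq : ((t, extChartAt I x x) : ℝ × E) ∈ (extChartAt (coneModel I) ((r, x) : Cone M)).target := by
    rw [target_cone]; exact ⟨ht, mem_extChartAt_target x⟩
  have hs : (extChartAt (coneModel I) ((r, x) : Cone M)).symm (t, extChartAt I x x) =
      ((⟨t, ht⟩, x) : Cone M) := by
    refine Prod.ext (Subtype.ext (cone_symm_fst hq)) ?_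
    rw [cone_symm_snd]; exact extChartAt_to_inv x
  have h4 := chartField_cone W hq
  simp only [extChartAt_to_inv, md_chart_self, hs] at h4
  exact (hv ⟨t, ht⟩).trans h4.symm

/-- A parallel field is determined by its values at the points with `r = 1`. -/
lemma eq_at_one (h : ConeParallel ε g W) (r : PosReals) (x : M) :
    W (r, x) = ((W (onePos, x)).1, (r : ℝ)⁻¹ • (W (onePos, x)).2) := by
  classical
  set v : ℝ → ℝ × E := fun t => if ht : 0 < t then W (⟨t, ht⟩, x) else 0 with hv
  have hvr : ∀ r : PosReals, v r = W (r, x) := fun r => dif_pos r.2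
  have hd : ∀ t ∈ Set.Ioi (0 : ℝ), HasDerivAt v (0, -(t⁻¹ • (v t).2)) t :=
    fun t ht => h.hasDerivAt_radial ⟨t, ht⟩ x v hvr
  -- The radial part and r times the fibre part are constant in r.
  have h1 : ∀ t ∈ Set.Ioi (0 : ℝ), HasDerivAt (fun t => ((v t).1, t • (v t).2)) (0 : ℝ × E) t := by
    intro t ht
    have e1 : HasDerivAt (fun t => (v t).1) ((0, -(t⁻¹ • (v t).2)) : ℝ × E).1 t :=
      (hasFDerivAt_fst (𝕜 := ℝ) (p := v t)).comp_hasDerivAt t (hd t ht)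
    have e2 : HasDerivAt (fun t => (v t).2) ((0, -(t⁻¹ • (v t).2)) : ℝ × E).2 t :=
      (hasFDerivAt_snd (𝕜 := ℝ) (p := v t)).comp_hasDerivAt t (hd t ht)
    have e3 := e1.prodMk ((hasDerivAt_id t).smul e2)
    have ht0 : t ≠ 0 := (Set.mem_Ioi.1 ht).ne'
    have e4 : (0 : ℝ × E) = (((0, -(t⁻¹ • (v t).2)) : ℝ × E).1,
        id t • ((0, -(t⁻¹ • (v t).2)) : ℝ × E).2 + (1 : ℝ) • (v t).2) := by
      refine Prod.ext rfl ?_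
      simp [smul_smul, ht0]
    rw [e4]
    exact e3
  have h2 := isOpen_Ioi.is_const_of_deriv_eq_zero (convex_Ioi (0 : ℝ)).isPreconnected
    (fun t ht => (h1 t ht).differentiableAt.differentiableWithinAt) (fun t ht => (h1 t ht).deriv)
    r.2 onePos.2
  simp only [hvr, Prod.mk.injEq] at h2
  have hr : (r : ℝ) ≠ 0 := (Set.mem_Ioi.1 r.2).ne'
  refine Prod.ext h2.1 ?_
  have h3 := congrArg (fun u => (r : ℝ)⁻¹ • u) h2.2
  simpa [smul_smul, hr, onePos] using h3

lemma inChart_eventuallyEq (W : Cone M → ℝ × E) (x : M) :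
    inChart I (fun x => (W (onePos, x)).1) x =ᶠ[𝓝 (extChartAt I x x)]
      fun y => (chartField (coneModel I) W (onePos, x) (1, y)).1 := by
  filter_upwards [(isOpen_target x).mem_nhds (mem_extChartAt_target x)] with y hy
  have hq : ((1, y) : ℝ × E) ∈ (extChartAt (coneModel I) ((onePos, x) : Cone M)).target := by
    rw [target_cone]; exact ⟨Set.mem_Ioi.2 one_pos, hy⟩
  rw [chartField_cone W hq]
  have hs : (extChartAt (coneModel I) ((onePos, x) : Cone M)).symm (1, y) =
      ((onePos, (extChartAt I x).symm y) : Cone M) :=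
    Prod.ext (Subtype.ext (cone_symm_fst hq)) (cone_symm_snd _ _)
  rw [hs]
  rfl

lemma contDiffAt_one (h : ConeParallel ε g W) (x : M) :
    ContDiffAt ℝ ∞ (fun y => chartField (coneModel I) W (onePos, x) (1, y)) (extChartAt I x x) :=
  ContDiffAt.comp (g := chartField (coneModel I) W (onePos, x)) (f := fun y : E => ((1, y) : ℝ × E))
    (extChartAt I x x) (h.contDiffAt (onePos, x)) (contDiffAt_const.prodMk contDiffAt_id)

lemma fderiv_one (h : ConeParallel ε g W) (x : M) (u : E) :
    fderiv ℝ (fun y => chartField (coneModel I) W (onePos, x) (1, y)) (extChartAt I x x) u =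
      (ε * form I g x u (W (onePos, x)).2,
        -(christoffel (chartMetric I g x) (extChartAt I x x) u (W (onePos, x)).2 +
          (W (onePos, x)).1 • u)) := by
  have h1 := ((h.contDiffAt (onePos, x)).differentiableAt (by simp)).hasFDerivAt
  have h2 : HasFDerivAt (fun y : E => ((1, y) : ℝ × E)) (ContinuousLinearMap.inr ℝ ℝ E)
    (extChartAt I x x) := hasFDerivAt_prodMk_right _ _
  have h3 := (HasFDerivAt.comp (f := fun y : E => ((1, y) : ℝ × E)) (extChartAt I x x) (g := chartField (coneModel I) W (onePos, x))
    h1 h2).fderiv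
  have h4 := congrArg (fun l : E →L[ℝ] ℝ × E => l u) h3
  refine h4.trans ?_
  have := h.fderiv_eq (onePos, x) (0, u)
  simp only [onePos, inv_one, one_smul, zero_smul, zero_add, mul_one] at this
  exact this

/-- The radial component of a parallel field on the cone and the gradient of this function. -/
lemma hessianData (h : ConeParallel ε g W) : HessianData I g (fun x => (W (onePos, x)).1)
    (fun x => ε • (W (onePos, x)).2) ε := by
  have hφ := fun x => inChart_eventuallyEq (I := I) W x
  have hw := fun x => h.contDiffAt_one x
  set f : M → ℝ := fun x => (W (onePos, x)).1 with hf
  have hsm : ContMDiff I 𝓘(ℝ, ℝ) ∞ f := by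
    intro x
    have h1 : ContDiffAt ℝ ∞ (inChart I f x) (extChartAt I x x) :=
      ((contDiff_fst.contDiffAt).comp _ (hw x)).congr_of_eventuallyEq (hφ x)
    refine (h1.contMDiffAt.comp x (contMDiffAt_chart (mem_extChartAt_source x))).congr_of_eventuallyEq
      ?_
    filter_upwards [(isOpen_extChartAt_source x).mem_nhds (mem_extChartAt_source (I := I) x)] with z hz
    exact congrArg f ((extChartAt I x).left_inv hz).symm
  -- The radial component of the parallel equation is df(v) = ε g(v, w) for the fibre part w; hence
  -- the gradient is ε w.
  have hgrad : ∀ x v, form I g x (ε • (W (onePos, x)).2) v = md I 𝓘(ℝ, ℝ) f x v := by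
    intro x v
    have h1 := md_inChart (I := I) (f := f) (x₀ := x) (y := extChartAt I x x)
      (mem_extChartAt_target x) ((hsm _).mdifferentiableAt (by simp)) v
    rw [md_chart_symm_self, extChartAt_to_inv, (hφ x).fderiv_eq] at h1
    refine Eq.trans ?_ h1
    have h2 : HasFDerivAt (fun y => (chartField (coneModel I) W (onePos, x) (1, y)).1) _ _ :=
      (hasFDerivAt_fst (𝕜 := ℝ)).comp (extChartAt I x x)
        ((hw x).differentiableAt (by simp)).hasFDerivAt
    rw [h2.fderiv]
    have h3 := congrArg Prod.fst (h.fderiv_one x v)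
    refine Eq.trans ?_ h3.symm
    rw [map_smul, smul_apply, smul_eq_mul]
    exact congrArg _ (h.metric.symm x _ _)
  refine ⟨h.metric, hsm, fun x v w => ?_, hgrad⟩
  have hm := h.metric.isMetricOn (I := I) x
  have ht := mem_extChartAt_target (I := I) x
  set b : E → E := fun y => (chartField (coneModel I) W (onePos, x) (1, y)).2 with hb
  have hbd : HasFDerivAt b ((ContinuousLinearMap.snd ℝ ℝ E).comp (fderiv ℝ
      (fun y => chartField (coneModel I) W (onePos, x) (1, y)) (extChartAt I x x)))
      (extChartAt I x x) :=
    (hasFDerivAt_snd (𝕜 := ℝ)).comp (extChartAt I x x)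
      ((hw x).differentiableAt (by simp)).hasFDerivAt
  -- The gradient relation is needed on a whole neighbourhood, in one chart, so that it can be
  -- differentiated once more.
  have hev : fderiv ℝ (inChart I f x) =ᶠ[𝓝 (extChartAt I x x)]
      fun y => ε • chartMetric I g x y (b y) := by
    filter_upwards [(isOpen_target x).mem_nhds ht] with y hy
    ext w
    have hq : ((1, y) : ℝ × E) ∈ (extChartAt (coneModel I) ((onePos, x) : Cone M)).target := by
      rw [target_cone]; exact ⟨Set.mem_Ioi.2 one_pos, hy⟩
    have hs : (extChartAt (coneModel I) ((onePos, x) : Cone M)).symm (1, y) =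
        ((onePos, (extChartAt I x).symm y) : Cone M) :=
      Prod.ext (Subtype.ext (cone_symm_fst hq)) (cone_symm_snd _ _)
    have hby : md 𝓘(ℝ, E) I (extChartAt I x).symm y (b y) =
        (W (onePos, (extChartAt I x).symm y)).2 := by
      simp only [hb, chartField_cone W hq, hs]
      exact md_symm_chartField (fun z => (W (onePos, z)).2) hy
    rw [md_inChart hy ((hsm _).mdifferentiableAt (by simp)), ← hgrad, smul_apply,
      chartMetric_apply, hby, map_smul, smul_apply]
  have hbx : b (extChartAt I x x) = (W (onePos, x)).2 := by
    have hq : ((1, extChartAt I x x) : ℝ × E) ∈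
        (extChartAt (coneModel I) ((onePos, x) : Cone M)).target := by
      rw [target_cone]; exact ⟨Set.mem_Ioi.2 one_pos, ht⟩
    have hs : (extChartAt (coneModel I) ((onePos, x) : Cone M)).symm (1, extChartAt I x x) =
        ((onePos, x) : Cone M) :=
      Prod.ext (Subtype.ext (cone_symm_fst hq))
        ((cone_symm_snd _ _).trans (extChartAt_to_inv x))
    simp only [hb, chartField_cone W hq, hs, extChartAt_to_inv, md_chart_self]
    rfl
  -- The fibre component of the parallel equation at r = 1 is ∇_v w = -f v. Differentiating df = ε
  -- g(w, ·) therefore gives the Hessian -ε f g plus the connection term.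
  have hd := (((hm.differentiableAt ht).hasFDerivAt.clm_apply hbd).const_smul ε).fderiv
  have hb' := congrArg Prod.snd (h.fderiv_one x v)
  have hgr := hgrad x (christoffel (chartMetric I g x) (extChartAt I x x) v w)
  have hmd := md_inChart (I := I) (f := f) (x₀ := x) (y := extChartAt I x x)
      (mem_extChartAt_target x) ((hsm _).mdifferentiableAt (by simp))
      (christoffel (chartMetric I g x) (extChartAt I x x) v w)
  rw [md_chart_symm_self, extChartAt_to_inv] at hmd
  have hb'' : (fderiv ℝ (fun y => chartField (coneModel I) W (onePos, x) (1, y))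
    (extChartAt I x x) v).2 = _ := hb'
  have hmd' : fderiv ℝ (inChart I f x) (extChartAt I x x)
    (christoffel (chartMetric I g x) (extChartAt I x x) v w) =
    md I 𝓘(ℝ, ℝ) f x (christoffel (chartMetric I g x) (extChartAt I x x) v w) := hmd
  rw [hev.fderiv_eq]
  refine (congrArg (fun l : E →L[ℝ] E →L[ℝ] ℝ => l v w) hd).trans ?_
  rw [hmd', ← hgr]
  simp only [smul_apply, add_apply, ContinuousLinearMap.comp_apply, ContinuousLinearMap.flip_apply,
    ContinuousLinearMap.coe_snd', hb'', hm.fderiv_eq ht, hbx, chartMetric_self, map_neg, map_add,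
    neg_apply, map_smul, smul_eq_mul]
  ring

/-- The factor r² of the metric cancels the two factors r⁻¹ of the fibre part, and ε² = 1 turns w
into the gradient ε w. This value, the same for all points in the theorem, separates the three
cases. -/
lemma form_self (h : ConeParallel ε g W) (r : PosReals) (x : M) :
    form (coneModel I) (coneMetric I ε g) (r, x) (W (r, x)) (W (r, x)) =
      ε * (W (onePos, x)).1 ^ 2 +
        form I g x (ε • (W (onePos, x)).2) (ε • (W (onePos, x)).2) := by
  rw [form_coneMetric, h.eq_at_one]
  have hr : (r : ℝ) ≠ 0 := (Set.mem_Ioi.1 r.2).ne'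
  simp only [map_smul, smul_apply, smul_eq_mul]
  rw [← mul_assoc ε ε, h.sq]
  field_simp

end ConeParallel

end Cone

/-! ### The curvature tensor in coordinates -/

section LocalCurvature

variable {E : Type*} [NormedAddCommGroup E] [NormedSpace ℝ E]

/-- The connection applied twice, `(X, Y) ↦ A X ∘ A Y`. -/
def compTwice (A : E →L[ℝ] E →L[ℝ] E) : E →L[ℝ] E →L[ℝ] E →L[ℝ] E :=
  (((ContinuousLinearMap.compL ℝ E E E).comp A).flip.comp A).flip

/-- The difference of the curvature tensor and the tensor of constant curvature `κ`. -/
def defect (G : E → E →L[ℝ] E →L[ℝ] ℝ) (κ : ℝ) (y : E) : E →L[ℝ] E →L[ℝ] E →L[ℝ] E :=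
  fderiv ℝ (christoffelCLM G) y - (fderiv ℝ (christoffelCLM G) y).flip
    + compTwice (christoffelCLM G y) - (compTwice (christoffelCLM G y)).flip
    - κ • (((ContinuousLinearMap.smulRightL ℝ E E).comp (G y)).flip
      - (ContinuousLinearMap.smulRightL ℝ E E).comp (G y))

lemma defect_apply (G : E → E →L[ℝ] E →L[ℝ] ℝ) (κ : ℝ) (y X Y Z : E) :
    defect G κ y X Y Z = fderiv ℝ (christoffelCLM G) y X Y Z - fderiv ℝ (christoffelCLM G) y Y X Z
      + christoffelCLM G y X (christoffelCLM G y Y Z)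
      - christoffelCLM G y Y (christoffelCLM G y X Z) - κ • (G y Y Z • X - G y X Z • Y) := rfl

lemma defect_skew (G : E → E →L[ℝ] E →L[ℝ] ℝ) (κ : ℝ) (y X Y Z : E) :
    defect G κ y X Y Z = -defect G κ y Y X Z := by
  rw [defect_apply, defect_apply]
  module

lemma contDiffAt_flip {X Y F : Type*} [NormedAddCommGroup X] [NormedSpace ℝ X]
    [NormedAddCommGroup Y] [NormedSpace ℝ Y] [NormedAddCommGroup F] [NormedSpace ℝ F]
    {K : E → X →L[ℝ] Y →L[ℝ] F} {y : E} (hK : ContDiffAt ℝ ∞ K y) :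
    ContDiffAt ℝ ∞ (fun z => (K z).flip) y :=
  (ContinuousLinearMap.flipₗᵢ ℝ X Y F).toContinuousLinearEquiv.contDiff.contDiffAt.comp y hK

variable [FiniteDimensional ℝ E] {G : E → E →L[ℝ] E →L[ℝ] ℝ} {O : Set E} {y : E} {κ : ℝ}

namespace IsMetricOn

lemma contDiffAt_christoffelCLM (h : IsMetricOn G O) (hy : y ∈ O) :
    ContDiffAt ℝ ∞ (christoffelCLM G) y :=
  (h.contDiffOn_christoffelCLM y hy).contDiffAt (h.mem_nhds hy)

lemma hasFDerivAt_christoffelCLM (h : IsMetricOn G O) (hy : y ∈ O) :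
    HasFDerivAt (christoffelCLM G) (fderiv ℝ (christoffelCLM G) y) y :=
  ((h.contDiffAt_christoffelCLM hy).differentiableAt (by simp)).hasFDerivAt

lemma hasFDerivAt_fderiv_christoffelCLM (h : IsMetricOn G O) (hy : y ∈ O) :
    HasFDerivAt (fderiv ℝ (christoffelCLM G)) (fderiv ℝ (fderiv ℝ (christoffelCLM G)) y) y :=
  (((h.contDiffAt_christoffelCLM hy).fderiv_right (m := ∞) (by simp)).differentiableAt
    (by simp)).hasFDerivAt

lemma fderiv_christoffel (h : IsMetricOn G O) (hy : y ∈ O) (X Y Z : E) :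
    fderiv ℝ (fun y' => christoffel G y' Y Z) y X = fderiv ℝ (christoffelCLM G) y X Y Z := by
  have h1 := ((h.hasFDerivAt_christoffelCLM hy).clm_apply (hasFDerivAt_const Y y)).clm_apply
    (hasFDerivAt_const Z y)
  simp only [christoffelCLM_apply] at h1
  rw [h1.fderiv]
  simp

lemma localCurvature_eq (h : IsMetricOn G O) (hy : y ∈ O) (X Y Z : E) :
    localCurvature G y X Y Z = defect G κ y X Y Z + κ • (G y Y Z • X - G y X Z • Y) := by
  rw [localCurvature, defect_apply, h.fderiv_christoffel hy, h.fderiv_christoffel hy]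
  simp only [christoffelCLM_apply]
  abel

lemma christoffelCLM_symm (h : IsMetricOn G O) (hy : y ∈ O) (X Y : E) :
    christoffelCLM G y X Y = christoffelCLM G y Y X := by
  rw [christoffelCLM_apply, christoffelCLM_apply, h.christoffel_symm hy]

lemma fderiv_christoffelCLM_symm (h : IsMetricOn G O) (hy : y ∈ O) (X Y Z : E) :
    fderiv ℝ (christoffelCLM G) y X Y Z = fderiv ℝ (christoffelCLM G) y X Z Y := by
  rw [← h.fderiv_christoffel hy, ← h.fderiv_christoffel hy]
  refine congrArg (fun l : E →L[ℝ] E => l X) (Filter.EventuallyEq.fderiv_eq ?_)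
  filter_upwards [h.mem_nhds hy] with z hz using h.christoffel_symm hz _ _

lemma fderiv_eq' (h : IsMetricOn G O) (hy : y ∈ O) (u v w : E) : fderiv ℝ G y u v w =
    G y (christoffelCLM G y u v) w + G y v (christoffelCLM G y u w) := by
  rw [h.fderiv_eq hy, christoffelCLM_apply, christoffelCLM_apply]

/-- The first Bianchi identity. -/
lemma defect_cyclic (h : IsMetricOn G O) (hy : y ∈ O) (X Y Z : E) :
    defect G κ y X Y Z + defect G κ y Y Z X + defect G κ y Z X Y = 0 := by
  simp only [defect_apply]
  rw [h.fderiv_christoffelCLM_symm hy X Z Y, h.fderiv_christoffelCLM_symm hy Y X Z,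
    h.fderiv_christoffelCLM_symm hy Z Y X, h.christoffelCLM_symm hy X Z,
    h.christoffelCLM_symm hy Y X, h.christoffelCLM_symm hy Z Y, h.symm y hy X Z,
    h.symm y hy Y X, h.symm y hy Z Y]
  module

/-- The curvature endomorphisms are skew-adjoint. -/
lemma apply_defect_skew (h : IsMetricOn G O) (hy : y ∈ O) (X Y Z W : E) :
    G y (defect G κ y X Y Z) W = -G y Z (defect G κ y X Y W) := by
  -- Metric compatibility is differentiated once more; symmetry of the second derivative of the
  -- metric in X and Y is then exactly the skew-adjointness of the curvature.
  have key : ∀ X Y, fderiv ℝ (fderiv ℝ G) y X Y Z W =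
      fderiv ℝ G y X (christoffelCLM G y Y Z) W + G y (fderiv ℝ (christoffelCLM G) y X Y Z) W
      + fderiv ℝ G y X Z (christoffelCLM G y Y W)
      + G y Z (fderiv ℝ (christoffelCLM G) y X Y W) := by
    intro X Y
    have hG := (h.differentiableAt hy).hasFDerivAt
    have hA := h.hasFDerivAt_christoffelCLM hy
    have hDG : HasFDerivAt (fderiv ℝ G) (fderiv ℝ (fderiv ℝ G) y) y :=
      (((h.contDiffAt hy).fderiv_right (m := ∞) (by simp)).differentiableAt (by simp)).hasFDerivAt
    have c : ∀ u : E, HasFDerivAt (fun _ : E => u) (0 : E →L[ℝ] E) y := fun u => hasFDerivAt_const u y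
    have h1 := ((hDG.clm_apply (c Y)).clm_apply (c Z)).clm_apply (c W)
    have h2 := ((hG.clm_apply ((hA.clm_apply (c Y)).clm_apply (c Z))).clm_apply (c W)).add
      ((hG.clm_apply (c Z)).clm_apply ((hA.clm_apply (c Y)).clm_apply (c W)))
    have hev : (fun y => fderiv ℝ G y Y Z W) =ᶠ[𝓝 y] fun y =>
        G y (christoffelCLM G y Y Z) W + G y Z (christoffelCLM G y Y W) := by
      filter_upwards [h.mem_nhds hy] with z hz using h.fderiv_eq' hz Y Z W
    have h3 := congrArg (fun l : E →L[ℝ] ℝ => l X) (h1.unique (h2.congr_of_eventuallyEq hev))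
    simp at h3
    linarith
  have hs := congrArg (fun l : E →L[ℝ] E →L[ℝ] ℝ => l Z W)
    (((h.contDiffAt hy).of_le two_le_infty).isSymmSndFDerivAt (by simp) X Y)
  simp only [key] at hs
  simp only [h.fderiv_eq' hy] at hs
  simp only [defect_apply, map_sub, map_add, map_smul, sub_apply, add_apply, smul_apply, smul_eq_mul]
  rw [h.symm y hy Z X, h.symm y hy Z Y]
  linarith

/-- The pair symmetry of the curvature tensor. -/
lemma apply_defect_pair (h : IsMetricOn G O) (hy : y ∈ O) (X Y Z W : E) :
    G y (defect G κ y X Y Z) W = G y (defect G κ y Z W X) Y := by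
  have b : ∀ X Y Z W, G y (defect G κ y X Y Z) W + G y (defect G κ y Y Z X) W
      + G y (defect G κ y Z X Y) W = 0 := by
    intro X Y Z W
    have := congrArg (fun u => G y u W) (h.defect_cyclic (κ := κ) hy X Y Z)
    simpa using this
  have s1 : ∀ X Y Z W, G y (defect G κ y X Y Z) W = -G y (defect G κ y Y X Z) W := by
    intro X Y Z W
    rw [defect_skew]
    simp
  have s2 : ∀ X Y Z W, G y (defect G κ y X Y Z) W = -G y (defect G κ y X Y W) Z := by
    intro X Y Z W
    rw [h.apply_defect_skew hy, h.symm y hy]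
  -- Pair symmetry is a formal consequence of the first Bianchi identity for the four cyclic
  -- rotations of X, Y, Z, W and of the two skew symmetries.
  linarith [b X Y Z W, b Y Z W X, b Z W X Y, b W X Y Z, s1 X Y Z W, s1 Z X Y W, s1 Y Z X W,
    s2 Y Z W X, s2 Z W Y X, s2 W Y Z X, s2 Z W X Y, s2 W X Z Y, s2 X Z W Y, s2 W X Y Z, s2 X Y W Z,
    s2 Y W X Z, s1 W Y Z X, s1 Y W Z X, s1 X Z W Y, s1 Z X W Y, s1 W Y X Z, s1 Z W X Y, s1 W X Y Z,
    s1 W X Z Y]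

lemma contDiffAt_defect (h : IsMetricOn G O) (hy : y ∈ O) : ContDiffAt ℝ ∞ (defect G κ) y := by
  have hA := h.contDiffAt_christoffelCLM hy
  have hA' : ContDiffAt ℝ ∞ (fderiv ℝ (christoffelCLM G)) y := hA.fderiv_right (by simp)
  have hT : ContDiffAt ℝ ∞ (fun z => compTwice (christoffelCLM G z)) y :=
    contDiffAt_flip ((contDiffAt_flip (contDiffAt_const.clm_comp hA)).clm_comp hA)
  have hS : ContDiffAt ℝ ∞ (fun z => (ContinuousLinearMap.smulRightL ℝ E E).comp (G z)) y :=
    contDiffAt_const.clm_comp (h.contDiffAt hy)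
  exact (((hA'.sub (contDiffAt_flip hA')).add hT).sub (contDiffAt_flip hT)).sub (((contDiffAt_flip hS).sub hS).const_smul κ)

lemma hasFDerivAt_defect (h : IsMetricOn G O) (hy : y ∈ O) :
    HasFDerivAt (defect G κ) (fderiv ℝ (defect G κ) y) y :=
  ((h.contDiffAt_defect hy).differentiableAt (by simp)).hasFDerivAt

lemma fderiv_defect_apply (h : IsMetricOn G O) (hy : y ∈ O) (V X Y Z : E) :
    fderiv ℝ (defect G κ) y V X Y Z =
      fderiv ℝ (fderiv ℝ (christoffelCLM G)) y V X Y Z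
      - fderiv ℝ (fderiv ℝ (christoffelCLM G)) y V Y X Z
      + fderiv ℝ (christoffelCLM G) y V X (christoffelCLM G y Y Z)
      + christoffelCLM G y X (fderiv ℝ (christoffelCLM G) y V Y Z)
      - fderiv ℝ (christoffelCLM G) y V Y (christoffelCLM G y X Z)
      - christoffelCLM G y Y (fderiv ℝ (christoffelCLM G) y V X Z)
      - κ • (fderiv ℝ G y V Y Z • X - fderiv ℝ G y V X Z • Y) := by
  have hA := h.hasFDerivAt_christoffelCLM hy
  have hA' := h.hasFDerivAt_fderiv_christoffelCLM hy
  have hG := (h.differentiableAt hy).hasFDerivAt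
  have c : ∀ u : E, HasFDerivAt (fun _ : E => u) (0 : E →L[ℝ] E) y := fun u => hasFDerivAt_const u y
  have h1 := (((h.hasFDerivAt_defect (κ := κ) hy).clm_apply (c X)).clm_apply (c Y)).clm_apply (c Z)
  have hX := hA.clm_apply (c X)
  have hY := hA.clm_apply (c Y)
  have h2 := ((((((hA'.clm_apply (c X)).clm_apply (c Y)).clm_apply (c Z)).sub
    (((hA'.clm_apply (c Y)).clm_apply (c X)).clm_apply (c Z))).add
    (hX.clm_apply (hY.clm_apply (c Z)))).sub
    (hY.clm_apply (hX.clm_apply (c Z)))).sub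
    (((((hG.clm_apply (c Y)).clm_apply (c Z)).smul_const X).sub
      (((hG.clm_apply (c X)).clm_apply (c Z)).smul_const Y)).const_smul κ)
  have h3 := congrArg (fun l : E →L[ℝ] E => l V) (h1.unique h2)
  simp at h3
  rw [h3]
  module

/-- The second Bianchi identity. -/
lemma fderiv_defect_cyclic (h : IsMetricOn G O) (hy : y ∈ O) (V X Y Z : E) :
    fderiv ℝ (defect G κ) y V X Y Z + fderiv ℝ (defect G κ) y X Y V Z
      + fderiv ℝ (defect G κ) y Y V X Z =
    -(christoffelCLM G y V (defect G κ y X Y Z) - defect G κ y X Y (christoffelCLM G y V Z))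
    - (christoffelCLM G y X (defect G κ y Y V Z) - defect G κ y Y V (christoffelCLM G y X Z))
    - (christoffelCLM G y Y (defect G κ y V X Z) - defect G κ y V X (christoffelCLM G y Y Z)) := by
  -- Symmetry of D²Γ kills the second order terms of the cyclic sum. The terms of the covariant
  -- derivative with Γ in the first two slots cancel by symmetry of Γ, and the constant curvature
  -- part contributes nothing because the metric is parallel.
  have hs : ∀ a b, fderiv ℝ (fderiv ℝ (christoffelCLM G)) y a b =
      fderiv ℝ (fderiv ℝ (christoffelCLM G)) y b a := fun a b =>
    ((h.contDiffAt_christoffelCLM hy).of_le two_le_infty).isSymmSndFDerivAt (by simp) a b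
  simp only [h.fderiv_defect_apply hy, defect_apply, h.fderiv_eq' hy, map_sub, map_add, map_smul,
    h.christoffelCLM_symm hy X V, h.christoffelCLM_symm hy Y V, h.christoffelCLM_symm hy Y X,
    hs X V, hs Y V, hs Y X]
  module

end IsMetricOn

namespace IsHessianOn

variable {φ : E → ℝ}

lemma contDiffAt_localGrad (h : IsHessianOn G φ κ O) (hy : y ∈ O) :
    ContDiffAt ℝ ∞ (localGrad G φ) y :=
  (h.contDiffOn_localGrad y hy).contDiffAt (h.metric.mem_nhds hy)

lemma hasFDerivAt_localGrad (h : IsHessianOn G φ κ O) (hy : y ∈ O) :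
    HasFDerivAt (localGrad G φ) (fderiv ℝ (localGrad G φ) y) y :=
  (h.differentiableAt_localGrad hy).hasFDerivAt

lemma fderiv_localGrad' (h : IsHessianOn G φ κ O) (hy : y ∈ O) (X : E) :
    fderiv ℝ (localGrad G φ) y X =
      -christoffelCLM G y X (localGrad G φ y) - (κ * φ y) • X := by
  rw [h.fderiv_localGrad hy, christoffelCLM_apply]

/-- The Ricci identity. Since ∇_X ξ = -κ f X, commuting derivatives gives R(X, Y)ξ = κ(df(Y) X -
df(X) Y), and df = g(ξ, ·) makes this the value prescribed by constant curvature κ. -/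
lemma defect_grad (h : IsHessianOn G φ κ O) (hy : y ∈ O) (X Y : E) :
    defect G κ y X Y (localGrad G φ y) = 0 := by
  have hm := h.metric
  have key : ∀ X Y, fderiv ℝ (fderiv ℝ (localGrad G φ)) y X Y =
      -fderiv ℝ (christoffelCLM G) y X Y (localGrad G φ y)
      - christoffelCLM G y Y (fderiv ℝ (localGrad G φ) y X) - (κ * fderiv ℝ φ y X) • Y := by
    intro X Y
    have hA := hm.hasFDerivAt_christoffelCLM hy
    have c : ∀ u : E, HasFDerivAt (fun _ : E => u) (0 : E →L[ℝ] E) y :=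
      fun u => hasFDerivAt_const u y
    have hD : HasFDerivAt (fderiv ℝ (localGrad G φ)) (fderiv ℝ (fderiv ℝ (localGrad G φ)) y) y :=
      (((h.contDiffAt_localGrad hy).fderiv_right (m := ∞) (by simp)).differentiableAt
        (by simp)).hasFDerivAt
    have hφ := ((h.contDiffAt hy).differentiableAt (by simp)).hasFDerivAt
    have h1 := hD.clm_apply (c Y)
    have h2 := (((hA.clm_apply (c Y)).clm_apply (h.hasFDerivAt_localGrad hy)).neg).sub
      ((hφ.const_mul κ).smul_const Y)
    have hev : (fun y => fderiv ℝ (localGrad G φ) y Y) =ᶠ[𝓝 y] fun y =>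
        -christoffelCLM G y Y (localGrad G φ y) - (κ * φ y) • Y := by
      filter_upwards [hm.mem_nhds hy] with z hz using h.fderiv_localGrad' hz Y
    have h3 := congrArg (fun l : E →L[ℝ] E => l X) (h1.unique (h2.congr_of_eventuallyEq hev))
    simp at h3
    rw [h3]
    module
  have hs := (((h.contDiffAt_localGrad hy).of_le two_le_infty).isSymmSndFDerivAt (by simp) X Y)
  rw [key, key, h.fderiv_localGrad' hy, h.fderiv_localGrad' hy] at hs
  rw [defect_apply, hm.symm y hy X, hm.symm y hy Y, h.apply_localGrad hy, h.apply_localGrad hy]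
  simp only [map_sub, map_neg, map_smul, hm.christoffelCLM_symm hy Y X] at hs
  have hs' := sub_eq_zero.2 hs
  rw [← neg_eq_zero, ← hs']
  module

/-- Pair symmetry and skew-adjointness: g(W(X, ξ)Y, Z) = g(W(Y, Z)X, ξ) = -g(X, W(Y, Z)ξ) = 0. -/
lemma defect_apply_grad (h : IsHessianOn G φ κ O) (hy : y ∈ O) (X Y : E) :
    defect G κ y X (localGrad G φ y) Y = 0 := by
  refine eq_of_apply_eq (h.metric.invertible y hy) fun Z => ?_
  rw [h.metric.apply_defect_pair hy, h.metric.apply_defect_skew hy, h.defect_grad hy]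
  simp

lemma defect_grad_apply (h : IsHessianOn G φ κ O) (hy : y ∈ O) (X Y : E) :
    defect G κ y (localGrad G φ y) X Y = 0 := by
  rw [defect_skew, h.defect_apply_grad hy, neg_zero]

/-- The derivative of the curvature defect in the direction of the gradient. -/
lemma fderiv_defect_grad (h : IsHessianOn G φ κ O) (hy : y ∈ O) (X Y Z : E) :
    fderiv ℝ (defect G κ) y (localGrad G φ y) X Y Z =
      -(christoffelCLM G y (localGrad G φ y) (defect G κ y X Y Z)
        - defect G κ y X Y (christoffelCLM G y (localGrad G φ y) Z))
      + defect G κ y (christoffelCLM G y (localGrad G φ y) X) Y Z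
      + defect G κ y X (christoffelCLM G y (localGrad G φ y) Y) Z
      + (2 * (κ * φ y)) • defect G κ y X Y Z := by
  have hm := h.metric
  have hb := hm.fderiv_defect_cyclic (κ := κ) hy (localGrad G φ y) X Y Z
  -- In the second Bianchi identity with one direction ξ, the other two terms are found by
  -- differentiating W(Y, ξ)Z = 0. Through ∇_X ξ = -κ f X each of them contributes κ f W, whence ∇_ξ
  -- W = 2κ f W.
  have key : ∀ X Y, fderiv ℝ (defect G κ) y X Y (localGrad G φ y) Z =
      -defect G κ y Y (fderiv ℝ (localGrad G φ) y X) Z := by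
    intro X Y
    have c : ∀ u : E, HasFDerivAt (fun _ : E => u) (0 : E →L[ℝ] E) y :=
      fun u => hasFDerivAt_const u y
    have h1 := (((hm.hasFDerivAt_defect (κ := κ) hy).clm_apply (c Y)).clm_apply
      (h.hasFDerivAt_localGrad hy)).clm_apply (c Z)
    have hev : (fun y => defect G κ y Y (localGrad G φ y) Z) =ᶠ[𝓝 y] fun _ => (0 : E) := by
      filter_upwards [hm.mem_nhds hy] with z hz using h.defect_apply_grad hz Y Z
    have h3 := congrArg (fun l : E →L[ℝ] E => l X)
      (h1.unique ((hasFDerivAt_const (0 : E) y).congr_of_eventuallyEq hev))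
    simp at h3
    rw [eq_neg_iff_add_eq_zero, ← h3]
    abel
  have hsk : fderiv ℝ (defect G κ) y Y (localGrad G φ y) X Z =
      -fderiv ℝ (defect G κ) y Y X (localGrad G φ y) Z := by
    rw [hm.fderiv_defect_apply hy, hm.fderiv_defect_apply hy]
    module
  rw [hsk, key, key, h.fderiv_localGrad' hy, h.fderiv_localGrad' hy] at hb
  simp only [map_sub, map_neg, map_smul, sub_apply, neg_apply, smul_apply, h.defect_apply_grad hy,
    h.defect_grad_apply hy, map_zero, hm.christoffelCLM_symm hy X (localGrad G φ y),
    hm.christoffelCLM_symm hy Y (localGrad G φ y)] at hb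
  rw [defect_skew G κ y Y X, defect_skew G κ y Y (christoffelCLM G y (localGrad G φ y) X)] at hb
  have hb' := sub_eq_zero.2 hb
  rw [← sub_eq_zero, ← hb']
  module

end IsHessianOn

end LocalCurvature

/-! ### Constant curvature -/

section Transform

variable {E : Type*} [NormedAddCommGroup E] [NormedSpace ℝ E] [FiniteDimensional ℝ E]
  {G G' : E → E →L[ℝ] E →L[ℝ] ℝ} {O O' : Set E} {y : E} {κ : ℝ} {F : E → E}

lemma christoffelCLM_transform (hm : IsMetricOn G O) (hm' : IsMetricOn G' O') (hy : y ∈ O')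
    (hF : ContDiffAt ℝ 2 F y) (hFy : F y ∈ O) (hFi : (fderiv ℝ F y).IsInvertible)
    (hev : G' =ᶠ[𝓝 y] pull F G) (v w : E) :
    fderiv ℝ F y (christoffelCLM G' y v w) =
      christoffelCLM G (F y) (fderiv ℝ F y v) (fderiv ℝ F y w) + fderiv ℝ (fderiv ℝ F) y v w := by
  rw [christoffelCLM_apply, christoffelCLM_apply, christoffel_congr hev]
  exact fderiv_christoffel_pull hF ((hm.contDiffAt hFy).of_le (by simp)) (hm.symm _ hFy)
    (hm.invertible _ hFy) hFi (hev.self_of_nhds ▸ hm'.invertible y hy) v w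

/-- The curvature is a tensor. -/
lemma fderiv_defect_transform (hm : IsMetricOn G O) (hm' : IsMetricOn G' O') (hy : y ∈ O')
    (hF : ContDiffAt ℝ ∞ F y) (hFy : F y ∈ O) (hFi : (fderiv ℝ F y).IsInvertible)
    (hev : G' =ᶠ[𝓝 y] pull F G) (X Y Z : E) :
    fderiv ℝ F y (defect G' κ y X Y Z) =
      defect G κ (F y) (fderiv ℝ F y X) (fderiv ℝ F y Y) (fderiv ℝ F y Z) := by
  have hF' : ContDiffAt ℝ ∞ (fderiv ℝ F) y := hF.fderiv_right (by simp)
  have hF'' : ContDiffAt ℝ ∞ (fderiv ℝ (fderiv ℝ F)) y := hF'.fderiv_right (by simp)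
  have hnear : ∀ᶠ z in 𝓝 y, ∀ v w, fderiv ℝ F z (christoffelCLM G' z v w) =
      christoffelCLM G (F z) (fderiv ℝ F z v) (fderiv ℝ F z w) + fderiv ℝ (fderiv ℝ F) z v w := by
    have hinv : ∀ᶠ z in 𝓝 y, (fderiv ℝ F z).IsInvertible := by
      obtain ⟨e, he⟩ := hFi
      have : Set.range ((↑) : (E ≃L[ℝ] E) → E →L[ℝ] E) ∈ 𝓝 (fderiv ℝ F y) := by
        rw [← he]; exact ContinuousLinearEquiv.nhds e
      exact hF'.continuousAt.preimage_mem_nhds this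
    filter_upwards [hm'.mem_nhds hy, hF.continuousAt.preimage_mem_nhds (hm.mem_nhds hFy),
      hinv, (hF.of_le two_le_infty).eventually (by simp), hev.eventuallyEq_nhds]
      with z h1 h2 h3 h4 h5 v w
    exact christoffelCLM_transform hm hm' h1 h4 h2 h3 h5 v w
  have key := hnear.self_of_nhds
  have c : ∀ u : E, HasFDerivAt (fun _ : E => u) (0 : E →L[ℝ] E) y := fun u => hasFDerivAt_const u y
  have dF := (hF.differentiableAt (by simp)).hasFDerivAt
  have dF' := (hF'.differentiableAt (by simp)).hasFDerivAt
  have dF'' := (hF''.differentiableAt (by simp)).hasFDerivAt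
  have dA' := hm'.hasFDerivAt_christoffelCLM hy
  have dA : HasFDerivAt (fun z => christoffelCLM G (F z)) _ y :=
    (hm.hasFDerivAt_christoffelCLM hFy).comp y dF
  -- Differentiates the transformation law of Γ, valid on a neighbourhood. In the curvature, the
  -- third derivatives of F and the remaining second derivative terms cancel by symmetry.
  have hD : ∀ u v w, fderiv ℝ F y (fderiv ℝ (christoffelCLM G') y u v w) =
      fderiv ℝ (christoffelCLM G) (F y) (fderiv ℝ F y u) (fderiv ℝ F y v) (fderiv ℝ F y w)
      + christoffelCLM G (F y) (fderiv ℝ (fderiv ℝ F) y u v) (fderiv ℝ F y w)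
      + christoffelCLM G (F y) (fderiv ℝ F y v) (fderiv ℝ (fderiv ℝ F) y u w)
      + fderiv ℝ (fderiv ℝ (fderiv ℝ F)) y u v w
      - fderiv ℝ (fderiv ℝ F) y u (christoffelCLM G' y v w) := by
    intro u v w
    have h1 := dF'.clm_apply ((dA'.clm_apply (c v)).clm_apply (c w))
    have h2 := ((dA.clm_apply (dF'.clm_apply (c v))).clm_apply (dF'.clm_apply (c w))).add
      ((dF''.clm_apply (c v)).clm_apply (c w))
    have h3 := congrArg (fun l : E →L[ℝ] E => l u)
      (h1.unique (h2.congr_of_eventuallyEq (hnear.mono fun z hz => hz v w)))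
    simp at h3
    rw [eq_sub_iff_add_eq, h3]
    abel
  have hs : ∀ a b, fderiv ℝ (fderiv ℝ F) y a b = fderiv ℝ (fderiv ℝ F) y b a := fun a b =>
    (hF.of_le two_le_infty).isSymmSndFDerivAt (by simp) a b
  have hs' : ∀ a b, fderiv ℝ (fderiv ℝ (fderiv ℝ F)) y a b = fderiv ℝ (fderiv ℝ (fderiv ℝ F)) y b a :=
    fun a b => (hF'.of_le two_le_infty).isSymmSndFDerivAt (by simp) a b
  have hG : ∀ a b, G' y a b = G (F y) (fderiv ℝ F y a) (fderiv ℝ F y b) := fun a b => by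
    rw [hev.self_of_nhds, pull_apply]
  simp only [defect_apply, map_sub, map_add, map_smul, hD, key, hG, hs Y X, hs' Y X]
  module

end Transform

/-! ### The equation y'' = -k y. -/

section Oscillator

/-- Uniqueness for the linear equation `y'' = -k y`. -/
lemma oscillator_unique {k : ℝ} {y y' z z' : ℝ → ℝ} (hy : ∀ t, HasDerivAt y (y' t) t)
    (hy' : ∀ t, HasDerivAt y' (-(k * y t)) t) (hz : ∀ t, HasDerivAt z (z' t) t)
    (hz' : ∀ t, HasDerivAt z' (-(k * z t)) t) {t₀ : ℝ} (h : y t₀ = z t₀) (h' : y' t₀ = z' t₀)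
    (t : ℝ) : y t = z t ∧ y' t = z' t := by
  have := eq_zero_of_norm_deriv_le (w := fun t => ((y t - z t, y' t - z' t) : ℝ × ℝ))
    (w' := fun t => (y' t - z' t, -(k * y t) - -(k * z t))) (K := fun _ => 1 + |k|)
    (s := Set.univ) Set.ordConnected_univ
    (fun t _ => ((hy t).sub (hz t)).prodMk ((hy' t).sub (hz' t))) continuousOn_const
    (fun t _ => ?_) (Set.mem_univ t₀) (by simp [h, h']) t (Set.mem_univ t)
  · simpa [sub_eq_zero] using this
  · have e : -(k * y t) - -(k * z t) = -(k * (y t - z t)) := by ring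
    rw [e, Prod.norm_def, Prod.norm_def]
    simp only [Real.norm_eq_abs, abs_neg, abs_mul]
    have h1 := le_max_left |y t - z t| |y' t - z' t|
    have h2 := le_max_right |y t - z t| |y' t - z' t|
    have h3 := abs_nonneg k
    have h4 := abs_nonneg (y t - z t)
    refine max_le ?_ ?_ <;> nlinarith

/-- Trigonometric solutions of `y'' = -w² y`. -/
lemma oscillator_trig {w : ℝ} (hw : w ≠ 0) {y y' : ℝ → ℝ} (hy : ∀ t, HasDerivAt y (y' t) t)
    (hy' : ∀ t, HasDerivAt y' (-(w ^ 2 * y t)) t) (t : ℝ) :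
    y t = y 0 * Real.cos (w * t) + y' 0 / w * Real.sin (w * t) ∧
      y' t = -(w * y 0) * Real.sin (w * t) + y' 0 * Real.cos (w * t) := by
  have hl : ∀ t, HasDerivAt (fun t : ℝ => w * t) w t := fun t => by
    simpa using (hasDerivAt_id t).const_mul w
  refine oscillator_unique (z := fun t => y 0 * Real.cos (w * t) + y' 0 / w * Real.sin (w * t))
    (z' := fun t => -(w * y 0) * Real.sin (w * t) + y' 0 * Real.cos (w * t))
    hy hy' (fun t => ?_) (fun t => ?_) (t₀ := 0) (by simp) (by simp) t
  · refine ((((hl t).cos).const_mul (y 0)).add (((hl t).sin).const_mul (y' 0 / w))).congr_deriv ?_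
    field_simp
  · refine ((((hl t).sin).const_mul (-(w * y 0))).add (((hl t).cos).const_mul (y' 0))).congr_deriv ?_
    field_simp
    ring

/-- Hyperbolic solutions of `y'' = w² y`. -/
lemma oscillator_hyperbolic {w : ℝ} (hw : w ≠ 0) {y y' : ℝ → ℝ} (hy : ∀ t, HasDerivAt y (y' t) t)
    (hy' : ∀ t, HasDerivAt y' (w ^ 2 * y t) t) (t : ℝ) :
    y t = y 0 * Real.cosh (w * t) + y' 0 / w * Real.sinh (w * t) ∧
      y' t = w * y 0 * Real.sinh (w * t) + y' 0 * Real.cosh (w * t) := by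
  have hl : ∀ t, HasDerivAt (fun t : ℝ => w * t) w t := fun t => by
    simpa using (hasDerivAt_id t).const_mul w
  refine oscillator_unique (k := -w ^ 2)
    (z := fun t => y 0 * Real.cosh (w * t) + y' 0 / w * Real.sinh (w * t))
    (z' := fun t => w * y 0 * Real.sinh (w * t) + y' 0 * Real.cosh (w * t)) hy (fun t => by simpa using hy' t) (fun t => ?_)
    (fun t => ?_) (t₀ := 0) (by simp) (by simp) t
  · refine ((((hl t).cosh).const_mul (y 0)).add (((hl t).sinh).const_mul (y' 0 / w))).congr_deriv ?_
    field_simp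
  · refine ((((hl t).sinh).const_mul (w * y 0)).add (((hl t).cosh).const_mul (y' 0))).congr_deriv ?_
    field_simp

end Oscillator

/-! ### Vanishing of the curvature defect on a complete manifold. -/

section ConstantCurvature

variable {E : Type*} [NormedAddCommGroup E] [NormedSpace ℝ E] [FiniteDimensional ℝ E]
  {H : Type*} [TopologicalSpace H] {I : ModelWithCorners ℝ E H} [I.Boundaryless]
  {M : Type*} [TopologicalSpace M] [ChartedSpace H M] [IsManifold I ∞ M]
  {g : BilinField I M} {f : M → ℝ} {ξ : M → E} {κ : ℝ}

/-- Tensoriality of the defect. It connects the pointwise statements, which use the preferred chart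
at each point, with arguments along a curve inside a single chart. -/
lemma defect_chart_eq_zero_iff (hg : IsSemiRiemannian I g) {x₀ x : M}
    (hx : x ∈ (extChartAt I x₀).source) :
    defect (chartMetric I g x₀) κ (extChartAt I x₀ x) = 0 ↔
      defect (chartMetric I g x) κ (extChartAt I x x) = 0 := by
  have ht := (extChartAt I x₀).map_source hx
  have hl : (extChartAt I x₀).symm (extChartAt I x₀ x) = x := (extChartAt I x₀).left_inv hx
  have hxx : (extChartAt I x₀).symm (extChartAt I x₀ x) ∈ (extChartAt I x).source := by
    rw [hl]; exact mem_extChartAt_source x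
  set y := extChartAt I x₀ x with hy
  set F : E → E := fun z => extChartAt I x ((extChartAt I x₀).symm z) with hF
  have hFs : ContDiffAt ℝ ∞ F y := contDiffAt_transition ht hxx
  have hFi : (fderiv ℝ F y).IsInvertible := isInvertible_fderiv_transition ht hxx
  have hFy : F y = extChartAt I x x := by simp only [hF, hl]
  have hev : chartMetric I g x₀ =ᶠ[𝓝 y] pull F (chartMetric I g x) := by
    filter_upwards [(isOpen_target x₀).mem_nhds ht, (contMDiffAt_chart_symm
      ht).continuousAt.preimage_mem_nhds ((isOpen_extChartAt_source x).mem_nhds hxx)] with z h1 h2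
    exact chartMetric_eq_pull g h1 h2
  have key : ∀ X Y Z, fderiv ℝ F y (defect (chartMetric I g x₀) κ y X Y Z) =
      defect (chartMetric I g x) κ (extChartAt I x x) (fderiv ℝ F y X) (fderiv ℝ F y Y)
        (fderiv ℝ F y Z) := by
    intro X Y Z
    rw [← hFy]
    exact fderiv_defect_transform (hg.isMetricOn x) (hg.isMetricOn x₀) ht hFs
      (by rw [hFy]; exact mem_extChartAt_target x) hFi hev X Y Z
  obtain ⟨e, he⟩ := hFi
  have hee : ∀ u, fderiv ℝ F y u = e u := fun u => by rw [← he]; rfl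
  simp only [hee] at key
  constructor
  · intro h0
    ext X Y Z
    have := key (e.symm X) (e.symm Y) (e.symm Z)
    simpa [h0] using this.symm
  · intro h0
    ext X Y Z
    have := key X Y Z
    rw [h0] at this
    simpa using this

namespace HessianData

/-- Away from `f² = 1` the vanishing of the curvature defect propagates along the gradient lines. -/
lemma defect_eq_zero_propagate (h : HessianData I g f ξ κ) (hκ : κ ≠ 0)
    (hn : ∀ x, form I g x (ξ x) (ξ x) = κ * (1 - f x ^ 2)) {γ : ℝ → M}
    (hγ : IsGeodesicOn I g γ Set.univ) {b : ℝ → ℝ}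
    (hb : ∀ t, HasDerivAt b (-(κ * f (γ t))) t) (hξ : ∀ t, ξ (γ t) = b t • vel I γ t) {t₀ t : ℝ}
    (h0 : f (γ t₀) ^ 2 = 1) :
    f (γ t) ^ 2 = 1 ∨ defect (chartMetric I g (γ t)) κ (extChartAt I (γ t) (γ t)) = 0 := by
  refine IsPreconnected.of_locally_imp (s := Set.univ) isPreconnected_univ
    (fun t => f (γ t) ^ 2 = 1 ∨ defect (chartMetric I g (γ t)) κ (extChartAt I (γ t) (γ t)) = 0)
    (fun τ hτ => ?_) (Set.mem_univ t₀) (Set.mem_univ t) (Or.inl h0)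
  have hs : IsOpen (Set.univ : Set ℝ) := isOpen_univ
  set x₀ := γ τ with hx₀
  have hx : γ τ ∈ (extChartAt I x₀).source := mem_extChartAt_source _
  set c : ℝ → E := fun τ => extChartAt I x₀ (γ τ) with hc
  have hloc := h.isHessianOn x₀
  have hm := hloc.metric
  set G := chartMetric I g x₀ with hG
  set φ := inChart I f x₀
  obtain ⟨δ, hδ, hball⟩ := Metric.mem_nhds_iff.1
    ((hγ.contMDiffAt hs hτ).continuousAt.preimage_mem_nhds
      ((isOpen_extChartAt_source x₀).mem_nhds hx))
  refine ⟨Metric.ball τ δ, Metric.ball_mem_nhds τ hδ, fun a ha a' ha' hPa => ?_⟩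
  have hφ : ∀ t ∈ Metric.ball τ δ, φ (c t) = f (γ t) := by
    intro t ht
    simp only [φ, inChart, hc]
    rw [(extChartAt I x₀).left_inv (hball ht)]
  have hcd : ∀ t ∈ Metric.ball τ δ, ContDiffAt ℝ ∞ c t := fun t ht =>
    contDiffAt_chart_comp (hγ.contMDiffAt hs (Set.mem_univ t)) le_rfl (hball ht)
  have htar : ∀ t ∈ Metric.ball τ δ, c t ∈ (extChartAt I x₀).target := fun t ht =>
    (extChartAt I x₀).map_source (hball ht)
  have hgr : ∀ t ∈ Metric.ball τ δ, localGrad G φ (c t) = b t • deriv c t := by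
    intro t ht
    rw [← h.grad_in_chart (hball ht), hξ, map_smul,
      ← (hasDerivAt_chart_comp (hγ.mdifferentiableAt hs (Set.mem_univ t)) (hball ht)).deriv]
  have hnorm : ∀ t ∈ Metric.ball τ δ, fderiv ℝ φ (c t) (localGrad G φ (c t)) =
      κ * (1 - φ (c t) ^ 2) := by
    intro t ht
    rw [← hloc.apply_localGrad (htar t ht), ← h.grad_in_chart (hball ht), hφ t ht, ← hn,
      form_eq_chartMetric g (hball ht)]
  -- This tensor is parallel along γ: the derivative of 1 - f² along ξ is -2κ f (1 - f²), which
  -- cancels ∇_ξ W = 2κ f W. It vanishes exactly where the propagated alternative holds.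
  set w : ℝ → E →L[ℝ] E →L[ℝ] E →L[ℝ] E := fun t => (1 - φ (c t) ^ 2) • defect G κ (c t) with hw
  have hwd : ∀ t ∈ Metric.ball τ δ, ContDiffAt ℝ ∞ w t := fun t ht =>
    ((contDiffAt_const.sub (((hloc.contDiffAt (htar t ht)).comp t (hcd t ht)).pow 2)).smul
      ((hm.contDiffAt_defect (htar t ht)).comp t (hcd t ht)))
  -- The constant 4 counts the Christoffel terms in the covariant derivative of a tensor with three
  -- arguments and vector values.
  have hKc : ∀ t ∈ Metric.ball τ δ,
      ContinuousAt (fun t => 4 * ‖christoffelCLM G (c t) (deriv c t)‖) t := by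
    intro t ht
    have h1 : ContinuousAt (fun t => christoffelCLM G (c t)) t :=
      (hm.contDiffAt_christoffelCLM (htar t ht)).continuousAt.comp (hcd t ht).continuousAt
    have h2 : ContinuousAt (deriv c) t := ((hcd t ht).derivWithin (m := ∞) (by simp)).continuousAt
    exact (h1.clm_apply h2).norm.const_mul 4
  have hle₁ : ∀ t ∈ Metric.ball τ δ, b t ≠ 0 →
      ‖deriv w t‖ ≤ 4 * ‖christoffelCLM G (c t) (deriv c t)‖ * ‖w t‖ := by
    intro t ht hbt
    have hdc := ((hcd t ht).differentiableAt (by simp)).hasDerivAt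
    have hdφ : HasDerivAt (fun t => φ (c t)) (fderiv ℝ φ (c t) (deriv c t)) t :=
      ((hloc.contDiffAt (htar t ht)).differentiableAt (by simp)).hasFDerivAt.comp_hasDerivAt t hdc
    have hdW : HasDerivAt (fun t => defect G κ (c t)) (fderiv ℝ (defect G κ) (c t) (deriv c t)) t :=
      (hm.hasFDerivAt_defect (htar t ht)).comp_hasDerivAt t hdc
    have hdw := (((hdφ.pow 2).const_sub 1).smul hdW).deriv
    have hc' : deriv c t = (b t)⁻¹ • localGrad G φ (c t) := by
      rw [hgr t ht, smul_smul, inv_mul_cancel₀ hbt, one_smul]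
    have hval : ∀ X Y Z, deriv w t X Y Z =
        -(christoffelCLM G (c t) (deriv c t) (w t X Y Z)
          - w t X Y (christoffelCLM G (c t) (deriv c t) Z))
        + w t (christoffelCLM G (c t) (deriv c t) X) Y Z
        + w t X (christoffelCLM G (c t) (deriv c t) Y) Z := by
      intro X Y Z
      have e1 := congrArg (fun l : E →L[ℝ] E →L[ℝ] E →L[ℝ] E => l X Y Z) hdw
      refine e1.trans ?_
      simp only [hw, hc', map_smul, hnorm t ht, add_apply, smul_apply,
        hloc.fderiv_defect_grad (htar t ht)]
      match_scalars <;> simp <;> ring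
    refine ContinuousLinearMap.opNorm_le_bound _ (by positivity) fun X => ?_
    refine ContinuousLinearMap.opNorm_le_bound _ (by positivity) fun Y => ?_
    refine ContinuousLinearMap.opNorm_le_bound _ (by positivity) fun Z => ?_
    rw [hval]
    set B := christoffelCLM G (c t) (deriv c t) with hB
    have n3 : ∀ X Y Z, ‖w t X Y Z‖ ≤ ‖w t‖ * ‖X‖ * ‖Y‖ * ‖Z‖ := fun X Y Z =>
      ((w t X Y).le_opNorm Z).trans (mul_le_mul_of_nonneg_right ((w t).le_opNorm₂ X Y)
        (norm_nonneg _))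
    have b1 : ‖B (w t X Y Z)‖ ≤ ‖B‖ * (‖w t‖ * ‖X‖ * ‖Y‖ * ‖Z‖) :=
      (B.le_opNorm _).trans (mul_le_mul_of_nonneg_left (n3 _ _ _) (norm_nonneg _))
    have b2 : ‖w t X Y (B Z)‖ ≤ ‖w t‖ * ‖X‖ * ‖Y‖ * (‖B‖ * ‖Z‖) :=
      (n3 _ _ _).trans (mul_le_mul_of_nonneg_left (B.le_opNorm _) (by positivity))
    have b3 : ‖w t (B X) Y Z‖ ≤ ‖w t‖ * (‖B‖ * ‖X‖) * ‖Y‖ * ‖Z‖ := by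
      refine (n3 _ _ _).trans ?_
      gcongr
      exact B.le_opNorm _
    have b4 : ‖w t X (B Y) Z‖ ≤ ‖w t‖ * ‖X‖ * (‖B‖ * ‖Y‖) * ‖Z‖ := by
      refine (n3 _ _ _).trans ?_
      gcongr
      exact B.le_opNorm _
    have b5 := norm_add_le (-(B (w t X Y Z) - w t X Y (B Z)) + w t (B X) Y Z) (w t X (B Y) Z)
    have b6 := norm_add_le (-(B (w t X Y Z) - w t X Y (B Z))) (w t (B X) Y Z)
    have b7 := norm_sub_le (B (w t X Y Z)) (w t X Y (B Z))
    rw [norm_neg] at b6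
    linarith
  have hle : ∀ t ∈ Metric.ball τ δ,
      ‖deriv w t‖ ≤ 4 * ‖christoffelCLM G (c t) (deriv c t)‖ * ‖w t‖ := by
    intro t ht
    -- Dividing by b to pass from ξ to γ' fails at zeros of b. These are isolated: there ξ = 0,
    -- hence f² = 1 and b' = -κ f ≠ 0. The bound then follows by taking limits.
    by_cases hbt : b t = 0
    · have hf : f (γ t) ≠ 0 := by
        intro hf
        have h1 := hn (γ t)
        rw [hξ t, hbt, zero_smul, hf] at h1
        simp at h1
        exact hκ h1.symm
      have hne := (hb t).eventually_ne (c := 0) (neg_ne_zero.2 (mul_ne_zero hκ hf))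
      have hcont : ContinuousAt (fun t => 4 * ‖christoffelCLM G (c t) (deriv c t)‖ * ‖w t‖) t :=
        (hKc t ht).mul (hwd t ht).continuousAt.norm
      have hcd' : ContinuousAt (deriv w) t :=
        ((hwd t ht).derivWithin (m := ∞) (by simp)).continuousAt
      refine le_of_tendsto_of_tendsto (hcd'.norm.mono_left nhdsWithin_le_nhds)
        (hcont.mono_left (nhdsWithin_le_nhds (s := {t}ᶜ))) ?_
      filter_upwards [hne, nhdsWithin_le_nhds (Metric.isOpen_ball.mem_nhds ht)] with t' h1 h2
      exact hle₁ t' h2 h1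
    · exact hle₁ t ht hbt
  have hconn : (Metric.ball τ δ).OrdConnected := by
    rw [Real.ball_eq_Ioo]
    exact Set.ordConnected_Ioo
  have hw0 : ∀ t ∈ Metric.ball τ δ, w t = 0 ↔
      (f (γ t) ^ 2 = 1 ∨ defect (chartMetric I g (γ t)) κ (extChartAt I (γ t) (γ t)) = 0) := by
    intro t ht
    rw [← defect_chart_eq_zero_iff h.metric (hball ht), hw]
    simp only [smul_eq_zero, hφ t ht]
    rw [sub_eq_zero, eq_comm]
  have hfin := eq_zero_of_norm_deriv_le hconn
    (fun t ht => ((hwd t ht).differentiableAt (by simp)).hasDerivAt)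
    (fun t ht => (hKc t ht).continuousWithinAt) hle ha.1 ((hw0 a ha.1).2 hPa) a' ha'.1
  exact (hw0 a' ha'.1).1 hfin

end HessianData

lemma IsGeodesicallyComplete.exists_geodesic (hc : IsGeodesicallyComplete I g) (x : M) (v : E) :
    ∃ γ : ℝ → M, IsGeodesicOn I g γ Set.univ ∧ γ 0 = x ∧ vel I γ 0 = v := by
  obtain ⟨γ, hγ, hv⟩ := hc ⟨x, v⟩
  refine ⟨γ, hγ, ?_⟩
  have key : ∀ u : E, vel I γ 0 = u → (⟨γ 0, u⟩ : TangentBundle I M) = ⟨x, v⟩ := by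
    rintro u rfl
    exact hv
  obtain ⟨h2, h3⟩ := Bundle.TotalSpace.mk.inj (key _ rfl)
  subst h2
  exact ⟨rfl, eq_of_heq h3⟩

namespace HessianData

/-- The place where completeness enters the first case. The geodesic with initial velocity ξ(q),
which is not null, follows the gradient, and f' along it solves an explicit linear equation. It has
a zero at some finite time; there ξ = 0 and f² = 1, and the propagation lemma carries the vanishing
back to q. -/
lemma defect_eq_zero_of_ne (h : HessianData I g f ξ κ) (hκ : κ * κ = 1)
    (hn : ∀ x, form I g x (ξ x) (ξ x) = κ * (1 - f x ^ 2)) (hc : IsGeodesicallyComplete I g)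
    {q : M} (hq : f q ^ 2 ≠ 1) : defect (chartMetric I g q) κ (extChartAt I q q) = 0 := by
  obtain ⟨γ, hγ, rfl, hv⟩ := hc.exists_geodesic q (ξ q)
  have hκ0 : κ ≠ 0 := left_ne_zero_of_mul_eq_one hκ
  have hu : IsOpen (Set.univ : Set ℝ) := isOpen_univ
  set k := 1 - f (γ 0) ^ 2 with hk
  have hk0 : k ≠ 0 := fun h0 => hq (by linarith)
  have hen : ∀ t, energy I g γ t = κ * k := by
    intro t
    rw [hγ.energy_eq h.metric hu Set.ordConnected_univ (Set.mem_univ t) (Set.mem_univ 0), energy,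
      hv, hn]
  set y' : ℝ → ℝ := fun t => md I 𝓘(ℝ, ℝ) f (γ t) (vel I γ t) with hy'
  have hd : ∀ t, HasDerivAt (fun t => f (γ t)) (y' t) t := fun t =>
    hγ.hasDerivAt_comp h.contMDiff hu (Set.mem_univ t)
  have hd' : ∀ t, HasDerivAt y' (-(k * f (γ t))) t := by
    intro t
    refine (hγ.hasDerivAt_deriv_comp h.metric h.contMDiff h.hess hu (Set.mem_univ t)).congr_deriv ?_
    rw [hen t]
    linear_combination (-(k * f (γ t))) * hκ
  have hy0 : y' 0 = κ * k := by
    simp only [hy', hv]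
    rw [← h.grad, hn]
  -- Pairing ξ = b γ' with γ' gives f' = b κ k, as κ k is the constant energy; this forces the
  -- choice of b.
  have hb : ∀ t, HasDerivAt (fun t => y' t / (κ * k)) (-(κ * f (γ t))) t := by
    intro t
    refine ((hd' t).div_const (κ * k)).congr_deriv ?_
    field_simp
    linear_combination f (γ t) * hκ
  have hξ : ∀ t, ξ (γ t) = (y' t / (κ * k)) • vel I γ t := fun t =>
    h.grad_eq_smul_vel hγ hu Set.ordConnected_univ (fun t _ => hb t) (Set.mem_univ 0)
      (by rw [hy0, hv, div_self (mul_ne_zero hκ0 hk0), one_smul]) (Set.mem_univ t)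
  have hzero : ∃ t₀, y' t₀ = 0 := by
    rcases lt_or_gt_of_ne hk0 with hneg | hpos
    · obtain ⟨w, hw, hwk⟩ : ∃ w : ℝ, 0 < w ∧ w ^ 2 = -k :=
        ⟨√(-k), Real.sqrt_pos.2 (by linarith), Real.sq_sqrt (by linarith)⟩
      have hf0 : f (γ 0) ≠ 0 := by
        intro h0
        rw [h0] at hk
        linarith
      obtain ⟨s, hs, hsf⟩ : ∃ s : ℝ, s ^ 2 = 1 ∧ |f (γ 0)| = s * f (γ 0) := by
        rcases lt_or_gt_of_ne hf0 with h1 | h1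
        · exact ⟨-1, by norm_num, by rw [abs_of_neg h1]; ring⟩
        · exact ⟨1, by norm_num, by rw [abs_of_pos h1]; ring⟩
      have hsol := fun t => (oscillator_hyperbolic hw.ne' hd
        (fun t => (hd' t).congr_deriv (by rw [hwk]; ring)) t).2
      -- The zero of w f(γ 0) sinh(w t) + κ k cosh(w t): with sinh(w t) = κ w s one has cosh(w t) =
      -- √(1 + w²) = |f(γ 0)| = s f(γ 0), and k = -w².
      refine ⟨Real.arsinh (κ * w * s) / w, ?_⟩
      rw [hsol, mul_div_cancel₀ _ hw.ne', Real.sinh_arsinh, Real.cosh_arsinh]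
      have e1 : 1 + (κ * w * s) ^ 2 = f (γ 0) ^ 2 := by
        have : (κ * w * s) ^ 2 = (κ * κ) * w ^ 2 * s ^ 2 := by ring
        rw [this, hκ, hs, hwk, hk]
        ring
      rw [e1, Real.sqrt_sq_eq_abs, hsf, hy0]
      have : k = -w ^ 2 := by linarith
      rw [this]
      ring
    · obtain ⟨w, hw, hwk⟩ : ∃ w : ℝ, 0 < w ∧ w ^ 2 = k :=
        ⟨√k, Real.sqrt_pos.2 hpos, Real.sq_sqrt hpos.le⟩
      -- After half a period f' has changed its sign, so it vanishes in between.
      have hsol := (oscillator_trig hw.ne' hd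
        (fun t => (hd' t).congr_deriv (by rw [hwk])) (Real.pi / w)).2
      rw [mul_div_cancel₀ _ hw.ne', Real.sin_pi, Real.cos_pi] at hsol
      have hcont : Continuous y' := continuous_iff_continuousAt.2 fun t => (hd' t).continuousAt
      have h0 : (0 : ℝ) ∈ Set.uIcc (y' 0) (y' (Real.pi / w)) := by
        rw [hsol, Set.mem_uIcc]
        rcases le_total (y' 0) 0 with h1 | h1
        · left; constructor <;> linarith
        · right; constructor <;> linarith
      obtain ⟨t, -, ht⟩ := intermediate_value_uIcc hcont.continuousOn h0
      exact ⟨t, ht⟩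
  obtain ⟨t₀, ht₀⟩ := hzero
  have h1 : f (γ t₀) ^ 2 = 1 := by
    have := hn (γ t₀)
    rw [hξ, ht₀, zero_div, zero_smul, map_zero] at this
    have h2 : κ * (1 - f (γ t₀) ^ 2) = 0 := by simpa using this.symm
    rcases mul_eq_zero.1 h2 with h3 | h3
    · exact absurd h3 hκ0
    · linarith
  exact (h.defect_eq_zero_propagate hκ0 hn hγ hb hξ h1 (t := 0)).resolve_left hq

/-- Completeness and a parallel field of this causal type force constant curvature. -/
theorem defect_eq_zero (h : HessianData I g f ξ κ) (hκ : κ * κ = 1)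
    (hn : ∀ x, form I g x (ξ x) (ξ x) = κ * (1 - f x ^ 2)) (hc : IsGeodesicallyComplete I g)
    (q : M) : defect (chartMetric I g q) κ (extChartAt I q q) = 0 := by
  by_contra hne
  have hloc := h.isHessianOn q
  have hm := hloc.metric
  have ht := mem_extChartAt_target (I := I) q
  -- A nonzero defect persists near q, so f² = 1 there by the previous lemma. Then f is locally
  -- constant, its Hessian vanishes, and -κ f g = 0 with f ≠ 0 leaves only the zero tangent space,
  -- on which every defect is zero.
  have hev : ∀ᶠ y in 𝓝 (extChartAt I q q), inChart I f q y ^ 2 = 1 := by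
    have hcont := (hm.contDiffAt_defect (κ := κ) ht).continuousAt
    filter_upwards [hcont.eventually_ne hne, (isOpen_target q).mem_nhds ht] with y h1 h2
    by_contra h3
    refine h1 ?_
    have h4 := (defect_chart_eq_zero_iff h.metric ((extChartAt I q).map_target h2)).2
      (h.defect_eq_zero_of_ne hκ hn hc h3)
    rwa [(extChartAt I q).right_inv h2] at h4
  have hD : ∀ᶠ y in 𝓝 (extChartAt I q q), fderiv ℝ (inChart I f q) y = 0 := by
    filter_upwards [hev.eventually_nhds, (isOpen_target q).mem_nhds ht] with y h1 h2
    have hd := ((hloc.contDiffAt h2).differentiableAt (by simp)).hasFDerivAt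
    have e := (hd.pow 2).unique ((hasFDerivAt_const (1 : ℝ) y).congr_of_eventuallyEq h1)
    have h0 : inChart I f q y ≠ 0 := by
      intro h0
      have := h1.self_of_nhds
      rw [h0] at this
      norm_num at this
    ext v
    have e2 := congrArg (fun l : E →L[ℝ] ℝ => l v) e
    simpa [h0] using e2
  have hess := hloc.eq _ ht
  have hD' : fderiv ℝ (fderiv ℝ (inChart I f q)) (extChartAt I q q) = 0 := by
    have : fderiv ℝ (inChart I f q) =ᶠ[𝓝 (extChartAt I q q)] fun _ => 0 := hD
    rw [this.fderiv_eq]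
    simp
  have h0 : inChart I f q (extChartAt I q q) ≠ 0 := by
    intro h0
    have := hev.self_of_nhds
    rw [h0] at this
    norm_num at this
  have hsub : ∀ v : E, v = 0 := by
    intro v
    refine eq_of_apply_eq (hm.invertible _ ht) fun z => ?_
    have := hess v z
    rw [hD', hD.self_of_nhds] at this
    have hκ0 : κ ≠ 0 := left_ne_zero_of_mul_eq_one hκ
    rw [zero_apply, zero_apply, zero_apply, zero_sub, eq_comm, neg_eq_zero] at this
    rw [map_zero, zero_apply]
    exact (mul_eq_zero.1 this).resolve_left (mul_ne_zero hκ0 h0)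
  apply hne
  ext X Y Z
  rw [hsub X]
  simp

end HessianData
end ConstantCurvature

/-! ### Curvature of the cone metric. -/

section ConeCurvature

variable {E : Type*} [NormedAddCommGroup E] [NormedSpace ℝ E]

lemma localCurvature_congr {G G' : E → E →L[ℝ] E →L[ℝ] ℝ} {y : E} (h : G =ᶠ[𝓝 y] G') (X Y Z : E) :
    localCurvature G y X Y Z = localCurvature G' y X Y Z := by
  have hc : ∀ Y Z, (fun y' => christoffel G y' Y Z) =ᶠ[𝓝 y] fun y' => christoffel G' y' Y Z :=
    fun Y Z => h.eventuallyEq_nhds.mono fun z hz => christoffel_congr hz Y Z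
  simp only [localCurvature, (hc _ _).fderiv_eq, christoffel_congr h]

variable [FiniteDimensional ℝ E] {G : E → E →L[ℝ] E →L[ℝ] ℝ} {O : Set E} {ε : ℝ}

lemma fderiv_christoffel_coneForm (h : IsMetricOn G O) (hε : ε * ε = 1)
    {p : ℝ × E} (hp : p ∈ Set.Ioi (0 : ℝ) ×ˢ O) (X Y Z : ℝ × E) :
    fderiv ℝ (fun q => christoffel (coneForm ε G) q Y Z) p X =
      (-(ε * (X.1 * G p.2 Y.2 Z.2 + p.1 * fderiv ℝ G p.2 X.2 Y.2 Z.2)),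
        fderiv ℝ (christoffelCLM G) p.2 X.2 Y.2 Z.2
          - (p.1 ^ 2)⁻¹ • X.1 • (Y.1 • Z.2 + Z.1 • Y.2)) := by
  have hε0 : ε ≠ 0 := left_ne_zero_of_mul_eq_one hε
  have hr : p.1 ≠ 0 := (Set.mem_Ioi.1 hp.1).ne'
  have hev : (fun q => christoffel (coneForm ε G) q Y Z) =ᶠ[𝓝 p] fun q =>
      (-(ε * (q.1 * G q.2 Y.2 Z.2)), christoffelCLM G q.2 Y.2 Z.2 +
        q.1⁻¹ • (Y.1 • Z.2 + Z.1 • Y.2)) := by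
    filter_upwards [(isOpen_Ioi.prod h.isOpen).mem_nhds hp] with q hq
    rw [christoffel_coneForm h hε hq, christoffelCLM_apply, mul_assoc]
  rw [hev.fderiv_eq]
  have h1 : HasFDerivAt (fun q : ℝ × E => q.1) (ContinuousLinearMap.fst ℝ ℝ E) p := hasFDerivAt_fst
  have h2 : HasFDerivAt (fun q : ℝ × E => q.2) (ContinuousLinearMap.snd ℝ ℝ E) p := hasFDerivAt_snd
  have hG : HasFDerivAt (fun q : ℝ × E => G q.2) _ p :=
    (h.differentiableAt hp.2).hasFDerivAt.comp p h2
  have hA : HasFDerivAt (fun q : ℝ × E => christoffelCLM G q.2) _ p :=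
    (h.hasFDerivAt_christoffelCLM hp.2).comp p h2
  have c : ∀ u : E, HasFDerivAt (fun _ : ℝ × E => u) (0 : ℝ × E →L[ℝ] E) p :=
    fun u => hasFDerivAt_const u p
  have hi : HasFDerivAt (fun q : ℝ × E => q.1⁻¹) _ p := (hasDerivAt_inv hr).comp_hasFDerivAt p h1
  have h3 := (((h1.mul ((hG.clm_apply (c Y.2)).clm_apply (c Z.2))).const_mul ε).neg).prodMk
    (((hA.clm_apply (c Y.2)).clm_apply (c Z.2)).add (hi.smul_const (Y.1 • Z.2 + Z.1 • Y.2)))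
  have h4 := congrArg (fun l : ℝ × E →L[ℝ] ℝ × E => l X) h3.fderiv
  refine h4.trans (Prod.ext ?_ ?_)
  · simp
    ring
  · simp
    module

/-- The curvature of a cone. -/
lemma localCurvature_coneForm (h : IsMetricOn G O) (hε : ε * ε = 1)
    {p : ℝ × E} (hp : p ∈ Set.Ioi (0 : ℝ) ×ˢ O) (X Y Z : ℝ × E) :
    localCurvature (coneForm ε G) p X Y Z = (0, defect G ε p.2 X.2 Y.2 Z.2) := by
  have hr : p.1 ≠ 0 := (Set.mem_Ioi.1 hp.1).ne'
  have hy := hp.2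
  rw [localCurvature, fderiv_christoffel_coneForm h hε hp, fderiv_christoffel_coneForm h hε hp]
  simp only [christoffel_coneForm h hε hp]
  simp only [defect_apply, ← christoffelCLM_apply, h.fderiv_eq' hy, map_add, map_smul]
  refine Prod.ext ?_ ?_
  · simp only [Prod.fst_add, Prod.fst_sub, smul_eq_mul]
    rw [h.symm _ hy Y.2 X.2, h.christoffelCLM_symm hy Y.2 X.2]
    field_simp
    ring
  · simp only [Prod.snd_add, Prod.snd_sub]
    rw [h.christoffelCLM_symm hy Y.2 X.2]
    match_scalars <;> field_simp <;> ring

end ConeCurvature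

/-! ### From the vanishing defect to flatness and constant curvature. -/

section Conclusion

variable {E : Type*} [NormedAddCommGroup E] [NormedSpace ℝ E] [FiniteDimensional ℝ E]
  {H : Type*} [TopologicalSpace H] {I : ModelWithCorners ℝ E H} [I.Boundaryless]
  {M : Type*} [TopologicalSpace M] [ChartedSpace H M] [IsManifold I ∞ M]
  {g : BilinField I M} {ε : ℝ}

lemma isFlat_coneMetric (hg : IsSemiRiemannian I g) (hε : ε * ε = 1)
    (hd : ∀ q : M, defect (chartMetric I g q) ε (extChartAt I q q) = 0) :
    IsFlat (coneModel I) (coneMetric I ε g) := by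
  intro p X Y Z
  have ht := mem_extChartAt_target (I := coneModel I) p
  have hev : chartMetric (coneModel I) (coneMetric I ε g) p =ᶠ[𝓝 (extChartAt (coneModel I) p p)]
      coneForm ε (chartMetric I g p.2) := by
    filter_upwards [(isOpen_target p).mem_nhds ht] with z hz using chartMetric_coneMetric ε g hz
  refine (curvature_eq (I := coneModel I) (coneMetric I ε g) p X Y Z).trans ?_
  have key : ∀ X Y Z : ℝ × E, localCurvature (chartMetric (coneModel I) (coneMetric I ε g) p)
      (extChartAt (coneModel I) p p) X Y Z = 0 := by
    intro X Y Z
    rw [localCurvature_congr hev, localCurvature_coneForm (hg.isMetricOn p.2) hε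
      (by rwa [← target_cone]), extChartAt_cone, hd p.2]
    rfl
  exact key X Y Z

lemma hasConstantCurvature_of_defect (hg : IsSemiRiemannian I g)
    (hd : ∀ q : M, defect (chartMetric I g q) ε (extChartAt I q q) = 0) :
    HasConstantCurvature I g ε := by
  intro x X Y Z
  refine (curvature_eq (I := I) g x X Y Z).trans ?_
  have key : ∀ X Y Z : E, localCurvature (chartMetric I g x) (extChartAt I x x) X Y Z =
      ε • (form I g x Y Z • X - form I g x X Z • Y) := by
    intro X Y Z
    rw [(hg.isMetricOn x).localCurvature_eq (mem_extChartAt_target x) (κ := ε), hd x,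
      chartMetric_self]
    simp
  exact key X Y Z

end Conclusion

/-! ### Uniqueness of integral curves and of geodesics -/

section LocalUniqueness

lemma eventually_ne_of_continuousAt {X Y : Type*} [TopologicalSpace X] [TopologicalSpace Y]
    [T2Space Y] {u v : X → Y} {x : X} (hu : ContinuousAt u x) (hv : ContinuousAt v x)
    (h : u x ≠ v x) : ∀ᶠ z in 𝓝 x, u z ≠ v z :=
  (hu.prodMk hv).eventually (isClosed_diagonal.isOpen_compl.mem_nhds h)

/-- Solutions of an autonomous equation that agree at one time agree at all nearby times. -/
lemma exists_nhds_ode_unique {X : Type*} [NormedAddCommGroup X] [NormedSpace ℝ X] {F : X → X}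
    {z₁ z₂ : ℝ → X} {τ : ℝ} (hF : ContDiffAt ℝ 1 F (z₁ τ))
    (h₁ : ∀ᶠ t in 𝓝 τ, HasDerivAt z₁ (F (z₁ t)) t) (h₂ : ∀ᶠ t in 𝓝 τ, HasDerivAt z₂ (F (z₂ t)) t) :
    ∃ U ∈ 𝓝 τ, ∀ a ∈ U, ∀ b ∈ U, z₁ a = z₂ a → z₁ b = z₂ b := by
  have c₁ : ContinuousAt z₁ τ := h₁.self_of_nhds.continuousAt
  have c₂ : ContinuousAt z₂ τ := h₂.self_of_nhds.continuousAt
  by_cases heq : z₁ τ = z₂ τ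
  · obtain ⟨K, S, hS, hK⟩ := hF.exists_lipschitzOnWith
    obtain ⟨δ, hδ, hball⟩ := Metric.mem_nhds_iff.1 (Filter.inter_mem (Filter.inter_mem h₁ h₂)
      (Filter.inter_mem (c₁.preimage_mem_nhds hS) (c₂.preimage_mem_nhds (heq ▸ hS))))
    refine ⟨Metric.ball τ δ, Metric.ball_mem_nhds τ hδ, fun a ha b hb hab => ?_⟩
    have hconn : (Metric.ball τ δ).OrdConnected := by
      rw [Real.ball_eq_Ioo]
      exact Set.ordConnected_Ioo
    refine sub_eq_zero.1 (eq_zero_of_norm_deriv_le (w := fun t => z₁ t - z₂ t)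
      (w' := fun t => F (z₁ t) - F (z₂ t)) (K := fun _ => K) hconn
      (fun t ht => (hball ht).1.1.sub (hball ht).1.2) continuousOn_const (fun t ht => ?_) ha
      (sub_eq_zero.2 hab) b hb)
    exact hK.norm_sub_le (hball ht).2.1 (hball ht).2.2
  · have := eventually_ne_of_continuousAt c₁ c₂ heq
    exact ⟨_, this, fun a ha b _ hab => absurd hab ha⟩

variable {E : Type*} [NormedAddCommGroup E] [NormedSpace ℝ E]
  {H : Type*} [TopologicalSpace H] {I : ModelWithCorners ℝ E H} [I.Boundaryless]
  {M : Type*} [TopologicalSpace M] [ChartedSpace H M] [IsManifold I ∞ M]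

lemma chart_injOn {x₀ x x' : M} (hx : x ∈ (extChartAt I x₀).source)
    (hx' : x' ∈ (extChartAt I x₀).source) (h : extChartAt I x₀ x = extChartAt I x₀ x') : x = x' :=
  (extChartAt I x₀).injOn hx hx' h

variable (I) in
/-- The curve `γ` is an integral curve of `T` at time `t`. -/
def IsIntegralAt (T : M → E) (γ : ℝ → M) (t : ℝ) : Prop :=
  MDifferentiableAt 𝓘(ℝ, ℝ) I γ t ∧ vel I γ t = T (γ t)

variable (I) in
/-- The vector field `T` is smooth at the points of `U`, in charts. -/
def SmoothFieldOn (T : M → E) (U : Set M) : Prop :=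
  ∀ x₀ : M, ∀ y ∈ (extChartAt I x₀).target, (extChartAt I x₀).symm y ∈ U →
    ContDiffAt ℝ ∞ (chartField I T x₀) y

variable {T : M → E} {U : Set M}

lemma chartField_chart {x₀ x : M} (hx : x ∈ (extChartAt I x₀).source) :
    chartField I T x₀ (extChartAt I x₀ x) = md I 𝓘(ℝ, E) (extChartAt I x₀) x (T x) := by
  rw [chartField, (extChartAt I x₀).left_inv hx]

lemma IsIntegralAt.hasDerivAt_chart {γ : ℝ → M} {t : ℝ} (h : IsIntegralAt I T γ t) {x₀ : M}
    (hx : γ t ∈ (extChartAt I x₀).source) : HasDerivAt (fun τ => extChartAt I x₀ (γ τ))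
      (chartField I T x₀ (extChartAt I x₀ (γ t))) t := by
  have := hasDerivAt_chart_comp h.1 hx
  rwa [h.2, ← chartField_chart hx] at this

/-- Where the curves meet, uniqueness in a chart applies; where they differ, the Hausdorff property
keeps them different at nearby times. In both cases agreement is locally all or nothing, as
`IsPreconnected.of_locally_imp` requires. -/
lemma exists_nhds_integral_unique [T2Space M] (hT : SmoothFieldOn I T U) {γ₁ γ₂ : ℝ → M} {τ : ℝ}
    (hU : γ₁ τ ∈ U) (h₁ : ∀ᶠ t in 𝓝 τ, IsIntegralAt I T γ₁ t)
    (h₂ : ∀ᶠ t in 𝓝 τ, IsIntegralAt I T γ₂ t) :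
    ∃ V ∈ 𝓝 τ, ∀ a ∈ V, ∀ b ∈ V, γ₁ a = γ₂ a → γ₁ b = γ₂ b := by
  have c₁ : ContinuousAt γ₁ τ := h₁.self_of_nhds.1.continuousAt
  have c₂ : ContinuousAt γ₂ τ := h₂.self_of_nhds.1.continuousAt
  by_cases heq : γ₁ τ = γ₂ τ
  · set x₀ := γ₁ τ with hx₀
    have hs := (isOpen_extChartAt_source (I := I) x₀).mem_nhds (mem_extChartAt_source (I := I) x₀)
    have e₁ := c₁.preimage_mem_nhds hs
    have e₂ : γ₂ ⁻¹' (extChartAt I x₀).source ∈ 𝓝 τ :=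
      c₂.preimage_mem_nhds (by rw [← heq]; exact hs)
    obtain ⟨V, hV, hV'⟩ := exists_nhds_ode_unique (F := chartField I T x₀)
      (z₁ := fun t => extChartAt I x₀ (γ₁ t)) (z₂ := fun t => extChartAt I x₀ (γ₂ t)) (τ := τ)
      ((hT x₀ _ (mem_extChartAt_target x₀) (by rwa [extChartAt_to_inv])).of_le (by simp))
      (by filter_upwards [h₁, e₁] with t h1 h2 using h1.hasDerivAt_chart h2)
      (by filter_upwards [h₂, e₂] with t h1 h2 using h1.hasDerivAt_chart h2)
    exact ⟨_, Filter.inter_mem hV (Filter.inter_mem e₁ e₂), fun a ha b hb hab =>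
      chart_injOn hb.2.1 hb.2.2 (hV' a ha.1 b hb.1 (by rw [hab]))⟩
  · have := eventually_ne_of_continuousAt c₁ c₂ heq
    exact ⟨_, this, fun a ha b _ hab => absurd hab ha⟩

lemma integral_unique [T2Space M] (hT : SmoothFieldOn I T U) {γ₁ γ₂ : ℝ → M} {s : Set ℝ}
    (hs : IsOpen s) (hs' : s.OrdConnected) (hU : ∀ t ∈ s, γ₁ t ∈ U)
    (h₁ : ∀ t ∈ s, IsIntegralAt I T γ₁ t) (h₂ : ∀ t ∈ s, IsIntegralAt I T γ₂ t) {t₀ t : ℝ}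
    (ht₀ : t₀ ∈ s) (ht : t ∈ s) (h0 : γ₁ t₀ = γ₂ t₀) : γ₁ t = γ₂ t := by
  refine IsPreconnected.of_locally_imp hs'.isPreconnected (fun t => γ₁ t = γ₂ t)
    (fun τ hτ => ?_) ht₀ ht h0
  obtain ⟨V, hV, h⟩ := exists_nhds_integral_unique hT (hU τ hτ)
    (Filter.mem_of_superset (hs.mem_nhds hτ) h₁) (Filter.mem_of_superset (hs.mem_nhds hτ) h₂)
  exact ⟨V, hV, fun a ha b hb => h a ha.1 b hb.1⟩

/-- A geodesic solves a first order equation in a chart of the tangent bundle. -/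
lemma IsGeodesicOn.hasDerivAt_pair [FiniteDimensional ℝ E] {g : BilinField I M}
    (hg : IsSemiRiemannian I g) {γ : ℝ → M} {s : Set ℝ} (h : IsGeodesicOn I g γ s) (hs : IsOpen s)
    {t : ℝ} (ht : t ∈ s) {x₀ : M} (hx : γ t ∈ (extChartAt I x₀).source) :
    HasDerivAt (fun τ => ((extChartAt I x₀ (γ τ), deriv (fun τ => extChartAt I x₀ (γ τ)) τ) : E × E))
      (deriv (fun τ => extChartAt I x₀ (γ τ)) t, -christoffelCLM (chartMetric I g x₀)
        (extChartAt I x₀ (γ t)) (deriv (fun τ => extChartAt I x₀ (γ τ)) t)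
          (deriv (fun τ => extChartAt I x₀ (γ τ)) t)) t := by
  have hc : ContDiffAt ℝ ∞ (fun τ => extChartAt I x₀ (γ τ)) t :=
    contDiffAt_chart_comp (h.contMDiffAt hs ht) le_rfl hx
  refine (hc.differentiableAt (by simp)).hasDerivAt.prodMk ?_
  refine (hasDerivAt_deriv (hc.of_le two_le_infty)).congr_deriv ?_
  rw [h.eq_in_chart hg hs ht hx rfl, christoffelCLM_apply]

/-- The property propagated is equality of position and velocity, for which geodesics are solutions
of a first order system in a chart. -/
lemma geodesic_unique [FiniteDimensional ℝ E] [T2Space M] {g : BilinField I M}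
    (hg : IsSemiRiemannian I g) {γ₁ γ₂ : ℝ → M} {s : Set ℝ} (hs : IsOpen s) (hs' : s.OrdConnected)
    (h₁ : IsGeodesicOn I g γ₁ s) (h₂ : IsGeodesicOn I g γ₂ s) {t₀ t : ℝ} (ht₀ : t₀ ∈ s) (ht : t ∈ s)
    (h0 : γ₁ t₀ = γ₂ t₀) (hv : vel I γ₁ t₀ = vel I γ₂ t₀) : γ₁ t = γ₂ t := by
  suffices h : γ₁ t = γ₂ t ∧ vel I γ₁ t = vel I γ₂ t from h.1
  refine IsPreconnected.of_locally_imp hs'.isPreconnected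
    (fun t => γ₁ t = γ₂ t ∧ vel I γ₁ t = vel I γ₂ t) (fun τ hτ => ?_) ht₀ ht ⟨h0, hv⟩
  have c₁ : ContinuousAt γ₁ τ := (h₁.contMDiffAt hs hτ).continuousAt
  have c₂ : ContinuousAt γ₂ τ := (h₂.contMDiffAt hs hτ).continuousAt
  by_cases heq : γ₁ τ = γ₂ τ
  · set x₀ := γ₁ τ with hx₀
    have hsr := (isOpen_extChartAt_source (I := I) x₀).mem_nhds (mem_extChartAt_source (I := I) x₀)
    have e₁ := c₁.preimage_mem_nhds hsr
    have e₂ : γ₂ ⁻¹' (extChartAt I x₀).source ∈ 𝓝 τ :=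
      c₂.preimage_mem_nhds (by rw [← heq]; exact hsr)
    have hm := hg.isMetricOn (I := I) x₀
    set z₁ : ℝ → E × E := fun τ => (extChartAt I x₀ (γ₁ τ),
      deriv (fun τ => extChartAt I x₀ (γ₁ τ)) τ)
    set z₂ : ℝ → E × E := fun τ => (extChartAt I x₀ (γ₂ τ),
      deriv (fun τ => extChartAt I x₀ (γ₂ τ)) τ)
    have hF : ContDiffAt ℝ 1 (fun p : E × E =>
        ((p.2, -christoffelCLM (chartMetric I g x₀) p.1 p.2 p.2) : E × E)) (z₁ τ) := by
      have hA : ContDiffAt ℝ ∞ (fun p : E × E => christoffelCLM (chartMetric I g x₀) p.1) (z₁ τ) :=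
        (hm.contDiffAt_christoffelCLM (mem_extChartAt_target x₀)).comp (z₁ τ) contDiffAt_fst
      exact (contDiffAt_snd.prodMk ((hA.clm_apply contDiffAt_snd).clm_apply
        contDiffAt_snd).neg).of_le (by simp)
    obtain ⟨V, hV, hV'⟩ := exists_nhds_ode_unique (z₁ := z₁) (z₂ := z₂) hF
      (by filter_upwards [hs.mem_nhds hτ, e₁] with t ht1 ht2 using h₁.hasDerivAt_pair hg hs ht1 ht2)
      (by filter_upwards [hs.mem_nhds hτ, e₂] with t ht1 ht2 using h₂.hasDerivAt_pair hg hs ht1 ht2)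
    have hz₁ : ∀ t ∈ s, γ₁ t ∈ (extChartAt I x₀).source → z₁ t = (extChartAt I x₀ (γ₁ t),
        md I 𝓘(ℝ, E) (extChartAt I x₀) (γ₁ t) (vel I γ₁ t)) := fun t ht hx => by
      rw [← (hasDerivAt_chart_comp (h₁.mdifferentiableAt hs ht) hx).deriv]
    have hz₂ : ∀ t ∈ s, γ₂ t ∈ (extChartAt I x₀).source → z₂ t = (extChartAt I x₀ (γ₂ t),
        md I 𝓘(ℝ, E) (extChartAt I x₀) (γ₂ t) (vel I γ₂ t)) := fun t ht hx => by
      rw [← (hasDerivAt_chart_comp (h₂.mdifferentiableAt hs ht) hx).deriv]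
    refine ⟨_, Filter.inter_mem hV (Filter.inter_mem e₁ e₂), fun a ha b hb hab => ?_⟩
    have h3 := hV' a ha.1.1 b hb.1.1 (by
      rw [hz₁ a ha.2 ha.1.2.1, hz₂ a ha.2 ha.1.2.2, hab.1, hab.2])
    rw [hz₁ b hb.2 hb.1.2.1, hz₂ b hb.2 hb.1.2.2, Prod.mk.injEq] at h3
    have h4 := chart_injOn hb.1.2.1 hb.1.2.2 h3.1
    refine ⟨h4, ?_⟩
    have h5 := congrArg (md 𝓘(ℝ, E) I (extChartAt I x₀).symm (extChartAt I x₀ (γ₁ b))) h3.2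
    rwa [md_chart_symm_comp hb.1.2.1, h4, md_chart_symm_comp hb.1.2.2] at h5
  · have := eventually_ne_of_continuousAt c₁ c₂ heq
    exact ⟨_, this, fun a ha b _ hab => absurd hab.1 ha.1⟩

end LocalUniqueness

/-! ### Smoothness of complete flows -/

section Flow

variable {E : Type*} [NormedAddCommGroup E] [NormedSpace ℝ E] [FiniteDimensional ℝ E]
  {H : Type*} [TopologicalSpace H] {I : ModelWithCorners ℝ E H} [I.Boundaryless]
  {M : Type*} [TopologicalSpace M] [ChartedSpace H M] [IsManifold I ∞ M]

variable (I) in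
/-- A complete flow `φ` of the vector field `T` on the open set `U`. -/
structure IsFlow (T : M → E) (U : Set M) (φ : ℝ → M → M) : Prop where
  isOpen : IsOpen U
  smooth : SmoothFieldOn I T U
  zero : ∀ x ∈ U, φ 0 x = x
  mem : ∀ x ∈ U, ∀ t, φ t x ∈ U
  integral : ∀ x ∈ U, ∀ t, IsIntegralAt I T (fun τ => φ τ x) t

variable {T : M → E} {U : Set M} {φ : ℝ → M → M}

lemma IsIntegralAt.comp_add {γ : ℝ → M} {t a : ℝ} (h : IsIntegralAt I T γ (t + a)) :
    IsIntegralAt I T (fun τ => γ (τ + a)) t := by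
  have hd : HasDerivAt (fun τ : ℝ => τ + a) 1 t := (hasDerivAt_id t).add_const a
  have hd' : MDifferentiableAt 𝓘(ℝ, ℝ) 𝓘(ℝ, ℝ) (fun τ : ℝ => τ + a) t :=
    hd.differentiableAt.mdifferentiableAt
  refine ⟨MDifferentiableAt.comp (g := γ) (f := fun τ : ℝ => τ + a) t h.1 hd', ?_⟩
  have h1 : vel I (fun τ => γ (τ + a)) t = md 𝓘(ℝ, ℝ) I γ (t + a)
      (md 𝓘(ℝ, ℝ) 𝓘(ℝ, ℝ) (fun τ : ℝ => τ + a) t 1) := 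
    md_comp_apply (f := γ) (h := fun τ : ℝ => τ + a) (x := t) h.1 hd' 1
  rw [h1, md_eq_fderiv, fderiv_apply_one_eq_deriv, hd.deriv]
  exact h.2

namespace IsFlow

lemma add [T2Space M] (h : IsFlow I T U φ) {x : M} (hx : x ∈ U) (t a : ℝ) :
    φ (t + a) x = φ t (φ a x) :=
  integral_unique h.smooth isOpen_univ Set.ordConnected_univ (γ₁ := fun t => φ (t + a) x)
    (γ₂ := fun t => φ t (φ a x)) (t₀ := 0)
    (fun t _ => h.mem x hx _) (fun t _ => (h.integral x hx (t + a)).comp_add)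
    (fun t _ => h.integral _ (h.mem x hx a) t) (Set.mem_univ _) (Set.mem_univ t)
    (by simp only [zero_add]; rw [h.zero _ (h.mem x hx a)])

/-- In a chart φ coincides, by uniqueness of integral curves, with the local C^k flow. The time δ
may depend on k, so k is kept finite. -/
lemma contMDiffAt_near_zero [T2Space M] (h : IsFlow I T U φ) (k : ℕ) {p : M} (hp : p ∈ U) :
    ∃ δ > 0, ∃ V ∈ 𝓝 p, ∀ t ∈ Set.Ioo (-δ) δ, ∀ x ∈ V,
      ContMDiffAt (𝓘(ℝ, ℝ).prod I) I k (Function.uncurry φ) (t, x) := by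
  set O : Set E := (extChartAt I p).target ∩ (extChartAt I p).symm ⁻¹' U with hO
  have hOo : IsOpen O :=
    (continuousOn_extChartAt_symm p).isOpen_inter_preimage (isOpen_target p) h.isOpen
  have hpO : extChartAt I p p ∈ O := ⟨mem_extChartAt_target p, by
    rw [Set.mem_preimage, extChartAt_to_inv]; exact hp⟩
  obtain ⟨δ, hδ, V, hV, hpV, θ, hθ, hθ0, hθ'⟩ := exists_contDiffOn_flow k hOo hpO
    (v := chartField I T p) (fun y hy => (h.smooth p y hy.1 hy.2).contDiffWithinAt)
  have hopen : IsOpen ((extChartAt I p).source ∩ extChartAt I p ⁻¹' V) :=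
    (continuousOn_extChartAt p).isOpen_inter_preimage (isOpen_extChartAt_source p) hV
  set W : Set M := ((extChartAt I p).source ∩ extChartAt I p ⁻¹' V) ∩ U with hW
  have hWo : IsOpen W := hopen.inter h.isOpen
  have key : ∀ t ∈ Set.Ioo (-δ) δ, ∀ x ∈ W,
      φ t x = (extChartAt I p).symm (θ (t, extChartAt I p x)) := by
    intro t ht x hx
    refine integral_unique h.smooth isOpen_Ioo Set.ordConnected_Ioo (γ₁ := fun t => φ t x)
      (γ₂ := fun t => (extChartAt I p).symm (θ (t, extChartAt I p x)))
      (fun t _ => h.mem x hx.2 t) (fun t _ => h.integral x hx.2 t) (fun t ht => ?_)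
      (t₀ := 0) ⟨by linarith, hδ⟩ ht ?_
    · obtain ⟨h1, h2⟩ := hθ' t ht _ hx.1.2
      have h3 := mdifferentiableAt_chart_symm (I := I) h1.1
      have h4 : MDifferentiableAt 𝓘(ℝ, ℝ) 𝓘(ℝ, E) (fun τ => θ (τ, extChartAt I p x)) t :=
        h2.differentiableAt.mdifferentiableAt
      refine ⟨MDifferentiableAt.comp (g := (extChartAt I p).symm)
        (f := fun τ => θ (τ, extChartAt I p x)) t h3 h4, ?_⟩
      have h5 : vel I (fun τ => (extChartAt I p).symm (θ (τ, extChartAt I p x))) t =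
        md 𝓘(ℝ, E) I (extChartAt I p).symm (θ (t, extChartAt I p x))
        (md 𝓘(ℝ, ℝ) 𝓘(ℝ, E) (fun τ => θ (τ, extChartAt I p x)) t 1) := 
        md_comp_apply (h := fun τ : ℝ => θ (τ, extChartAt I p x)) (x := t) h3 h4 1
      rw [h5, md_eq_fderiv, fderiv_apply_one_eq_deriv, h2.deriv, md_symm_chartField T h1.1]
    · simp only [hθ0 _ hx.1.2]
      rw [(extChartAt I p).left_inv hx.1.1, h.zero x hx.2]
  refine ⟨δ, hδ, W, hWo.mem_nhds ⟨⟨mem_extChartAt_source p, hpV⟩, hp⟩, fun t ht x hx => ?_⟩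
  have hev : Function.uncurry φ =ᶠ[𝓝 (t, x)]
      fun q => (extChartAt I p).symm (θ (q.1, extChartAt I p q.2)) := by
    filter_upwards [(isOpen_Ioo.prod hWo).mem_nhds (Set.mk_mem_prod ht hx)] with q hq
    exact key q.1 hq.1 q.2 hq.2
  refine ContMDiffAt.congr_of_eventuallyEq ?_ hev
  have hk : (k : WithTop ℕ∞) ≤ ∞ := by exact_mod_cast le_top
  have h1 : ContMDiffAt (𝓘(ℝ, ℝ).prod I) 𝓘(ℝ, ℝ × E) k
      (fun q : ℝ × M => (q.1, extChartAt I p q.2)) (t, x) :=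
    contMDiffAt_fst.prodMk_space (((contMDiffAt_chart hx.1.1).of_le hk).comp (t, x)
      contMDiffAt_snd)
  have h2 : ContMDiffAt 𝓘(ℝ, ℝ × E) 𝓘(ℝ, E) k θ (t, extChartAt I p x) :=
    (hθ.contDiffAt ((isOpen_Ioo.prod hV).mem_nhds (Set.mk_mem_prod ht hx.1.2))).contMDiffAt
  have h3 : ContMDiffAt 𝓘(ℝ, E) I k (extChartAt I p).symm (θ (t, extChartAt I p x)) :=
    (contMDiffAt_chart_symm (hθ' t ht _ hx.1.2).1.1).of_le hk
  exact h3.comp (t, x) (h2.comp (t, x) h1)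

/-- By φ_t = φ_(t - a) ∘ φ_a, regularity at (a, x) implies regularity at (b, x) for b close to a;
connectedness of the line carries it from time 0 to all times. -/
lemma contMDiffAt_nat [T2Space M] (h : IsFlow I T U φ) (k : ℕ) {x : M} (hx : x ∈ U) (t : ℝ) :
    ContMDiffAt (𝓘(ℝ, ℝ).prod I) I k (Function.uncurry φ) (t, x) := by
  refine IsPreconnected.of_locally_imp (s := Set.univ) isPreconnected_univ
    (fun t => ContMDiffAt (𝓘(ℝ, ℝ).prod I) I k (Function.uncurry φ) (t, x))
    (fun τ _ => ?_) (a := 0) (Set.mem_univ _) (Set.mem_univ t) ?_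
  · obtain ⟨δ, hδ, V, hV, hsm⟩ := h.contMDiffAt_near_zero k (h.mem x hx τ)
    have hc : ContinuousAt (fun τ => φ τ x) τ := (h.integral x hx τ).1.continuousAt
    refine ⟨Metric.ball τ (δ / 2) ∩ (fun τ => φ τ x) ⁻¹' V,
      Filter.inter_mem (Metric.ball_mem_nhds _ (by linarith)) (hc.preimage_mem_nhds hV),
      fun a ha b hb hPa => ?_⟩
    have hab : b - a ∈ Set.Ioo (-δ) δ := by
      have h1 := Metric.mem_ball.1 ha.1.1
      have h2 := Metric.mem_ball.1 hb.1.1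
      rw [Real.dist_eq, abs_lt] at h1 h2
      constructor <;> linarith
    have h1 : ContMDiffAt I I k (φ a) x :=
      ContMDiffAt.comp (g := Function.uncurry φ) (f := fun x' : M => ((a, x') : ℝ × M)) x hPa
        (contMDiffAt_const.prodMk contMDiffAt_id)
    have h2 : ContMDiffAt (𝓘(ℝ, ℝ).prod I) (𝓘(ℝ, ℝ).prod I) k
        (fun q : ℝ × M => ((q.1 - a, φ a q.2) : ℝ × M)) (b, x) := by
      refine ContMDiffAt.prodMk ?_ (h1.comp (b, x) contMDiffAt_snd)
      have h3 : ContMDiffAt 𝓘(ℝ, ℝ) 𝓘(ℝ, ℝ) k (fun r : ℝ => r - a) b :=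
        (contDiffAt_id.sub contDiffAt_const).contMDiffAt
      exact ContMDiffAt.comp (g := fun r : ℝ => r - a) (b, x) h3 contMDiffAt_fst
    have h3 := ContMDiffAt.comp (b, x) (hsm (b - a) hab (φ a x) ha.1.2) h2
    refine h3.congr_of_eventuallyEq ?_
    have : ∀ᶠ q in 𝓝 (b, x), q.2 ∈ U := continuousAt_snd.preimage_mem_nhds (h.isOpen.mem_nhds hx)
    filter_upwards [this] with q hq
    have := h.add hq (q.1 - a) a
    rw [sub_add_cancel] at this
    exact this
  · obtain ⟨δ, hδ, V, hV, hsm⟩ := h.contMDiffAt_near_zero k hx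
    exact hsm 0 ⟨by linarith, hδ⟩ x (mem_of_mem_nhds hV)

/-- A complete flow is smooth. -/
lemma contMDiffAt [T2Space M] (h : IsFlow I T U φ) {x : M} (hx : x ∈ U) (t : ℝ) :
    ContMDiffAt (𝓘(ℝ, ℝ).prod I) I ∞ (Function.uncurry φ) (t, x) :=
  contMDiffAt_infty.2 fun k => h.contMDiffAt_nat k hx t

end IsFlow
end Flow

/-! ### Regular level sets -/

section LevelSet

variable {E : Type*} [NormedAddCommGroup E] [NormedSpace ℝ E] [FiniteDimensional ℝ E]
  {E' : Type*} [NormedAddCommGroup E'] [NormedSpace ℝ E'] [FiniteDimensional ℝ E']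

/-- Completes a nonzero functional to linear coordinates: π is a projection onto the kernel of L
followed by an identification of the kernel with E'. -/
lemma exists_equiv_of_ne_zero (hdim : Module.finrank ℝ E = Module.finrank ℝ E' + 1)
    {L : E →L[ℝ] ℝ} (hL : L ≠ 0) : ∃ π : E →L[ℝ] E', (L.prod π).IsInvertible := by
  have hk : Module.finrank ℝ (L : E →ₗ[ℝ] ℝ).ker = Module.finrank ℝ E' := by
    have h1 := LinearMap.finrank_range_add_finrank_ker (L : E →ₗ[ℝ] ℝ)
    have h2 : (L : E →ₗ[ℝ] ℝ).range = ⊤ := by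
      refine LinearMap.range_eq_top.2 (LinearMap.surjective fun h0 => hL ?_)
      ext v
      exact congrArg (fun l : E →ₗ[ℝ] ℝ => l v) h0
    rw [h2, finrank_top, Module.finrank_self] at h1
    omega
  obtain ⟨p, hp⟩ := LinearMap.exists_leftInverse_of_injective (L : E →ₗ[ℝ] ℝ).ker.subtype
    (Submodule.ker_subtype _)
  set e := LinearEquiv.ofFinrankEq (L : E →ₗ[ℝ] ℝ).ker E' hk
  set π : E →L[ℝ] E' := LinearMap.toContinuousLinearMap (e.toLinearMap ∘ₗ p) with hπ
  have hinj : Function.Injective (L.prod π : E →ₗ[ℝ] ℝ × E') := by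
    rw [← LinearMap.ker_eq_bot, LinearMap.ker_eq_bot']
    intro v hv
    have h1 : L v = 0 := congrArg Prod.fst hv
    have h2 : e (p v) = 0 := congrArg Prod.snd hv
    have h3 : p v = ⟨v, h1⟩ := congrArg (fun l : (L : E →ₗ[ℝ] ℝ).ker →ₗ[ℝ] _ => l ⟨v, h1⟩) hp
    rw [h3] at h2
    have h4 := e.map_eq_zero_iff.1 h2
    exact congrArg Subtype.val h4
  have hd : Module.finrank ℝ E = Module.finrank ℝ (ℝ × E') := by
    rw [Module.finrank_prod, Module.finrank_self, hdim, add_comm]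
  exact ⟨π, (LinearEquiv.ofInjectiveOfFinrankEq _ hinj hd).toContinuousLinearEquiv, by ext <;> rfl⟩

variable {H : Type*} [TopologicalSpace H] {I : ModelWithCorners ℝ E H} [I.Boundaryless]
  {M : Type*} [TopologicalSpace M] [ChartedSpace H M] [IsManifold I ∞ M]

/-- Local coordinates in which a given function is affine. -/
lemma exists_sliceChart (hdim : Module.finrank ℝ E = Module.finrank ℝ E' + 1) {f : M → ℝ}
    (hf : ContMDiff I 𝓘(ℝ, ℝ) ∞ f) {x : M} (hx : md I 𝓘(ℝ, ℝ) f x ≠ 0) (c : ℝ) :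
    ∃ Q : OpenPartialHomeomorph M (ℝ × E'), x ∈ Q.source ∧ (∀ z ∈ Q.source, (Q z).1 = f z - c) ∧
      (∀ z ∈ Q.source, ContMDiffAt I 𝓘(ℝ, ℝ × E') ∞ Q z) ∧
      (∀ w ∈ Q.target, ContMDiffAt 𝓘(ℝ, ℝ × E') I ∞ Q.symm w) := by
  set y₀ := extChartAt I x x with hy₀
  have ht := mem_extChartAt_target (I := I) x
  have hφ : ∀ y ∈ (extChartAt I x).target, ContDiffAt ℝ ∞ (inChart I f x) y :=
    fun y hy => contDiffAt_inChart hy (hf _)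
  have hL : fderiv ℝ (inChart I f x) y₀ ≠ 0 := by
    intro h0
    apply hx
    ext v
    have := md_inChart (I := I) ht ((hf _).mdifferentiableAt (by simp)) v
    rw [md_chart_symm_self, extChartAt_to_inv, h0] at this
    exact this.symm
  obtain ⟨π, hπ⟩ := exists_equiv_of_ne_zero hdim hL
  set q : E → ℝ × E' := fun y => (inChart I f x y - c, π y) with hq
  have hqs : ∀ y ∈ (extChartAt I x).target, ContDiffAt ℝ ∞ q y := fun y hy =>
    ((hφ y hy).sub contDiffAt_const).prodMk π.contDiff.contDiffAt
  have hqd : ∀ y ∈ (extChartAt I x).target,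
      HasFDerivAt q ((fderiv ℝ (inChart I f x) y).prod π) y := fun y hy =>
    (((hφ y hy).differentiableAt (by simp)).hasFDerivAt.sub_const c).prodMk π.hasFDerivAt
  obtain ⟨e, he⟩ := hπ
  have hqd₀ : HasFDerivAt q (e : E →L[ℝ] ℝ × E') y₀ := he ▸ hqd y₀ ht
  set P := (hqs y₀ ht).toOpenPartialHomeomorph q hqd₀ (by simp) with hP
  have hPc : (P : E → ℝ × E') = q := (hqs y₀ ht).toOpenPartialHomeomorph_coe hqd₀ (by simp)
  have hyP : y₀ ∈ P.source := (hqs y₀ ht).mem_toOpenPartialHomeomorph_source hqd₀ (by simp)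
  -- The inverse function theorem provides smoothness of the inverse at the image of y₀ only.
  -- Restricting to the open set where the derivative is invertible makes the inverse smooth on the
  -- whole target.
  set S : Set E := (extChartAt I x).target ∩ {y | ((fderiv ℝ (inChart I f x) y).prod π).IsInvertible}
    with hS
  have hSo : IsOpen S := by
    rw [isOpen_iff_mem_nhds]
    rintro y ⟨hy1, e', he'⟩
    refine Filter.inter_mem ((isOpen_target x).mem_nhds hy1) ?_
    have hc : ContinuousAt (fun y => (fderiv ℝ (inChart I f x) y).prod π) y := by
      have h1 : ContinuousAt (fderiv ℝ (inChart I f x)) y :=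
        ((hφ y hy1).fderiv_right (m := ∞) (by simp)).continuousAt
      have h2 : (fun y => (fderiv ℝ (inChart I f x) y).prod π) = fun y =>
          (ContinuousLinearMap.inl ℝ ℝ E').comp (fderiv ℝ (inChart I f x) y) +
            (ContinuousLinearMap.inr ℝ ℝ E').comp π := by
        funext y
        ext <;> simp
      rw [h2]
      exact (continuousAt_const.clm_comp h1).add continuousAt_const
    have : Set.range ((↑) : (E ≃L[ℝ] ℝ × E') → E →L[ℝ] ℝ × E') ∈
        𝓝 ((fderiv ℝ (inChart I f x) y).prod π) := by
      rw [← he']; exact ContinuousLinearEquiv.nhds e'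
    exact hc.preimage_mem_nhds this
  -- The extended chart as an open partial homeomorphism, available because the model has no
  -- boundary.
  set K : OpenPartialHomeomorph M E := (chartAt H x).transHomeomorph I.toHomeomorph with hK
  have hKc : (K : M → E) = extChartAt I x := rfl
  have hKs : (K.symm : E → M) = (extChartAt I x).symm := rfl
  have hKsrc : K.source = (extChartAt I x).source := by rw [extChartAt_source]; rfl
  refine ⟨K.trans (P.restrOpen S hSo), ?_, ?_, ?_, ?_⟩
  · rw [OpenPartialHomeomorph.trans_source, OpenPartialHomeomorph.restrOpen_source]
    refine ⟨hKsrc ▸ mem_extChartAt_source x, hyP, ht, e, he⟩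
  · intro z hz
    rw [OpenPartialHomeomorph.trans_source, OpenPartialHomeomorph.restrOpen_source] at hz
    have hz1 : z ∈ (extChartAt I x).source := hKsrc ▸ hz.1
    have : (K.trans (P.restrOpen S hSo)) z = q (extChartAt I x z) := congrFun hPc _
    rw [this]
    simp only [hq, inChart]
    rw [(extChartAt I x).left_inv hz1]
  · intro z hz
    rw [OpenPartialHomeomorph.trans_source, OpenPartialHomeomorph.restrOpen_source] at hz
    have hz1 : z ∈ (extChartAt I x).source := hKsrc ▸ hz.1
    have : (K.trans (P.restrOpen S hSo) : M → ℝ × E') = q ∘ extChartAt I x := by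
      rw [← hPc]; rfl
    rw [this]
    exact (hqs _ ((extChartAt I x).map_source hz1)).contMDiffAt.comp z (contMDiffAt_chart hz1)
  · intro w hw
    have hw' := (K.trans (P.restrOpen S hSo)).map_target hw
    rw [OpenPartialHomeomorph.trans_target] at hw
    have hw2 := (P.restrOpen S hSo).map_target hw.1
    rw [OpenPartialHomeomorph.restrOpen_source] at hw2
    obtain ⟨-, hw3, e', he'⟩ := hw2
    have h1 : ContDiffAt ℝ ∞ (P.restrOpen S hSo).symm w := by
      refine (P.restrOpen S hSo).contDiffAt_symm (f₀' := e') hw.1 ?_ ?_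
      · rw [he']
        have : ((P.restrOpen S hSo : OpenPartialHomeomorph E (ℝ × E')) : E → ℝ × E') = q := hPc
        rw [this]
        exact hqd _ hw3
      · have : ((P.restrOpen S hSo : OpenPartialHomeomorph E (ℝ × E')) : E → ℝ × E') = q := hPc
        rw [this]
        exact hqs _ hw3
    exact (contMDiffAt_chart_symm hw3).comp w h1.contMDiffAt

variable (I) in
/-- The value `c` is a regular value of the smooth function `f`. -/
structure IsRegularLevel (f : M → ℝ) (c : ℝ) : Prop where
  contMDiff : ContMDiff I 𝓘(ℝ, ℝ) ∞ f
  ne_zero : ∀ x, f x = c → md I 𝓘(ℝ, ℝ) f x ≠ 0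

/-- The chart of a level set induced by slice coordinates. -/
def sliceChartRestr {f : M → ℝ} {c : ℝ} (Q : OpenPartialHomeomorph M (ℝ × E'))
    (hQ : ∀ z ∈ Q.source, (Q z).1 = f z - c) (x : {z : M // f z = c}) :
    OpenPartialHomeomorph {z : M // f z = c} E' where
  toFun z := (Q z.1).2
  invFun u := by
    classical
    -- Off the target the value x is a mere default.
    exact if h : f (Q.symm (0, u)) = c then ⟨Q.symm (0, u), h⟩ else x
  source := Subtype.val ⁻¹' Q.source
  target := (fun u => ((0, u) : ℝ × E')) ⁻¹' Q.target
  map_source' z hz := by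
    have h1 : ((0, (Q z.1).2) : ℝ × E') = Q z.1 :=
      Prod.ext (by rw [hQ _ hz, z.2, sub_self]) rfl
    rw [Set.mem_preimage, h1]
    exact Q.map_source hz
  map_target' u hu := by
    have h1 := Q.map_target hu
    have h2 : f (Q.symm (0, u)) = c := by
      have := hQ _ h1
      rw [Q.right_inv hu] at this
      exact sub_eq_zero.1 this.symm
    rw [dif_pos h2]
    exact h1
  left_inv' z hz := by
    have h1 : ((0, (Q z.1).2) : ℝ × E') = Q z.1 :=
      Prod.ext (by rw [hQ _ hz, z.2, sub_self]) rfl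
    have h2 : Q.symm (0, (Q z.1).2) = z.1 := by rw [h1, Q.left_inv hz]
    rw [dif_pos (by rw [h2]; exact z.2)]
    exact Subtype.ext h2
  right_inv' u hu := by
    have h1 := Q.map_target hu
    have h2 : f (Q.symm (0, u)) = c := by
      have := hQ _ h1
      rw [Q.right_inv hu] at this
      exact sub_eq_zero.1 this.symm
    rw [dif_pos h2, Q.right_inv hu]
  continuousOn_toFun :=
    continuous_snd.comp_continuousOn (Q.continuousOn.comp continuous_subtype_val.continuousOn
      fun _ h => h)
  continuousOn_invFun := by
    refine (Topology.IsEmbedding.subtypeVal (p := fun z => f z = c)).isInducing.continuousOn_iff.2 ?_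
    have h3 : ContinuousOn (fun u => Q.symm (0, u))
        ((fun u => ((0, u) : ℝ × E')) ⁻¹' Q.target) :=
      Q.continuousOn_symm.comp (by fun_prop) fun _ h => h
    refine h3.congr fun u hu => ?_
    have h2 : f (Q.symm (0, u)) = c := by
      have := hQ _ (Q.map_target hu)
      rw [Q.right_inv hu] at this
      exact sub_eq_zero.1 this.symm
    simp only [Function.comp_apply, dif_pos h2]
  open_source := Q.open_source.preimage continuous_subtype_val
  open_target := Q.open_target.preimage (by fun_prop)

lemma sliceChartRestr_symm {f : M → ℝ} {c : ℝ} (Q : OpenPartialHomeomorph M (ℝ × E'))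
    (hQ : ∀ z ∈ Q.source, (Q z).1 = f z - c) (x : {z : M // f z = c}) {u : E'}
    (hu : ((0, u) : ℝ × E') ∈ Q.target) :
    (((sliceChartRestr Q hQ x).symm u : {z : M // f z = c}) : M) = Q.symm (0, u) := by
  have h2 : f (Q.symm (0, u)) = c := by
    have := hQ _ (Q.map_target hu)
    rw [Q.right_inv hu] at this
    exact sub_eq_zero.1 this.symm
  have : (sliceChartRestr Q hQ x).symm u = ⟨Q.symm (0, u), h2⟩ := dif_pos h2
  rw [this]

variable (I) in
/-- The properties of the inclusion `ι` of a regular level set that are used below. -/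
structure IsLevelEmbedding {N : Type*} [TopologicalSpace N] [ChartedSpace E' N] (ι : N → M)
    (f : M → ℝ) (c : ℝ) : Prop where
  finrank : Module.finrank ℝ E = Module.finrank ℝ E' + 1
  isEmbedding : Topology.IsEmbedding ι
  range_eq : ∀ x, x ∈ Set.range ι ↔ f x = c
  contMDiff : ContMDiff 𝓘(ℝ, E') I ∞ ι
  retract : ∀ z, ∃ r : M → N, ContMDiffAt I 𝓘(ℝ, E') ∞ r (ι z) ∧ ∀ᶠ z' in 𝓝 z, r (ι z') = z'

/-- Slice coordinates straighten f, so their remaining components are charts of the level set, with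
transition maps u ↦ (Q'(Q⁻¹(0, u))).2. These components are also defined on M near the level set,
and this yields the local smooth retractions. -/
theorem IsRegularLevel.exists_manifold (hdim : Module.finrank ℝ E = Module.finrank ℝ E' + 1)
    {f : M → ℝ} {c : ℝ} (hf : IsRegularLevel I f c) :
    ∃ (_ : ChartedSpace E' {z : M // f z = c}), IsManifold 𝓘(ℝ, E') ∞ {z : M // f z = c} ∧
      IsLevelEmbedding (E' := E') I (Subtype.val : {z : M // f z = c} → M) f c := by
  choose Q hQx hQ1 hQs hQs' using fun x : {z : M // f z = c} =>
    exists_sliceChart hdim hf.contMDiff (hf.ne_zero x.1 x.2) c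
  set κ : ∀ x : {z : M // f z = c}, OpenPartialHomeomorph {z : M // f z = c} E' := fun x =>
    sliceChartRestr (Q x) (hQ1 x) x with hκ
  let cs : ChartedSpace E' {z : M // f z = c} :=
    { atlas := Set.range κ
      chartAt := κ
      mem_chart_source := fun x => hQx x
      chart_mem_atlas := fun x => ⟨x, rfl⟩ }
  have hman : IsManifold 𝓘(ℝ, E') ∞ {z : M // f z = c} := by
    refine isManifold_of_contDiffOn _ _ _ ?_
    rintro _ _ ⟨x, rfl⟩ ⟨x', rfl⟩
    intro u hu
    simp only [modelWithCornersSelf_coe, modelWithCornersSelf_coe_symm, Set.preimage_id,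
      Set.range_id, Set.inter_univ, Function.id_comp, Function.comp_id] at hu ⊢
    refine ContDiffAt.contDiffWithinAt ?_
    rw [OpenPartialHomeomorph.trans_source] at hu
    have hu1 : ((0, u) : ℝ × E') ∈ (Q x).target := hu.1
    have hu2 : (Q x).symm (0, u) ∈ (Q x').source := by
      rw [← sliceChartRestr_symm (Q x) (hQ1 x) x hu1]
      exact hu.2
    have h1 : ContMDiffAt 𝓘(ℝ, E') 𝓘(ℝ, ℝ × E') ∞ (fun u => ((0, u) : ℝ × E')) u :=
      (contDiffAt_const.prodMk contDiffAt_id).contMDiffAt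
    have h2 : ContMDiffAt 𝓘(ℝ, E') 𝓘(ℝ, ℝ × E') ∞ (fun u => Q x' ((Q x).symm (0, u))) u :=
      (hQs x' _ hu2).comp u ((hQs' x _ hu1).comp u h1)
    have h3 : ContDiffAt ℝ ∞ (fun u => (Q x' ((Q x).symm (0, u))).2) u :=
      contDiffAt_snd.comp u h2.contDiffAt
    refine h3.congr_of_eventuallyEq ?_
    filter_upwards [(κ x).open_target.mem_nhds hu.1] with v hv
    have := sliceChartRestr_symm (Q x) (hQ1 x) x hv
    change (Q x' ((κ x).symm v).1).2 = _
    rw [this]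
  refine ⟨cs, hman, hdim, Topology.IsEmbedding.subtypeVal, ?_, ?_, ?_⟩
  · intro x
    rw [Subtype.range_val_subtype]
    rfl
  · intro x
    have hx := mem_extChartAt_source (I := 𝓘(ℝ, E')) x
    have h0 : ((0, extChartAt 𝓘(ℝ, E') x x) : ℝ × E') ∈ (Q x).target :=
      (κ x).map_source (hQx x)
    have h1 : ContMDiffAt 𝓘(ℝ, E') 𝓘(ℝ, ℝ × E') ∞ (fun u => ((0, u) : ℝ × E'))
        (extChartAt 𝓘(ℝ, E') x x) := (contDiffAt_const.prodMk contDiffAt_id).contMDiffAt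
    have h2 := ((hQs' x _ h0).comp _ h1).comp x (contMDiffAt_chart hx)
    refine h2.congr_of_eventuallyEq ?_
    filter_upwards [(κ x).open_source.mem_nhds (hQx x)] with z hz
    have h3 : ((0, (Q x z.1).2) : ℝ × E') = Q x z.1 :=
      Prod.ext (by rw [hQ1 x _ hz, z.2, sub_self]) rfl
    change z.1 = (Q x).symm (0, (Q x z.1).2)
    rw [h3, (Q x).left_inv hz]
  · intro x
    refine ⟨fun m => (extChartAt 𝓘(ℝ, E') x).symm (Q x m).2, ?_, ?_⟩
    · have h1 : ContMDiffAt I 𝓘(ℝ, E') ∞ (fun m => (Q x m).2) x.1 :=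
        contDiffAt_snd.contMDiffAt.comp x.1 (hQs x x.1 (hQx x))
      have h2 := contMDiffAt_chart_symm (I := 𝓘(ℝ, E')) (mem_extChartAt_target x)
      exact ContMDiffAt.comp (g := (extChartAt 𝓘(ℝ, E') x).symm) x.1 h2 h1
    · filter_upwards [(isOpen_extChartAt_source (I := 𝓘(ℝ, E')) x).mem_nhds
        (mem_extChartAt_source x)] with z hz
      exact (extChartAt 𝓘(ℝ, E') x).left_inv hz

end LevelSet

/-! ### The index of an orthogonal complement -/

section Index

lemma finrank_le_sigPos {E F : Type*} [AddCommGroup E] [Module ℝ E] [FiniteDimensional ℝ E]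
    [AddCommGroup F] [Module ℝ F] [FiniteDimensional ℝ F] (Q : QuadraticForm ℝ E) (ψ : F →ₗ[ℝ] E)
    (h : ∀ v, v ≠ 0 → 0 < Q (ψ v)) : Module.finrank ℝ F ≤ sigPos Q := by
  have hinj : Function.Injective ψ := by
    rw [← LinearMap.ker_eq_bot, LinearMap.ker_eq_bot']
    intro v hv
    by_contra hne
    have := h v hne
    rw [hv, map_zero] at this
    exact lt_irrefl _ this
  rw [← LinearMap.finrank_range_of_inj hinj]
  refine le_sigPos_of_posDef Q ?_
  rintro ⟨w, v, rfl⟩ hw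
  refine h v ?_
  rintro rfl
  exact hw (Subtype.ext (map_zero ψ))

variable {E : Type*} [NormedAddCommGroup E] [NormedSpace ℝ E] [FiniteDimensional ℝ E]
  {E' : Type*} [NormedAddCommGroup E'] [NormedSpace ℝ E'] [FiniteDimensional ℝ E']

def quadForm (B : E →L[ℝ] E →L[ℝ] ℝ) : QuadraticForm ℝ E :=
  LinearMap.BilinMap.toQuadraticMap
    ((ContinuousLinearMap.coeLM ℝ).comp B.toLinearMap : E →ₗ[ℝ] E →ₗ[ℝ] ℝ)

lemma quadForm_apply (B : E →L[ℝ] E →L[ℝ] ℝ) (v : E) : quadForm B v = B v v := rfl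

lemma sigPos_add_sigNeg (B : E →L[ℝ] E →L[ℝ] ℝ) (hs : ∀ v w, B v w = B w v)
    (hB : ∀ v, (∀ w, B v w = 0) → v = 0) :
    sigPos (quadForm B) + sigNeg (quadForm B) = Module.finrank ℝ E := by
  have h := QuadraticForm.sigPos_add_sigNeg_add_radical (Q := quadForm B)
  have hr : (quadForm B).radical = ⊥ := by
    rw [Submodule.eq_bot_iff]
    intro v hv
    refine hB v fun w => ?_
    obtain ⟨h0, h1⟩ := QuadraticMap.mem_radical_iff'.1 hv
    have h1 := h1 w
    simp only [quadForm_apply, map_add, add_apply] at h0 h1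
    rw [hs w v] at h1
    linarith
  rw [hr, finrank_bot] at h
  simpa using h

/-- The index of the orthogonal complement of a non-isotropic vector. -/
lemma index_orthogonal {B : E →L[ℝ] E →L[ℝ] ℝ} (hs : ∀ v w, B v w = B w v)
    (hB : ∀ v, (∀ w, B v w = 0) → v = 0) {B' : E' →L[ℝ] E' →L[ℝ] ℝ}
    (hs' : ∀ v w, B' v w = B' w v) (hB' : ∀ v, (∀ w, B' v w = 0) → v = 0)
    (hdim : Module.finrank ℝ E = Module.finrank ℝ E' + 1) (j : E' →L[ℝ] E) {T : E} {c : ℝ}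
    (hc : c ≠ 0) (hT : B T T = c) (hj : ∀ u v, B (j u) (j v) = B' u v) (hjT : ∀ u, B (j u) T = 0) :
    index B = index B' + if c < 0 then 1 else 0 := by
  have h1 := sigPos_add_sigNeg B hs hB
  have h2 := sigPos_add_sigNeg B' hs' hB'
  have hval : ∀ u a, B (j u + a • T) (j u + a • T) = B' u u + a ^ 2 * c := by
    intro u a
    simp only [map_add, map_smul, add_apply, smul_apply, smul_eq_mul, hj, hjT, hT, hs T (j u)]
    ring
  obtain ⟨Vp, hVp, hVp'⟩ := exists_finrank_eq_sigPos_and_posDef (quadForm B')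
  obtain ⟨Vn, hVn, hVn'⟩ := exists_finrank_eq_sigNeg_and_negDef (quadForm B')
  have hpos : ∀ v : Vp, v ≠ 0 → 0 < B' v v := fun v hv => hVp' v hv
  have hneg : ∀ v : Vn, v ≠ 0 → 0 < -B' v v := fun v hv => hVn' v hv
  have hneg' : ∀ v : E, (-quadForm B) v = -B v v := fun v => rfl
  -- Neither part of the signature decreases when passing from B' to B, and the part with the sign
  -- of c grows by at least one. The totals are the dimensions, which differ by one, so the index is
  -- determined.
  have p0 : sigPos (quadForm B') ≤ sigPos (quadForm B) := by
    rw [← hVp]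
    refine finrank_le_sigPos _ (j.toLinearMap ∘ₗ Vp.subtype) fun v hv => ?_
    have := hpos v hv
    rwa [← hj] at this
  have n0 : sigNeg (quadForm B') ≤ sigNeg (quadForm B) := by
    rw [← hVn, ← sigPos_neg]
    refine finrank_le_sigPos _ (j.toLinearMap ∘ₗ Vn.subtype) fun v hv => ?_
    have := hneg v hv
    rwa [← hj] at this
  have hcop : ∀ (V : Submodule ℝ E') (p : V × ℝ), (j.toLinearMap ∘ₗ V.subtype).coprod
    (LinearMap.toSpanSingleton ℝ E T) p = j p.1 + p.2 • T := fun V p => by simp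
  have hne : ∀ {V : Submodule ℝ E'} {p : V × ℝ}, p ≠ 0 → p.1 ≠ 0 ∨ p.2 ≠ 0 := by
    intro V p hp
    by_contra hcon
    push Not at hcon
    exact hp (Prod.ext hcon.1 hcon.2)
  change sigNeg (quadForm B) = sigNeg (quadForm B') + _
  rcases lt_or_gt_of_ne hc with hlt | hgt
  · have n1 : sigNeg (quadForm B') + 1 ≤ sigNeg (quadForm B) := by
      have : Module.finrank ℝ (Vn × ℝ) = sigNeg (quadForm B') + 1 := by
        rw [Module.finrank_prod, hVn, Module.finrank_self]
      rw [← this, ← sigPos_neg]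
      refine finrank_le_sigPos _ ((j.toLinearMap ∘ₗ Vn.subtype).coprod
        (LinearMap.toSpanSingleton ℝ E T)) fun p hp => ?_
      rw [hcop, hneg', hval]
      rcases eq_or_ne p.1 0 with h0 | h0
      · have h3 := (hne hp).resolve_left (by simpa using h0)
        have h4 : 0 < p.2 ^ 2 := by positivity
        rw [h0]
        simp
        nlinarith
      · have h3 := hneg p.1 h0
        nlinarith [sq_nonneg p.2]
    rw [if_pos hlt]
    omega
  · have n1 : sigPos (quadForm B') + 1 ≤ sigPos (quadForm B) := by
      have : Module.finrank ℝ (Vp × ℝ) = sigPos (quadForm B') + 1 := by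
        rw [Module.finrank_prod, hVp, Module.finrank_self]
      rw [← this]
      refine finrank_le_sigPos _ ((j.toLinearMap ∘ₗ Vp.subtype).coprod
        (LinearMap.toSpanSingleton ℝ E T)) fun p hp => ?_
      rw [hcop, quadForm_apply, hval]
      rcases eq_or_ne p.1 0 with h0 | h0
      · have h3 := (hne hp).resolve_left (by simpa using h0)
        have h4 : 0 < p.2 ^ 2 := by positivity
        rw [h0]
        simp
        nlinarith
      · have h3 := hpos p.1 h0
        nlinarith [sq_nonneg p.2]
    rw [if_neg (by linarith)]
    omega

end Index

/-! ### The flow of the normalized gradient -/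

section WarpFlow

variable {E : Type*} [NormedAddCommGroup E] [NormedSpace ℝ E] [FiniteDimensional ℝ E]
  {H : Type*} [TopologicalSpace H] {I : ModelWithCorners ℝ E H} [I.Boundaryless]
  {M : Type*} [TopologicalSpace M] [ChartedSpace H M] [IsManifold I ∞ M]

variable (I) in
/-- A solution `f` of the Hessian equation with `f = F(s)` on the open set `U` and
`g(ξ, ξ) = -κ F'(s)²` there, for a solution `F` of `F'' = F` with positive derivative `F₁`. -/
structure WarpData (g : BilinField I M) (f : M → ℝ) (ξ : M → E) (κ : ℝ) (F F₁ : ℝ → ℝ) (U : Set M)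
    (s : M → ℝ) : Prop where
  data : HessianData I g f ξ κ
  sq : κ * κ = 1
  hasDerivAt : ∀ t, HasDerivAt F (F₁ t) t
  hasDerivAt₁ : ∀ t, HasDerivAt F₁ (F t) t
  contDiff : ContDiff ℝ ∞ F₁
  pos : ∀ t, 0 < F₁ t
  one : F₁ 0 = 1
  isOpen : IsOpen U
  smooth : ∀ x ∈ U, ContMDiffAt I 𝓘(ℝ, ℝ) ∞ s x
  eq : ∀ x ∈ U, f x = F (s x)
  mem : ∀ x t, f x = F t → x ∈ U
  norm : ∀ x ∈ U, form I g x (ξ x) (ξ x) = -κ * F₁ (s x) ^ 2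

/-- The normalized gradient. -/
def warpField (ξ : M → E) (κ : ℝ) (F₁ : ℝ → ℝ) (s : M → ℝ) (x : M) : E :=
  -(κ / F₁ (s x)) • ξ x

variable {g : BilinField I M} {f : M → ℝ} {ξ : M → E} {κ : ℝ} {F F₁ : ℝ → ℝ} {U : Set M} {s : M → ℝ}

namespace WarpData

lemma ne (h : WarpData I g f ξ κ F F₁ U s) (t : ℝ) : F₁ t ≠ 0 := (h.pos t).ne'

lemma injective (h : WarpData I g f ξ κ F F₁ U s) : Function.Injective F :=
  (strictMono_of_deriv_pos fun t => by rw [(h.hasDerivAt t).deriv]; exact h.pos t).injective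

lemma mdifferentiableAt (h : WarpData I g f ξ κ F F₁ U s) {x : M} (hx : x ∈ U) :
    MDifferentiableAt I 𝓘(ℝ, ℝ) s x := (h.smooth x hx).mdifferentiableAt (by simp)

lemma eq_of_eq (h : WarpData I g f ξ κ F F₁ U s) {x : M} {t : ℝ} (hx : f x = F t) : s x = t :=
  h.injective (by rw [← h.eq x (h.mem x t hx), hx])

lemma md_eq (h : WarpData I g f ξ κ F F₁ U s) {x : M} (hx : x ∈ U) (v : E) :
    md I 𝓘(ℝ, ℝ) f x v = F₁ (s x) * md I 𝓘(ℝ, ℝ) s x v := by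
  have h1 : f =ᶠ[𝓝 x] fun z => F (s z) := by
    filter_upwards [h.isOpen.mem_nhds hx] with z hz using h.eq z hz
  have h2 : MDifferentiableAt 𝓘(ℝ, ℝ) 𝓘(ℝ, ℝ) F (s x) :=
    (h.hasDerivAt (s x)).differentiableAt.mdifferentiableAt
  rw [md_congr h1, md_comp_apply (f := F) (h := s) (x := x) h2 (h.mdifferentiableAt hx),
    md_eq_fderiv, (h.hasDerivAt (s x)).hasFDerivAt.fderiv]
  simp [mul_comm]

/-- As df = F₁(s) ds, the field T = -(κ / F₁(s)) ξ is -κ times the gradient of s. With κ² = 1 this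
leads to ds(T) = 1 and g(T, T) = -κ. -/
lemma form_field (h : WarpData I g f ξ κ F F₁ U s) {x : M} (hx : x ∈ U) (v : E) :
    form I g x (warpField ξ κ F₁ s x) v = -κ * md I 𝓘(ℝ, ℝ) s x v := by
  have := h.ne (s x)
  rw [warpField, map_smul, smul_apply, h.data.grad, h.md_eq hx, smul_eq_mul]
  field_simp

lemma md_field (h : WarpData I g f ξ κ F F₁ U s) {x : M} (hx : x ∈ U) :
    md I 𝓘(ℝ, ℝ) s x (warpField ξ κ F₁ s x) = 1 := by
  have h0 := h.ne (s x)
  have h1 := h.md_eq hx (warpField ξ κ F₁ s x)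
  rw [← h.data.grad, warpField, map_smul, h.norm x hx, smul_eq_mul, ← warpField] at h1
  have h2 : -(κ / F₁ (s x)) * (-κ * F₁ (s x) ^ 2) = F₁ (s x) * 1 := by
    field_simp
    linear_combination h.sq
  exact (mul_left_cancel₀ h0 (h2.symm.trans h1)).symm

lemma form_field_self (h : WarpData I g f ξ κ F F₁ U s) {x : M} (hx : x ∈ U) :
    form I g x (warpField ξ κ F₁ s x) (warpField ξ κ F₁ s x) = -κ := by
  rw [h.form_field hx, h.md_field hx, mul_one]

/-- The normalized gradient in a chart. -/
lemma chartField_eq (h : WarpData I g f ξ κ F F₁ U s) {x₀ : M} {y : E}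
    (hy : y ∈ (extChartAt I x₀).target) : chartField I (warpField ξ κ F₁ s) x₀ y =
      -(κ / F₁ (inChart I s x₀ y)) • localGrad (chartMetric I g x₀) (inChart I f x₀) y := by
  have h1 := h.data.grad_in_chart ((extChartAt I x₀).map_target hy)
  rw [(extChartAt I x₀).right_inv hy] at h1
  rw [chartField, warpField, map_smul, h1]
  rfl

lemma contDiffAt_inChart_s (h : WarpData I g f ξ κ F F₁ U s) {x₀ : M} {y : E}
    (hy : y ∈ (extChartAt I x₀).target) (hU : (extChartAt I x₀).symm y ∈ U) :
    ContDiffAt ℝ ∞ (inChart I s x₀) y := contDiffAt_inChart hy (h.smooth _ hU)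

lemma smoothFieldOn (h : WarpData I g f ξ κ F F₁ U s) :
    SmoothFieldOn I (warpField ξ κ F₁ s) U := by
  intro x₀ y hy hU
  have hloc := h.data.isHessianOn x₀
  have h1 := (hloc.contDiffOn_localGrad y hy).contDiffAt (hloc.metric.mem_nhds hy)
  have h2 : ContDiffAt ℝ ∞ (fun y => F₁ (inChart I s x₀ y)) y :=
    h.contDiff.contDiffAt.comp y (h.contDiffAt_inChart_s hy hU)
  refine (((contDiffAt_const (c := κ)).div h2 (h.ne _)).neg.smul h1).congr_of_eventuallyEq ?_
  filter_upwards [(isOpen_target x₀).mem_nhds hy] with z hz using h.chartField_eq hz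

/-- The integral curves of the normalized gradient are geodesics. -/
lemma exists_flow [T2Space M] (h : WarpData I g f ξ κ F F₁ U s)
    (hc : IsGeodesicallyComplete I g) :
    ∃ φ : ℝ → M → M, IsFlow I (warpField ξ κ F₁ s) U φ ∧ ∀ x ∈ U, ∀ t, s (φ t x) = s x + t := by
  choose γ hγ h0 hv using fun x => hc.exists_geodesic x (warpField ξ κ F₁ s x)
  have hu : IsOpen (Set.univ : Set ℝ) := isOpen_univ
  -- The geodesic of T has energy -κ, so (f ∘ γ)'' = f ∘ γ; the translate of F solves the same
  -- equation with the same initial data.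
  have key : ∀ x ∈ U, ∀ t, f (γ x t) = F (s x + t) := by
    intro x hx t
    have hen : ∀ t, energy I g (γ x) t = -κ := fun t => by
      rw [(hγ x).energy_eq h.data.metric hu Set.ordConnected_univ (Set.mem_univ t) (Set.mem_univ 0),
        energy, hv, h0, h.form_field_self hx]
    refine (oscillator_unique (k := -1) (y := fun t => f (γ x t))
      (y' := fun t => md I 𝓘(ℝ, ℝ) f (γ x t) (vel I (γ x) t)) (z := fun t => F (s x + t))
      (z' := fun t => F₁ (s x + t))
      (fun t => (hγ x).hasDerivAt_comp h.data.contMDiff hu (Set.mem_univ t)) (fun t => ?_)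
      (fun t => (h.hasDerivAt _).comp_const_add (s x) t)
      (fun t => by simpa using (h.hasDerivAt₁ _).comp_const_add (s x) t) (t₀ := 0) ?_ ?_ t).1
    · have := (hγ x).hasDerivAt_deriv_comp h.data.metric h.data.contMDiff h.data.hess hu
        (Set.mem_univ t)
      refine this.congr_deriv ?_
      rw [hen]
      linear_combination f (γ x t) * h.sq
    · simp only [h0, add_zero, h.eq x hx]
    · simp only [h0, hv, add_zero]
      rw [h.md_eq hx, h.md_field hx, mul_one]
  have hs : ∀ x ∈ U, ∀ t, s (γ x t) = s x + t := fun x hx t => h.eq_of_eq (key x hx t)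
  have hm : ∀ x ∈ U, ∀ t, γ x t ∈ U := fun x hx t => h.mem _ _ (key x hx t)
  refine ⟨fun t x => γ x t, ⟨h.isOpen, h.smoothFieldOn, fun x _ => h0 x, hm, fun x hx t =>
    ⟨(hγ x).mdifferentiableAt hu (Set.mem_univ t), ?_⟩⟩, hs⟩
  -- Now ξ = -κ F₁(s + t) γ' along the geodesic, which inverts to γ' = T: the geodesic is an
  -- integral curve, and it is defined for all times.
  have h1 := h.data.grad_eq_smul_vel (hγ x) hu Set.ordConnected_univ
    (b := fun t => -κ * F₁ (s x + t)) (fun t _ => ?_) (t₀ := 0) (Set.mem_univ 0) ?_ (Set.mem_univ t)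
  · rw [warpField, h1, hs x hx, smul_smul]
    have h2 : -(κ / F₁ (s x + t)) * (-κ * F₁ (s x + t)) = 1 := by
      have := h.ne (s x + t)
      field_simp
      linear_combination h.sq
    rw [h2, one_smul]
  · refine (((h.hasDerivAt₁ _).comp_const_add (s x) t).const_mul (-κ)).congr_deriv ?_
    rw [key x hx]
    ring
  · rw [h0, hv, warpField, add_zero, smul_smul]
    have h2 : -κ * F₁ (s x) * -(κ / F₁ (s x)) = 1 := by
      have := h.ne (s x)
      field_simp
      linear_combination h.sq
    rw [h2, one_smul]

end WarpData
end WarpFlow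

/-! ### The flow of the normalized gradient is conformal on the level sets -/

section Conformal

/-- If ∇W = a W and ∇W' = a W' along c, their product grows at the rate 2a by metric compatibility.
This gives the conformal factor of the flow. -/
lemma IsMetricOn.hasDerivAt_apply {E : Type*} [NormedAddCommGroup E] [NormedSpace ℝ E]
    {G : E → E →L[ℝ] E →L[ℝ] ℝ} {O : Set E} (hG : IsMetricOn G O) {c W W' : ℝ → E} {t a : ℝ} {X : E}
    (hc : HasDerivAt c X t) (ht : c t ∈ O)
    (hW : HasDerivAt W (-christoffel G (c t) (W t) X + a • W t) t)
    (hW' : HasDerivAt W' (-christoffel G (c t) (W' t) X + a • W' t) t) :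
    HasDerivAt (fun τ => G (c τ) (W τ) (W' τ)) (2 * a * G (c t) (W t) (W' t)) t := by
  have h1 := (((hG.differentiableAt ht).hasFDerivAt.comp_hasDerivAt t hc).clm_apply hW).clm_apply hW'
  refine h1.congr_deriv ?_
  rw [hG.christoffel_symm ht (W t), hG.christoffel_symm ht (W' t)]
  simp only [add_apply, Function.comp_def, map_neg, neg_apply, map_add, map_smul, smul_apply,
    hG.fderiv_eq ht, smul_eq_mul]
  ring

variable {E : Type*} [NormedAddCommGroup E] [NormedSpace ℝ E] [FiniteDimensional ℝ E]
  {H : Type*} [TopologicalSpace H] {I : ModelWithCorners ℝ E H} [I.Boundaryless]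
  {M : Type*} [TopologicalSpace M] [ChartedSpace H M] [IsManifold I ∞ M]

variable {T : M → E} {U : Set M} {φ : ℝ → M → M}

namespace IsFlow

lemma contMDiffAt_snd [T2Space M] (h : IsFlow I T U φ) {x : M} (hx : x ∈ U) (t : ℝ) :
    ContMDiffAt I I ∞ (φ t) x :=
  ContMDiffAt.comp (g := Function.uncurry φ) (f := fun x' : M => ((t, x') : ℝ × M)) x
    (h.contMDiffAt hx t) (contMDiffAt_const.prodMk contMDiffAt_id)

lemma mdifferentiableAt_snd [T2Space M] (h : IsFlow I T U φ) {x : M} (hx : x ∈ U) (t : ℝ) :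
    MDifferentiableAt I I (φ t) x := (h.contMDiffAt_snd hx t).mdifferentiableAt (by simp)

/-- The derivative of a flow solves the linearized equation. -/
lemma hasDerivAt_md [T2Space M] (h : IsFlow I T U φ) {x : M} (hx : x ∈ U) {t : ℝ} {x₀ : M}
    (hx₀ : φ t x ∈ (extChartAt I x₀).source) (u : E) :
    HasDerivAt (fun τ => md I 𝓘(ℝ, E) (extChartAt I x₀) (φ τ x) (md I I (φ τ) x u))
      (fderiv ℝ (chartField I T x₀) (extChartAt I x₀ (φ t x))
        (md I 𝓘(ℝ, E) (extChartAt I x₀) (φ t x) (md I I (φ t) x u))) t := by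
  set y₀ := extChartAt I x x with hy₀
  have hy₀t : y₀ ∈ (extChartAt I x).target := mem_extChartAt_target x
  have hsy : (extChartAt I x).symm y₀ = x := extChartAt_to_inv x
  set Y : ℝ × E → E := fun q => extChartAt I x₀ (φ q.1 ((extChartAt I x).symm q.2)) with hY
  have hψ : ∀ q : ℝ × E, q.2 ∈ (extChartAt I x).target → (extChartAt I x).symm q.2 ∈ U →
      ContMDiffAt 𝓘(ℝ, ℝ × E) I ∞ (fun q : ℝ × E => φ q.1 ((extChartAt I x).symm q.2)) q := by
    intro q hq hqU
    have h1 : ContMDiffAt 𝓘(ℝ, ℝ × E) (𝓘(ℝ, ℝ).prod I) ∞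
        (fun q : ℝ × E => ((q.1, (extChartAt I x).symm q.2) : ℝ × M)) q := by
      have h3 : ContMDiffAt 𝓘(ℝ, ℝ × E) 𝓘(ℝ, E) ∞ (Prod.snd : ℝ × E → E) q :=
        contDiffAt_snd.contMDiffAt
      have h2 : ContMDiffAt 𝓘(ℝ, ℝ × E) I ∞ (fun q : ℝ × E => (extChartAt I x).symm q.2) q :=
        ContMDiffAt.comp (g := (extChartAt I x).symm) (f := (Prod.snd : ℝ × E → E)) q
          (contMDiffAt_chart_symm hq) h3
      exact (contDiffAt_fst.contMDiffAt).prodMk h2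
    exact ContMDiffAt.comp (g := Function.uncurry φ) q (h.contMDiffAt hqU q.1) h1
  have hev : ∀ᶠ q in 𝓝 ((t, y₀) : ℝ × E), q.2 ∈ (extChartAt I x).target ∧
      (extChartAt I x).symm q.2 ∈ U ∧ φ q.1 ((extChartAt I x).symm q.2) ∈
        (extChartAt I x₀).source := by
    have h1 : ∀ᶠ q in 𝓝 ((t, y₀) : ℝ × E), q.2 ∈ (extChartAt I x).target :=
      continuousAt_snd.preimage_mem_nhds ((isOpen_target x).mem_nhds hy₀t)
    have h2 : ContinuousAt (fun q : ℝ × E => (extChartAt I x).symm q.2) (t, y₀) :=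
      ContinuousAt.comp (g := (extChartAt I x).symm) (contMDiffAt_chart_symm hy₀t).continuousAt
        continuousAt_snd
    have h3 := h2.preimage_mem_nhds (h.isOpen.mem_nhds (by simpa only [hsy] using hx))
    have h4 := (hψ (t, y₀) hy₀t (by simpa only [hsy] using hx)).continuousAt.preimage_mem_nhds
      ((isOpen_extChartAt_source (I := I) x₀).mem_nhds (by simpa only [hsy] using hx₀))
    filter_upwards [h1, h3, h4] with q a b c using ⟨a, b, c⟩
  have hYs : ContDiffAt ℝ ∞ Y (t, y₀) :=
    contDiffAt_chart_comp (hψ _ hev.self_of_nhds.1 hev.self_of_nhds.2.1) le_rfl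
      hev.self_of_nhds.2.2
  have hYd : ∀ᶠ q in 𝓝 ((t, y₀) : ℝ × E), DifferentiableAt ℝ Y q :=
    eventually_differentiableAt (hYs.of_le two_le_infty)
  have hDt : ∀ᶠ q in 𝓝 ((t, y₀) : ℝ × E),
      fderiv ℝ Y q (1, 0) = chartField I T x₀ (Y q) := by
    filter_upwards [hev, hYd] with q hq hqd
    have h1 : HasDerivAt (fun τ : ℝ => ((τ, q.2) : ℝ × E)) (1, 0) q.1 :=
      (hasDerivAt_id q.1).prodMk (hasDerivAt_const q.1 q.2)
    have h2 : HasDerivAt (fun τ => Y (τ, q.2)) (fderiv ℝ Y q (1, 0)) q.1 :=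
      HasFDerivAt.comp_hasDerivAt (l := Y) (f := fun τ : ℝ => ((τ, q.2) : ℝ × E)) q.1
        hqd.hasFDerivAt h1
    exact h2.unique ((h.integral _ hq.2.1 q.1).hasDerivAt_chart hq.2.2)
  have hDx : ∀ᶠ τ in 𝓝 t, fderiv ℝ Y (τ, y₀) (0, u) =
      md I 𝓘(ℝ, E) (extChartAt I x₀) (φ τ x) (md I I (φ τ) x u) := by
    have hc : ContinuousAt (fun τ : ℝ => ((τ, y₀) : ℝ × E)) t := by fun_prop
    filter_upwards [hc.eventually hev, hc.eventually hYd] with τ hτ hτd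
    have hh : HasFDerivAt (fun z : E => ((τ, z) : ℝ × E))
        ((0 : E →L[ℝ] ℝ).prod (ContinuousLinearMap.id ℝ E)) y₀ :=
      (hasFDerivAt_const τ y₀).prodMk (hasFDerivAt_id y₀)
    have h2 : HasFDerivAt (fun z => Y (τ, z)) ((fderiv ℝ Y (τ, y₀)).comp
        ((0 : E →L[ℝ] ℝ).prod (ContinuousLinearMap.id ℝ E))) y₀ :=
      HasFDerivAt.comp (g := Y) (f := fun z : E => ((τ, z) : ℝ × E)) y₀ hτd.hasFDerivAt hh
    have h3 := congrArg (fun l : E →L[ℝ] E => l u) h2.fderiv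
    have h5 : MDifferentiableAt I I (φ τ) ((extChartAt I x).symm y₀) := by
      rw [hsy]
      exact h.mdifferentiableAt_snd hx τ
    have h4 : MDifferentiableAt 𝓘(ℝ, E) I (fun z => φ τ ((extChartAt I x).symm z)) y₀ :=
      MDifferentiableAt.comp (g := φ τ) (f := (extChartAt I x).symm) y₀ h5
        (mdifferentiableAt_chart_symm hy₀t)
    have h6 := fderiv_chart_comp (x₀ := x₀) h4 (by simpa only [hsy] using hτ.2.2) u
    rw [md_comp_apply (f := φ τ) (h := (extChartAt I x).symm) (x := y₀) h5
      (mdifferentiableAt_chart_symm hy₀t), md_chart_symm_self, hsy] at h6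
    exact (h3.symm.trans h6)
  -- The linearized equation is an interchange of derivatives: ∂_t ∂_u Y = ∂_u ∂_t Y = ∂_u (T ∘ Y).
  have hsymm : IsSymmSndFDerivAt ℝ Y (t, y₀) :=
    hYs.isSymmSndFDerivAt (by simpa using two_le_infty)
  have hD : HasFDerivAt (fderiv ℝ Y) (fderiv ℝ (fderiv ℝ Y) (t, y₀)) (t, y₀) :=
    (((hYs.of_le two_le_infty).fderiv_right (m := 1) (by norm_num)).differentiableAt
      (by simp)).hasFDerivAt
  have h1 : HasDerivAt (fun τ : ℝ => ((τ, y₀) : ℝ × E)) (1, 0) t :=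
    (hasDerivAt_id t).prodMk (hasDerivAt_const t y₀)
  have h2 : HasDerivAt (fun τ => fderiv ℝ Y (τ, y₀) (0, u))
      (fderiv ℝ (fderiv ℝ Y) (t, y₀) (1, 0) (0, u)) t := by
    have := (HasFDerivAt.comp_hasDerivAt (l := fderiv ℝ Y) (f := fun τ : ℝ => ((τ, y₀) : ℝ × E)) t
      hD h1).clm_apply (hasDerivAt_const t ((0, u) : ℝ × E))
    simpa using this
  have h3 : HasDerivAt (fun τ => fderiv ℝ Y (τ, y₀) (0, u))
      (fderiv ℝ (chartField I T x₀) (Y (t, y₀)) (fderiv ℝ Y (t, y₀) (0, u))) t := by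
    refine h2.congr_deriv ?_
    rw [hsymm.eq]
    have hF : ContDiffAt ℝ ∞ (chartField I T x₀) (Y (t, y₀)) := by
      refine h.smooth x₀ _ ((extChartAt I x₀).map_source hev.self_of_nhds.2.2) ?_
      rw [(extChartAt I x₀).left_inv hev.self_of_nhds.2.2]
      exact h.mem _ hev.self_of_nhds.2.1 _
    have h4 : HasFDerivAt (fun q => fderiv ℝ Y q (1, 0))
        ((fderiv ℝ (chartField I T x₀) (Y (t, y₀))).comp (fderiv ℝ Y (t, y₀))) (t, y₀) :=
      (HasFDerivAt.comp (g := chartField I T x₀) (f := Y) (t, y₀)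
        (hF.differentiableAt (by simp)).hasFDerivAt
        (hYs.differentiableAt (by simp)).hasFDerivAt).congr_of_eventuallyEq hDt
    have h5 := hD.clm_apply (hasFDerivAt_const ((1, 0) : ℝ × E) ((t, y₀) : ℝ × E))
    have h6 := congrArg (fun l : (ℝ × E) →L[ℝ] E => l (0, u)) (h5.unique h4)
    simpa using h6
  have h4 := h3.congr_of_eventuallyEq (f₁ := fun τ => md I 𝓘(ℝ, E) (extChartAt I x₀) (φ τ x)
    (md I I (φ τ) x u)) (hDx.mono fun τ hτ => hτ.symm)
  refine h4.congr_deriv ?_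
  rw [hDx.self_of_nhds]
  simp only [hY, hsy]

end IsFlow

variable {g : BilinField I M} {f : M → ℝ} {ξ : M → E} {κ : ℝ} {F F₁ : ℝ → ℝ} {s : M → ℝ}

namespace WarpData

/-- Level sets are umbilic: for w tangent to them the coefficient -κ / F₁(s) is constant in the
direction w, so ∇_w T = (F / F₁) w follows from ∇_w ξ = -κ F w. -/
lemma fderiv_chartField (h : WarpData I g f ξ κ F F₁ U s) {x₀ : M} {y : E}
    (hy : y ∈ (extChartAt I x₀).target) (hU : (extChartAt I x₀).symm y ∈ U) {w : E}
    (hw : fderiv ℝ (inChart I s x₀) y w = 0) :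
    fderiv ℝ (chartField I (warpField ξ κ F₁ s) x₀) y w =
      -christoffel (chartMetric I g x₀) y w (chartField I (warpField ξ κ F₁ s) x₀ y)
        + (F (inChart I s x₀ y) / F₁ (inChart I s x₀ y)) • w := by
  have hloc := h.data.isHessianOn x₀
  have h1 := (hloc.differentiableAt_localGrad hy).hasFDerivAt
  have h2 := ((h.contDiffAt_inChart_s hy hU).differentiableAt (by simp)).hasFDerivAt
  have h3 : HasDerivAt (fun t => -(κ / F₁ t)) (κ * F (inChart I s x₀ y) /
      F₁ (inChart I s x₀ y) ^ 2) (inChart I s x₀ y) := by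
    refine (((hasDerivAt_const (inChart I s x₀ y) κ).div (h.hasDerivAt₁ _) (h.ne _)).neg).congr_deriv ?_
    simp [neg_div]
  have h4 := (h3.comp_hasFDerivAt y h2).smul h1
  have hev : chartField I (warpField ξ κ F₁ s) x₀ =ᶠ[𝓝 y] fun y => -(κ / F₁ (inChart I s x₀ y)) •
      localGrad (chartMetric I g x₀) (inChart I f x₀) y := by
    filter_upwards [(isOpen_target x₀).mem_nhds hy] with z hz using h.chartField_eq hz
  have h5 := congrArg (fun l : E →L[ℝ] E => l w) (h4.congr_of_eventuallyEq hev).fderiv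
  refine h5.trans ?_
  have hf : inChart I f x₀ y = F (inChart I s x₀ y) := h.eq _ hU
  simp only [add_apply, smul_apply, ContinuousLinearMap.smulRight_apply, Function.comp_apply, hw,
    smul_zero, zero_smul, add_zero, hloc.fderiv_localGrad hy, hev.self_of_nhds, hf,
    ← christoffelCLM_apply, map_smul]
  have h6 := h.ne (inChart I s x₀ y)
  have h7 : F (inChart I s x₀ y) / F₁ (inChart I s x₀ y) =
    -(κ / F₁ (inChart I s x₀ y)) * -(κ * F (inChart I s x₀ y)) := by
    field_simp
    linear_combination -F (inChart I s x₀ y) * h.sq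
  rw [h7]
  module

variable [T2Space M]

lemma md_s_flow (h : WarpData I g f ξ κ F F₁ U s) (hφ : IsFlow I (warpField ξ κ F₁ s) U φ)
    (hs : ∀ x ∈ U, ∀ t, s (φ t x) = s x + t) {x : M} (hx : x ∈ U) (t : ℝ) (u : E) :
    md I 𝓘(ℝ, ℝ) s (φ t x) (md I I (φ t) x u) = md I 𝓘(ℝ, ℝ) s x u := by
  rw [← md_comp_apply (f := s) (h := φ t) (x := x) (h.mdifferentiableAt (hφ.mem x hx t))
    (hφ.mdifferentiableAt_snd hx t)]
  have hev : (fun z => s (φ t z)) =ᶠ[𝓝 x] fun z => s z + t := by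
    filter_upwards [hφ.isOpen.mem_nhds hx] with z hz using hs z hz t
  have h2 : HasDerivAt (fun r : ℝ => r + t) 1 (s x) := (hasDerivAt_id _).add_const t
  rw [md_congr hev, md_comp_apply (f := fun r : ℝ => r + t) (h := s) (x := x)
    h2.differentiableAt.mdifferentiableAt (h.mdifferentiableAt hx), md_eq_fderiv,
    h2.hasFDerivAt.fderiv]
  simp

lemma hasDerivAt_form_flow (h : WarpData I g f ξ κ F F₁ U s)
    (hφ : IsFlow I (warpField ξ κ F₁ s) U φ) (hs : ∀ x ∈ U, ∀ t, s (φ t x) = s x + t) {x : M}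
    (hx : x ∈ U) {u v : E} (hu : md I 𝓘(ℝ, ℝ) s x u = 0) (hv : md I 𝓘(ℝ, ℝ) s x v = 0) (t : ℝ) :
    HasDerivAt (fun τ => form I g (φ τ x) (md I I (φ τ) x u) (md I I (φ τ) x v))
      (2 * (F (s x + t) / F₁ (s x + t)) *
        form I g (φ t x) (md I I (φ t) x u) (md I I (φ t) x v)) t := by
  set x₀ := φ t x with hx₀
  have hsrc : φ t x ∈ (extChartAt I x₀).source := mem_extChartAt_source _
  have htar : extChartAt I x₀ (φ t x) ∈ (extChartAt I x₀).target := (extChartAt I x₀).map_source hsrc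
  have hU : (extChartAt I x₀).symm (extChartAt I x₀ (φ t x)) ∈ U := by
    rw [(extChartAt I x₀).left_inv hsrc]
    exact hφ.mem x hx t
  have hc : HasDerivAt (fun τ => extChartAt I x₀ (φ τ x)) _ t :=
    (hφ.integral x hx t).hasDerivAt_chart hsrc
  have hσ : inChart I s x₀ (extChartAt I x₀ (φ t x)) = s x + t := by
    rw [inChart, (extChartAt I x₀).left_inv hsrc, hs x hx]
  have hW : ∀ u, md I 𝓘(ℝ, ℝ) s x u = 0 →
      HasDerivAt (fun τ => md I 𝓘(ℝ, E) (extChartAt I x₀) (φ τ x) (md I I (φ τ) x u))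
        (-christoffel (chartMetric I g x₀) (extChartAt I x₀ (φ t x))
          (md I 𝓘(ℝ, E) (extChartAt I x₀) (φ t x) (md I I (φ t) x u))
          (chartField I (warpField ξ κ F₁ s) x₀ (extChartAt I x₀ (φ t x)))
          + (F (s x + t) / F₁ (s x + t)) •
            md I 𝓘(ℝ, E) (extChartAt I x₀) (φ t x) (md I I (φ t) x u)) t := by
    intro u hu
    refine (hφ.hasDerivAt_md hx hsrc u).congr_deriv ?_
    rw [h.fderiv_chartField htar hU, hσ]
    rw [md_inChart htar (h.mdifferentiableAt hU), md_chart_symm_comp hsrc,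
      (extChartAt I x₀).left_inv hsrc, h.md_s_flow hφ hs hx, hu]
  have h2 := (h.data.metric.isMetricOn x₀).hasDerivAt_apply hc htar (hW u hu) (hW v hv)
  rw [form_eq_chartMetric g hsrc]
  refine h2.congr_of_eventuallyEq ?_
  have hcont : ContinuousAt (fun τ => φ τ x) t := (hφ.integral x hx t).1.continuousAt
  filter_upwards [hcont.preimage_mem_nhds ((isOpen_extChartAt_source (I := I) x₀).mem_nhds hsrc)]
    with τ hτ
  exact form_eq_chartMetric g hτ _ _

/-- The flow of the normalized gradient is conformal on the level sets. -/
lemma form_flow (h : WarpData I g f ξ κ F F₁ U s)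
    (hφ : IsFlow I (warpField ξ κ F₁ s) U φ) (hs : ∀ x ∈ U, ∀ t, s (φ t x) = s x + t) {x : M}
    (hx : x ∈ U) {u v : E} (hu : md I 𝓘(ℝ, ℝ) s x u = 0) (hv : md I 𝓘(ℝ, ℝ) s x v = 0)
    (hs0 : s x = 0) (t : ℝ) :
    form I g (φ t x) (md I I (φ t) x u) (md I I (φ t) x v) = F₁ t ^ 2 * form I g x u v := by
  set B : ℝ → ℝ := fun τ => form I g (φ τ x) (md I I (φ τ) x u) (md I I (φ τ) x v) with hB
  -- B and F₁² have the same logarithmic derivative 2 F / F₁, because F₁' = F; the quotient is used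
  -- so that B may vanish.
  have h1 : ∀ t, HasDerivAt (fun τ => B τ / F₁ τ ^ 2) 0 t := by
    intro t
    have h2 := h.hasDerivAt_form_flow hφ hs hx hu hv t
    rw [hs0, zero_add] at h2
    refine (h2.div ((h.hasDerivAt₁ t).pow 2) (pow_ne_zero 2 (h.ne t))).congr_deriv ?_
    have := h.ne t
    field_simp
    simp only [Nat.cast_ofNat, Nat.add_one_sub_one, pow_one, Pi.pow_apply]
    ring
  have h2 := is_const_of_deriv_eq_zero (fun t => (h1 t).differentiableAt) (fun t => (h1 t).deriv) t 0
  have h3 : B 0 = form I g x u v := by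
    have h4 : φ 0 =ᶠ[𝓝 x] id := by
      filter_upwards [hφ.isOpen.mem_nhds hx] with z hz using hφ.zero z hz
    simp only [hB, md_congr h4, md_id, hφ.zero x hx]
    rfl
  simp only [h.one, h3] at h2
  have := h.ne t
  change B t = _
  field_simp at h2
  linarith

end WarpData
end Conformal

/-! ### The induced metric on a level set -/

section LevelMetric

variable {E : Type*} [NormedAddCommGroup E] [NormedSpace ℝ E] [FiniteDimensional ℝ E]
  {H : Type*} [TopologicalSpace H] {I : ModelWithCorners ℝ E H} [I.Boundaryless]
  {M : Type*} [TopologicalSpace M] [ChartedSpace H M] [IsManifold I ∞ M]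
  {E' : Type*} [NormedAddCommGroup E'] [NormedSpace ℝ E'] [FiniteDimensional ℝ E']
  {N : Type*} [TopologicalSpace N] [ChartedSpace E' N] [IsManifold 𝓘(ℝ, E') ∞ N]

lemma contDiffAt_chartMetric_pullback {g : BilinField I M} (hg : IsSemiRiemannian I g) {ι : N → M}
    (hι : ContMDiff 𝓘(ℝ, E') I ∞ ι) (z : N) :
    ContDiffAt ℝ ∞ (chartMetric 𝓘(ℝ, E') (pullback 𝓘(ℝ, E') I ι g) z)
      (extChartAt 𝓘(ℝ, E') z z) := by
  set y₀ := extChartAt 𝓘(ℝ, E') z z with hy₀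
  have hy₀t : y₀ ∈ (extChartAt 𝓘(ℝ, E') z).target := mem_extChartAt_target z
  set ψ : E' → M := fun y => ι ((extChartAt 𝓘(ℝ, E') z).symm y) with hψ
  have hψs : ∀ y ∈ (extChartAt 𝓘(ℝ, E') z).target, ContMDiffAt 𝓘(ℝ, E') I ∞ ψ y := fun y hy =>
    (hι _).comp y (contMDiffAt_chart_symm hy)
  have hsrc : ψ y₀ ∈ (extChartAt I (ι z)).source := by
    simp only [hψ, hy₀, extChartAt_to_inv]
    exact mem_extChartAt_source _
  have h1 : ContDiffAt ℝ ∞ (pull (fun y => extChartAt I (ι z) (ψ y)) (chartMetric I g (ι z))) y₀ := by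
    refine contDiffAt_pull (n := ⊤) (by simpa using contDiffAt_chart_comp (hψs y₀ hy₀t) le_rfl hsrc) ?_
    exact (hg.isMetricOn (ι z)).contDiffAt ((extChartAt I (ι z)).map_source hsrc)
  refine h1.congr_of_eventuallyEq ?_
  filter_upwards [(isOpen_target z).mem_nhds hy₀t, (hψs y₀ hy₀t).continuousAt.preimage_mem_nhds
    ((isOpen_extChartAt_source (ι z)).mem_nhds hsrc)] with y hy hy'
  rw [← pullback_eq_pull_chartMetric g ((hψs y hy).mdifferentiableAt (by simp)) hy']
  exact (pullback_comp (f := ι) (h := (extChartAt 𝓘(ℝ, E') z).symm)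
    ((hι _).mdifferentiableAt (by simp)) (mdifferentiableAt_chart_symm hy) g).symm

variable {g : BilinField I M} {f : M → ℝ} {ξ : M → E} {κ : ℝ} {F F₁ : ℝ → ℝ} {U : Set M} {s : M → ℝ}
  {ι : N → M} {c : ℝ}

namespace IsLevelEmbedding

lemma eq_level (hι : IsLevelEmbedding (E' := E') I ι f c) (z : N) : f (ι z) = c :=
  (hι.range_eq _).1 ⟨z, rfl⟩

lemma mdifferentiableAt (hι : IsLevelEmbedding (E' := E') I ι f c) (z : N) :
    MDifferentiableAt 𝓘(ℝ, E') I ι z := (hι.contMDiff z).mdifferentiableAt (by simp)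

lemma md_injective (hι : IsLevelEmbedding (E' := E') I ι f c) (z : N) :
    Function.Injective (md 𝓘(ℝ, E') I ι z) := by
  obtain ⟨r, hr, hrι⟩ := hι.retract z
  refine Function.LeftInverse.injective (g := md I 𝓘(ℝ, E') r (ι z)) fun u => ?_
  rw [← md_comp_apply (f := r) (h := ι) (x := z) (hr.mdifferentiableAt (by simp))
    (hι.mdifferentiableAt z), md_congr (f' := id) hrι, md_id]
  rfl

lemma md_comp_eq_zero (hι : IsLevelEmbedding (E' := E') I ι f c) {z : N}
    (hf : MDifferentiableAt I 𝓘(ℝ, ℝ) f (ι z)) (u : E') :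
    md I 𝓘(ℝ, ℝ) f (ι z) (md 𝓘(ℝ, E') I ι z u) = 0 := by
  rw [← md_comp_apply (f := f) (h := ι) (x := z) hf (hι.mdifferentiableAt z)]
  have : (fun z => f (ι z)) = fun _ => c := funext fun z => hι.eq_level z
  rw [this]
  exact congrArg (fun l : E' →L[ℝ] ℝ => l u) mfderiv_const

/-- A dimension count: the image of dι lies in the kernel of df, and both have the dimension of E'.
-/
lemma exists_md_eq (hι : IsLevelEmbedding (E' := E') I ι f c) {z : N}
    (hf : MDifferentiableAt I 𝓘(ℝ, ℝ) f (ι z)) (hne : md I 𝓘(ℝ, ℝ) f (ι z) ≠ 0) {v : E}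
    (hv : md I 𝓘(ℝ, ℝ) f (ι z) v = 0) : ∃ u, md 𝓘(ℝ, E') I ι z u = v := by
  set L := md I 𝓘(ℝ, ℝ) f (ι z)
  set J := md 𝓘(ℝ, E') I ι z
  have h1 := LinearMap.finrank_range_add_finrank_ker (L : E →ₗ[ℝ] ℝ)
  have h2 : (L : E →ₗ[ℝ] ℝ).range = ⊤ := by
    refine LinearMap.range_eq_top.2 (LinearMap.surjective fun h0 => hne ?_)
    ext v
    exact congrArg (fun l : E →ₗ[ℝ] ℝ => l v) h0
  rw [h2, finrank_top, Module.finrank_self, hι.finrank] at h1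
  have h3 : (J : E' →ₗ[ℝ] E).range ≤ (L : E →ₗ[ℝ] ℝ).ker := by
    rintro _ ⟨u, rfl⟩
    exact hι.md_comp_eq_zero hf u
  have h4 := LinearMap.finrank_range_of_inj (f := (J : E' →ₗ[ℝ] E)) (hι.md_injective z)
  have h5 := Submodule.eq_of_le_of_finrank_eq h3 (by omega)
  have h6 : v ∈ (L : E →ₗ[ℝ] ℝ).ker := hv
  rw [← h5] at h6
  exact h6

end IsLevelEmbedding

namespace WarpData

lemma mem_level (h : WarpData I g f ξ κ F F₁ U s) (hι : IsLevelEmbedding (E' := E') I ι f (F 0)) (z : N) :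
    ι z ∈ U := h.mem _ 0 (hι.eq_level z)

lemma s_level (h : WarpData I g f ξ κ F F₁ U s) (hι : IsLevelEmbedding (E' := E') I ι f (F 0)) (z : N) :
    s (ι z) = 0 := h.eq_of_eq (hι.eq_level z)

lemma md_s_level (h : WarpData I g f ξ κ F F₁ U s) (hι : IsLevelEmbedding (E' := E') I ι f (F 0)) (z : N)
    (u : E') : md I 𝓘(ℝ, ℝ) s (ι z) (md 𝓘(ℝ, E') I ι z u) = 0 := by
  have h1 := h.md_eq (h.mem_level hι z) (md 𝓘(ℝ, E') I ι z u)
  rw [hι.md_comp_eq_zero (h.data.mdifferentiableAt _)] at h1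
  exact (mul_eq_zero.1 h1.symm).resolve_left (h.ne _)

lemma md_ne_zero (h : WarpData I g f ξ κ F F₁ U s) {x : M} (hx : x ∈ U) :
    md I 𝓘(ℝ, ℝ) f x ≠ 0 := by
  intro h0
  have h1 := h.md_eq hx (warpField ξ κ F₁ s x)
  rw [h0, h.md_field hx, mul_one] at h1
  exact h.ne (s x) h1.symm

/-- Tangent vectors along the level set. -/
lemma exists_decomp (h : WarpData I g f ξ κ F F₁ U s) (hι : IsLevelEmbedding (E' := E') I ι f (F 0)) (z : N)
    (v : E) : ∃ u, v = md 𝓘(ℝ, E') I ι z u +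
      md I 𝓘(ℝ, ℝ) s (ι z) v • warpField ξ κ F₁ s (ι z) := by
  have hx := h.mem_level hι z
  obtain ⟨u, hu⟩ := hι.exists_md_eq (z := z) (h.data.mdifferentiableAt _) (h.md_ne_zero hx)
    (v := v - md I 𝓘(ℝ, ℝ) s (ι z) v • warpField ξ κ F₁ s (ι z)) (by
      rw [h.md_eq hx, map_sub, map_smul, h.md_field hx]
      simp)
  exact ⟨u, by rw [hu, sub_add_cancel]⟩

lemma form_field_level (h : WarpData I g f ξ κ F F₁ U s) (hι : IsLevelEmbedding (E' := E') I ι f (F 0)) (z : N)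
    (u : E') : form I g (ι z) (warpField ξ κ F₁ s (ι z)) (md 𝓘(ℝ, E') I ι z u) = 0 := by
  rw [h.form_field (h.mem_level hι z), h.md_s_level hι, mul_zero]

/-- Along the level set the tangent space splits orthogonally into the image of dι and the line of
T, with g(T, T) = -κ ≠ 0. Hence the induced form is nondegenerate, and its index is that of g, less
one if -κ < 0. -/
lemma isSemiRiemannian_level (h : WarpData I g f ξ κ F F₁ U s)
    (hι : IsLevelEmbedding (E' := E') I ι f (F 0)) :
    IsSemiRiemannian 𝓘(ℝ, E') (pullback 𝓘(ℝ, E') I ι g) := by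
  have hnd : ∀ (z : N) (u : E'), (∀ w, form 𝓘(ℝ, E') (pullback 𝓘(ℝ, E') I ι g) z u w = 0) →
      u = 0 := by
    intro z u hu
    refine hι.md_injective z ?_
    rw [map_zero]
    refine h.data.eq_of_form (x := ι z) fun v => ?_
    obtain ⟨w, hw⟩ := h.exists_decomp hι z v
    have h1 := hu w
    rw [form_pullback] at h1
    rw [hw, map_add, map_smul, h1, h.data.symm, h.form_field_level hι]
    simp
  refine ⟨fun z => (contMDiffAt_section_iff _ z).2
    (contDiffAt_chartMetric_pullback h.data.metric hι.contMDiff z),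
    fun z v w => h.data.metric.symm _ _ _, hnd, ?_⟩
  obtain ⟨k, hk⟩ := h.data.metric.constant_index
  -- The truncated subtraction is exact, since `index_orthogonal` expresses k as the index of the
  -- level plus this number.
  refine ⟨k - if -κ < 0 then 1 else 0, fun z => ?_⟩
  have hκ : -κ ≠ 0 := neg_ne_zero.2 (left_ne_zero_of_mul_eq_one h.sq)
  have h1 := index_orthogonal (B := form I g (ι z))
    (B' := form 𝓘(ℝ, E') (pullback 𝓘(ℝ, E') I ι g) z) (h.data.symm (ι z))
    (h.data.metric.nondegenerate (ι z)) (fun v w => h.data.symm (ι z) _ _) (hnd z) hι.finrank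
    (md 𝓘(ℝ, E') I ι z) hκ (h.form_field_self (h.mem_level hι z)) (fun u v => rfl)
    (fun u => by rw [h.data.symm, h.form_field_level hι])
  have h2 : index (form I g (ι z)) = k := hk (ι z)
  have h3 : index (pullback 𝓘(ℝ, E') I ι g z) =
    index (form 𝓘(ℝ, E') (pullback 𝓘(ℝ, E') I ι g) z) := rfl
  rw [h3]
  omega

end WarpData
end LevelMetric

/-! ### The isometry with a warped product -/

section WarpMap

variable {E : Type*} [NormedAddCommGroup E] [NormedSpace ℝ E] [FiniteDimensional ℝ E]
  {H : Type*} [TopologicalSpace H] {I : ModelWithCorners ℝ E H} [I.Boundaryless]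
  {M : Type*} [TopologicalSpace M] [ChartedSpace H M] [IsManifold I ∞ M] [T2Space M]
  {E' : Type*} [NormedAddCommGroup E'] [NormedSpace ℝ E'] [FiniteDimensional ℝ E']
  {N : Type*} [TopologicalSpace N] [ChartedSpace E' N] [IsManifold 𝓘(ℝ, E') ∞ N]

def warpMap (φ : ℝ → M → M) (ι : N → M) (q : ℝ × N) : M := φ q.1 (ι q.2)

lemma form_warpedForm (c : ℝ) (h : ℝ → ℝ) (gN : BilinField 𝓘(ℝ, E') N) (q : ℝ × N)
    (X Y : ℝ × E') : form (𝓘(ℝ, ℝ).prod 𝓘(ℝ, E'))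
      (warpedForm (𝓘(ℝ, ℝ).prod 𝓘(ℝ, E')) 𝓘(ℝ, E') c h Prod.fst Prod.snd gN) q X Y =
        c * (X.1 * Y.1) + h q.1 * form 𝓘(ℝ, E') gN q.2 X.2 Y.2 := by
  have h1 : form (𝓘(ℝ, ℝ).prod 𝓘(ℝ, E'))
      (warpedForm (𝓘(ℝ, ℝ).prod 𝓘(ℝ, E')) 𝓘(ℝ, E') c h Prod.fst Prod.snd gN) q X Y =
    c * (md (𝓘(ℝ, ℝ).prod 𝓘(ℝ, E')) 𝓘(ℝ, ℝ) (Prod.fst : ℝ × N → ℝ) q X *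
      md (𝓘(ℝ, ℝ).prod 𝓘(ℝ, E')) 𝓘(ℝ, ℝ) (Prod.fst : ℝ × N → ℝ) q Y) +
    h q.1 * form 𝓘(ℝ, E') gN q.2 (md (𝓘(ℝ, ℝ).prod 𝓘(ℝ, E')) 𝓘(ℝ, E') (Prod.snd : ℝ × N → N) q X)
      (md (𝓘(ℝ, ℝ).prod 𝓘(ℝ, E')) 𝓘(ℝ, E') (Prod.snd : ℝ × N → N) q Y) := rfl
  have h2 : md (𝓘(ℝ, ℝ).prod 𝓘(ℝ, E')) 𝓘(ℝ, ℝ) (Prod.fst : ℝ × N → ℝ) q =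
    ContinuousLinearMap.fst ℝ ℝ E' := mfderiv_fst
  rw [h1, md_prod_snd, h2]
  rfl

variable {g : BilinField I M} {f : M → ℝ} {ξ : M → E} {κ : ℝ} {F F₁ : ℝ → ℝ} {U : Set M} {s : M → ℝ}
  {ι : N → M} {φ : ℝ → M → M}

namespace WarpData

lemma contMDiff_warpMap (h : WarpData I g f ξ κ F F₁ U s)
    (hφ : IsFlow I (warpField ξ κ F₁ s) U φ) (hι : IsLevelEmbedding (E' := E') I ι f (F 0)) :
    ContMDiff (𝓘(ℝ, ℝ).prod 𝓘(ℝ, E')) I ∞ (warpMap φ ι) := by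
  intro q
  have h1 : ContMDiffAt (𝓘(ℝ, ℝ).prod 𝓘(ℝ, E')) (𝓘(ℝ, ℝ).prod I) ∞
      (fun q : ℝ × N => ((q.1, ι q.2) : ℝ × M)) q :=
    contMDiffAt_fst.prodMk ((hι.contMDiff q.2).comp q contMDiffAt_snd)
  exact ContMDiffAt.comp (g := Function.uncurry φ) q (hφ.contMDiffAt (h.mem_level hι q.2) q.1) h1

lemma md_warpMap (h : WarpData I g f ξ κ F F₁ U s)
    (hφ : IsFlow I (warpField ξ κ F₁ s) U φ) (hι : IsLevelEmbedding (E' := E') I ι f (F 0))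
    (q : ℝ × N) (X : ℝ × E') : md (𝓘(ℝ, ℝ).prod 𝓘(ℝ, E')) I (warpMap φ ι) q X =
      X.1 • warpField ξ κ F₁ s (φ q.1 (ι q.2)) +
        md I I (φ q.1) (ι q.2) (md 𝓘(ℝ, E') I ι q.2 X.2) := by
  have hx := h.mem_level hι q.2
  have h1 : md (𝓘(ℝ, ℝ).prod 𝓘(ℝ, E')) I (warpMap φ ι) q X =
      md 𝓘(ℝ, ℝ) I (fun t => φ t (ι q.2)) q.1 X.1 +
        md 𝓘(ℝ, E') I (fun z => φ q.1 (ι z)) q.2 X.2 :=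
    mfderiv_prod_eq_add_apply ((h.contMDiff_warpMap hφ hι q).mdifferentiableAt (by simp))
  have h2 : md 𝓘(ℝ, ℝ) I (fun t => φ t (ι q.2)) q.1 X.1 =
      X.1 • warpField ξ κ F₁ s (φ q.1 (ι q.2)) := by
    rw [← (hφ.integral _ hx q.1).2, vel, ← map_smul, smul_eq_mul, mul_one]
  rw [h1, h2, md_comp_apply (f := φ q.1) (h := ι) (x := q.2) (hφ.mdifferentiableAt_snd hx q.1)
    (hι.mdifferentiableAt q.2)]

/-- The flow preserves ds and therefore keeps tangent vectors of the level orthogonal to T; the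
mixed terms vanish, and conformality gives the fibre term. -/
lemma form_pullback_warpMap (h : WarpData I g f ξ κ F F₁ U s)
    (hφ : IsFlow I (warpField ξ κ F₁ s) U φ) (hs : ∀ x ∈ U, ∀ t, s (φ t x) = s x + t)
    (hι : IsLevelEmbedding (E' := E') I ι f (F 0)) (q : ℝ × N) (X Y : ℝ × E') :
    form (𝓘(ℝ, ℝ).prod 𝓘(ℝ, E')) (pullback (𝓘(ℝ, ℝ).prod 𝓘(ℝ, E')) I (warpMap φ ι) g) q X Y =
      -κ * (X.1 * Y.1) +
        F₁ q.1 ^ 2 * form 𝓘(ℝ, E') (pullback 𝓘(ℝ, E') I ι g) q.2 X.2 Y.2 := by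
  have hx := h.mem_level hι q.2
  have hx' := hφ.mem _ hx q.1
  rw [form_pullback, form_pullback, ← h.form_flow hφ hs hx (h.md_s_level hι _ _)
    (h.md_s_level hι _ _) (h.s_level hι _) q.1, h.md_warpMap hφ hι, h.md_warpMap hφ hι]
  have h1 : ∀ u, form I g (φ q.1 (ι q.2)) (warpField ξ κ F₁ s (φ q.1 (ι q.2)))
      (md I I (φ q.1) (ι q.2) (md 𝓘(ℝ, E') I ι q.2 u)) = 0 := fun u => by
    rw [h.form_field hx', h.md_s_flow hφ hs hx, h.md_s_level hι, mul_zero]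
  have h2 := h.form_field_self hx'
  change form I g (φ q.1 (ι q.2)) _ _ = _
  simp only [map_add, map_smul, add_apply, smul_apply, smul_eq_mul, h2, h1]
  rw [h.data.symm _ _ (warpField ξ κ F₁ s (φ q.1 (ι q.2))), h1]
  ring

/-- The projection to the level set along the flow. -/
lemma exists_proj [Nonempty N] (h : WarpData I g f ξ κ F F₁ U s)
    (hφ : IsFlow I (warpField ξ κ F₁ s) U φ) (hs : ∀ x ∈ U, ∀ t, s (φ t x) = s x + t)
    (hι : IsLevelEmbedding (E' := E') I ι f (F 0)) :
    ∃ π : M → N, (∀ p ∈ U, ι (π p) = φ (-s p) p) ∧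
      (∀ p ∈ U, ContMDiffAt I 𝓘(ℝ, E') ∞ π p) ∧ (∀ p ∈ U, warpMap φ ι (s p, π p) = p) ∧
      ∀ t z, π (φ t (ι z)) = z := by
  -- Flowing back for the time s(p) reaches the level s = 0. Outside U an arbitrary value is taken.
  have hex : ∀ p, ∃ z, p ∈ U → ι z = φ (-s p) p := by
    intro p
    by_cases hp : p ∈ U
    · have h1 : f (φ (-s p) p) = F 0 := by
        rw [h.eq _ (hφ.mem p hp _), hs p hp]
        simp
      obtain ⟨z, hz⟩ := (hι.range_eq _).2 h1
      exact ⟨z, fun _ => hz⟩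
    · exact ⟨Classical.arbitrary N, fun h' => absurd h' hp⟩
  choose π hπ using hex
  have hsm : ∀ p ∈ U, ContMDiffAt I I ∞ (fun p => φ (-s p) p) p := by
    intro p hp
    have h2 : ContMDiffAt I 𝓘(ℝ, ℝ) ∞ (fun p => -s p) p := (h.smooth p hp).neg
    have h1 : ContMDiffAt I (𝓘(ℝ, ℝ).prod I) ∞ (fun p : M => ((-s p, p) : ℝ × M)) p :=
      h2.prodMk contMDiffAt_id
    exact ContMDiffAt.comp (g := Function.uncurry φ) (f := fun p : M => ((-s p, p) : ℝ × M)) p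
      (hφ.contMDiffAt hp _) h1
  refine ⟨π, hπ, fun p hp => ?_, fun p hp => ?_, fun t z => ?_⟩
  · have hev : (fun p => φ (-s p) p) =ᶠ[𝓝 p] fun p => ι (π p) := by
      filter_upwards [h.isOpen.mem_nhds hp] with q hq using (hπ q hq).symm
    have hcont : ContinuousAt π p :=
      hι.isEmbedding.isInducing.continuousAt_iff.2 ((hsm p hp).continuousAt.congr hev)
    -- The map ι ∘ π is smooth; continuity of π comes from the embedding, and then π agrees near p
    -- with a local retraction composed with ι ∘ π.
    obtain ⟨r, hr, hrι⟩ := hι.retract (π p)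
    rw [hπ p hp] at hr
    refine (ContMDiffAt.comp (g := r) (f := fun p => φ (-s p) p) p hr (hsm p hp)).congr_of_eventuallyEq ?_
    filter_upwards [hcont.eventually hrι, hev] with q hq hq'
    exact hq.symm.trans (congrArg r hq'.symm)
  · change φ (s p) (ι (π p)) = p
    rw [hπ p hp, ← hφ.add hp, add_neg_cancel, hφ.zero p hp]
  · have hx := h.mem_level hι z
    refine hι.isEmbedding.injective ?_
    rw [hπ _ (hφ.mem _ hx t), hs _ hx, h.s_level hι, ← hφ.add hx]
    simp [hφ.zero _ hx]

/-- The isometry of a warped product with the open set `U`. -/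
theorem exists_diffeomorph {U : TopologicalSpace.Opens M} (h : WarpData I g f ξ κ F F₁ (U : Set M) s)
    (hφ : IsFlow I (warpField ξ κ F₁ s) (U : Set M) φ)
    (hs : ∀ x ∈ (U : Set M), ∀ t, s (φ t x) = s x + t)
    (hι : IsLevelEmbedding (E' := E') I ι f (F 0)) :
    ∃ Φ : Diffeomorph (𝓘(ℝ, ℝ).prod 𝓘(ℝ, E')) I (ℝ × N) U ∞,
      pullback (𝓘(ℝ, ℝ).prod 𝓘(ℝ, E')) I Φ (restrict I g U) =
        warpedForm (𝓘(ℝ, ℝ).prod 𝓘(ℝ, E')) 𝓘(ℝ, E') (-κ) (fun t => F₁ t ^ 2) Prod.fst Prod.snd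
          (pullback 𝓘(ℝ, E') I ι g) := by
  -- The projection needs a point of N as default value. If N is empty then so is U, because the
  -- flow carries each point of U into the level.
  have hinv : ∃ P : U → N, ContMDiff I 𝓘(ℝ, E') ∞ P ∧ (∀ p : U, warpMap φ ι (s p, P p) = p) := by
    by_cases hne : Nonempty N
    · obtain ⟨π, -, hsm, hπ, -⟩ := h.exists_proj hφ hs hι
      exact ⟨fun p => π p, fun p => contMDiffAt_subtype_iff.2 (hsm p p.2), fun p => hπ p p.2⟩
    · have hU : IsEmpty U := by
        refine ⟨fun p => hne ?_⟩
        have h1 : f (φ (-s p) p) = F 0 := by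
          rw [h.eq _ (hφ.mem p p.2 _), hs p p.2]
          simp
        exact ⟨((hι.range_eq _).2 h1).choose⟩
      exact ⟨isEmptyElim, fun p => isEmptyElim p, isEmptyElim⟩
  obtain ⟨P, hPs, hP⟩ := hinv
  have hsW : ∀ q : ℝ × N, s (warpMap φ ι q) = q.1 := fun q => by
    rw [warpMap, hs _ (h.mem_level hι _), h.s_level hι, zero_add]
  set Ψ : ℝ × N → U := fun q => ⟨warpMap φ ι q, hφ.mem _ (h.mem_level hι q.2) q.1⟩ with hΨ
  have hΨs : ContMDiff (𝓘(ℝ, ℝ).prod 𝓘(ℝ, E')) I ∞ Ψ :=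
    (ContMDiff.subtypeVal_comp_iff U Ψ).1 (h.contMDiff_warpMap hφ hι)
  refine ⟨⟨⟨Ψ, fun p => (s p, P p), fun q => ?_, fun p => Subtype.ext (hP p)⟩, hΨs, ?_⟩, ?_⟩
  · have h1 : warpMap φ ι (q.1, P (Ψ q)) = warpMap φ ι q := by
      have := hP (Ψ q)
      rwa [hsW q] at this
    refine Prod.ext (hsW q) (hι.isEmbedding.injective ?_)
    have h2 : ∀ z, φ (-q.1) (warpMap φ ι (q.1, z)) = ι z := fun z => by
      rw [warpMap, ← hφ.add (h.mem_level hι z)]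
      simp [hφ.zero _ (h.mem_level hι z)]
    rw [← h2 (P (Ψ q)), h1, h2]
  · have h1 : ContMDiff I 𝓘(ℝ, ℝ) ∞ (fun p : U => s p) := fun p =>
      contMDiffAt_subtype_iff.2 (h.smooth p p.2)
    exact h1.prodMk hPs
  · funext q
    have key : form (𝓘(ℝ, ℝ).prod 𝓘(ℝ, E')) (pullback (𝓘(ℝ, ℝ).prod 𝓘(ℝ, E')) I Ψ (restrict I g U)) q
        = form (𝓘(ℝ, ℝ).prod 𝓘(ℝ, E')) (warpedForm (𝓘(ℝ, ℝ).prod 𝓘(ℝ, E')) 𝓘(ℝ, E') (-κ)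
          (fun t => F₁ t ^ 2) Prod.fst Prod.snd (pullback 𝓘(ℝ, E') I ι g)) q := by
      rw [restrict, ← pullback_comp (f := (Subtype.val : U → M)) (h := Ψ) (x := q)
        (contMDiff_subtype_val.mdifferentiableAt (n := ∞) (by simp))
        ((hΨs q).mdifferentiableAt (by simp))]
      refine ContinuousLinearMap.ext fun X => ContinuousLinearMap.ext fun Y => ?_
      exact (h.form_pullback_warpMap hφ hs hι q X Y).trans
        (form_warpedForm (-κ) (fun t => F₁ t ^ 2) (pullback 𝓘(ℝ, E') I ι g) q X Y).symm
    exact key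

end WarpData
end WarpMap

/-! ### Accelerations in warped products -/

section LocalWarp

variable {E : Type*} [NormedAddCommGroup E] [NormedSpace ℝ E]

/-- The form `a dt² + η(t) G` on `ℝ × E`. -/
def warpForm (a : ℝ) (η : ℝ → ℝ) (G : E → E →L[ℝ] E →L[ℝ] ℝ) (p : ℝ × E) :
    (ℝ × E) →L[ℝ] (ℝ × E) →L[ℝ] ℝ :=
  a • (ContinuousLinearMap.fst ℝ ℝ E).smulRight (ContinuousLinearMap.fst ℝ ℝ E) +
    η p.1 • pull (Prod.snd : ℝ × E → E) G p

variable {a : ℝ} {η : ℝ → ℝ} {G : E → E →L[ℝ] E →L[ℝ] ℝ}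

lemma warpForm_apply (p X Y : ℝ × E) :
    warpForm a η G p X Y = a * (X.1 * Y.1) + η p.1 * G p.2 X.2 Y.2 := by
  simp [warpForm, fderiv_snd]

lemma fderiv_warpForm {p : ℝ × E} (hG : ContDiffAt ℝ ∞ G p.2) (hη : ContDiffAt ℝ ∞ η p.1)
    (W X Y : ℝ × E) : fderiv ℝ (warpForm a η G) p W X Y =
      deriv η p.1 * W.1 * G p.2 X.2 Y.2 + η p.1 * fderiv ℝ G p.2 W.2 X.2 Y.2 := by
  have hη' : ContDiffAt ℝ ∞ (fun p : ℝ × E => η p.1) p := hη.comp p contDiffAt_fst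
  have hs : ContDiffAt ℝ ∞ (warpForm a η G) p :=
    contDiffAt_const.add (hη'.smul (contDiffAt_pull (n := ⊤) (by exact contDiffAt_snd) hG))
  have h1 := ((hs.differentiableAt (by simp)).hasFDerivAt.clm_apply
    (hasFDerivAt_const X p)).clm_apply (hasFDerivAt_const Y p)
  have hG' : HasFDerivAt (fun p : ℝ × E => G p.2) ((fderiv ℝ G p.2).comp
    (ContinuousLinearMap.snd ℝ ℝ E)) p :=
    (hG.differentiableAt (by simp)).hasFDerivAt.comp p hasFDerivAt_snd
  have h2 := (hG'.clm_apply (hasFDerivAt_const X.2 p)).clm_apply (hasFDerivAt_const Y.2 p)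
  have h5 : HasFDerivAt (fun p : ℝ × E => η p.1) (deriv η p.1 • ContinuousLinearMap.fst ℝ ℝ E) p :=
    (hη.differentiableAt (by simp)).hasDerivAt.comp_hasFDerivAt p hasFDerivAt_fst
  have h3 := (h5.mul h2).const_add (a * (X.1 * Y.1))
  have hfun : (fun p => warpForm a η G p X Y) =
      fun p => a * (X.1 * Y.1) + η p.1 * G p.2 X.2 Y.2 :=
    funext fun p => warpForm_apply p X Y
  rw [hfun] at h1
  have h4 := congrArg (fun l : (ℝ × E) →L[ℝ] ℝ => l W) (h1.unique h3)
  simp at h4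
  rw [h4]
  ring

lemma deriv_prodMk {σ : ℝ → ℝ} {y : ℝ → E} {τ : ℝ} (hσ : DifferentiableAt ℝ σ τ)
    (hy : DifferentiableAt ℝ y τ) :
    deriv (fun τ => ((σ τ, y τ) : ℝ × E)) τ = (deriv σ τ, deriv y τ) :=
  (hσ.hasDerivAt.prodMk hy.hasDerivAt).deriv

lemma deriv_deriv_prodMk {σ : ℝ → ℝ} {y : ℝ → E} {τ : ℝ} (hσ : ContDiffAt ℝ 2 σ τ)
    (hy : ContDiffAt ℝ 2 y τ) : deriv (deriv fun τ => ((σ τ, y τ) : ℝ × E)) τ =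
      (deriv (deriv σ) τ, deriv (deriv y) τ) := by
  have h1 : (deriv fun τ => ((σ τ, y τ) : ℝ × E)) =ᶠ[𝓝 τ] fun τ => (deriv σ τ, deriv y τ) := by
    filter_upwards [eventually_differentiableAt hσ, eventually_differentiableAt hy] with t h h'
    exact deriv_prodMk h h'
  rw [h1.deriv_eq]
  exact ((hasDerivAt_deriv hσ).prodMk (hasDerivAt_deriv hy)).deriv

/-- The component tangent to the fibre of the acceleration of a curve in a warped product. -/
lemma accel_warpForm {σ : ℝ → ℝ} {y : ℝ → E} {τ : ℝ} (hσ : ContDiffAt ℝ 2 σ τ)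
    (hy : ContDiffAt ℝ 2 y τ) (hG : ContDiffAt ℝ ∞ G (y τ)) (hη : ContDiffAt ℝ ∞ η (σ τ)) (ζ : E) :
    accel (warpForm a η G) (fun τ => ((σ τ, y τ) : ℝ × E)) τ (0, ζ) =
      η (σ τ) * accel G y τ ζ + deriv η (σ τ) * deriv σ τ * G (y τ) (deriv y τ) ζ := by
  simp only [accel, christoffelOne]
  rw [fderiv_warpForm hG hη, fderiv_warpForm hG hη, deriv_deriv_prodMk hσ hy,
    deriv_prodMk (hσ.differentiableAt (by simp)) (hy.differentiableAt (by simp)), warpForm_apply]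
  simp only
  ring

/-- The acceleration of a reparametrized curve. -/
lemma accel_comp {c : ℝ → E} {θ : ℝ → ℝ} {τ : ℝ} (hc : ContDiffAt ℝ 2 c (θ τ))
    (hθ : ContDiffAt ℝ 2 θ τ) (z : E) : accel G (fun τ => c (θ τ)) τ z =
      deriv θ τ ^ 2 * accel G c (θ τ) z + deriv (deriv θ) τ * G (c (θ τ)) (deriv c (θ τ)) z := by
  have h1 : (deriv fun τ => c (θ τ)) =ᶠ[𝓝 τ] fun τ => deriv θ τ • deriv c (θ τ) := by
    filter_upwards [eventually_differentiableAt hθ,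
      hθ.continuousAt.eventually (eventually_differentiableAt hc)] with t h h'
    exact (h'.hasDerivAt.scomp t h.hasDerivAt).deriv
  have h2 : HasDerivAt (fun τ => deriv c (θ τ)) (deriv θ τ • deriv (deriv c) (θ τ)) τ :=
    (hasDerivAt_deriv hc).scomp τ (hθ.differentiableAt (by simp)).hasDerivAt
  have h3 := (hasDerivAt_deriv hθ).smul h2
  have h4 : deriv (deriv fun τ => c (θ τ)) τ =
    deriv θ τ • (deriv θ τ • deriv (deriv c) (θ τ)) + deriv (deriv θ) τ • deriv c (θ τ) := by
    rw [h1.deriv_eq]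
    exact h3.deriv
  simp only [accel, christoffelOne]
  rw [h4, h1.self_of_nhds]
  simp only [map_add, map_smul, add_apply, smul_apply, smul_eq_mul]
  ring

end LocalWarp

/-! ### Geodesics of the fibre of a warped product -/

section FibreGeodesics

variable {E : Type*} [NormedAddCommGroup E] [NormedSpace ℝ E] [FiniteDimensional ℝ E]
  {H : Type*} [TopologicalSpace H] {I : ModelWithCorners ℝ E H} [I.Boundaryless]
  {M : Type*} [TopologicalSpace M] [ChartedSpace H M] [IsManifold I ∞ M] [T2Space M]
  {E' : Type*} [NormedAddCommGroup E'] [NormedSpace ℝ E'] [FiniteDimensional ℝ E']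
  {N : Type*} [TopologicalSpace N] [ChartedSpace E' N] [IsManifold 𝓘(ℝ, E') ∞ N]

variable {g : BilinField I M} {f : M → ℝ} {ξ : M → E} {κ : ℝ} {F F₁ : ℝ → ℝ} {U : Set M} {s : M → ℝ}
  {ι : N → M} {φ : ℝ → M → M}

namespace WarpData

/-- The warped product metric in a chart of the fibre. -/
lemma form_pullback_warpChart (h : WarpData I g f ξ κ F F₁ U s)
    (hφ : IsFlow I (warpField ξ κ F₁ s) U φ) (hs : ∀ x ∈ U, ∀ t, s (φ t x) = s x + t)
    (hι : IsLevelEmbedding (E' := E') I ι f (F 0)) {z₀ : N} {p : ℝ × E'}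
    (hp : p.2 ∈ (extChartAt 𝓘(ℝ, E') z₀).target) :
    ContMDiffAt 𝓘(ℝ, ℝ × E') I ∞
      (fun p : ℝ × E' => warpMap φ ι (p.1, (extChartAt 𝓘(ℝ, E') z₀).symm p.2)) p ∧
    form 𝓘(ℝ, ℝ × E') (pullback 𝓘(ℝ, ℝ × E') I
      (fun p : ℝ × E' => warpMap φ ι (p.1, (extChartAt 𝓘(ℝ, E') z₀).symm p.2)) g) p =
      warpForm (-κ) (fun t => F₁ t ^ 2)
        (chartMetric 𝓘(ℝ, E') (pullback 𝓘(ℝ, E') I ι g) z₀) p := by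
  set m : ℝ × E' → ℝ × N := fun p => (p.1, (extChartAt 𝓘(ℝ, E') z₀).symm p.2) with hm
  have h3 : ContMDiffAt 𝓘(ℝ, ℝ × E') 𝓘(ℝ, E') ∞ (Prod.snd : ℝ × E' → E') p :=
    contDiffAt_snd.contMDiffAt
  have h4 : ContMDiffAt 𝓘(ℝ, ℝ × E') 𝓘(ℝ, ℝ) ∞ (Prod.fst : ℝ × E' → ℝ) p :=
    contDiffAt_fst.contMDiffAt
  have h2 : ContMDiffAt 𝓘(ℝ, ℝ × E') 𝓘(ℝ, E') ∞
      (fun q : ℝ × E' => (extChartAt 𝓘(ℝ, E') z₀).symm q.2) p :=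
    ContMDiffAt.comp (g := (extChartAt 𝓘(ℝ, E') z₀).symm) (f := (Prod.snd : ℝ × E' → E')) p
      (contMDiffAt_chart_symm hp) h3
  have hms : ContMDiffAt 𝓘(ℝ, ℝ × E') (𝓘(ℝ, ℝ).prod 𝓘(ℝ, E')) ∞ m p := h4.prodMk h2
  have hW := h.contMDiff_warpMap hφ hι
  refine ⟨ContMDiffAt.comp (g := warpMap φ ι) (f := m) p (hW (m p)) hms, ?_⟩
  have h5 := pullback_comp (f := warpMap φ ι) (h := m) (x := p)
    ((hW (m p)).mdifferentiableAt (by simp)) (hms.mdifferentiableAt (by simp)) g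
  have hmd : ∀ X : ℝ × E', md 𝓘(ℝ, ℝ × E') (𝓘(ℝ, ℝ).prod 𝓘(ℝ, E')) m p X =
      (X.1, md 𝓘(ℝ, E') 𝓘(ℝ, E') (extChartAt 𝓘(ℝ, E') z₀).symm p.2 X.2) := by
    intro X
    have h6 : md 𝓘(ℝ, ℝ × E') (𝓘(ℝ, ℝ).prod 𝓘(ℝ, E')) m p =
      (md 𝓘(ℝ, ℝ × E') 𝓘(ℝ, ℝ) (Prod.fst : ℝ × E' → ℝ) p).prod (md 𝓘(ℝ, ℝ × E') 𝓘(ℝ, E')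
        (fun q : ℝ × E' => (extChartAt 𝓘(ℝ, E') z₀).symm q.2) p) :=
      mfderiv_prodMk (h4.mdifferentiableAt (by simp)) (h2.mdifferentiableAt (by simp))
    rw [h6]
    refine Prod.ext ?_ ?_
    · change md 𝓘(ℝ, ℝ × E') 𝓘(ℝ, ℝ) (Prod.fst : ℝ × E' → ℝ) p X = X.1
      rw [md_eq_fderiv, fderiv_fst]
      rfl
    · change md 𝓘(ℝ, ℝ × E') 𝓘(ℝ, E')
        (fun q : ℝ × E' => (extChartAt 𝓘(ℝ, E') z₀).symm q.2) p X = _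
      rw [md_comp_apply (f := (extChartAt 𝓘(ℝ, E') z₀).symm) (h := (Prod.snd : ℝ × E' → E')) (x := p)
        (mdifferentiableAt_chart_symm hp) (h3.mdifferentiableAt (by simp)), md_eq_fderiv, fderiv_snd]
      rfl
  refine h5.trans ?_
  refine ContinuousLinearMap.ext fun X => ContinuousLinearMap.ext fun Y => ?_
  rw [warpForm_apply, form_pullback, hmd, hmd]
  exact h.form_pullback_warpMap hφ hs hι (m p) _ _

/-- The projection to the fibre of a geodesic, in a suitable parametrization. -/
lemma isGeodesicOn_proj (h : WarpData I g f ξ κ F F₁ U s)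
    (hφ : IsFlow I (warpField ξ κ F₁ s) U φ) (hs : ∀ x ∈ U, ∀ t, s (φ t x) = s x + t)
    (hι : IsLevelEmbedding (E' := E') I ι f (F 0)) {π : M → N}
    (hπs : ∀ p ∈ U, ContMDiffAt I 𝓘(ℝ, E') ∞ π p) (hπ : ∀ p ∈ U, warpMap φ ι (s p, π p) = p)
    {γ : ℝ → M} (hγ : IsGeodesicOn I g γ Set.univ) {J : Set ℝ} (hJ : IsOpen J) {θ : ℝ → ℝ}
    (hθ : ContDiffOn ℝ ∞ θ J) (hθ0 : ∀ τ ∈ J, deriv θ τ ≠ 0) (hU : ∀ τ ∈ J, γ (θ τ) ∈ U)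
    (heq : ∀ τ ∈ J, deriv (deriv θ) τ * F₁ (s (γ (θ τ))) =
      2 * F (s (γ (θ τ))) * deriv (fun τ => s (γ (θ τ))) τ * deriv θ τ) :
    IsGeodesicOn 𝓘(ℝ, E') (pullback 𝓘(ℝ, E') I ι g) (fun τ => π (γ (θ τ))) J := by
  have hgN := h.isSemiRiemannian_level hι
  have hθs : ∀ τ ∈ J, ContDiffAt ℝ ∞ θ τ := fun τ hτ => hθ.contDiffAt (hJ.mem_nhds hτ)
  have hδ : ∀ τ ∈ J, ContMDiffAt 𝓘(ℝ, ℝ) I ∞ (fun τ => γ (θ τ)) τ := fun τ hτ =>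
    ContMDiffAt.comp (g := γ) (f := θ) τ (hγ.contMDiffAt isOpen_univ (Set.mem_univ _))
      (hθs τ hτ).contMDiffAt
  have hy : ∀ τ ∈ J, ContMDiffAt 𝓘(ℝ, ℝ) 𝓘(ℝ, E') ∞ (fun τ => π (γ (θ τ))) τ := fun τ hτ =>
    ContMDiffAt.comp (g := π) (f := fun τ => γ (θ τ)) τ (hπs _ (hU τ hτ)) (hδ τ hτ)
  refine isGeodesicOn_of_accel hgN (fun τ hτ => (hy τ hτ).contMDiffWithinAt) fun τ hτ ζ => ?_
  set z₀ := π (γ (θ τ)) with hz₀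
  have hsrc : π (γ (θ τ)) ∈ (extChartAt 𝓘(ℝ, E') z₀).source := mem_extChartAt_source _
  set y : ℝ → E' := fun τ => extChartAt 𝓘(ℝ, E') z₀ (π (γ (θ τ))) with hyd
  set σ : ℝ → ℝ := fun τ => s (γ (θ τ)) with hσd
  have hys : ContDiffAt ℝ ∞ y τ := contDiffAt_chart_comp (hy τ hτ) le_rfl hsrc
  have hσs : ContDiffAt ℝ ∞ σ τ :=
    (ContMDiffAt.comp (g := s) (f := fun τ => γ (θ τ)) τ (h.smooth _ (hU τ hτ)) (hδ τ hτ)).contDiffAt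
  have hyt : y τ ∈ (extChartAt 𝓘(ℝ, E') z₀).target := (extChartAt 𝓘(ℝ, E') z₀).map_source hsrc
  set ψ : ℝ × E' → M := fun p => warpMap φ ι (p.1, (extChartAt 𝓘(ℝ, E') z₀).symm p.2) with hψ
  have hev : (fun τ => γ (θ τ)) =ᶠ[𝓝 τ] fun τ => ψ (σ τ, y τ) := by
    filter_upwards [hJ.mem_nhds hτ, (hy τ hτ).continuousAt.preimage_mem_nhds
      ((isOpen_extChartAt_source z₀).mem_nhds hsrc)] with τ' h1 h2
    simp only [hψ, hyd, hσd]
    rw [(extChartAt 𝓘(ℝ, E') z₀).left_inv h2, hπ _ (hU τ' h1)]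
  have hY : ContDiffAt ℝ ∞ (fun τ => ((σ τ, y τ) : ℝ × E')) τ := hσs.prodMk hys
  set x₀ := γ (θ τ) with hx₀
  have hxs : γ (θ τ) ∈ (extChartAt I x₀).source := mem_extChartAt_source _
  set c : ℝ → E := fun t => extChartAt I x₀ (γ t) with hc
  have hcs : ContDiffAt ℝ ∞ c (θ τ) :=
    contDiffAt_chart_comp (hγ.contMDiffAt isOpen_univ (Set.mem_univ _)) le_rfl hxs
  have hψs := (h.form_pullback_warpChart hφ hs hι (z₀ := z₀) (p := (σ τ, y τ)) hyt).1
  have hG : form 𝓘(ℝ, ℝ × E') (pullback 𝓘(ℝ, ℝ × E') I ψ g) =ᶠ[𝓝 (σ τ, y τ)]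
      warpForm (-κ) (fun t => F₁ t ^ 2)
        (chartMetric 𝓘(ℝ, E') (pullback 𝓘(ℝ, E') I ι g) z₀) := by
    have : ∀ᶠ p in 𝓝 ((σ τ, y τ) : ℝ × E'), p.2 ∈ (extChartAt 𝓘(ℝ, E') z₀).target :=
      continuousAt_snd.preimage_mem_nhds ((isOpen_target z₀).mem_nhds hyt)
    filter_upwards [this] with p hp
    exact (h.form_pullback_warpChart hφ hs hι hp).2
  have h1 := accel_param h.data.metric (ψ := ψ) (y := fun τ => ((σ τ, y τ) : ℝ × E'))
    (γ := fun τ => γ (θ τ)) (t := τ) (x₀ := x₀) hψs hY hev hxs (0, ζ)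
  have h2 := two_le_infty
  have hGN := (hgN.isMetricOn z₀).contDiffAt hyt
  have hη : ContDiffAt ℝ ∞ (fun t => F₁ t ^ 2) (σ τ) := (h.contDiff.pow 2).contDiffAt
  have hη' : deriv (fun t => F₁ t ^ 2) (σ τ) = 2 * F₁ (σ τ) * F (σ τ) := by
    have e1 : deriv (fun t => F₁ t ^ 2) (σ τ) = _ := ((h.hasDerivAt₁ (σ τ)).pow 2).deriv
    rw [e1]
    simp
  rw [accel_congr hG Filter.EventuallyEq.rfl, accel_warpForm (hσs.of_le h2) (hys.of_le h2) hGN hη,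
    hη', accel_comp (c := c) (hcs.of_le h2) ((hθs τ hτ).of_le h2)] at h1
  have h3 : accel (chartMetric I g x₀) c (θ τ) (md I 𝓘(ℝ, E) (extChartAt I x₀) (γ (θ τ))
      (md 𝓘(ℝ, ℝ × E') I ψ (σ τ, y τ) (0, ζ))) = 0 :=
    hγ.accel_eq_zero h.data.metric (Set.mem_univ (θ τ)) _
  -- The velocity of γ ∘ θ paired with a fibre direction, computed in M and in the warped product.
  have h4 : deriv θ τ * chartMetric I g x₀ (c (θ τ)) (deriv c (θ τ)) (md I 𝓘(ℝ, E)
      (extChartAt I x₀) (γ (θ τ)) (md 𝓘(ℝ, ℝ × E') I ψ (σ τ, y τ) (0, ζ))) =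
      F₁ (σ τ) ^ 2 * chartMetric 𝓘(ℝ, E') (pullback 𝓘(ℝ, E') I ι g) z₀ (y τ) (deriv y τ) ζ := by
    have h5 : deriv θ τ • deriv c (θ τ) = md I 𝓘(ℝ, E) (extChartAt I x₀) (γ (θ τ))
        (md 𝓘(ℝ, ℝ × E') I ψ (σ τ, y τ) (deriv σ τ, deriv y τ)) := by
      have e1 : HasDerivAt (fun τ => c (θ τ)) (deriv θ τ • deriv c (θ τ)) τ :=
        (hcs.differentiableAt (by simp)).hasDerivAt.scomp τ
          ((hθs τ hτ).differentiableAt (by simp)).hasDerivAt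
      have e2 := hasDerivAt_chart_comp (γ := fun τ => γ (θ τ)) (t := τ) (x₀ := x₀)
        ((hδ τ hτ).mdifferentiableAt (by simp)) hxs
      rw [e1.unique e2, vel_congr hev]
      have e3 : vel I (fun τ => ψ (σ τ, y τ)) τ = md 𝓘(ℝ, ℝ × E') I ψ (σ τ, y τ)
          (md 𝓘(ℝ, ℝ) 𝓘(ℝ, ℝ × E') (fun τ => ((σ τ, y τ) : ℝ × E')) τ 1) :=
        md_comp_apply (f := ψ) (h := fun τ => ((σ τ, y τ) : ℝ × E')) (x := τ)
          (hψs.mdifferentiableAt (by simp)) (hY.differentiableAt (by simp)).mdifferentiableAt 1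
      rw [e3, md_eq_fderiv, fderiv_apply_one_eq_deriv,
        deriv_prodMk (hσs.differentiableAt (by simp)) (hys.differentiableAt (by simp))]
    have h6 := congrArg (fun l : (ℝ × E') →L[ℝ] (ℝ × E') →L[ℝ] ℝ =>
      l (deriv σ τ, deriv y τ) (0, ζ)) hG.self_of_nhds
    simp only [warpForm_apply, form_pullback] at h6
    rw [← smul_eq_mul, ← smul_apply, ← map_smul, h5, ← form_eq_chartMetric g hxs]
    have h7 : ψ (σ τ, y τ) = γ (θ τ) := hev.self_of_nhds.symm
    rw [h7] at h6
    rw [h6]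
    ring
  rw [h3] at h1
  have h5 := heq τ hτ
  have hF := h.ne (σ τ)
  -- The acceleration of γ ∘ θ is θ'' γ', as γ is a geodesic. Its fibre part equals F₁² times the
  -- acceleration of y plus 2 F₁ F σ' y'; the assumed equation, which says that θ' / F₁(σ)² has zero
  -- derivative, cancels the two velocity terms.
  have h6 : deriv θ τ * F₁ (σ τ) ^ 2 *
      accel (chartMetric 𝓘(ℝ, E') (pullback 𝓘(ℝ, E') I ι g) z₀) y τ ζ = 0 := by
    linear_combination deriv θ τ * h1 + deriv (deriv θ) τ * h4 + F₁ (σ τ) *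
      chartMetric 𝓘(ℝ, E') (pullback 𝓘(ℝ, E') I ι g) z₀ (y τ) (deriv y τ) ζ * h5
  exact (mul_eq_zero.1 h6).resolve_left (mul_ne_zero (hθ0 τ hτ) (pow_ne_zero 2 hF))

end WarpData
end FibreGeodesics

/-! ### Gluing geodesics -/

section Gluing

variable {E : Type*} [NormedAddCommGroup E] [NormedSpace ℝ E]
  {H : Type*} [TopologicalSpace H] {I : ModelWithCorners ℝ E H}
  {M : Type*} [TopologicalSpace M] [ChartedSpace H M] {g : BilinField I M}

lemma IsGeodesicOn.of_locally {γ : ℝ → M} {s : Set ℝ} (h : ∀ t ∈ s, ∃ (γ' : ℝ → M) (s' : Set ℝ),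
    IsOpen s' ∧ t ∈ s' ∧ IsGeodesicOn I g γ' s' ∧ γ =ᶠ[𝓝 t] γ') : IsGeodesicOn I g γ s := by
  refine ⟨fun t ht => ?_, fun t ht => ?_⟩
  · obtain ⟨γ', s', hs', hts', hγ', heq⟩ := h t ht
    exact (((hγ'.1 t hts').contMDiffAt (hs'.mem_nhds hts')).congr_of_eventuallyEq
      heq).contMDiffWithinAt
  · obtain ⟨γ', s', hs', hts', hγ', heq⟩ := h t ht
    have h1 := hγ'.2 t hts'
    have hc : (fun τ => extChartAt I (γ t) (γ τ)) =ᶠ[𝓝 t] fun τ => extChartAt I (γ t) (γ' τ) :=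
      heq.mono fun τ hτ => congrArg _ hτ
    simp only [hc.deriv.deriv_eq, hc.deriv_eq]
    rw [heq.self_of_nhds]
    exact h1

lemma IsGeodesicOn.mono {γ : ℝ → M} {s s' : Set ℝ} (h : IsGeodesicOn I g γ s) (hs : s' ⊆ s) :
    IsGeodesicOn I g γ s' := ⟨h.1.mono hs, fun t ht => h.2 t (hs ht)⟩

lemma IsGeodesicOn.comp_add {γ : ℝ → M} {s : Set ℝ} (h : IsGeodesicOn I g γ s) (a : ℝ) :
    IsGeodesicOn I g (fun t => γ (t + a)) ((fun t => t + a) ⁻¹' s) := by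
  refine ⟨?_, fun t ht => ?_⟩
  · have h1 : ContMDiff 𝓘(ℝ, ℝ) 𝓘(ℝ, ℝ) ∞ (fun t : ℝ => t + a) :=
      (contDiff_id.add contDiff_const).contMDiff
    exact h.1.comp (g := γ) (f := fun t : ℝ => t + a) h1.contMDiffOn (fun t ht => ht)
  · have h1 := h.2 (t + a) ht
    have e1 : deriv (fun τ => extChartAt I (γ (t + a)) (γ (τ + a))) =
        fun τ => deriv (fun τ => extChartAt I (γ (t + a)) (γ τ)) (τ + a) := by
      funext τ
      exact deriv_comp_add_const (fun τ => extChartAt I (γ (t + a)) (γ τ)) a τ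
    have e2 := deriv_comp_add_const (deriv fun τ => extChartAt I (γ (t + a)) (γ τ)) a t
    simp only [e1, e2]
    exact h1

lemma vel_comp_add {γ : ℝ → M} {t a : ℝ} (h : MDifferentiableAt 𝓘(ℝ, ℝ) I γ (t + a)) :
    vel I (fun τ => γ (τ + a)) t = vel I γ (t + a) := by
  have hd : HasDerivAt (fun τ : ℝ => τ + a) 1 t := (hasDerivAt_id t).add_const a
  have h1 : vel I (fun τ => γ (τ + a)) t = md 𝓘(ℝ, ℝ) I γ (t + a)
      (md 𝓘(ℝ, ℝ) 𝓘(ℝ, ℝ) (fun τ : ℝ => τ + a) t 1) :=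
    md_comp_apply (f := γ) (h := fun τ : ℝ => τ + a) (x := t) h
      hd.differentiableAt.mdifferentiableAt 1
  rw [h1, md_eq_fderiv, fderiv_apply_one_eq_deriv, hd.deriv]
  rfl

lemma initialVelocity_eq {γ : ℝ → M} {x : M} {v : E} (h0 : γ 0 = x) (hv : vel I γ 0 = v) :
    initialVelocity I γ = (⟨x, v⟩ : TangentBundle I M) := by
  subst h0 hv
  rfl

variable [FiniteDimensional ℝ E] [I.Boundaryless] [IsManifold I ∞ M] [T2Space M]

/-- Energy is conserved, so the time a is available again when the geodesic is restarted at the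
times ±a / 2; together the pieces cover (-3a / 2, 3a / 2). -/
lemma exists_geodesic_extend (hg : IsSemiRiemannian I g) {c a : ℝ} (ha : 0 < a)
    (h : ∀ (x : M) (v : E), form I g x v v = c → ∃ γ : ℝ → M,
      IsGeodesicOn I g γ (Set.Ioo (-a) a) ∧ γ 0 = x ∧ vel I γ 0 = v)
    (x : M) (v : E) (hv : form I g x v v = c) : ∃ γ : ℝ → M,
      IsGeodesicOn I g γ (Set.Ioo (-(3 / 2 * a)) (3 / 2 * a)) ∧ γ 0 = x ∧ vel I γ 0 = v := by
  obtain ⟨γ, hγ, h0, hv0⟩ := h x v hv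
  have key : ∀ b, -a < b → b < a → ∃ γ' : ℝ → M, IsGeodesicOn I g γ' (Set.Ioo (b - a) (b + a)) ∧
      ∀ t ∈ Set.Ioo (-a) a ∩ Set.Ioo (b - a) (b + a), γ t = γ' t := by
    intro b hb hb'
    have hbm : b ∈ Set.Ioo (-a) a := ⟨hb, hb'⟩
    have hen : form I g (γ b) (vel I γ b) (vel I γ b) = c := by
      have h0m : (0 : ℝ) ∈ Set.Ioo (-a) a := ⟨by linarith, ha⟩
      have h1 := hγ.energy_eq hg isOpen_Ioo Set.ordConnected_Ioo hbm h0m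
      rw [energy, energy, h0, hv0, hv] at h1
      exact h1
    obtain ⟨γ₁, hγ₁, h1, hv1⟩ := h _ _ hen
    have hγ₂ : IsGeodesicOn I g (fun t => γ₁ (t + -b)) (Set.Ioo (b - a) (b + a)) := by
      have := hγ₁.comp_add (-b)
      refine this.mono fun t ht => ⟨?_, ?_⟩
      · linarith [ht.1]
      · linarith [ht.2]
    refine ⟨_, hγ₂, fun t ht => ?_⟩
    refine geodesic_unique hg (isOpen_Ioo.inter isOpen_Ioo)
      (Set.ordConnected_Ioo.inter Set.ordConnected_Ioo) (hγ.mono Set.inter_subset_left)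
      (hγ₂.mono Set.inter_subset_right) (t₀ := b)
      ⟨hbm, by linarith, by linarith⟩ ht ?_ ?_
    · simp [h1]
    · rw [vel_comp_add]
      · rw [add_neg_cancel, hv1]
      · rw [add_neg_cancel]
        exact hγ₁.mdifferentiableAt isOpen_Ioo ⟨by linarith, ha⟩
  obtain ⟨γp, hγp, hp⟩ := key (a / 2) (by linarith) (by linarith)
  obtain ⟨γm, hγm, hm⟩ := key (-(a / 2)) (by linarith) (by linarith)
  -- The two restarted pieces are switched at time 0, around which both agree with γ, so the result
  -- is a geodesic there too.
  have heq : (fun t => if 0 ≤ t then γp t else γm t) =ᶠ[𝓝 0] γ := by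
    filter_upwards [Ioo_mem_nhds (a := -(a / 2)) (b := a / 2) (by linarith) (by linarith)] with t ht
    have h1 := ht.1
    have h2 := ht.2
    split_ifs
    · exact (hp t ⟨⟨by linarith, by linarith⟩, by linarith, by linarith⟩).symm
    · exact (hm t ⟨⟨by linarith, by linarith⟩, by linarith, by linarith⟩).symm
  refine ⟨fun t => if 0 ≤ t then γp t else γm t, IsGeodesicOn.of_locally fun t ht => ?_,
    heq.self_of_nhds.trans h0, (vel_congr heq).trans hv0⟩
  rcases lt_trichotomy t 0 with hlt | rfl | hgt
  · refine ⟨γm, _, isOpen_Ioo, ⟨by linarith [ht.1], by linarith⟩, hγm, ?_⟩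
    filter_upwards [Iio_mem_nhds hlt] with τ hτ
    rw [if_neg (not_le.2 hτ)]
  · exact ⟨γ, _, isOpen_Ioo, ⟨by linarith, ha⟩, hγ, heq⟩
  · refine ⟨γp, _, isOpen_Ioo, ⟨by linarith, by linarith [ht.2]⟩, hγp, ?_⟩
    filter_upwards [Ioi_mem_nhds hgt] with τ hτ
    rw [if_pos (le_of_lt hτ)]

/-- If geodesics exist for a time which depends only on the square of the initial velocity, then
the metric is geodesically complete. -/
theorem isGeodesicallyComplete_of_uniform (hg : IsSemiRiemannian I g) (r : ℝ → ℝ)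
    (hr : ∀ c, 0 < r c) (h : ∀ (x : M) (v : E), ∃ γ : ℝ → M,
      IsGeodesicOn I g γ (Set.Ioo (-(r (form I g x v v))) (r (form I g x v v))) ∧
        γ 0 = x ∧ vel I γ 0 = v) : IsGeodesicallyComplete I g := by
  rintro ⟨x, v⟩
  set c := form I g x v v with hc
  -- Existence times after n extensions; they are unbounded because r c > 0.
  set a : ℕ → ℝ := fun n => (3 / 2) ^ n * r c with ha
  have ha0 : ∀ n, 0 < a n := fun n => mul_pos (by positivity) (hr c)
  have hex : ∀ n, ∀ (x : M) (v : E), form I g x v v = c → ∃ γ : ℝ → M,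
      IsGeodesicOn I g γ (Set.Ioo (-(a n)) (a n)) ∧ γ 0 = x ∧ vel I γ 0 = v := by
    intro n
    induction n with
    | zero =>
      intro x v hv
      have := h x v
      rw [hv] at this
      simpa [ha] using this
    | succ n ih =>
      have h1 : a (n + 1) = 3 / 2 * a n := by
        simp only [ha, pow_succ]
        ring
      rw [h1]
      exact exists_geodesic_extend hg (ha0 n) ih
  choose γ hγ h0 hv using fun n => hex n x v rfl
  have hlim : ∀ t : ℝ, ∃ n, |t| < a n := by
    intro t
    obtain ⟨n, hn⟩ := pow_unbounded_of_one_lt (|t| / r c) (show (1 : ℝ) < 3 / 2 by norm_num)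
    exact ⟨n, (div_lt_iff₀ (hr c)).1 hn⟩
  choose n hn using hlim
  have heq : ∀ m t, |t| < a m → γ (n t) t = γ m t := by
    intro m t ht
    have h1 : t ∈ Set.Ioo (-(a m)) (a m) ∩ Set.Ioo (-(a (n t))) (a (n t)) :=
      ⟨abs_lt.1 ht, abs_lt.1 (hn t)⟩
    exact geodesic_unique hg (isOpen_Ioo.inter isOpen_Ioo)
      (Set.ordConnected_Ioo.inter Set.ordConnected_Ioo) ((hγ (n t)).mono Set.inter_subset_right)
      ((hγ m).mono Set.inter_subset_left) (t₀ := 0)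
      ⟨⟨by linarith [ha0 m], ha0 m⟩, by linarith [ha0 (n t)], ha0 (n t)⟩ h1
      (by rw [h0, h0]) (by rw [hv, hv])
  have hloc : ∀ t, (fun τ => γ (n τ) τ) =ᶠ[𝓝 t] γ (n t) := by
    intro t
    filter_upwards [Ioo_mem_nhds (abs_lt.1 (hn t)).1 (abs_lt.1 (hn t)).2] with τ hτ
    exact heq _ τ (abs_lt.2 hτ)
  refine ⟨fun t => γ (n t) t, IsGeodesicOn.of_locally fun t _ =>
    ⟨γ (n t), _, isOpen_Ioo, abs_lt.1 (hn t), hγ (n t), hloc t⟩, ?_⟩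
  exact initialVelocity_eq (h0 _) ((vel_congr (hloc 0)).trans (hv _))

end Gluing

/-! ### Completeness of the fibre -/

section Reparametrization

lemma exists_antideriv {J : Set ℝ} (hJ : IsOpen J) (hJ' : J.OrdConnected) (h0 : (0 : ℝ) ∈ J)
    {u : ℝ → ℝ} (hu : ContDiffOn ℝ ∞ u J) :
    ∃ θ : ℝ → ℝ, θ 0 = 0 ∧ ContDiffOn ℝ ∞ θ J ∧ ∀ τ ∈ J, HasDerivAt θ (u τ) τ := by
  have hd : ∀ τ ∈ J, HasDerivAt (fun τ => ∫ t in (0 : ℝ)..τ, u t) (u τ) τ := by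
    intro τ hτ
    have hsub : Set.uIcc 0 τ ⊆ J := hJ'.uIcc_subset h0 hτ
    refine intervalIntegral.integral_hasDerivAt_right
      (hu.continuousOn.mono hsub).intervalIntegrable ?_ (hu.continuousOn.continuousAt (hJ.mem_nhds hτ))
    exact hu.continuousOn.stronglyMeasurableAtFilter hJ τ hτ
  refine ⟨fun τ => ∫ t in (0 : ℝ)..τ, u t, by simp, ?_, hd⟩
  rw [contDiffOn_infty_iff_deriv_of_isOpen hJ]
  exact ⟨fun τ hτ => (hd τ hτ).differentiableAt.differentiableWithinAt,
    hu.congr fun τ hτ => (hd τ hτ).deriv⟩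

/-- The explicit solution of `p' = q / D`, `q' = -k p / D`, `p(0) = 1`, `q(0) = 0` with
`D = 1 + k τ²`. -/
lemma eq_inv_sqrt {k : ℝ} {J : Set ℝ} (hJ' : J.OrdConnected) (h0 : (0 : ℝ) ∈ J)
    (hD : ∀ τ ∈ J, 0 < 1 + k * τ ^ 2) {p q : ℝ → ℝ}
    (hp : ∀ τ ∈ J, HasDerivAt p (q τ / (1 + k * τ ^ 2)) τ)
    (hq : ∀ τ ∈ J, HasDerivAt q (-(k * p τ) / (1 + k * τ ^ 2)) τ) (hp0 : p 0 = 1) (hq0 : q 0 = 0)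
    {τ : ℝ} (hτ : τ ∈ J) : p τ = (√(1 + k * τ ^ 2))⁻¹ ∧ q τ = -(k * τ) * (√(1 + k * τ ^ 2))⁻¹ := by
  have hD' : ∀ τ, HasDerivAt (fun τ : ℝ => 1 + k * τ ^ 2) (2 * k * τ) τ := fun τ => by
    refine (((hasDerivAt_pow 2 τ).const_mul k).const_add 1).congr_deriv ?_
    simp
    ring
  have hP : ∀ τ ∈ J, HasDerivAt (fun τ : ℝ => (√(1 + k * τ ^ 2))⁻¹)
      (-(k * τ) * (√(1 + k * τ ^ 2))⁻¹ / (1 + k * τ ^ 2)) τ := by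
    intro τ hτ
    have h1 := hD τ hτ
    have h2 := Real.sqrt_pos.2 h1
    refine (((hD' τ).sqrt h1.ne').inv h2.ne').congr_deriv ?_
    rw [Real.sq_sqrt h1.le]
    field_simp
  have hQ : ∀ τ ∈ J, HasDerivAt (fun τ : ℝ => -(k * τ) * (√(1 + k * τ ^ 2))⁻¹)
      (-(k * (√(1 + k * τ ^ 2))⁻¹) / (1 + k * τ ^ 2)) τ := by
    intro τ hτ
    have h1 := hD τ hτ
    have h2 := Real.sqrt_pos.2 h1
    refine ((((hasDerivAt_id τ).const_mul k).neg).mul (hP τ hτ)).congr_deriv ?_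
    simp only [id, mul_one, Pi.neg_apply]
    field_simp
    ring
  have := eq_zero_of_norm_deriv_le (w := fun τ => ((p τ - (√(1 + k * τ ^ 2))⁻¹,
      q τ - -(k * τ) * (√(1 + k * τ ^ 2))⁻¹) : ℝ × ℝ))
    (w' := fun τ => (q τ / (1 + k * τ ^ 2) - -(k * τ) * (√(1 + k * τ ^ 2))⁻¹ / (1 + k * τ ^ 2),
      -(k * p τ) / (1 + k * τ ^ 2) - -(k * (√(1 + k * τ ^ 2))⁻¹) / (1 + k * τ ^ 2)))
    (K := fun τ => (1 + |k|) / (1 + k * τ ^ 2)) hJ'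
    (fun τ hτ => ((hp τ hτ).sub (hP τ hτ)).prodMk ((hq τ hτ).sub (hQ τ hτ))) ?_ ?_ h0
    (by simp [hp0, hq0]) τ hτ
  · simp only [Prod.mk_eq_zero, sub_eq_zero] at this
    exact this
  · exact continuousOn_const.div (by fun_prop) fun τ hτ => (hD τ hτ).ne'
  · intro τ hτ
    have h1 := hD τ hτ
    set P := (√(1 + k * τ ^ 2))⁻¹
    have e1 : q τ / (1 + k * τ ^ 2) - -(k * τ) * P / (1 + k * τ ^ 2) =
      (q τ - -(k * τ) * P) / (1 + k * τ ^ 2) := by ring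
    have e2 : -(k * p τ) / (1 + k * τ ^ 2) - -(k * P) / (1 + k * τ ^ 2) =
      -k * (p τ - P) / (1 + k * τ ^ 2) := by ring
    rw [e1, e2, div_mul_eq_mul_div]
    have a1 := norm_fst_le ((p τ - P, q τ - -(k * τ) * P) : ℝ × ℝ)
    have a2 := norm_snd_le ((p τ - P, q τ - -(k * τ) * P) : ℝ × ℝ)
    have a3 := norm_nonneg ((p τ - P, q τ - -(k * τ) * P) : ℝ × ℝ)
    have a4 := abs_nonneg k
    refine norm_prod_le_iff.2 ⟨?_, ?_⟩
    · rw [norm_div, Real.norm_of_nonneg h1.le]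
      exact div_le_div_of_nonneg_right (by nlinarith) h1.le
    · rw [norm_div, Real.norm_of_nonneg h1.le, norm_mul, norm_neg, Real.norm_eq_abs k]
      refine div_le_div_of_nonneg_right ?_ h1.le
      have := mul_le_mul_of_nonneg_left a1 a4
      nlinarith

end Reparametrization

/-! ### Completeness of the level set. -/

section FibreComplete

variable {E : Type*} [NormedAddCommGroup E] [NormedSpace ℝ E] [FiniteDimensional ℝ E]
  {H : Type*} [TopologicalSpace H] {I : ModelWithCorners ℝ E H} [I.Boundaryless]
  {M : Type*} [TopologicalSpace M] [ChartedSpace H M] [IsManifold I ∞ M] [T2Space M]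
  {E' : Type*} [NormedAddCommGroup E'] [NormedSpace ℝ E'] [FiniteDimensional ℝ E']
  {N : Type*} [TopologicalSpace N] [ChartedSpace E' N] [IsManifold 𝓘(ℝ, E') ∞ N]

variable {g : BilinField I M} {f : M → ℝ} {ξ : M → E} {κ : ℝ} {F F₁ : ℝ → ℝ} {U : Set M} {s : M → ℝ}
  {ι : N → M} {φ : ℝ → M → M}

namespace WarpData

lemma vel_proj (h : WarpData I g f ξ κ F F₁ U s)
    (hφ : IsFlow I (warpField ξ κ F₁ s) U φ)
    (hι : IsLevelEmbedding (E' := E') I ι f (F 0)) {π : M → N}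
    (hπs : ∀ p ∈ U, ContMDiffAt I 𝓘(ℝ, E') ∞ π p) (hπι : ∀ t z, π (φ t (ι z)) = z) {γ : ℝ → M}
    {θ : ℝ → ℝ} {z : N} {u : E'} (hθ0 : θ 0 = 0) (hθ : HasDerivAt θ 1 0)
    (hγ : MDifferentiableAt 𝓘(ℝ, ℝ) I γ 0) (h0 : γ 0 = ι z) (hv : vel I γ 0 = md 𝓘(ℝ, E') I ι z u) :
    π (γ (θ 0)) = z ∧ vel 𝓘(ℝ, E') (fun τ => π (γ (θ τ))) 0 = u := by
  have hx := h.mem_level hι z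
  have hπι' : ∀ z, π (ι z) = z := fun z => by
    rw [← hφ.zero _ (h.mem_level hι z), hπι]
  refine ⟨by rw [hθ0, h0, hπι'], ?_⟩
  have h1 : MDifferentiableAt I 𝓘(ℝ, E') π (ι z) := (hπs _ hx).mdifferentiableAt (by simp)
  have h2 : MDifferentiableAt 𝓘(ℝ, ℝ) I (fun τ => γ (θ τ)) 0 :=
    MDifferentiableAt.comp (g := γ) (f := θ) 0 (by rwa [hθ0]) hθ.differentiableAt.mdifferentiableAt
  have h3 : vel I (fun τ => γ (θ τ)) 0 = md 𝓘(ℝ, ℝ) I γ (θ 0) (md 𝓘(ℝ, ℝ) 𝓘(ℝ, ℝ) θ 0 1) :=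
    md_comp_apply (f := γ) (h := θ) (x := 0) (by rwa [hθ0]) hθ.differentiableAt.mdifferentiableAt 1
  rw [md_eq_fderiv, fderiv_apply_one_eq_deriv, hθ.deriv, hθ0] at h3
  have h4 := vel_comp (ψ := π) (γ := fun τ => γ (θ τ)) (t := 0) (by rwa [hθ0, h0]) h2
  rw [h4, h3, hθ0, h0]
  change md I 𝓘(ℝ, E') π (ι z) (vel I γ 0) = u
  rw [hv, ← md_comp_apply (f := π) (h := ι) (x := z) h1 (hι.mdifferentiableAt z),
    funext hπι']
  exact congrArg (fun l : E' →L[ℝ] E' => l u) (md_id (I := 𝓘(ℝ, E')) z)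

/-- As F(0) = 0, the constant F(0) solves the equation for f along geodesics. So a geodesic of M
tangent to the level stays in it, and no reparametrization is needed. -/
theorem complete_level_of_eq_zero (h : WarpData I g f ξ κ F F₁ U s) (hF : F 0 = 0)
    (hφ : IsFlow I (warpField ξ κ F₁ s) U φ) (hs : ∀ x ∈ U, ∀ t, s (φ t x) = s x + t)
    (hι : IsLevelEmbedding (E' := E') I ι f (F 0)) (hc : IsGeodesicallyComplete I g) :
    IsGeodesicallyComplete 𝓘(ℝ, E') (pullback 𝓘(ℝ, E') I ι g) := by
  rintro ⟨z, u⟩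
  have : Nonempty N := ⟨z⟩
  obtain ⟨π, -, hπs, hπ, hπι⟩ := h.exists_proj hφ hs hι
  obtain ⟨γ, hγ, h0, hv⟩ := hc.exists_geodesic (ι z) (md 𝓘(ℝ, E') I ι z u)
  have hu : IsOpen (Set.univ : Set ℝ) := isOpen_univ
  have hf : ∀ t, f (γ t) = F 0 := by
    intro t
    refine (oscillator_unique (k := κ * energy I g γ 0) (y := fun t => f (γ t))
      (y' := fun t => md I 𝓘(ℝ, ℝ) f (γ t) (vel I γ t)) (z := fun _ => F 0) (z' := fun _ => 0)
      (fun t => hγ.hasDerivAt_comp h.data.contMDiff hu (Set.mem_univ t)) (fun t => ?_)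
      (fun t => hasDerivAt_const _ _) (fun t => ?_) (t₀ := 0) ?_ ?_ t).1
    · refine (hγ.hasDerivAt_deriv_comp h.data.metric h.data.contMDiff h.data.hess hu
        (Set.mem_univ t)).congr_deriv ?_
      rw [hγ.energy_eq h.data.metric hu Set.ordConnected_univ (Set.mem_univ t) (Set.mem_univ 0)]
      ring
    · refine (hasDerivAt_const t (0 : ℝ)).congr_deriv ?_
      rw [hF]
      ring
    · simp only [h0, hι.eq_level z]
    · simp only [h0, hv]
      exact hι.md_comp_eq_zero (h.data.mdifferentiableAt _) u
  have hsz : ∀ t, s (γ t) = 0 := fun t => h.eq_of_eq (hf t)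
  have hd : ∀ t : ℝ, HasDerivAt (fun t : ℝ => t) 1 t := fun t => hasDerivAt_id t
  have hd' : deriv (fun t : ℝ => t) = fun _ => 1 := funext fun t => (hd t).deriv
  refine ⟨fun t => π (γ t), h.isGeodesicOn_proj hφ hs hι hπs hπ hγ hu (θ := fun t => t)
    contDiffOn_id (fun τ _ => by rw [hd']; exact one_ne_zero) (fun τ _ => h.mem _ 0 (hf τ))
    (fun τ _ => ?_), ?_⟩
  · rw [hd', hsz, hF]
    simp
  · obtain ⟨h1, h2⟩ := h.vel_proj hφ hι hπs hπι (θ := fun t => t) rfl (hd 0)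
      (hγ.mdifferentiableAt hu (Set.mem_univ 0)) h0 hv
    exact initialVelocity_eq h1 h2

/-- The fibre of a warped product with warping function `exp` is complete. -/
theorem complete_level_of_exp (h : WarpData I g f ξ κ Real.exp Real.exp U s) [T2Space N]
    (hφ : IsFlow I (warpField ξ κ Real.exp s) U φ) (hs : ∀ x ∈ U, ∀ t, s (φ t x) = s x + t)
    (hι : IsLevelEmbedding (E' := E') I ι f (Real.exp 0)) (hc : IsGeodesicallyComplete I g) :
    IsGeodesicallyComplete 𝓘(ℝ, E') (pullback 𝓘(ℝ, E') I ι g) := by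
  -- The radius depends on g(u, u) only, and |τ| below it ensures |k| τ² < 1, hence 1 + k τ² > 0 for
  -- either sign of k.
  refine isGeodesicallyComplete_of_uniform (h.isSemiRiemannian_level hι)
    (fun c => (√(|κ * c| + 1))⁻¹) (fun c => by positivity) fun z u => ?_
  have : Nonempty N := ⟨z⟩
  set c := form 𝓘(ℝ, E') (pullback 𝓘(ℝ, E') I ι g) z u u with hcdef
  set k := κ * c with hk
  set J := Set.Ioo (-(√(|k| + 1))⁻¹) (√(|k| + 1))⁻¹ with hJ
  have hr : 0 < (√(|k| + 1))⁻¹ := by positivity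
  have hD : ∀ τ ∈ J, 0 < 1 + k * τ ^ 2 := by
    intro τ hτ
    have h1 : τ ^ 2 < (|k| + 1)⁻¹ := by
      have h2 := abs_lt.2 hτ
      have h3 : |τ| ^ 2 < ((√(|k| + 1))⁻¹) ^ 2 := by gcongr
      rwa [sq_abs, inv_pow, Real.sq_sqrt (by positivity)] at h3
    have h2 : |k * τ ^ 2| < 1 := by
      rw [abs_mul, abs_of_nonneg (sq_nonneg τ)]
      have h3 : (|k| + 1) * (|k| + 1)⁻¹ = 1 := mul_inv_cancel₀ (by positivity)
      have h4 := abs_nonneg k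
      nlinarith [sq_nonneg τ]
    linarith [(abs_lt.1 h2).1]
  have h0J : (0 : ℝ) ∈ J := ⟨by linarith, hr⟩
  have hus : ContDiffOn ℝ ∞ (fun τ : ℝ => (1 + k * τ ^ 2)⁻¹) J :=
    ContDiffOn.inv (by fun_prop) fun τ hτ => (hD τ hτ).ne'
  -- The projected curve becomes a geodesic when θ' is a constant multiple of F₁(s)² = f². Along γ
  -- one has f'' = -k f with f = 1 and f' = 0 at time 0, and solving θ' = f(γ ∘ θ)² gives θ' = 1 /
  -- (1 + k τ²).
  obtain ⟨θ, hθ0, hθs, hθ⟩ := exists_antideriv isOpen_Ioo Set.ordConnected_Ioo h0J hus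
  obtain ⟨π, -, hπs, hπ, hπι⟩ := h.exists_proj hφ hs hι
  obtain ⟨γ, hγ, h0, hv⟩ := hc.exists_geodesic (ι z) (md 𝓘(ℝ, E') I ι z u)
  have hu : IsOpen (Set.univ : Set ℝ) := isOpen_univ
  have hen : ∀ t, energy I g γ t = c := by
    intro t
    rw [hγ.energy_eq h.data.metric hu Set.ordConnected_univ (Set.mem_univ t) (Set.mem_univ 0),
      energy, h0, hv]
    rfl
  have hfd : ∀ t, HasDerivAt (fun t => f (γ t)) (md I 𝓘(ℝ, ℝ) f (γ t) (vel I γ t)) t := fun t =>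
    hγ.hasDerivAt_comp h.data.contMDiff hu (Set.mem_univ t)
  -- In the parameter τ trigonometric and hyperbolic solutions take the same algebraic form, so the
  -- sign of k need not be distinguished. Positivity of f on J keeps the curve inside U.
  have hpq : ∀ τ ∈ J, f (γ (θ τ)) = (√(1 + k * τ ^ 2))⁻¹ ∧
      md I 𝓘(ℝ, ℝ) f (γ (θ τ)) (vel I γ (θ τ)) = -(k * τ) * (√(1 + k * τ ^ 2))⁻¹ := by
    intro τ hτ
    refine eq_inv_sqrt (p := fun τ => f (γ (θ τ)))
      (q := fun τ => md I 𝓘(ℝ, ℝ) f (γ (θ τ)) (vel I γ (θ τ))) Set.ordConnected_Ioo h0J hD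
      (fun τ hτ => ?_) (fun τ hτ => ?_) ?_ ?_ hτ
    · exact HasDerivAt.comp (h₂ := fun t => f (γ t)) τ (hfd (θ τ)) (hθ τ hτ)
    · refine (HasDerivAt.comp (h₂ := fun t => md I 𝓘(ℝ, ℝ) f (γ t) (vel I γ t)) τ
        (hγ.hasDerivAt_deriv_comp h.data.metric h.data.contMDiff h.data.hess hu
          (Set.mem_univ (θ τ))) (hθ τ hτ)).congr_deriv ?_
      rw [hen]
      simp only [hk]
      ring
    · simp only [hθ0, h0, hι.eq_level z, Real.exp_zero]
    · simp only [hθ0, h0, hv]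
      exact hι.md_comp_eq_zero (h.data.mdifferentiableAt _) u
  have hpos : ∀ τ ∈ J, 0 < f (γ (θ τ)) := by
    intro τ hτ
    rw [(hpq τ hτ).1]
    exact inv_pos.2 (Real.sqrt_pos.2 (hD τ hτ))
  have hU : ∀ τ ∈ J, γ (θ τ) ∈ U := fun τ hτ =>
    h.mem _ (Real.log (f (γ (θ τ)))) (Real.exp_log (hpos τ hτ)).symm
  have hσ : ∀ τ ∈ J, s (γ (θ τ)) = Real.log (f (γ (θ τ))) := fun τ hτ =>
    h.eq_of_eq (Real.exp_log (hpos τ hτ)).symm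
  have hdσ : ∀ τ ∈ J, HasDerivAt (fun τ => s (γ (θ τ))) (-(k * τ) / (1 + k * τ ^ 2)) τ := by
    intro τ hτ
    have h1 : HasDerivAt (fun τ => Real.log (f (γ (θ τ)))) _ τ :=
      (HasDerivAt.comp (h₂ := fun t => f (γ t)) τ (hfd (θ τ)) (hθ τ hτ)).log (hpos τ hτ).ne'
    have h2 := h1.congr_of_eventuallyEq (f₁ := fun τ => s (γ (θ τ))) (by
      filter_upwards [isOpen_Ioo.mem_nhds hτ] with τ' hτ' using hσ τ' hτ')
    refine h2.congr_deriv ?_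
    simp only [Function.comp_apply]
    rw [(hpq τ hτ).2, (hpq τ hτ).1]
    have h3 := Real.sqrt_pos.2 (hD τ hτ)
    have h4 := hD τ hτ
    field_simp
  have hθ' : ∀ τ ∈ J, deriv θ τ = (1 + k * τ ^ 2)⁻¹ := fun τ hτ => (hθ τ hτ).deriv
  have hθ'' : ∀ τ ∈ J, deriv (deriv θ) τ = -(2 * k * τ) / (1 + k * τ ^ 2) ^ 2 := by
    intro τ hτ
    have h1 : deriv θ =ᶠ[𝓝 τ] fun τ => (1 + k * τ ^ 2)⁻¹ := by
      filter_upwards [isOpen_Ioo.mem_nhds hτ] with τ' hτ' using hθ' τ' hτ'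
    have h2 : HasDerivAt (fun τ : ℝ => 1 + k * τ ^ 2) (2 * k * τ) τ := by
      refine (((hasDerivAt_pow 2 τ).const_mul k).const_add 1).congr_deriv ?_
      simp
      ring
    rw [h1.deriv_eq]
    exact (h2.inv (hD τ hτ).ne').deriv
  refine ⟨fun τ => π (γ (θ τ)), h.isGeodesicOn_proj hφ hs hι hπs hπ hγ isOpen_Ioo hθs
    (fun τ hτ => ?_) hU (fun τ hτ => ?_), ?_⟩
  · rw [hθ' τ hτ]
    exact inv_ne_zero (hD τ hτ).ne'
  · rw [hθ'' τ hτ, hθ' τ hτ, (hdσ τ hτ).deriv]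
    have := hD τ hτ
    field_simp
  · exact h.vel_proj hφ hι hπs hπι hθ0 (by simpa using hθ 0 h0J)
      (hγ.mdifferentiableAt hu (Set.mem_univ 0)) h0 hv

end WarpData
end FibreComplete

/-! ### The three cases -/

section Normalized

variable {E : Type*} [NormedAddCommGroup E] [NormedSpace ℝ E] [FiniteDimensional ℝ E]
  {H : Type*} [TopologicalSpace H] {I : ModelWithCorners ℝ E H} [I.Boundaryless]
  {M : Type*} [TopologicalSpace M] [ChartedSpace H M] [IsManifold I ∞ M]
  {g : BilinField I M} {f : M → ℝ} {ξ : M → E} {κ : ℝ}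

namespace HessianData

/-- The case of a gradient with `g(ξ, ξ) + κ f² = -κ`. -/
lemma warpData_sinh (h : HessianData I g f ξ κ) (hκ : κ * κ = 1)
    (hn : ∀ x, κ * f x ^ 2 + form I g x (ξ x) (ξ x) = -κ) :
    WarpData I g f ξ κ Real.sinh Real.cosh ((⊤ : TopologicalSpace.Opens M) : Set M)
      (fun x => Real.arsinh (f x)) where
  data := h
  sq := hκ
  hasDerivAt := Real.hasDerivAt_sinh
  hasDerivAt₁ := Real.hasDerivAt_cosh
  contDiff := Real.contDiff_cosh
  pos := Real.cosh_pos
  one := Real.cosh_zero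
  isOpen := isOpen_univ
  smooth x _ := (Real.contDiff_arsinh.contDiffAt.contMDiffAt).comp x (h.contMDiff x)
  eq x _ := (Real.sinh_arsinh _).symm
  mem _ _ _ := trivial
  norm x _ := by
    rw [Real.cosh_sq, Real.sinh_arsinh]
    linarith [hn x]

/-- The open set where a function is positive. -/
def posSet (f : M → ℝ) (hf : Continuous f) : TopologicalSpace.Opens M :=
  ⟨{x | 0 < f x}, isOpen_lt continuous_const hf⟩

/-- The case of a gradient with `g(ξ, ξ) + κ f² = 0`. -/
lemma warpData_exp (h : HessianData I g f ξ κ) (hκ : κ * κ = 1)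
    (hn : ∀ x, κ * f x ^ 2 + form I g x (ξ x) (ξ x) = 0) :
    WarpData I g f ξ κ Real.exp Real.exp (posSet f h.contMDiff.continuous : Set M)
      (fun x => Real.log (f x)) where
  data := h
  sq := hκ
  hasDerivAt := Real.hasDerivAt_exp
  hasDerivAt₁ := Real.hasDerivAt_exp
  contDiff := Real.contDiff_exp
  pos := Real.exp_pos
  one := Real.exp_zero
  isOpen := (posSet f h.contMDiff.continuous).isOpen
  smooth x hx := ((Real.contDiffAt_log.2 (show f x ≠ 0 from ne_of_gt hx)).contMDiffAt).comp x
    (h.contMDiff x)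
  eq x hx := (Real.exp_log hx).symm
  mem x t hx := by
    change 0 < f x
    rw [hx]
    exact Real.exp_pos t
  norm x hx := by
    rw [Real.exp_log hx]
    linarith [hn x]

/-- A solution of the Hessian equation along a complete geodesic. -/
lemma oscillator (h : HessianData I g f ξ κ) {γ : ℝ → M} (hγ : IsGeodesicOn I g γ Set.univ) (t : ℝ) :
    HasDerivAt (fun t => f (γ t)) (md I 𝓘(ℝ, ℝ) f (γ t) (vel I γ t)) t ∧
      HasDerivAt (fun t => md I 𝓘(ℝ, ℝ) f (γ t) (vel I γ t))
        (-(κ * energy I g γ 0 * f (γ t))) t := by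
  have hu : IsOpen (Set.univ : Set ℝ) := isOpen_univ
  refine ⟨hγ.hasDerivAt_comp h.contMDiff hu (Set.mem_univ t),
    (hγ.hasDerivAt_deriv_comp h.metric h.contMDiff h.hess hu (Set.mem_univ t)).congr_deriv ?_⟩
  rw [hγ.energy_eq h.metric hu Set.ordConnected_univ (Set.mem_univ t) (Set.mem_univ 0)]
  ring

/-- At a critical point ξ = 0, so the null relation forces f = 0 as well; by unique continuation f
and df then vanish everywhere. -/
lemma md_ne_zero_of_null [PreconnectedSpace M] (h : HessianData I g f ξ κ) (hκ : κ * κ = 1)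
    (hn : ∀ x, κ * f x ^ 2 + form I g x (ξ x) (ξ x) = 0) (hne : ∃ x, f x ≠ 0 ∨ ξ x ≠ 0) (x : M) :
    md I 𝓘(ℝ, ℝ) f x ≠ 0 := by
  intro h0
  have hξ : ∀ x, md I 𝓘(ℝ, ℝ) f x = 0 → ξ x = 0 := fun x hx => h.eq_of_form fun v => by
    rw [h.grad, hx, map_zero]
  have hκ0 : κ ≠ 0 := left_ne_zero_of_mul_eq_one hκ
  have hf : f x = 0 := by
    have := hn x
    rw [hξ x h0, map_zero, add_zero] at this
    simpa [hκ0] using this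
  obtain ⟨x', hx'⟩ := hne
  obtain ⟨h1, h2⟩ := h.eq_zero_of_eq_zero hf h0 x'
  exact hx'.elim (fun h3 => h3 h1) fun h3 => h3 (hξ x' h2)

lemma isSmoothHypersurface (h : HessianData I g f ξ κ) (hd : ∀ x, md I 𝓘(ℝ, ℝ) f x ≠ 0) :
    IsSmoothHypersurface I {x | f x = 0} := fun _ _ =>
  ⟨Set.univ, isOpen_univ, Set.mem_univ _, f, h.contMDiff.contMDiffOn, fun x _ => hd x, by
    ext x
    simp⟩

lemma eq_of_initialVelocity_eq {c γ : ℝ → M} (h : initialVelocity I c = initialVelocity I γ) :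
    c 0 = γ 0 ∧ vel I c 0 = vel I γ 0 := by
  have key : ∀ (x y : M) (u v : E), (⟨x, u⟩ : TangentBundle I M) = ⟨y, v⟩ → x = y ∧ u = v := by
    intro x y u v h
    obtain ⟨h2, h3⟩ := Bundle.TotalSpace.mk.inj h
    subst h2
    exact ⟨rfl, eq_of_heq h3⟩
  exact key _ _ _ _ h

/-- The zero set of a solution of the Hessian equation is totally geodesic. -/
lemma isTotallyGeodesic [T2Space M] (h : HessianData I g f ξ κ)
    (hc : IsGeodesicallyComplete I g) : IsTotallyGeodesic I g {x | f x = 0} := by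
  rintro γ δ hδ hγ ⟨c, hcs, hcS, hcv⟩
  obtain ⟨h0, hv⟩ := eq_of_initialVelocity_eq hcv
  obtain ⟨γ', hγ', h0', hv'⟩ := hc.exists_geodesic (γ 0) (vel I γ 0)
  have hf0 : f (γ 0) = 0 := by
    rw [← h0]
    exact hcS.self_of_nhds
  have hdf : md I 𝓘(ℝ, ℝ) f (γ 0) (vel I γ 0) = 0 := by
    have h1 := hasDerivAt_comp_vel (h.mdifferentiableAt (c 0)) (hcs.mdifferentiableAt (by simp))
    have h2 : (fun t => f (c t)) =ᶠ[𝓝 0] fun _ => 0 := hcS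
    rw [← h0, ← hv, ← h1.deriv, h2.deriv_eq, deriv_const]
  have hz : ∀ t, f (γ' t) = 0 := fun t =>
    (oscillator_unique (z := fun _ => 0) (z' := fun _ => 0) (fun t => (h.oscillator hγ' t).1)
      (fun t => (h.oscillator hγ' t).2) (fun t => hasDerivAt_const _ _)
      (fun t => (hasDerivAt_const _ _).congr_deriv (by ring)) (t₀ := 0)
      (by simp only [h0', hf0]) (by simp only [h0', hv', hdf]) t).1
  filter_upwards [Ioo_mem_nhds (neg_lt_zero.2 hδ) hδ] with t ht
  rw [geodesic_unique h.metric isOpen_Ioo Set.ordConnected_Ioo hγ (hγ'.mono (Set.subset_univ _))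
    (t₀ := 0) ⟨neg_lt_zero.2 hδ, hδ⟩ ht h0'.symm hv'.symm, hz]

/-- If κ g(v, v) > 0, then f is a trigonometric function along the complete geodesic of v and
changes its sign after half a period. -/
lemma nonpos_of_ne_zero (h : HessianData I g f ξ κ) (hc : IsGeodesicallyComplete I g)
    (hf : ∀ x, f x ≠ 0) (x : M) (v : E) : κ * form I g x v v ≤ 0 := by
  by_contra hpos
  push Not at hpos
  obtain ⟨γ, hγ, h0, hv⟩ := hc.exists_geodesic x v
  have hw := Real.sqrt_pos.2 hpos
  set w := √(κ * form I g x v v) with hwd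
  have hen : κ * energy I g γ 0 = w ^ 2 := by
    rw [energy, h0, hv, Real.sq_sqrt hpos.le]
  have h1 := (oscillator_trig hw.ne' (fun t => (h.oscillator hγ t).1)
    (fun t => by simpa only [hen] using (h.oscillator hγ t).2) (Real.pi / w)).1
  rw [mul_div_cancel₀ _ hw.ne', Real.cos_pi, Real.sin_pi] at h1
  have hcont : Continuous fun t => f (γ t) :=
    continuous_iff_continuousAt.2 fun t => (h.oscillator hγ t).1.continuousAt
  have h2 : f (γ (Real.pi / w)) = -f (γ 0) := by linarith
  obtain ⟨t, ht⟩ := mem_range_of_exists_le_of_exists_ge hcont (c := 0) (by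
    rcases le_total (f (γ 0)) 0 with h3 | h3
    · exact ⟨0, h3⟩
    · exact ⟨Real.pi / w, by simp only [h2]; linarith⟩) (by
    rcases le_total (f (γ 0)) 0 with h3 | h3
    · exact ⟨Real.pi / w, by simp only [h2]; linarith⟩
    · exact ⟨0, h3⟩)
  exact hf _ ht

/-- A semidefinite nondegenerate form is definite: a null vector must be orthogonal to everything,
by varying it in the direction of another vector w. -/
lemma neg_of_nonpos (h : HessianData I g f ξ κ) (hκ : κ * κ = 1)
    (hle : ∀ x v, κ * form I g x v v ≤ 0) (x : M) {v : E} (hv : v ≠ 0) :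
    κ * form I g x v v < 0 := by
  refine lt_of_le_of_ne (hle x v) fun h0 => hv ?_
  have hκ0 : κ ≠ 0 := left_ne_zero_of_mul_eq_one hκ
  refine h.eq_of_form (x := x) fun w => ?_
  rw [map_zero]
  change form I g x v w = 0
  by_contra hne
  have hq : ∀ t : ℝ, 2 * t * (κ * form I g x v w) + t ^ 2 * (κ * form I g x w w) ≤ 0 := by
    intro t
    have h1 := hle x (v + t • w)
    have h2 : κ * form I g x (v + t • w) (v + t • w) =
        κ * form I g x v v + (2 * t * (κ * form I g x v w) + t ^ 2 * (κ * form I g x w w)) := by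
      simp only [map_add, map_smul, add_apply, smul_apply, smul_eq_mul, h.symm x w v]
      ring
    linarith
  have hb : κ * form I g x v w ≠ 0 := mul_ne_zero hκ0 hne
  have ha := hle x w
  have hd : 0 < 1 - κ * form I g x w w := by linarith
  -- With a = κ g(w, w) ≤ 0 and b = κ g(v, w) ≠ 0, the parameter t = b / (1 - a) makes 2tb + t²a =
  -- b²(2 - a) / (1 - a)² positive; the 1 in the denominator covers a = 0.
  have h3 := hq (κ * form I g x v w / (1 - κ * form I g x w w))
  set b := κ * form I g x v w
  set a := κ * form I g x w w
  have h4 : 2 * (b / (1 - a)) * b + (b / (1 - a)) ^ 2 * a = b ^ 2 * (2 - a) / (1 - a) ^ 2 := by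
    field_simp
    ring
  rw [h4] at h3
  have h5 : 0 < b ^ 2 * (2 - a) / (1 - a) ^ 2 := by
    have : 0 < b ^ 2 := by positivity
    have : 0 < 2 - a := by linarith
    positivity
  linarith

/-- A solution of the Hessian equation with null gradient has a zero if and only if the metric is
indefinite. -/
lemma zeroSet_eq_empty_iff (h : HessianData I g f ξ κ) (hκ : κ = 1 ∨ κ = -1)
    (hn : ∀ x, κ * f x ^ 2 + form I g x (ξ x) (ξ x) = 0) (hd : ∀ x, md I 𝓘(ℝ, ℝ) f x ≠ 0)
    (hc : IsGeodesicallyComplete I g) : {x | f x = 0} = ∅ ↔ IsDefinite I g := by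
  have hκ' : κ * κ = 1 := by rcases hκ with rfl | rfl <;> norm_num
  constructor
  · intro hf
    have hneg := fun x (v : E) (hv : v ≠ 0) => h.neg_of_nonpos hκ'
      (h.nonpos_of_ne_zero hc fun x hx => Set.notMem_empty x (hf ▸ hx)) x hv
    rcases hκ with rfl | rfl
    · refine Or.inr fun x v hv => ?_
      have h1 : 1 * form I g x v v < 0 := hneg x v hv
      rw [one_mul] at h1
      exact h1
    · refine Or.inl fun x v hv => ?_
      have h1 : -1 * form I g x v v < 0 := hneg x v hv
      have h2 : 0 < form I g x v v := by linarith
      exact h2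
  · intro hdef
    -- At a zero of f the gradient is nonzero and null, which a definite metric excludes.
    refine Set.eq_empty_iff_forall_notMem.2 fun x hx => ?_
    have hf : f x = 0 := hx
    have hξ : ξ x ≠ 0 := by
      intro h0
      refine hd x (ContinuousLinearMap.ext fun v => ?_)
      rw [← h.grad, h0, map_zero]
    have h1 : form I g x (ξ x) (ξ x) = 0 := by
      have := hn x
      rwa [hf, zero_pow two_ne_zero, mul_zero, zero_add] at this
    rcases hdef with h2 | h2
    · have h3 : 0 < form I g x (ξ x) (ξ x) := h2 x (ξ x) hξ
      exact h3.ne' h1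
    · have h3 : form I g x (ξ x) (ξ x) < 0 := h2 x (ξ x) hξ
      exact h3.ne h1

end HessianData
end Normalized

/-! ### Warped product isometries over Euclidean model spaces. -/

section Euclidean

universe u

variable {n : ℕ} {M : Type u} [TopologicalSpace M] [T2Space M] [SecondCountableTopology M]
  [ChartedSpace (EuclideanSpace ℝ (Fin n)) M] [IsManifold (𝓡 n) ∞ M]
  {g : BilinField (𝓡 n) M} {f : M → ℝ} {ξ : M → EuclideanSpace ℝ (Fin n)} {κ : ℝ} {F F₁ : ℝ → ℝ}
  {U : TopologicalSpace.Opens M} {s : M → ℝ}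

/-- For n ≠ 0 the truncated difference satisfies n = (n - 1) + 1, the dimension relation between the
manifold and a regular level. -/
lemma WarpData.exists_level (h : WarpData (𝓡 n) g f ξ κ F F₁ (U : Set M) s) (hn : n ≠ 0) :
    ∃ (_ : ChartedSpace (EuclideanSpace ℝ (Fin (n - 1))) {z : M // f z = F 0}),
      IsManifold 𝓘(ℝ, EuclideanSpace ℝ (Fin (n - 1))) ∞ {z : M // f z = F 0} ∧
      IsLevelEmbedding (E' := EuclideanSpace ℝ (Fin (n - 1))) (𝓡 n)
        (Subtype.val : {z : M // f z = F 0} → M) f (F 0) :=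
  IsRegularLevel.exists_manifold (by simp; omega)
    ⟨h.data.contMDiff, fun x hx => h.md_ne_zero (h.mem x 0 hx)⟩

lemma WarpData.isometric_of_eq_zero (h : WarpData (𝓡 n) g f ξ κ F F₁ (U : Set M) s) (hn : n ≠ 0)
    (hF : F 0 = 0) (hc : IsGeodesicallyComplete (𝓡 n) g) :
    IsometricToWarpedProduct (restrict (𝓡 n) g U) (-κ) (fun t => F₁ t ^ 2) := by
  obtain ⟨_, hman, hι⟩ := h.exists_level hn
  obtain ⟨φ, hφ, hs⟩ := h.exists_flow hc
  obtain ⟨Φ, hΦ⟩ := h.exists_diffeomorph hφ hs hι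
  exact ⟨_, inferInstance, inferInstance, hman, inferInstance,
    TopologicalSpace.Subtype.secondCountableTopology _, _, Φ,
    h.isSemiRiemannian_level hι, h.complete_level_of_eq_zero hF hφ hs hι hc, hΦ⟩

lemma WarpData.isometric_of_exp (h : WarpData (𝓡 n) g f ξ κ Real.exp Real.exp (U : Set M) s)
    (hn : n ≠ 0) (hc : IsGeodesicallyComplete (𝓡 n) g) :
    IsometricToWarpedProduct (restrict (𝓡 n) g U) (-κ) (fun t => Real.exp (2 * t)) := by
  obtain ⟨_, hman, hι⟩ := h.exists_level hn
  obtain ⟨φ, hφ, hs⟩ := h.exists_flow hc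
  obtain ⟨Φ, hΦ⟩ := h.exists_diffeomorph hφ hs hι
  have hexp : (fun t => Real.exp t ^ 2) = fun t => Real.exp (2 * t) := by
    funext t
    rw [two_mul, Real.exp_add, pow_two]
  rw [hexp] at hΦ
  exact ⟨_, inferInstance, inferInstance, hman, inferInstance,
    TopologicalSpace.Subtype.secondCountableTopology _, _, Φ,
    h.isSemiRiemannian_level hι, h.complete_level_of_exp hφ hs hι hc, hΦ⟩

lemma IsometricToWarpedProduct.of_restrict_top {c : ℝ} {η : ℝ → ℝ}
    (h : IsometricToWarpedProduct (restrict (𝓡 n) g ⊤) c η) : IsometricToWarpedProduct g c η := by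
  obtain ⟨N, _, _, _, _, _, gN, Φ, h1, h2, h3⟩ := h
  have hv : ContMDiff (𝓡 n) (𝓡 n) ∞ (Subtype.val : (⊤ : TopologicalSpace.Opens M) → M) :=
    contMDiff_subtype_val
  have hi : ContMDiff (𝓡 n) (𝓡 n) ∞
      (fun x : M => (⟨x, trivial⟩ : (⊤ : TopologicalSpace.Opens M))) :=
    (ContMDiff.subtypeVal_comp_iff (⊤ : TopologicalSpace.Opens M) _).1 contMDiff_id
  let Ψ : Diffeomorph (𝓘(ℝ, ℝ).prod (𝓡 (n - 1))) (𝓡 n) (ℝ × N) M ∞ :=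
    ⟨Φ.toEquiv.trans ⟨Subtype.val, fun x => ⟨x, trivial⟩, fun _ => rfl, fun _ => rfl⟩,
      hv.comp Φ.contMDiff_toFun, Φ.contMDiff_invFun.comp hi⟩
  refine ⟨N, inferInstance, inferInstance, inferInstance, inferInstance, inferInstance, gN, Ψ,
    h1, h2, ?_⟩
  rw [← h3]
  funext q
  exact pullback_comp (f := (Subtype.val : (⊤ : TopologicalSpace.Opens M) → M)) (h := Φ) (x := q)
    ((hv _).mdifferentiableAt (by simp)) ((Φ.contMDiff_toFun q).mdifferentiableAt (by simp)) g

end Euclidean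

/-! ### The hyperbolic cosine case and the null case. -/

section Cases

universe u

variable {n : ℕ} {M : Type u} [TopologicalSpace M] [T2Space M] [SecondCountableTopology M]
  [ConnectedSpace M] [ChartedSpace (EuclideanSpace ℝ (Fin n)) M] [IsManifold (𝓡 n) ∞ M]
  {g : BilinField (𝓡 n) M} {f : M → ℝ} {ξ : M → EuclideanSpace ℝ (Fin n)} {κ : ℝ}

namespace HessianData

/-- Serves to exclude dimension 0, where n - 1 would be truncated: there g(ξ, ξ) = 0, which
contradicts the norm relation or the nontriviality of (f, ξ). -/
lemma form_eq_zero_of_dim_eq_zero {n : ℕ} (hn : n = 0) {M : Type u} [TopologicalSpace M]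
    [ChartedSpace (EuclideanSpace ℝ (Fin n)) M] (g : BilinField (𝓡 n) M) (x : M)
    (v : EuclideanSpace ℝ (Fin n)) : v = 0 ∧ form (𝓡 n) g x v v = 0 := by
  subst hn
  have hv : v = 0 := Subsingleton.elim _ _
  exact ⟨hv, by rw [hv, map_zero]⟩

theorem isometric_cosh (h : HessianData (𝓡 n) g f ξ κ) (hκ : κ * κ = 1)
    (hn : ∀ x, κ * f x ^ 2 + form (𝓡 n) g x (ξ x) (ξ x) = -κ)
    (hc : IsGeodesicallyComplete (𝓡 n) g) :
    IsometricToWarpedProduct g (-κ) (fun t => Real.cosh t ^ 2) := by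
  have hdim : n ≠ 0 := by
    intro h0
    obtain ⟨x⟩ := (inferInstance : Nonempty M)
    have h1 := hn x
    rw [(form_eq_zero_of_dim_eq_zero h0 g x (ξ x)).2] at h1
    have hκ0 : κ ≠ 0 := left_ne_zero_of_mul_eq_one hκ
    have h2 : κ * (f x ^ 2 + 1) = 0 := by linarith
    rcases mul_eq_zero.1 h2 with h3 | h3
    · exact hκ0 h3
    · nlinarith [sq_nonneg (f x)]
  exact ((h.warpData_sinh hκ hn).isometric_of_eq_zero hdim Real.sinh_zero hc).of_restrict_top

/-- The three pieces are the sets where f is negative, zero and positive. The negative piece is the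
positive one of -f, which satisfies the same equations. -/
theorem decomposition_of_null (h : HessianData (𝓡 n) g f ξ κ) (hκ : κ = 1 ∨ κ = -1)
    (hn : ∀ x, κ * f x ^ 2 + form (𝓡 n) g x (ξ x) (ξ x) = 0) (hne : ∃ x, f x ≠ 0 ∨ ξ x ≠ 0)
    (hc : IsGeodesicallyComplete (𝓡 n) g) :
    ∃ (Mminus Mplus : TopologicalSpace.Opens M) (Mzero : Set M),
      (Mminus : Set M) ∪ Mzero ∪ (Mplus : Set M) = Set.univ ∧
      Disjoint (Mminus : Set M) Mzero ∧ Disjoint Mzero (Mplus : Set M) ∧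
      Disjoint (Mminus : Set M) (Mplus : Set M) ∧
      ((Mzero = ∅ ∧ ((Mminus : Set M) = ∅ ∨ (Mplus : Set M) = ∅)) ∨
        (Mzero.Nonempty ∧ IsSmoothHypersurface (𝓡 n) Mzero ∧
          IsTotallyGeodesic (𝓡 n) g Mzero)) ∧
      IsometricToWarpedProduct (restrict (𝓡 n) g Mminus) (-κ) (fun s => Real.exp (2 * s)) ∧
      IsometricToWarpedProduct (restrict (𝓡 n) g Mplus) (-κ) (fun s => Real.exp (2 * s)) ∧
      (Mzero = ∅ ↔ IsDefinite (𝓡 n) g) := by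
  have hκ' : κ * κ = 1 := by rcases hκ with rfl | rfl <;> norm_num
  have hκ0 : κ ≠ 0 := left_ne_zero_of_mul_eq_one hκ'
  have hdim : n ≠ 0 := by
    intro h0
    obtain ⟨x, hx⟩ := hne
    have h1 := hn x
    rw [(form_eq_zero_of_dim_eq_zero h0 g x (ξ x)).2, add_zero] at h1
    refine hx.elim (fun h2 => h2 ?_) fun h2 => h2 (form_eq_zero_of_dim_eq_zero h0 g x (ξ x)).1
    simpa [hκ0] using h1
  have hd := h.md_ne_zero_of_null hκ' hn hne
  have hcont := h.contMDiff.continuous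
  have hn' : ∀ x, κ * (-f) x ^ 2 + form (𝓡 n) g x ((-ξ) x) ((-ξ) x) = 0 := fun x => by
    simpa using hn x
  have hmem : ∀ x, x ∈ posSet f hcont ↔ 0 < f x := fun x => Iff.rfl
  have hmem' : ∀ x, x ∈ posSet (-f) h.neg.contMDiff.continuous ↔ f x < 0 := fun x => by
    change 0 < -f x ↔ f x < 0
    exact neg_pos
  refine ⟨posSet (-f) h.neg.contMDiff.continuous, posSet f hcont, {x | f x = 0}, ?_, ?_, ?_, ?_, ?_,
    (h.neg.warpData_exp hκ' hn').isometric_of_exp hdim hc,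
    (h.warpData_exp hκ' hn).isometric_of_exp hdim hc, h.zeroSet_eq_empty_iff hκ hn hd hc⟩
  · refine Set.eq_univ_of_forall fun x => ?_
    rcases lt_trichotomy (f x) 0 with h1 | h1 | h1
    · exact Or.inl (Or.inl ((hmem' x).2 h1))
    · exact Or.inl (Or.inr h1)
    · exact Or.inr h1
  · exact Set.disjoint_left.2 fun x h1 h2 => ((hmem' x).1 h1).ne h2
  · exact Set.disjoint_left.2 fun x h1 h2 => ((hmem x).1 h2).ne' h1
  · exact Set.disjoint_left.2 fun x h1 h2 => ((hmem' x).1 h1).not_gt ((hmem x).1 h2)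
  · rcases Set.eq_empty_or_nonempty {x | f x = 0} with h0 | h0
    · refine Or.inl ⟨h0, ?_⟩
      by_contra hcon
      rw [not_or] at hcon
      obtain ⟨a, ha⟩ := Set.nonempty_iff_ne_empty.2 hcon.1
      obtain ⟨b, hb⟩ := Set.nonempty_iff_ne_empty.2 hcon.2
      -- M is connected, so f cannot take both signs without a zero.
      obtain ⟨x, hx⟩ := mem_range_of_exists_le_of_exists_ge hcont (c := 0)
        ⟨a, ((hmem' a).1 ha).le⟩ ⟨b, ((hmem b).1 hb).le⟩
      exact Set.notMem_empty x (h0 ▸ hx)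
    · exact Or.inr ⟨h0, h.isSmoothHypersurface hd, h.isTotallyGeodesic hc⟩

end HessianData
end Cases

end SemiRiem

end

theorem theorem1p1 {n : ℕ} {M : Type*} [TopologicalSpace M] [T2Space M]
    [SecondCountableTopology M] [ConnectedSpace M]
    [ChartedSpace (EuclideanSpace ℝ (Fin n)) M]
    [IsManifold (𝓡 n) ∞ M]
    (g : SemiRiem.BilinField (𝓡 n) M)
    (hg : SemiRiem.IsSemiRiemannian (𝓡 n) g)
    (hcomplete : SemiRiem.IsGeodesicallyComplete (𝓡 n) g)
    (ε : ℝ) (hε : ε = 1 ∨ ε = -1)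
    (V : Π p : SemiRiem.Cone M,
      TangentSpace (SemiRiem.coneModel (𝓡 n)) p)
    (hVsmooth : ContMDiff (SemiRiem.coneModel (𝓡 n))
      (SemiRiem.coneModel (𝓡 n)).tangent ∞
      (fun p => (⟨p, V p⟩ : TangentBundle
        (SemiRiem.coneModel (𝓡 n)) (SemiRiem.Cone M))))
    (hVparallel : SemiRiem.IsParallel (SemiRiem.coneModel (𝓡 n))
      (SemiRiem.coneMetric (𝓡 n) ε g) V) :
    ((∀ p, SemiRiem.coneMetric (𝓡 n) ε g p (V p) (V p) = ε) →
      SemiRiem.IsFlat (SemiRiem.coneModel (𝓡 n))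
        (SemiRiem.coneMetric (𝓡 n) ε g) ∧
      SemiRiem.HasConstantCurvature (𝓡 n) g ε) ∧
    ((∀ p, SemiRiem.coneMetric (𝓡 n) ε g p (V p) (V p) = -ε) →
      SemiRiem.IsometricToWarpedProduct g (-ε) (fun s => Real.cosh s ^ 2)) ∧
    ((∀ p, SemiRiem.coneMetric (𝓡 n) ε g p (V p) (V p) = 0) →
      (∃ p, V p ≠ 0) →
      ∃ (Mminus Mplus : TopologicalSpace.Opens M) (Mzero : Set M),
        (Mminus : Set M) ∪ Mzero ∪ (Mplus : Set M) = Set.univ ∧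
        Disjoint (Mminus : Set M) Mzero ∧ Disjoint Mzero (Mplus : Set M) ∧
        Disjoint (Mminus : Set M) (Mplus : Set M) ∧
        ((Mzero = ∅ ∧ ((Mminus : Set M) = ∅ ∨ (Mplus : Set M) = ∅)) ∨
          (Mzero.Nonempty ∧
            SemiRiem.IsSmoothHypersurface (𝓡 n) Mzero ∧
            SemiRiem.IsTotallyGeodesic (𝓡 n) g Mzero)) ∧
        SemiRiem.IsometricToWarpedProduct
          (SemiRiem.restrict (𝓡 n) g Mminus)
          (-ε) (fun s => Real.exp (2 * s)) ∧
        SemiRiem.IsometricToWarpedProduct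
          (SemiRiem.restrict (𝓡 n) g Mplus)
          (-ε) (fun s => Real.exp (2 * s)) ∧
        (Mzero = ∅ ↔ SemiRiem.IsDefinite (𝓡 n) g)) := by
  have hε' : ε * ε = 1 := by rcases hε with rfl | rfl <;> norm_num
  have hε0 : ε ≠ 0 := left_ne_zero_of_mul_eq_one hε'
  have hW := SemiRiem.coneParallel hε' hg hVsmooth hVparallel
  have hH := hW.hessianData
  have hnorm : ∀ c, (∀ p, SemiRiem.coneMetric (𝓡 n) ε g p (V p) (V p) = c) → ∀ x, _ = c :=
    fun c hc x => (hW.form_self SemiRiem.onePos x).symm.trans (hc (SemiRiem.onePos, x))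
  refine ⟨fun h => ?_, fun h => hH.isometric_cosh hε' (hnorm _ h) hcomplete, fun h hne =>
    hH.decomposition_of_null hε (hnorm _ h) ?_ hcomplete⟩
  · have hd := fun q => hH.defect_eq_zero hε' (fun x => by linarith [hnorm _ h x]) hcomplete q
    exact ⟨SemiRiem.isFlat_coneMetric hg hε' hd, SemiRiem.hasConstantCurvature_of_defect hg hd⟩
  -- V is determined by f and ξ, hence a nonzero value of V at some radius gives a nonzero f or ξ at
  -- the same point of M.
  · obtain ⟨⟨r, x⟩, hp⟩ := hne
    refine ⟨x, ?_⟩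
    by_contra hcon
    push Not at hcon
    refine hp ((hW.eq_at_one r x).trans ?_)
    rw [hcon.1, (smul_eq_zero.1 hcon.2).resolve_left hε0, smul_zero]
    rfl
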